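/- \textbf{Setting.} Let $E\to M$ be a smooth real vector bundle of finite rank over an $n$-dimensional manifold $M$ with volume form $\nu$ (orienting $M$), and let $J^\infty E$ be its infinite jet bundle with coordinates $(x^i,u^a_I)$. $Loc_E$ denotes the algebra of local functions (pull-backs to $J^\infty E$ of smooth functions on finite jet bundles), and $\Omega^{k,0}(J^\infty E)$ the space of horizontal $k$-forms $\alpha=\alpha_I\,dx^I$ with $\alpha_I\in Loc_E$; the horizontal differential is $d_H\alpha=D_i\alpha_I\,dx^i\wedge dx^I$, where $D_i=\partial_{x^i}+u^a_{iJ}\partial_{u^a_J}$, i.e. $(j^\infty\phi)^*d_H\alpha=d\,(j^\infty\phi)^*\alpha$ for all sections $\phi$. For a Lagrangian form $\alpha=L\,d^nx$ the Euler--Lagrange form is $\mathbf E(\alpha)=\mathbf E_a(L)\,\theta^a\wedge d^nx$, with $\mathbf E_a(L)=(-D)_I(\partial L/\partial u^a_I)$ and $\theta^a=du^a-u^a_i\,dx^i$. For $k\neq n$, $\Omega^{k,0}_c(J^\infty E)$ consists of the $\alpha\in\Omega^{k,0}(J^\infty E)$ such that $(j^\infty\phi)^*\alpha$ has compact support for every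 compactly supported smooth section $\phi$; for $k=n$ it is required in addition that $\mathbf E(\alpha)$ has compact support along $j^\infty\phi$ for all such $\phi$. Let $\Omega^{n,1}_0$ be the $Loc_E$-module locally generated by the forms $\theta^a\wedge d^nx$, and let $\omega:\Omega^{n,1}_0\times\Omega^{n,1}_0\to Loc_E$ be skew-symmetric and $Loc_E$-bilinear. Put $\tilde l_2(\alpha,\beta)=\omega(\mathbf E(\alpha),\mathbf E(\beta))\,\nu$. For $\alpha\in\Omega^{n,0}_c(J^\infty E)$ let $\mathcal P_\alpha(\phi)=\int_M(j^\infty\phi)^*\alpha$ be the associated local functional of compactly supported sections $\phi$, and put $\{\mathcal P_\alpha,\mathcal P_\beta\}=\mathcal P_{\tilde l_2(\alpha,\beta)}$. Assume that $\omega$ is such that this Poisson bracket of local functionals satisfies the Jacobi identity. Let $G$ be a group (for instance a Lie group) acting on $E$ by smooth bundle automorphisms $\psi_g$ that cover the identity of $M$ (not necessarily linear on the fibres) and map compactly supported sections to compactly supported sections. Assume that every $\psi_g$ is canonical, i.e. $\{\mathcal P\circ\hat\psi_g,\mathcal Q\circ\hat\psi_g\}=\{\mathcal P,\mathcal Q\}\circ\hat\psi_g$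 for all local functionals $\mathcal P,\mathcal Q$, where $\hat\psi_g(\phi)=\psi_g\circ\phi$. Let $j\psi_g$ be the induced action on $J^\infty E$, let $\pi:J^\infty E\to J^\infty E/G$ be the projection, let $\Omega^{k,0}_G(J^\infty E)$ be the space of $G$-invariant forms in $\Omega^{k,0}_c(J^\infty E)$, and let $\Omega^{k,0}_c(J^\infty E/G)$ be the space of horizontal $k$-forms $f$ on $J^\infty E/G$ with $\pi^*f\in\Omega^{k,0}_G(J^\infty E)$, where a function on $J^\infty E/G$ counts as smooth if its pull-back to $J^\infty E$ is a local function. Assume the reduction hypothesis: every $\alpha\in\Omega^{k+1,0}_G(J^\infty E)$ of the form $d_H\beta$ with $\beta\in\Omega^{k,0}_c(J^\infty E)$ equals $d_H\gamma$ for some $\gamma\in\Omega^{k,0}_G(J^\infty E)$. \textbf{Theorem.} The formulas $\hat d_H f=(\pi^*)^{-1}d_H(\pi^*f)$ and $\hat l_2(f_1,f_2)=(\pi^*)^{-1}\tilde l_2(\pi^*f_1,\pi^*f_2)$ define maps $\hat d_H:\Omega^{k,0}_c(J^\infty E/G)\to\Omega^{k+1,0}_c(J^\infty E/G)$ and $\hat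 l_2:\Omega^{n,0}_c(J^\infty E/G)\times\Omega^{n,0}_c(J^\infty E/G)\to\Omega^{n,0}_c(J^\infty E/G)$, and $\hat l_2$ extends to an sh-Lie structure on the graded space $X_*$, $X_i=\Omega^{n-i,0}_c(J^\infty E/G)$: there are multilinear, graded skew-symmetric maps $l_k:\bigotimes^kX_*\to X_*$ ($k\ge1$) of degree $k-2$, with $l_1=\hat d_H$ and with $l_2=\hat l_2$ on $X_0\otimes X_0$, such that for all $m\ge1$ and all homogeneous $x_1,\dots,x_m\in X_*$ $$\sum_{i+j=m+1}\ \sum_{\sigma\in unsh(i,m-i)}e(\sigma)(-1)^\sigma(-1)^{i(j-1)}\,l_j\big(l_i(x_{\sigma(1)},\dots,x_{\sigma(i)}),x_{\sigma(i+1)},\dots,x_{\sigma(m)}\big)=0,$$ where $e(\sigma)$ is the Koszul sign. -/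

import Mathlib

open Bundle Set Filter Topology MeasureTheory
open scoped Manifold ContDiff DirectSum

noncomputable section

/-! ### Coordinate calculus -/

namespace LocalFunctionals

/-- The model space `ℝⁿ` of the base manifold. -/
abbrev Model (n : ℕ) : Type := EuclideanSpace ℝ (Fin n)

section Coordinates

variable {n : ℕ} {F W : Type*} [NormedAddCommGroup F] [NormedSpace ℝ F]
  [NormedAddCommGroup W] [NormedSpace ℝ W]

/-- The partial derivative `∂f/∂xⁱ`. -/
def partialD (i : Fin n) (f : Model n → W) : Model n → W :=
  fun z => fderiv ℝ f z (EuclideanSpace.single i 1)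

/-- The iterated partial derivative `∂_I f` for the multi-index `I = (I₁, …, Iₙ)`. -/
def partialMulti (I : Fin n → ℕ) (f : Model n → W) : Model n → W :=
  (List.finRange n).foldr (fun i g => (partialD i)^[I i] g) f

/-- Fibre coordinates `(u_I)` of a finite jet, `I` running over the multi-indices all of whose
entries are `≤ p`.  A function of finitely many jet coordinates depends only on such coordinates
for some `p`, so nothing is lost by truncating entrywise instead of by the total order `|I|`. -/
abbrev JetCoord (n p : ℕ) (F : Type*) : Type _ := (Fin n → Fin (p + 1)) → F

/-- The jet coordinates `u_I = ∂_I u` at the point `z` of a function `u`. -/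
def jetCoord (p : ℕ) (u : Model n → F) (z : Model n) : JetCoord n p F :=
  fun I => partialMulti (fun i => (I i : ℕ)) u z

/-- `∂A/∂u_I` as a linear function of the fibre direction. -/
def jetPartial {p : ℕ} (A : Model n × JetCoord n p F → W) (I : Fin n → Fin (p + 1))
    (w : Model n × JetCoord n p F) : F →L[ℝ] W :=
  (fderiv ℝ A w).comp ((ContinuousLinearMap.inr ℝ (Model n) (JetCoord n p F)).comp
    (ContinuousLinearMap.single ℝ (fun _ : Fin n → Fin (p + 1) => F) I))

/-- The Euler–Lagrange expression `∑_I (-D)_I (∂A/∂u_I)` evaluated on the jet of `u` at `z`.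
Along the jet of `u` the total derivative `D_I Q` is `∂_I` of `z ↦ Q(j_z u)`. -/
def eulerExpr {p : ℕ} (A : Model n × JetCoord n p F → W) (u : Model n → F) (z : Model n) :
    F →L[ℝ] W :=
  ∑ I : Fin n → Fin (p + 1), (-1 : ℝ) ^ (∑ i, (I i : ℕ)) •
    partialMulti (fun i => (I i : ℕ)) (fun z' => jetPartial A I (z', jetCoord p u z')) z

/-! Helper facts: iterated partial derivatives of smooth functions on an open set. -/

lemma partialD_contDiffOn {U : Set (Model n)} (hU : IsOpen U) {f : Model n → W}
    (hf : ContDiffOn ℝ ∞ f U) (i : Fin n) : ContDiffOn ℝ ∞ (partialD i f) U :=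
  (hf.fderiv_of_isOpen hU (m := ∞) (by simp)).clm_apply contDiffOn_const

lemma partialD_iter_contDiffOn {U : Set (Model n)} (hU : IsOpen U) {f : Model n → W}
    (hf : ContDiffOn ℝ ∞ f U) (i : Fin n) (k : ℕ) :
    ContDiffOn ℝ ∞ ((partialD i)^[k] f) U := by
  induction k with
  | zero => simpa using hf
  | succ k ih =>
    rw [Function.iterate_succ_apply']
    exact partialD_contDiffOn hU ih i

lemma foldr_contDiffOn {U : Set (Model n)} (hU : IsOpen U) {f : Model n → W}
    (hf : ContDiffOn ℝ ∞ f U) (I : Fin n → ℕ) (l : List (Fin n)) :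
    ContDiffOn ℝ ∞ (l.foldr (fun i g => (partialD i)^[I i] g) f) U := by
  induction l with
  | nil => simpa using hf
  | cons i l ih => exact partialD_iter_contDiffOn hU ih i _

lemma partialMulti_contDiffOn {U : Set (Model n)} (hU : IsOpen U) {f : Model n → W}
    (hf : ContDiffOn ℝ ∞ f U) (I : Fin n → ℕ) : ContDiffOn ℝ ∞ (partialMulti I f) U :=
  foldr_contDiffOn hU hf I _

lemma partialD_comb {U : Set (Model n)} (hU : IsOpen U) {f g h : Model n → W} (c : ℝ)
    (hf : ContDiffOn ℝ ∞ f U) (hg : ContDiffOn ℝ ∞ g U)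
    (hh : EqOn h (fun z => c • f z + g z) U) (i : Fin n) :
    EqOn (partialD i h) (fun z => c • partialD i f z + partialD i g z) U := by
  intro z hz
  have hUz : U ∈ 𝓝 z := hU.mem_nhds hz
  have hf' : DifferentiableAt ℝ f z := (hf.contDiffAt hUz).differentiableAt (by simp)
  have hg' : DifferentiableAt ℝ g z := (hg.contDiffAt hUz).differentiableAt (by simp)
  have : h =ᶠ[𝓝 z] (fun z => c • f z + g z) := hh.eventuallyEq_of_mem hUz
  have h1 : fderiv ℝ (fun z => c • f z + g z) z = c • fderiv ℝ f z + fderiv ℝ g z :=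
    ((hf'.hasFDerivAt.const_smul c).add hg'.hasFDerivAt).fderiv
  simp [partialD, this.fderiv_eq, h1]

lemma partialD_iter_comb {U : Set (Model n)} (hU : IsOpen U) {f g h : Model n → W} (c : ℝ)
    (hf : ContDiffOn ℝ ∞ f U) (hg : ContDiffOn ℝ ∞ g U)
    (hh : EqOn h (fun z => c • f z + g z) U) (i : Fin n) (k : ℕ) :
    EqOn ((partialD i)^[k] h)
      (fun z => c • (partialD i)^[k] f z + (partialD i)^[k] g z) U := by
  induction k with
  | zero => simpa using hh
  | succ k ih =>
    simp only [Function.iterate_succ_apply']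
    exact partialD_comb hU c (partialD_iter_contDiffOn hU hf i k)
      (partialD_iter_contDiffOn hU hg i k) ih i

lemma partialMulti_comb {U : Set (Model n)} (hU : IsOpen U) {f g h : Model n → W} (c : ℝ)
    (hf : ContDiffOn ℝ ∞ f U) (hg : ContDiffOn ℝ ∞ g U)
    (hh : EqOn h (fun z => c • f z + g z) U) (I : Fin n → ℕ) :
    EqOn (partialMulti I h) (fun z => c • partialMulti I f z + partialMulti I g z) U := by
  unfold partialMulti
  induction List.finRange n with
  | nil => simpa using hh
  | cons i l ih =>
    exact partialD_iter_comb hU c (foldr_contDiffOn hU hf I l) (foldr_contDiffOn hU hg I l) ih i _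

lemma jetCoord_contDiffOn {U : Set (Model n)} (hU : IsOpen U) {u : Model n → F}
    (hu : ContDiffOn ℝ ∞ u U) (p : ℕ) : ContDiffOn ℝ ∞ (jetCoord p u) U :=
  contDiffOn_pi.2 fun _ => partialMulti_contDiffOn hU hu _

lemma jetPartial_contDiffOn [FiniteDimensional ℝ F] {U : Set (Model n)} (hU : IsOpen U)
    {u : Model n → F} (hu : ContDiffOn ℝ ∞ u U) {p : ℕ} {A : Model n × JetCoord n p F → W}
    (hA : ContDiffOn ℝ ∞ A (U ×ˢ univ)) (I : Fin n → Fin (p + 1)) :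
    ContDiffOn ℝ ∞ (fun z => jetPartial A I (z, jetCoord p u z)) U := by
  have h1 : ContDiffOn ℝ ∞ (fderiv ℝ A) (U ×ˢ univ) :=
    hA.fderiv_of_isOpen (hU.prod isOpen_univ) (m := ∞) (by simp)
  have h2 : ContDiffOn ℝ ∞ (fun z => fderiv ℝ A (z, jetCoord p u z)) U :=
    h1.comp (contDiffOn_id.prodMk (jetCoord_contDiffOn hU hu p)) (fun z hz => ⟨hz, mem_univ _⟩)
  exact h2.clm_comp contDiffOn_const

lemma eulerExpr_comb [FiniteDimensional ℝ F] {U : Set (Model n)} (hU : IsOpen U)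
    {u : Model n → F} (hu : ContDiffOn ℝ ∞ u U) {p : ℕ} {A B : Model n × JetCoord n p F → W}
    (hA : ContDiffOn ℝ ∞ A (U ×ˢ univ)) (hB : ContDiffOn ℝ ∞ B (U ×ˢ univ)) (c : ℝ)
    {z : Model n} (hz : z ∈ U) :
    eulerExpr (fun w => c • A w + B w) u z = c • eulerExpr A u z + eulerExpr B u z := by
  unfold eulerExpr
  rw [Finset.smul_sum, ← Finset.sum_add_distrib]
  refine Finset.sum_congr rfl fun I _ => ?_
  have key : EqOn (fun z' => jetPartial (fun w => c • A w + B w) I (z', jetCoord p u z'))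
      (fun z' => c • jetPartial A I (z', jetCoord p u z')
        + jetPartial B I (z', jetCoord p u z')) U := by
    intro z' hz'
    have hm : U ×ˢ (univ : Set (JetCoord n p F)) ∈ 𝓝 (z', jetCoord p u z') :=
      (hU.prod isOpen_univ).mem_nhds ⟨hz', mem_univ _⟩
    have hA' : DifferentiableAt ℝ A (z', jetCoord p u z') :=
      (hA.contDiffAt hm).differentiableAt (by simp)
    have hB' : DifferentiableAt ℝ B (z', jetCoord p u z') :=
      (hB.contDiffAt hm).differentiableAt (by simp)
    have h1 : fderiv ℝ (fun w => c • A w + B w) (z', jetCoord p u z')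
        = c • fderiv ℝ A (z', jetCoord p u z') + fderiv ℝ B (z', jetCoord p u z') :=
      ((hA'.hasFDerivAt.const_smul c).add hB'.hasFDerivAt).fderiv
    ext v
    simp [jetPartial, h1]
  have := partialMulti_comb hU c (jetPartial_contDiffOn hU hu hA I)
    (jetPartial_contDiffOn hU hu hB I) key (fun i => (I i : ℕ)) hz
  rw [this, smul_add, smul_comm]

end Coordinates

/-! ### Differential forms on the base manifold -/

section Base

variable {n : ℕ} {M : Type*} [TopologicalSpace M] [ChartedSpace (Model n) M]

/-- `Λᵏ T*_x M`. -/
abbrev Cov (n : ℕ) {M : Type*} [TopologicalSpace M] [ChartedSpace (Model n) M] (k : ℕ) (x : M) :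
    Type := (TangentSpace (𝓡 n) x) [⋀^Fin k]→L[ℝ] ℝ

/-- Pull-back of a `k`-covector at the point `e⁻¹ z` along the inverse of the chart `e` at `x₀`:
its expression in the coordinates of that chart. -/
def chartCov {k : ℕ} (x₀ : M) (z : Model n) (b : Cov n k ((extChartAt (𝓡 n) x₀).symm z)) :
    (Model n) [⋀^Fin k]→L[ℝ] ℝ :=
  b.compContinuousLinearMap (mfderiv 𝓘(ℝ, Model n) (𝓡 n) (extChartAt (𝓡 n) x₀).symm z)

/-- The coordinate expression of a `k`-form on `M` in the chart at `x₀`. -/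
def chartForm {k : ℕ} (x₀ : M) (β : ∀ x : M, Cov n k x) (z : Model n) :
    (Model n) [⋀^Fin k]→L[ℝ] ℝ :=
  chartCov x₀ z (β ((extChartAt (𝓡 n) x₀).symm z))

/-- The exterior derivative of a `k`-form on `M`, computed at `x` in the chart at `x`. -/
def dM {k : ℕ} (β : ∀ x : M, Cov n k x) (x : M) : Cov n (k + 1) x :=
  (extDeriv (chartForm x β) (extChartAt (𝓡 n) x x)).compContinuousLinearMap
    (mfderiv (𝓡 n) 𝓘(ℝ, Model n) (extChartAt (𝓡 n) x) x)

variable (n M) in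
/-- A smooth volume form (nowhere vanishing `n`-form); it also orients `M`. -/
structure VolumeForm where
  toForm : ∀ x : M, Cov n n x
  smooth : ∀ x₀ : M, ContDiffOn ℝ ∞ (chartForm x₀ toForm) (extChartAt (𝓡 n) x₀).target
  ne_zero : ∀ x : M, toForm x ≠ 0

/-- The coefficient of `dx¹ ∧ … ∧ dxⁿ` in the chart at `x₀`. -/
def chartCoeff (x₀ : M) (β : ∀ x : M, Cov n n x) (z : Model n) : ℝ :=
  chartForm x₀ β z (fun i => EuclideanSpace.single i 1)

/-- The integral over `M`, oriented by `ν`, of a (compactly supported, continuous) `n`-form: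
the sum over a partition of unity subordinate to the charts of the integrals of the coefficients
with respect to Lebesgue measure, a chart that reverses the orientation counting with a minus
sign. -/
def integralM [IsManifold (𝓡 n) ∞ M] [T2Space M] [SigmaCompactSpace M]
    (ν : VolumeForm n M) (β : ∀ x : M, Cov n n x) : ℝ :=
  let ρ := (SmoothPartitionOfUnity.exists_isSubordinate_chartAt_source (𝓡 n) M).choose
  ∑ᶠ i : M, ∫ z in (extChartAt (𝓡 n) i).target,
    ρ i ((extChartAt (𝓡 n) i).symm z) *
      (SignType.sign (chartCoeff i ν.toForm z) : ℝ) * chartCoeff i β z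

end Base

/-! ### The infinite jet bundle and its horizontal forms -/

section Jets

variable {n : ℕ} {M : Type*} [TopologicalSpace M] [ChartedSpace (Model n) M]
  (F : Type*) [NormedAddCommGroup F] [NormedSpace ℝ F]
  (V : M → Type*) [TopologicalSpace (TotalSpace F V)] [∀ x, AddCommGroup (V x)]
  [∀ x, Module ℝ (V x)] [∀ x, TopologicalSpace (V x)] [FiberBundle F V]
  [VectorBundle ℝ F V]

/-- Smooth global sections of the vector bundle. -/
abbrev Sec (n : ℕ) {M : Type*} [TopologicalSpace M] [ChartedSpace (Model n) M]
    (F : Type*) [NormedAddCommGroup F] [NormedSpace ℝ F]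
    (V : M → Type*) [TopologicalSpace (TotalSpace F V)] [∀ x, AddCommGroup (V x)]
    [∀ x, TopologicalSpace (V x)] [FiberBundle F V] : Type _ :=
  ContMDiffSection (𝓡 n) F ∞ V

variable {F V}

/-- A section with compact support. -/
def IsCompactlySupported (φ : Sec n F V) : Prop := IsCompact (closure {x : M | φ x ≠ 0})

/-- The coordinate domain at `x₀`: the part of the chart at `x₀` over which the bundle is
trivialised by the trivialisation at `x₀`. -/
def chartDom (n : ℕ) {M : Type*} [TopologicalSpace M] [ChartedSpace (Model n) M]
    (F : Type*) [NormedAddCommGroup F] [NormedSpace ℝ F]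
    (V : M → Type*) [TopologicalSpace (TotalSpace F V)]
    [∀ x, TopologicalSpace (V x)] [FiberBundle F V] (x₀ : M) : Set (Model n) :=
  (extChartAt (𝓡 n) x₀).target ∩ (extChartAt (𝓡 n) x₀).symm ⁻¹' (trivializationAt F V x₀).baseSet

/-- The coordinate expression `u = u(x)` of a section over the coordinate domain at `x₀`. -/
def secCoord (x₀ : M) (φ : Sec n F V) (z : Model n) : F :=
  (trivializationAt F V x₀ ⟨(extChartAt (𝓡 n) x₀).symm z, φ ((extChartAt (𝓡 n) x₀).symm z)⟩).2

/-- The base point and all the derivatives at the base point, in the coordinates there. -/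
def jetCode (a : M × Sec n F V) : M × ((Fin n → ℕ) → F) :=
  (a.1, fun I => partialMulti I (secCoord a.1 a.2) (extChartAt (𝓡 n) a.1 a.1))

variable (n F V) in
/-- Two pairs `(x, φ)`, `(y, χ)` define the same infinite jet iff `x = y` and all partial
derivatives of `φ` and `χ` at `x` agree (in the coordinates at `x`). -/
def jetSetoid : Setoid (M × Sec n F V) := Setoid.ker jetCode

variable (n F V) in
/-- The infinite jet bundle `J^∞E`. -/
def InfJet : Type _ := Quotient (jetSetoid n F V)

/-- The jet `j_x φ`. -/
def jet (φ : Sec n F V) (x : M) : InfJet n F V := Quotient.mk (jetSetoid n F V) (x, φ)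

/-- The projection `J^∞E → M`. -/
def InfJet.base (j : InfJet n F V) : M :=
  Quotient.lift (s := jetSetoid n F V) (fun a : M × Sec n F V => a.1)
    (fun a b h => (congrArg Prod.fst (h : jetCode a = jetCode b) : (jetCode a).1 = (jetCode b).1)) j

/-- A section whose jet at the base point of `j` is `j`. -/
def InfJet.section (j : InfJet n F V) : Sec n F V := (Quotient.out j).2

lemma jet_section (j : InfJet n F V) : jet j.section j.base = j := by
  have h : Quotient.mk (jetSetoid n F V) (Quotient.out j) = j := Quotient.out_eq j
  have hb : j.base = (Quotient.out j).1 := congrArg InfJet.base h.symm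
  rw [hb]
  exact h

/-- A quantity `c`, given over each coordinate domain as a function of a point `z` and of a
section, is at `x₀` the smooth function `A` of the coordinates `(xⁱ, u_I)`. -/
def IsJetRep {W : Type*} [NormedAddCommGroup W] [NormedSpace ℝ W] (x₀ : M)
    (c : Model n → Sec n F V → W) {p : ℕ} (A : Model n × JetCoord n p F → W) : Prop :=
  ContDiffOn ℝ ∞ A (chartDom n F V x₀ ×ˢ univ) ∧
    ∀ φ : Sec n F V, ∀ z ∈ chartDom n F V x₀, c z φ = A (z, jetCoord p (secCoord x₀ φ) z)

/-- Local functions: pull-backs to `J^∞E` of smooth functions on a finite jet bundle.  (A smooth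
function on a jet bundle of some order is one on all those of higher order, so that "for some
order" may be read as "for all large orders".) -/
def IsLocalFunction (P : InfJet n F V → ℝ) : Prop :=
  ∀ᶠ p in (atTop : Filter ℕ), ∀ x₀ : M, ∃ A : Model n × JetCoord n p F → ℝ,
    IsJetRep x₀ (fun z φ => P (jet φ ((extChartAt (𝓡 n) x₀).symm z))) A

variable (n F V) in
/-- Fields of horizontal `k`-covectors on `J^∞E`: `α = α_I dx^I` with arbitrary functions `α_I`
on `J^∞E`. -/
abbrev HForm (k : ℕ) : Type _ := ∀ j : InfJet n F V, Cov n k j.base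

/-- The pull-back `(j^∞φ)^* α`. -/
def pullSec {k : ℕ} (α : HForm n F V k) (φ : Sec n F V) (x : M) : Cov n k x := α (jet φ x)

/-- `α ∈ Ω^{k,0}(J^∞E)`: the coefficients of `α` are local functions. -/
def IsLocalForm {k : ℕ} (α : HForm n F V k) : Prop :=
  ∀ᶠ p in (atTop : Filter ℕ), ∀ x₀ : M, ∃ A : Model n × JetCoord n p F →
      (Model n) [⋀^Fin k]→L[ℝ] ℝ,
    IsJetRep x₀ (fun z φ => chartForm x₀ (pullSec α φ) z) A

/-- The fibre of source forms: linear maps `V_x → Λᵏ T*_x M`; for `k = n` the form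
`f_a θ^a ∧ dⁿx` corresponds to `v ↦ f_a v^a dⁿx`. -/
abbrev SrcFiber {k : ℕ} (j : InfJet n F V) : Type _ := V j.base →ₗ[ℝ] Cov n k j.base

variable (n F V) in
/-- Fields of source forms. -/
abbrev Src (k : ℕ) : Type _ := ∀ j : InfJet n F V, SrcFiber (k := k) j

/-- The component of a source form along the constant direction `v`, in coordinates at `x₀`. -/
def srcCoord {k : ℕ} (ε : Src n F V k) (x₀ : M) (v : F) (z : Model n) (φ : Sec n F V) :
    (Model n) [⋀^Fin k]→L[ℝ] ℝ :=
  chartForm x₀ (fun y => ε (jet φ y) (show V (jet φ y).base from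
    (trivializationAt F V x₀).symm y v)) z

/-- For `k = n`: `ε ∈ Ω^{n,1}_0`, the module generated locally over `Loc_E` by the forms
`θ^a ∧ dⁿx`. -/
def IsLocalSrc {k : ℕ} (ε : Src n F V k) : Prop :=
  ∀ v : F, ∀ᶠ p in (atTop : Filter ℕ), ∀ x₀ : M, ∃ A : Model n × JetCoord n p F →
      (Model n) [⋀^Fin k]→L[ℝ] ℝ, IsJetRep x₀ (srcCoord ε x₀ v) A

/-- For `k = n`: `ε` is the Euler–Lagrange form `E(α)` of the Lagrangian form `α`, i.e. in all
coordinates at points of `M`, `ε = E_a(L) θ^a ∧ dⁿx` with `E_a(L) = (-D)_I (∂L/∂u^a_I)`, if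
`α = L dⁿx`. -/
def IsEulerLagrange {k : ℕ} (α : HForm n F V k) (ε : Src n F V k) : Prop :=
  ∀ᶠ p in (atTop : Filter ℕ), ∀ x₀ : M, ∃ A : Model n × JetCoord n p F →
      (Model n) [⋀^Fin k]→L[ℝ] ℝ,
    IsJetRep x₀ (fun z φ => chartForm x₀ (pullSec α φ) z) A ∧
    ∀ φ : Sec n F V, ∀ z ∈ chartDom n F V x₀, ∀ v : F,
      srcCoord ε x₀ v z φ = eulerExpr A (secCoord x₀ φ) z v

open Classical in
/-- The Euler–Lagrange operator `E : Ω^{n,0} → Ω^{n,1}_0`. -/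
def eulerLagrange (α : HForm n F V n) : Src n F V n :=
  if h : ∃ ε, IsEulerLagrange α ε then h.choose else 0

/-- The horizontal differential, characterised by `(j^∞φ)^* (d_H α) = d ((j^∞φ)^* α)`; in
coordinates `d_H (α_I dx^I) = D_i α_I dxⁱ ∧ dx^I`. -/
def dH {k : ℕ} (α : HForm n F V k) : HForm n F V (k + 1) :=
  fun j => dM (pullSec α j.section) j.base

/-- `(j^∞φ)^* α` has compact support for all compactly supported sections `φ`. -/
def HasCompactPull {k : ℕ} (α : HForm n F V k) : Prop :=
  ∀ φ : Sec n F V, IsCompactlySupported φ → IsCompact (closure {x : M | α (jet φ x) ≠ 0})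

/-- Membership in `Ω^{k,0}_c(J^∞E)`; for `k = n` the Euler–Lagrange form is required to be
compactly supported along compactly supported sections, too. -/
def IsCompactForm {k : ℕ} (α : HForm n F V k) : Prop :=
  IsLocalForm α ∧ HasCompactPull α ∧ (k = n → ∃ ε : Src n F V k, IsEulerLagrange α ε ∧
    ∀ φ : Sec n F V, IsCompactlySupported φ → IsCompact (closure {x : M | ε (jet φ x) ≠ 0}))

/-! Helper facts: the compactly supported horizontal forms are a vector space. -/

lemma chartForm_comb {k : ℕ} (x₀ : M) (c : ℝ) (β γ : ∀ x : M, Cov n k x) (z : Model n) :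
    chartForm x₀ (fun x => c • β x + γ x) z = c • chartForm x₀ β z + chartForm x₀ γ z := by
  ext v
  rfl

lemma IsJetRep.comb {W : Type*} [NormedAddCommGroup W] [NormedSpace ℝ W] {x₀ : M} (c : ℝ)
    {a b d : Model n → Sec n F V → W} {p : ℕ} {A B : Model n × JetCoord n p F → W}
    (hA : IsJetRep x₀ a A) (hB : IsJetRep x₀ b B) (hd : ∀ z φ, d z φ = c • a z φ + b z φ) :
    IsJetRep x₀ d (fun w => c • A w + B w) :=
  ⟨(hA.1.const_smul c).add hB.1, fun φ z hz => by rw [hd, hA.2 φ z hz, hB.2 φ z hz]⟩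

lemma isOpen_chartDom (x₀ : M) : IsOpen (chartDom n F V x₀) :=
  (continuousOn_extChartAt_symm x₀).isOpen_inter_preimage (isOpen_extChartAt_target x₀)
    (trivializationAt F V x₀).open_baseSet

lemma secCoord_contDiffOn [IsManifold (𝓡 n) ∞ M] [ContMDiffVectorBundle ∞ F V (𝓡 n)]
    (φ : Sec n F V) (x₀ : M) : ContDiffOn ℝ ∞ (secCoord x₀ φ) (chartDom n F V x₀) := by
  rw [← contMDiffOn_iff_contDiffOn]
  have h1 : ContMDiffOn (𝓡 n) 𝓘(ℝ, F) ∞ (fun x => (trivializationAt F V x₀ ⟨x, φ x⟩).2)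
      (trivializationAt F V x₀).baseSet :=
    (Trivialization.contMDiffOn_section_baseSet_iff (trivializationAt F V x₀)).1
      φ.contMDiff.contMDiffOn
  exact h1.comp ((contMDiffOn_extChartAt_symm x₀).mono inter_subset_left) (fun z hz => hz.2)

lemma IsLocalForm.comb {k : ℕ} {α β : HForm n F V k} (c : ℝ) (hα : IsLocalForm α)
    (hβ : IsLocalForm β) : IsLocalForm (c • α + β) := by
  filter_upwards [hα, hβ] with p h1 h2 x₀
  obtain ⟨A, hA⟩ := h1 x₀
  obtain ⟨B, hB⟩ := h2 x₀
  exact ⟨_, hA.comb c hB fun z φ => chartForm_comb x₀ c _ _ z⟩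

lemma IsEulerLagrange.comb [IsManifold (𝓡 n) ∞ M] [ContMDiffVectorBundle ∞ F V (𝓡 n)]
    [FiniteDimensional ℝ F] {k : ℕ} {α β : HForm n F V k} {ε δ : Src n F V k} (c : ℝ)
    (hα : IsEulerLagrange α ε) (hβ : IsEulerLagrange β δ) :
    IsEulerLagrange (c • α + β) (c • ε + δ) := by
  filter_upwards [hα, hβ] with p h1 h2 x₀
  obtain ⟨A, hA, hA'⟩ := h1 x₀
  obtain ⟨B, hB, hB'⟩ := h2 x₀
  refine ⟨_, hA.comb c hB fun z φ => chartForm_comb x₀ c _ _ z, fun φ z hz v => ?_⟩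
  rw [eulerExpr_comb (isOpen_chartDom x₀) (secCoord_contDiffOn φ x₀) hA.1 hB.1 c hz]
  simp only [add_apply, smul_apply]
  rw [← hA' φ z hz v, ← hB' φ z hz v]
  exact chartForm_comb x₀ c _ _ z

lemma isCompact_comb {X : Type*} [TopologicalSpace X] [R1Space X] {Y : X → Type*}
    [∀ x, AddCommGroup (Y x)] [∀ x, Module ℝ (Y x)] (c : ℝ) {a b : ∀ x, Y x}
    (ha : IsCompact (closure {x | a x ≠ 0})) (hb : IsCompact (closure {x | b x ≠ 0})) :
    IsCompact (closure {x | c • a x + b x ≠ 0}) := by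
  refine (ha.union hb).closure_of_subset fun x hx => ?_
  by_cases h : a x = 0
  · refine Or.inr (subset_closure fun h' => hx ?_)
    simp [h, h']
  · exact Or.inl (subset_closure h)

lemma IsCompactForm.comb [IsManifold (𝓡 n) ∞ M] [T2Space M] [ContMDiffVectorBundle ∞ F V (𝓡 n)]
    [FiniteDimensional ℝ F] {k : ℕ} {α β : HForm n F V k} (c : ℝ)
    (hα : IsCompactForm α) (hβ : IsCompactForm β) : IsCompactForm (c • α + β) := by
  refine ⟨hα.1.comb c hβ.1, fun φ hφ => isCompact_comb c (a := fun x => α (jet φ x))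
    (b := fun x => β (jet φ x)) (hα.2.1 φ hφ) (hβ.2.1 φ hφ), fun hk => ?_⟩
  obtain ⟨ε, h1, h2⟩ := hα.2.2 hk
  obtain ⟨δ, h3, h4⟩ := hβ.2.2 hk
  exact ⟨c • ε + δ, h1.comb c h3, fun φ hφ => isCompact_comb c (a := fun x => ε (jet φ x))
    (b := fun x => δ (jet φ x)) (h2 φ hφ) (h4 φ hφ)⟩

lemma chartForm_zero {k : ℕ} (x₀ : M) (z : Model n) :
    chartForm x₀ (fun x : M => (0 : Cov n k x)) z = 0 := by
  ext v
  rfl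

lemma IsCompactForm.zero [IsManifold (𝓡 n) ∞ M] [ContMDiffVectorBundle ∞ F V (𝓡 n)]
    [FiniteDimensional ℝ F] {k : ℕ} : IsCompactForm (0 : HForm n F V k) := by
  have hrep : ∀ (p : ℕ) (x₀ : M), IsJetRep x₀
      (fun z φ => chartForm x₀ (pullSec (0 : HForm n F V k) φ) z)
      (fun _ : Model n × JetCoord n p F => (0 : (Model n) [⋀^Fin k]→L[ℝ] ℝ)) :=
    fun p x₀ => ⟨contDiffOn_const, fun φ z _ => chartForm_zero x₀ z⟩
  refine ⟨Eventually.of_forall fun p x₀ => ⟨_, hrep p x₀⟩, fun φ _ => by simp,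
    fun _ => ⟨0, Eventually.of_forall fun p x₀ => ⟨_, hrep p x₀, fun φ z hz v => ?_⟩,
      fun φ _ => by simp⟩⟩
  have h0 : eulerExpr (fun _ : Model n × JetCoord n p F => (0 : (Model n) [⋀^Fin k]→L[ℝ] ℝ))
      (secCoord x₀ φ) z = 0 := by
    have := eulerExpr_comb (isOpen_chartDom x₀) (secCoord_contDiffOn φ x₀) (hrep p x₀).1
      (hrep p x₀).1 (-1) hz
    simpa using this
  rw [h0]
  exact chartForm_zero x₀ z

variable (n F V) in
/-- The vector space `Ω^{k,0}_c(J^∞E)`. -/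
def compactForms [IsManifold (𝓡 n) ∞ M] [T2Space M] [ContMDiffVectorBundle ∞ F V (𝓡 n)]
    [FiniteDimensional ℝ F] (k : ℕ) : Submodule ℝ (HForm n F V k) where
  carrier := {α | IsCompactForm α}
  zero_mem' := IsCompactForm.zero
  add_mem' := fun {α β} hα hβ => by simpa using IsCompactForm.comb 1 hα hβ
  smul_mem' := fun c α hα => by simpa using IsCompactForm.comb c hα IsCompactForm.zero

/-! ### The Poisson bracket of local functionals -/

variable (n F V) in
/-- The tensor `ω : Ω^{n,1}_0 × Ω^{n,1}_0 → Loc_E`, skew-symmetric and `Loc_E`-linear in each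
variable, i.e. given by a skew-symmetric bilinear form on source forms at each point of `J^∞E`,
with local functions as components. -/
structure BracketTensor where
  form : ∀ j : InfJet n F V, SrcFiber (k := n) j →ₗ[ℝ] SrcFiber (k := n) j →ₗ[ℝ] ℝ
  skew : ∀ j ε δ, form j ε δ = - form j δ ε
  isLocal : ∀ ε δ : Src n F V n, IsLocalSrc ε → IsLocalSrc δ →
    IsLocalFunction fun j => form j (ε j) (δ j)

/-- The bracket `l̃₂(α, β) = ω(E(α), E(β)) ν` on `Ω^{n,0}`. -/
def bracketForm (ν : VolumeForm n M) (Ω : BracketTensor n F V) (α β : HForm n F V n) :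
    HForm n F V n :=
  fun j => Ω.form j (eulerLagrange α j) (eulerLagrange β j) • ν.toForm j.base

section Functionals

variable [IsManifold (𝓡 n) ∞ M] [T2Space M] [SigmaCompactSpace M]

/-- The local functional `𝒫(φ) = ∫_M (j^∞φ)^* α` of `α = P ν`. -/
def functional (ν : VolumeForm n M) (α : HForm n F V n) (φ : Sec n F V) : ℝ :=
  integralM ν (pullSec α φ)

variable [ContMDiffVectorBundle ∞ F V (𝓡 n)] [FiniteDimensional ℝ F]

/-- The Poisson bracket `{𝒫, 𝒬}(φ) = ∫_M [ω(E(P), E(Q)) ∘ j^∞φ] ν` of the local functionals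
`𝒫 = ∫ Pν`, `𝒬 = ∫ Qν` satisfies the Jacobi identity. -/
def SatisfiesJacobi (ν : VolumeForm n M) (Ω : BracketTensor n F V) : Prop :=
  ∀ α ∈ compactForms n F V n, ∀ β ∈ compactForms n F V n, ∀ γ ∈ compactForms n F V n,
    ∀ φ : Sec n F V, IsCompactlySupported φ →
      functional ν (bracketForm ν Ω (bracketForm ν Ω α β) γ) φ
        + functional ν (bracketForm ν Ω (bracketForm ν Ω β γ) α) φ
        + functional ν (bracketForm ν Ω (bracketForm ν Ω γ α) β) φ = 0

end Functionals

/-! ### Group actions by automorphisms covering the identity -/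

variable (n F V) in
/-- An action of `G` on `E` by (not necessarily fibrewise linear) automorphisms `ψ_g` of the
bundle which cover the identity of the base; so that they act on compactly supported sections,
they are required to preserve these (which is automatic if they are fibrewise linear). -/
structure FiberAction (G : Type*) [Group G] where
  act : G → ∀ x : M, V x → V x
  one_act : ∀ x v, act 1 x v = v
  mul_act : ∀ g h x v, act (g * h) x v = act g x (act h x v)
  smooth : ∀ g, ContMDiff ((𝓡 n).prod 𝓘(ℝ, F)) ((𝓡 n).prod 𝓘(ℝ, F)) ∞
    (fun e : TotalSpace F V => (⟨e.1, act g e.1 e.2⟩ : TotalSpace F V))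
  compact : ∀ g (φ : Sec n F V), IsCompactlySupported φ →
    IsCompact (closure {x : M | act g x (φ x) ≠ 0})

namespace FiberAction

variable {G : Type*} [Group G] (ρ : FiberAction n F V G)

/-- `ψ̂_g(φ) = ψ_g ∘ φ`. -/
def onSec (g : G) (φ : Sec n F V) : Sec n F V :=
  ⟨fun x => ρ.act g x (φ x), (ρ.smooth g).comp φ.contMDiff⟩

/-- The prolongation `jψ_g : J^∞E → J^∞E`, `j_xφ ↦ j_x(ψ_g ∘ φ)`. -/
def prolong (g : G) (j : InfJet n F V) : InfJet n F V := jet (ρ.onSec g j.section) j.base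

/-- The pull-back `(jψ_g)^*` of horizontal forms, as `ψ_g` covers the identity. -/
def pull {k : ℕ} (g : G) : HForm n F V k →ₗ[ℝ] HForm n F V k where
  toFun α := fun j => α (ρ.prolong g j)
  map_add' _ _ := rfl
  map_smul' _ _ := rfl

/-- The quotient `J^∞E/G`. -/
def JetQuot : Type _ := Quot fun j j' : InfJet n F V => ∃ g : G, ρ.prolong g j = j'

/-- The canonical projection `π : J^∞E → J^∞E/G`. -/
def proj (j : InfJet n F V) : ρ.JetQuot := Quot.mk _ j

/-- The projection `J^∞E/G → M`. -/
def quotBase (q : ρ.JetQuot) : M :=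
  Quot.lift InfJet.base (fun j _ h => by obtain ⟨g, rfl⟩ := h; rfl) q

/-- Fields of horizontal `k`-covectors on `J^∞E/G`. -/
abbrev QuotForm (k : ℕ) : Type _ := ∀ q : ρ.JetQuot, Cov n k (ρ.quotBase q)

/-- The pull-back `π^*`. -/
def projPull {k : ℕ} : ρ.QuotForm k →ₗ[ℝ] HForm n F V k where
  toFun a := fun j => a (ρ.proj j)
  map_add' _ _ := rfl
  map_smul' _ _ := rfl

variable [IsManifold (𝓡 n) ∞ M] [T2Space M] [ContMDiffVectorBundle ∞ F V (𝓡 n)]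
  [FiniteDimensional ℝ F]

/-- `Ω^{k,0}_G(J^∞E)`: the `G`-invariant forms in `Ω^{k,0}_c(J^∞E)`. -/
def invariantForms (k : ℕ) : Submodule ℝ (HForm n F V k) :=
  compactForms n F V k ⊓ ⨅ g : G, LinearMap.eqLocus (ρ.pull g) LinearMap.id

/-- `Ω^{k,0}_c(J^∞E/G)`: the horizontal `k`-forms `a` on `J^∞E/G` with
`π^*a ∈ Ω^{k,0}_G(J^∞E)`.  (A function on the quotient is smooth iff its pull-back is.) -/
def reducedForms (k : ℕ) : Submodule ℝ (ρ.QuotForm k) := (ρ.invariantForms k).comap ρ.projPull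

/-- The reduction hypothesis: an invariant `d_H`-exact form is `d_H` of an invariant form. -/
def ReductionHypothesis : Prop :=
  ∀ k : ℕ, ∀ α ∈ ρ.invariantForms (k + 1), (∃ β ∈ compactForms n F V k, dH β = α) →
    ∃ γ ∈ ρ.invariantForms k, dH γ = α

/-- `ψ_g` is canonical: `{𝒫 ∘ ψ̂_g, 𝒬 ∘ ψ̂_g} = {𝒫, 𝒬} ∘ ψ̂_g` for all local functionals.
If `𝒫` is the functional of `α`, then `𝒫 ∘ ψ̂_g` is that of `(jψ_g)^* α`. -/
def IsCanonical [SigmaCompactSpace M] (ν : VolumeForm n M) (Ω : BracketTensor n F V) (g : G) :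
    Prop :=
  ∀ α ∈ compactForms n F V n, ∀ β ∈ compactForms n F V n,
    ∀ φ : Sec n F V, IsCompactlySupported φ →
      functional ν (bracketForm ν Ω (ρ.pull g α) (ρ.pull g β)) φ
        = functional ν (bracketForm ν Ω α β) (ρ.onSec g φ)

/-- The total space `⨁_k Ω^{k,0}_c(J^∞E/G)` of the reduced graded space. -/
abbrev Reduced : Type _ := ⨁ k : ℕ, ρ.reducedForms k

/-- The inclusion of `Ω^{k,0}_c(J^∞E/G)` into the reduced graded space. -/
abbrev incl (k : ℕ) : ρ.reducedForms k →ₗ[ℝ] ρ.Reduced :=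
  DirectSum.lof ℝ ℕ (fun k => ρ.reducedForms k) k

/-- The homological grading `X_i = Ω^{n-i,0}_c(J^∞E/G)`. -/
def grading (i : ℤ) : Submodule ℝ ρ.Reduced :=
  ⨆ (k : ℕ) (_ : (k : ℤ) = n - i), LinearMap.range (ρ.incl k)

end FiberAction

end Jets

/-! ### sh-Lie structures -/

section ShLie

/-- The Koszul sign `e(σ)` of a permutation of elements of degrees `d₁, …, d_m`:
`x₁ ∧ ⋯ ∧ x_m = e(σ) x_{σ(1)} ∧ ⋯ ∧ x_{σ(m)}` in the free graded commutative algebra. -/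
def koszulSign {m : ℕ} (d : Fin m → ℤ) (σ : Equiv.Perm (Fin m)) : ℤˣ :=
  ∏ a : Fin m, ∏ b : Fin m,
    if a < b ∧ σ b < σ a then (-1 : ℤˣ) ^ (d (σ a) * d (σ b)) else 1

/-- The sign `e(σ) (-1)^σ`, as a real number. -/
def shSign {m : ℕ} (d : Fin m → ℤ) (σ : Equiv.Perm (Fin m)) : ℝ :=
  ((koszulSign d σ * Equiv.Perm.sign σ : ℤˣ) : ℤ)

/-- `σ` is an `(i, m - i)`-unshuffle. -/
def IsUnshuffle {m : ℕ} (i : ℕ) (σ : Equiv.Perm (Fin m)) : Prop :=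
  ∀ a b : Fin m, a < b → ((b : ℕ) < i ∨ i ≤ (a : ℕ)) → σ a < σ b

instance {m : ℕ} (i : ℕ) : DecidablePred (IsUnshuffle (m := m) i) :=
  fun _ => inferInstanceAs (Decidable (∀ _ _, _))

/-- An sh-Lie structure on the graded vector space `T = ⨁ X_i`: multilinear, graded
skew-symmetric maps `l_k`, `k ≥ 1`, of degree `k - 2`, with
`∑_{i+j=m+1} ∑_{unsh(i,m-i)} e(σ)(-1)^σ(-1)^{i(j-1)} l_j(l_i(x_σ(1),…,x_σ(i)),…,x_σ(m)) = 0`.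
In `relation` the inner map has `i + 1` arguments, `i = 0, …, m - 1`, and the outer one `m - i`. -/
structure ShLieStructure {T : Type*} [AddCommMonoid T] [Module ℝ T] (X : ℤ → Submodule ℝ T) where
  l : ∀ k : ℕ, MultilinearMap ℝ (fun _ : Fin k => T) T
  degree : ∀ (k : ℕ), 1 ≤ k → ∀ (d : Fin k → ℤ) (x : Fin k → T), (∀ a, x a ∈ X (d a)) →
    l k x ∈ X (∑ a, d a + k - 2)
  skew : ∀ (k : ℕ), 1 ≤ k → ∀ (d : Fin k → ℤ) (x : Fin k → T), (∀ a, x a ∈ X (d a)) →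
    ∀ σ : Equiv.Perm (Fin k),
      l k (fun a => x (σ a)) = shSign d σ • l k x
  relation : ∀ (m : ℕ), 1 ≤ m → ∀ (d : Fin m → ℤ) (x : Fin m → T), (∀ a, x a ∈ X (d a)) →
    ∑ i : Fin m, ∑ σ : Equiv.Perm (Fin m) with IsUnshuffle (i + 1) σ,
      (shSign d σ * (-1) ^ (((i : ℕ) + 1) * (m - i - 1))) •
        l (m - i) (fun b : Fin (m - i) =>
          if (b : ℕ) = 0 then l (i + 1) (fun a : Fin (i + 1) => x (σ ⟨a, by omega⟩))
          else x (σ ⟨i + b, by omega⟩)) = 0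

end ShLie

end LocalFunctionals

end

set_option linter.unusedSectionVars false

/-! The sh-Lie structure is very short. `l_1` is the differential, `l_2` is the bracket of top forms
extended by zero, `l_3` is `S ∘ jac` with `S` minus a linear section of the differential over its
range, and all higher brackets vanish. For this it suffices (`IsShDatum`, `exists_shLieStructure`)
that elements of nonzero degree are central, that brackets are closed, that exact elements are
central, and that the Jacobiator is exact. Brackets are closed because they are forms of top degree.
Exact forms are central because the Euler–Lagrange operator kills them (`eulerLagrange_dH`). The
relation in three variables is the choice of `S`. The one in four variables holds because the
Jacobiator, being exact, is central (`IsShDatum.sum_jac_B`), and beyond that every term vanishes,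
since `S` takes values in degree one.

The analytic core is the exactness of the Jacobiator (`exists_primitive_jacobiator`). The Jacobi
identity of functionals only says that its integrals along compactly supported sections vanish.
Rather than the cohomology of the variational complex, a localization is used: for a test function
`f` the form `fα` is again admissible, and in coordinates the Jacobiator of `fα, β, γ` is a linear
differential operator in `f` whose coefficients are functions of the jet of the section. Integration
by parts turns it into `h f + div b` with `h` independent of `f`
(`JetFrame.exists_boundary_of_linear`). Since its integral vanishes for all `f`, so does `h`
(`exists_local_primitive`). Letting `f` run through a partition of unity, the fields `b` are glued
to a global primitive. The glued form must have finite order, which requires a common order for the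
components of `ω` along a locally finite family of frames; a diagonal argument provides it
(`exists_uniform_omegaCoeff`). It must also have compact support along compactly supported sections,
and this holds because `b` vanishes wherever `E(β)` and `E(γ)` vanish nearby.

The Euler–Lagrange operator is accessed through the first variation formula: its value is the only
continuous coefficient that represents the variation against all test fields
(`eulerExpr_eq_of_integral`). Vanishing on divergences (`eulerExpr_divergence`), the transformation
law that makes `E` globally defined (`eulerExpr_transform`), and naturality under the automorphisms
`ψ_g` all follow from this without manipulating total derivatives.

Invariant forms are closed under the bracket because the canonical property, an identity of
integrals, holds pointwise. It is tested on the Lagrangians `f ℓ(u) ν`, whose Euler–Lagrange forms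
contain no derivative of `f`, so the fundamental lemma applies (`FiberAction.bracketForm_pull`).
Hence differential and bracket descend along `π^*`, and the reduction hypothesis replaces the
primitive of an invariant Jacobiator by an invariant primitive. -/

noncomputable section

namespace LocalFunctionals

/-! ### Iterated partial derivatives along words of indices -/

section Words

variable {n : ℕ} {X Y : Type*} [NormedAddCommGroup X] [NormedSpace ℝ X]
  [NormedAddCommGroup Y] [NormedSpace ℝ Y]

/-- The iterated partial derivative `∂_{w₁} ∂_{w₂} ⋯ f` along a word `w`. -/
def wordD (w : List (Fin n)) (f : Model n → X) : Model n → X := w.foldr partialD f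

/-- The nondecreasing word with `I i` letters `i`. -/
def multiWord (I : Fin n → ℕ) : List (Fin n) :=
  (List.finRange n).flatMap fun i => List.replicate (I i) i

@[simp] lemma wordD_nil (f : Model n → X) : wordD [] f = f := rfl

@[simp] lemma wordD_cons (i : Fin n) (w : List (Fin n)) (f : Model n → X) :
    wordD (i :: w) f = partialD i (wordD w f) := rfl

lemma wordD_append (w w' : List (Fin n)) (f : Model n → X) :
    wordD (w ++ w') f = wordD w (wordD w' f) := by
  simp [wordD, List.foldr_append]

lemma wordD_replicate (k : ℕ) (i : Fin n) (f : Model n → X) :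
    wordD (List.replicate k i) f = (partialD i)^[k] f := by
  induction k with
  | zero => rfl
  | succ k ih => rw [List.replicate_succ, wordD_cons, ih, Function.iterate_succ_apply']

lemma partialMulti_eq_wordD (I : Fin n → ℕ) (f : Model n → X) :
    partialMulti I f = wordD (multiWord I) f := by
  unfold partialMulti multiWord
  induction List.finRange n with
  | nil => rfl
  | cons i l ih => rw [List.foldr_cons, ih, List.flatMap_cons, wordD_append, wordD_replicate]

lemma count_multiWord (I : Fin n → ℕ) (i : Fin n) : (multiWord I).count i = I i := by
  have h : ∀ l : List (Fin n), l.Nodup →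
      (l.flatMap fun j => List.replicate (I j) j).count i = if i ∈ l then I i else 0 := by
    intro l
    induction l with
    | nil => simp
    | cons j l ih =>
      intro hl
      rw [List.nodup_cons] at hl
      rw [List.flatMap_cons, List.count_append, ih hl.2, List.count_replicate]
      by_cases hij : j = i
      · subst hij
        simp [hl.1]
      · simp [hij, Ne.symm hij]
  rw [multiWord, h _ (List.nodup_finRange n), if_pos (List.mem_finRange i)]

lemma length_multiWord (I : Fin n → ℕ) : (multiWord I).length = ∑ i, I i := by
  simp [multiWord, List.length_flatMap, List.sum_ofFn, ← List.ofFn_eq_map]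

/-- In general only a permutation: the sorted word puts the new letter inside its block of equal
letters and not in front. Symmetry of derivatives makes up for the difference. -/
lemma multiWord_add_single_perm (I : Fin n → ℕ) (i : Fin n) :
    (multiWord (I + Pi.single i 1)).Perm (i :: multiWord I) := by
  rw [List.perm_iff_count]
  intro j
  rw [count_multiWord, List.count_cons, count_multiWord]
  by_cases h : i = j
  · subst h; simp
  · simp [h, Ne.symm h]

lemma partialD_eventuallyEq {f g : Model n → X} {z : Model n} (h : f =ᶠ[𝓝 z] g) (i : Fin n) :
    partialD i f =ᶠ[𝓝 z] partialD i g :=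
  h.fderiv.fun_comp fun L : Model n →L[ℝ] X => L (EuclideanSpace.single i 1)

lemma wordD_eventuallyEq {f g : Model n → X} {z : Model n} (h : f =ᶠ[𝓝 z] g)
    (w : List (Fin n)) : wordD w f =ᶠ[𝓝 z] wordD w g := by
  induction w with
  | nil => exact h
  | cons i w ih => exact partialD_eventuallyEq ih i

lemma wordD_eqOn {f g : Model n → X} {U : Set (Model n)} (hU : IsOpen U) (h : EqOn f g U)
    (w : List (Fin n)) : EqOn (wordD w f) (wordD w g) U := fun _ hz =>
  (wordD_eventuallyEq (h.eventuallyEq_of_mem (hU.mem_nhds hz)) w).self_of_nhds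

lemma partialMulti_eventuallyEq {f g : Model n → X} {z : Model n} (h : f =ᶠ[𝓝 z] g)
    (I : Fin n → ℕ) : partialMulti I f =ᶠ[𝓝 z] partialMulti I g := by
  simpa only [partialMulti_eq_wordD] using wordD_eventuallyEq h _

lemma jetCoord_eventuallyEq {f g : Model n → X} {z : Model n} (h : f =ᶠ[𝓝 z] g) (p : ℕ) :
    jetCoord p f =ᶠ[𝓝 z] jetCoord p g := by
  have : ∀ I : Fin n → Fin (p + 1), ∀ᶠ y in 𝓝 z, partialMulti (fun i => (I i : ℕ)) f y =
    partialMulti (fun i => (I i : ℕ)) g y := fun I => partialMulti_eventuallyEq h _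
  filter_upwards [eventually_all.2 this] with y hy
  exact funext hy

lemma wordD_contDiffOn {U : Set (Model n)} (hU : IsOpen U) {f : Model n → X}
    (hf : ContDiffOn ℝ ∞ f U) (w : List (Fin n)) : ContDiffOn ℝ ∞ (wordD w f) U := by
  induction w with
  | nil => exact hf
  | cons i w ih => exact partialD_contDiffOn hU ih i

/-- Both sides are values of the second derivative of `f`, which is symmetric. -/
lemma partialD_comm {U : Set (Model n)} (hU : IsOpen U) {f : Model n → X}
    (hf : ContDiffOn ℝ ∞ f U) (i j : Fin n) :
    EqOn (partialD i (partialD j f)) (partialD j (partialD i f)) U := by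
  intro z hz
  have hc : ContDiffAt ℝ ∞ f z := hf.contDiffAt (hU.mem_nhds hz)
  have hd : DifferentiableAt ℝ (fderiv ℝ f) z :=
    (hc.fderiv_right (m := 1) (by norm_cast)).differentiableAt (by simp)
  have key : ∀ a b : Fin n, partialD a (partialD b f) z
      = fderiv ℝ (fderiv ℝ f) z (EuclideanSpace.single a 1) (EuclideanSpace.single b 1) := by
    intro a b
    unfold partialD
    rw [fderiv_clm_apply hd (differentiableAt_const _)]
    simp
  rw [key, key]
  exact (hc.isSymmSndFDerivAt (by simp; norm_cast)) _ _

lemma wordD_perm {U : Set (Model n)} (hU : IsOpen U) {f : Model n → X}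
    (hf : ContDiffOn ℝ ∞ f U) {w w' : List (Fin n)} (h : w.Perm w') :
    EqOn (wordD w f) (wordD w' f) U := by
  induction h with
  | nil => exact fun _ _ => rfl
  | cons i _ ih => exact wordD_eqOn hU ih [i]
  | swap i j l => exact partialD_comm hU (wordD_contDiffOn hU hf l) _ _
  | trans _ _ h1 h2 => exact h1.trans h2

lemma partialD_partialMulti {U : Set (Model n)} (hU : IsOpen U) {f : Model n → X}
    (hf : ContDiffOn ℝ ∞ f U) (i : Fin n) (I : Fin n → ℕ) :
    EqOn (partialD i (partialMulti I f)) (partialMulti (I + Pi.single i 1) f) U := by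
  rw [partialMulti_eq_wordD, partialMulti_eq_wordD, ← wordD_cons]
  exact wordD_perm hU hf (multiWord_add_single_perm I i).symm

lemma wordD_clm_comp {U : Set (Model n)} (hU : IsOpen U) {f : Model n → X}
    (hf : ContDiffOn ℝ ∞ f U) (L : X →L[ℝ] Y) (w : List (Fin n)) :
    EqOn (wordD w fun z => L (f z)) (fun z => L (wordD w f z)) U := by
  induction w with
  | nil => exact fun _ _ => rfl
  | cons i w ih =>
    intro z hz
    refine (wordD_eqOn hU ih [i] hz).trans ?_
    have hd : DifferentiableAt ℝ (wordD w f) z :=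
      ((wordD_contDiffOn hU hf w).contDiffAt (hU.mem_nhds hz)).differentiableAt (by simp)
    change fderiv ℝ (fun z => L (wordD w f z)) z _ = _
    have h1 : HasFDerivAt (fun z => L (wordD w f z)) (L.comp (fderiv ℝ (wordD w f) z)) z :=
      L.hasFDerivAt.comp z hd.hasFDerivAt
    rw [h1.fderiv]
    rfl

lemma partialMulti_clm_comp {U : Set (Model n)} (hU : IsOpen U) {f : Model n → X}
    (hf : ContDiffOn ℝ ∞ f U) (L : X →L[ℝ] Y) (I : Fin n → ℕ) :
    EqOn (partialMulti I fun z => L (f z)) (fun z => L (partialMulti I f z)) U := by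
  simpa only [partialMulti_eq_wordD] using wordD_clm_comp hU hf L _

lemma jetCoord_comb {U : Set (Model n)} (hU : IsOpen U) {f g : Model n → X}
    (hf : ContDiffOn ℝ ∞ f U) (hg : ContDiffOn ℝ ∞ g U) (c : ℝ) (p : ℕ) {z : Model n}
    (hz : z ∈ U) :
    jetCoord p (fun y => c • f y + g y) z = c • jetCoord p f z + jetCoord p g z :=
  funext fun _ => partialMulti_comb hU c hf hg (fun _ _ => rfl) _ hz

lemma wordD_zero (w : List (Fin n)) : wordD w (fun _ => (0 : X)) = fun _ => 0 := by
  induction w with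
  | nil => rfl
  | cons i w ih => rw [wordD_cons, ih]; funext z; simp [partialD]

end Words

/-! ### Smooth functions of finite jets and their total derivatives -/

section JetFunctions

variable {n : ℕ} {F X Y Z S : Type*} [NormedAddCommGroup F] [NormedSpace ℝ F]
  [NormedAddCommGroup X] [NormedSpace ℝ X] [NormedAddCommGroup Y] [NormedSpace ℝ Y]
  [NormedAddCommGroup Z] [NormedSpace ℝ Z]

/-- `c` is over `W` a smooth function of `z` and of the jet of order `p` at `τ z` of the
fields `u s`. -/
def JetFn (u : S → Model n → F) (τ : Model n → Model n) (W : Set (Model n)) (p : ℕ)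
    (c : Model n → S → X) : Prop :=
  ∃ A : Model n × JetCoord n p F → X, ContDiffOn ℝ ∞ A (W ×ˢ univ) ∧
    ∀ s, ∀ z ∈ W, c z s = A (z, jetCoord p (u s) (τ z))

/-- Smooth fields on `U` and a smooth map `τ : W → U` between open sets. -/
structure JetFrame (u : S → Model n → F) (τ : Model n → Model n) (W U : Set (Model n)) :
    Prop where
  openW : IsOpen W
  openU : IsOpen U
  smooth : ContDiffOn ℝ ∞ τ W
  maps : MapsTo τ W U
  fields : ∀ s, ContDiffOn ℝ ∞ (u s) U

variable {u : S → Model n → F} {τ : Model n → Model n} {W W' U : Set (Model n)} {p q : ℕ}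

lemma JetFn.mono_set {c : Model n → S → X} (h : JetFn u τ W p c) (hs : W' ⊆ W) :
    JetFn u τ W' p c := by
  obtain ⟨A, hA, hc⟩ := h
  exact ⟨A, hA.mono (prod_mono_left hs), fun s z hz => hc s z (hs hz)⟩

lemma JetFn.congr {c d : Model n → S → X} (h : JetFn u τ W p c)
    (hcd : ∀ s, ∀ z ∈ W, d z s = c z s) : JetFn u τ W p d := by
  obtain ⟨A, hA, hc⟩ := h
  exact ⟨A, hA, fun s z hz => (hcd s z hz).trans (hc s z hz)⟩

/-- Forgetting the jet coordinates of higher order. -/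
def jetTrunc (F : Type*) [NormedAddCommGroup F] [NormedSpace ℝ F] (n : ℕ) {p q : ℕ} (h : p ≤ q) :
    JetCoord n q F →L[ℝ] JetCoord n p F :=
  ContinuousLinearMap.pi fun I => ContinuousLinearMap.proj
    (fun i => Fin.castLE (Nat.succ_le_succ h) (I i))

lemma JetFn.mono {c : Model n → S → X} (h : JetFn u τ W p c) (hpq : p ≤ q) :
    JetFn u τ W q c := by
  obtain ⟨A, hA, hc⟩ := h
  refine ⟨fun w => A (w.1, jetTrunc F n hpq w.2), ?_, fun s z hz => hc s z hz⟩
  exact hA.comp (contDiff_fst.prodMk ((jetTrunc F n hpq).contDiff.comp contDiff_snd)).contDiffOn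
    fun w hw => ⟨hw.1, mem_univ _⟩

lemma JetFn.of_base {g : Model n → X} (hg : ContDiffOn ℝ ∞ g W) :
    JetFn u τ W p fun z _ => g z :=
  ⟨fun w => g w.1, hg.comp contDiffOn_fst fun _ hw => hw.1, fun _ _ _ => rfl⟩

lemma JetFn.comp {c : Model n → S → X} (h : JetFn u τ W p c) {Φ : Model n × X → Y}
    (hΦ : ContDiffOn ℝ ∞ Φ (W ×ˢ univ)) : JetFn u τ W p fun z s => Φ (z, c z s) := by
  obtain ⟨A, hA, hc⟩ := h
  refine ⟨fun w => Φ (w.1, A w), hΦ.comp (contDiffOn_fst.prodMk hA) fun w hw => ⟨hw.1, mem_univ _⟩,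
    fun s z hz => by simp only [hc s z hz]⟩

lemma JetFn.comp_smooth {c : Model n → S → X} (h : JetFn u τ W p c) {Φ : X → Y}
    (hΦ : ContDiff ℝ ∞ Φ) : JetFn u τ W p fun z s => Φ (c z s) :=
  h.comp (Φ := fun w => Φ w.2) (hΦ.comp contDiff_snd).contDiffOn

lemma JetFn.prodMk {c : Model n → S → X} {d : Model n → S → Y} (h : JetFn u τ W p c)
    (h' : JetFn u τ W p d) : JetFn u τ W p fun z s => (c z s, d z s) := by
  obtain ⟨A, hA, hc⟩ := h
  obtain ⟨B, hB, hd⟩ := h'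
  exact ⟨fun w => (A w, B w), hA.prodMk hB, fun s z hz => by simp only [hc s z hz, hd s z hz]⟩

lemma JetFn.pi {ι : Type*} [Fintype ι] {c : ι → Model n → S → X}
    (h : ∀ i, JetFn u τ W p (c i)) : JetFn u τ W p fun z s i => c i z s := by
  choose A hA hc using h
  exact ⟨fun w i => A i w, contDiffOn_pi.2 hA, fun s z hz => funext fun i => hc i s z hz⟩

lemma JetFn.sum {ι : Type*} {t : Finset ι} {c : ι → Model n → S → X}
    (h : ∀ i ∈ t, JetFn u τ W p (c i)) : JetFn u τ W p fun z s => ∑ i ∈ t, c i z s := by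
  classical
  induction t using Finset.induction_on with
  | empty => simpa using JetFn.of_base (X := X) contDiffOn_const
  | insert a t ha ih =>
    have h1 := h a (Finset.mem_insert_self a t)
    have h2 := ih fun i hi => h i (Finset.mem_insert_of_mem hi)
    refine ((h1.prodMk h2).comp_smooth (contDiff_fst.add contDiff_snd)).congr fun s z _ => ?_
    rw [Finset.sum_insert ha]

lemma JetFn.add {c d : Model n → S → X} (h : JetFn u τ W p c) (h' : JetFn u τ W p d) :
    JetFn u τ W p fun z s => c z s + d z s :=
  (h.prodMk h').comp_smooth (contDiff_fst.add contDiff_snd)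

lemma JetFn.smul {c : Model n → S → ℝ} {d : Model n → S → X} (h : JetFn u τ W p c)
    (h' : JetFn u τ W p d) : JetFn u τ W p fun z s => c z s • d z s :=
  (h.prodMk h').comp_smooth (contDiff_fst.smul contDiff_snd)

lemma JetFn.mul {c d : Model n → S → ℝ} (h : JetFn u τ W p c)
    (h' : JetFn u τ W p d) : JetFn u τ W p fun z s => c z s * d z s := h.smul h'

lemma JetFn.const_smul {d : Model n → S → X} (h : JetFn u τ W p d) (a : ℝ) :
    JetFn u τ W p fun z s => a • d z s :=
  (JetFn.of_base contDiffOn_const).smul h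

lemma JetFn.clm {c : Model n → S → X} (h : JetFn u τ W p c) (L : X →L[ℝ] Y) :
    JetFn u τ W p fun z s => L (c z s) := h.comp_smooth L.contDiff

lemma JetFn.jet : JetFn u τ W p fun z s => jetCoord p (u s) (τ z) :=
  ⟨fun w => w.2, contDiffOn_snd, fun _ _ _ => rfl⟩

/-- The derivative of the jet coordinates along `e`, as a function of the next jet. -/
def jetShift (F : Type*) [NormedAddCommGroup F] [NormedSpace ℝ F] (n p : ℕ) (i : Fin n) :
    JetCoord n (p + 1) F →L[ℝ] JetCoord n p F :=
  ContinuousLinearMap.pi fun I => ContinuousLinearMap.proj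
    (fun j => if j = i then (I j).succ else (I j).castSucc)

/-- Differentiating `u_I` along `i` raises one entry of `I` by one. As the truncation is entrywise,
the result is still a coordinate of the jet of level `p + 1`. -/
lemma partialD_jetCoord (hU : IsOpen U) {f : Model n → F} (hf : ContDiffOn ℝ ∞ f U) (i : Fin n)
    {z : Model n} (hz : z ∈ U) :
    partialD i (jetCoord p f) z = jetShift F n p i (jetCoord (p + 1) f z) := by
  funext I
  have hd : DifferentiableAt ℝ (jetCoord p f) z :=
    ((jetCoord_contDiffOn hU hf p).contDiffAt (hU.mem_nhds hz)).differentiableAt (by simp)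
  have h1 : partialD i (jetCoord p f) z I
      = partialD i (partialMulti (fun j => (I j : ℕ)) f) z := by
    have h2 : HasFDerivAt (partialMulti (fun j => (I j : ℕ)) f)
        ((ContinuousLinearMap.proj I).comp (fderiv ℝ (jetCoord p f) z)) z :=
      (hasFDerivAt_pi'.1 hd.hasFDerivAt) I
    unfold partialD
    rw [h2.fderiv]
    rfl
  rw [h1, partialD_partialMulti hU hf i _ hz]
  change _ = partialMulti _ f z
  congr 1
  funext j
  by_cases h : j = i
  · subst h; simp
  · simp [h]

lemma eq_sum_single (e : Model n) : e = ∑ i, e i • EuclideanSpace.single i (1 : ℝ) := by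
  ext j
  simp [Finset.sum_apply, Pi.single_apply]

lemma fderiv_eq_sum_partialD (f : Model n → X) (z e : Model n) :
    fderiv ℝ f z e = ∑ i, e i • partialD i f z := by
  conv_lhs => rw [eq_sum_single e]
  simp [partialD]

lemma JetFrame.hasFDerivAt (hf : JetFrame u τ W U) {A : Model n × JetCoord n p F → X}
    (hA : ContDiffOn ℝ ∞ A (W ×ˢ univ)) (s : S) {z : Model n} (hz : z ∈ W) :
    HasFDerivAt (fun z => A (z, jetCoord p (u s) (τ z)))
      ((fderiv ℝ A (z, jetCoord p (u s) (τ z))).comp ((ContinuousLinearMap.id ℝ _).prod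
        ((fderiv ℝ (jetCoord p (u s)) (τ z)).comp (fderiv ℝ τ z)))) z := by
  have h1 : HasFDerivAt τ (fderiv ℝ τ z) z :=
    ((hf.smooth.contDiffAt (hf.openW.mem_nhds hz)).differentiableAt (by simp)).hasFDerivAt
  have h2 : HasFDerivAt (jetCoord p (u s)) (fderiv ℝ (jetCoord p (u s)) (τ z)) (τ z) :=
    (((jetCoord_contDiffOn hf.openU (hf.fields s) p).contDiffAt
      (hf.openU.mem_nhds (hf.maps hz))).differentiableAt (by simp)).hasFDerivAt
  have h3 : HasFDerivAt A (fderiv ℝ A (z, jetCoord p (u s) (τ z))) (z, jetCoord p (u s) (τ z)) :=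
    ((hA.contDiffAt ((hf.openW.prod isOpen_univ).mem_nhds ⟨hz, mem_univ _⟩)).differentiableAt
      (by simp)).hasFDerivAt
  exact h3.comp z ((hasFDerivAt_id z).prodMk (h2.comp z h1))

lemma JetFrame.contDiffOn (hf : JetFrame u τ W U) {c : Model n → S → X} (h : JetFn u τ W p c)
    (s : S) : ContDiffOn ℝ ∞ (fun z => c z s) W := by
  obtain ⟨A, hA, hc⟩ := h
  refine ContDiffOn.congr (f := fun z => A (z, jetCoord p (u s) (τ z))) ?_ fun z hz => hc s z hz
  exact hA.comp (contDiffOn_id.prodMk ((jetCoord_contDiffOn hf.openU (hf.fields s) p).comp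
    hf.smooth hf.maps)) fun z hz => ⟨hz, mem_univ _⟩

/-- This is the total derivative. By the chain rule the differential of `z ↦ A (z, j u (τ z))`
involves the derivative of the jet coordinates, and that is a linear function of the next jet which
is the same for all fields. -/
lemma JetFrame.fderiv (hf : JetFrame u τ W U) {c : Model n → S → X} (h : JetFn u τ W p c) :
    JetFn u τ W (p + 1) fun z s => _root_.fderiv ℝ (fun y => c y s) z := by
  obtain ⟨A, hA, hc⟩ := h
  -- `T` sends a jet of level `p + 1` to the differential of the jet coordinates of level `p`,
  -- assembled from the shifts in the coordinate directions.
  let T : JetCoord n (p + 1) F →L[ℝ] (Model n →L[ℝ] JetCoord n p F) :=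
    ∑ i, ((ContinuousLinearMap.smulRightL ℝ (Model n) (JetCoord n p F)
      (EuclideanSpace.proj i)).comp (jetShift F n p i))
  have hT : ∀ s, ∀ z ∈ W, _root_.fderiv ℝ (jetCoord p (u s)) (τ z)
      = T (jetCoord (p + 1) (u s) (τ z)) := by
    intro s z hz
    ext1 e
    rw [fderiv_eq_sum_partialD]
    simp only [T, sum_apply]
    refine Finset.sum_congr rfl fun i _ => ?_
    rw [partialD_jetCoord hf.openU (hf.fields s) i (hf.maps hz)]
    rfl
  have hp := Nat.le_succ p
  refine ⟨fun w => (_root_.fderiv ℝ A (w.1, jetTrunc F n hp w.2)).comp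
      ((ContinuousLinearMap.id ℝ _).prod ((T w.2).comp (_root_.fderiv ℝ τ w.1))), ?_,
    fun s z hz => ?_⟩
  · have h1 : ContDiffOn ℝ ∞ (_root_.fderiv ℝ A) (W ×ˢ univ) :=
      hA.fderiv_of_isOpen (hf.openW.prod isOpen_univ) (m := ∞) (by simp)
    have h2 : ContDiffOn ℝ ∞ (_root_.fderiv ℝ τ) W :=
      hf.smooth.fderiv_of_isOpen hf.openW (m := ∞) (by simp)
    have h3 : ContDiffOn ℝ ∞ (fun w : Model n × JetCoord n (p + 1) F =>
        _root_.fderiv ℝ A (w.1, jetTrunc F n hp w.2)) (W ×ˢ univ) :=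
      h1.comp (contDiff_fst.prodMk ((jetTrunc F n hp).contDiff.comp contDiff_snd)).contDiffOn
        fun w hw => ⟨hw.1, mem_univ _⟩
    have h4 : ContDiffOn ℝ ∞ (fun w : Model n × JetCoord n (p + 1) F => _root_.fderiv ℝ τ w.1)
        (W ×ˢ univ) := h2.comp contDiffOn_fst fun w hw => hw.1
    have h5 : ContDiffOn ℝ ∞ (fun w : Model n × JetCoord n (p + 1) F =>
        (T w.2).comp (_root_.fderiv ℝ τ w.1)) (W ×ˢ univ) :=
      (T.contDiff.comp contDiff_snd).contDiffOn.clm_comp h4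
    refine h3.clm_comp ?_
    have h6 : ContDiffOn ℝ ∞ (fun w : Model n × JetCoord n (p + 1) F =>
        (ContinuousLinearMap.inl ℝ (Model n) (JetCoord n p F)) +
        (ContinuousLinearMap.inr ℝ (Model n) (JetCoord n p F)).comp
          ((T w.2).comp (_root_.fderiv ℝ τ w.1))) (W ×ˢ univ) :=
      contDiffOn_const.add (contDiffOn_const.clm_comp h5)
    refine h6.congr fun w _ => ?_
    ext <;> simp
  · have hz' : W ∈ 𝓝 z := hf.openW.mem_nhds hz
    have : (fun y => c y s) =ᶠ[𝓝 z] fun z => A (z, jetCoord p (u s) (τ z)) :=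
      Filter.mem_of_superset hz' fun y hy => hc s y hy
    beta_reduce
    rw [this.fderiv_eq, (hf.hasFDerivAt hA s hz).fderiv, hT s z hz]
    rfl

lemma JetFrame.partialD (hf : JetFrame u τ W U) {c : Model n → S → X} (h : JetFn u τ W p c)
    (i : Fin n) : JetFn u τ W (p + 1) fun z s => LocalFunctionals.partialD i (fun y => c y s) z :=
  (hf.fderiv h).clm (ContinuousLinearMap.apply ℝ X (EuclideanSpace.single i 1))

lemma JetFrame.wordD (hf : JetFrame u τ W U) {c : Model n → S → X} (h : JetFn u τ W p c)
    (w : List (Fin n)) :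
    JetFn u τ W (p + w.length) fun z s => LocalFunctionals.wordD w (fun y => c y s) z := by
  induction w with
  | nil => exact h
  | cons i w ih => exact hf.partialD ih i

lemma JetFrame.partialMulti (hf : JetFrame u τ W U) {c : Model n → S → X} (h : JetFn u τ W p c)
    (I : Fin n → ℕ) :
    JetFn u τ W (p + ∑ i, I i) fun z s => LocalFunctionals.partialMulti I (fun y => c y s) z := by
  simpa only [partialMulti_eq_wordD, length_multiWord] using hf.wordD h (multiWord I)

/-- Origin of the recurring bound `n * p`: entrywise truncation at `p` allows derivatives of total
order up to `n * p`. -/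
lemma sum_le_of_le (I : Fin n → Fin (p + 1)) : ∑ i, (I i : ℕ) ≤ n * p := by
  calc ∑ i, (I i : ℕ) ≤ ∑ _i : Fin n, p := Finset.sum_le_sum fun i _ => by omega
    _ = n * p := by simp

end JetFunctions

/-! ### The Euler–Lagrange expression as a function of jets -/

section EulerExpr

variable {n : ℕ} {F X Y S : Type*} [NormedAddCommGroup F] [NormedSpace ℝ F]
  [NormedAddCommGroup X] [NormedSpace ℝ X] [NormedAddCommGroup Y] [NormedSpace ℝ Y]
  {W U : Set (Model n)} {p q : ℕ}

lemma JetFrame.eulerSum {u : S → Model n → F} {τ : Model n → Model n} (hf : JetFrame u τ W U)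
    {Q : (Fin n → Fin (p + 1)) → Model n → S → X} (hQ : ∀ I, JetFn u τ W q (Q I)) :
    JetFn u τ W (q + n * p) fun z s => ∑ I : Fin n → Fin (p + 1), (-1 : ℝ) ^ (∑ i, (I i : ℕ)) •
      LocalFunctionals.partialMulti (fun i => (I i : ℕ)) (fun z' => Q I z' s) z :=
  JetFn.sum fun I _ => ((hf.partialMulti (hQ I) fun i => (I i : ℕ)).mono
    (Nat.add_le_add_left (sum_le_of_le I) q)).const_smul _

lemma jetPartial_smooth (hW : IsOpen W) {A : Model n × JetCoord n p F → X}
    (hA : ContDiffOn ℝ ∞ A (W ×ˢ univ)) (I : Fin n → Fin (p + 1)) :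
    ContDiffOn ℝ ∞ (jetPartial A I) (W ×ˢ univ) :=
  (hA.fderiv_of_isOpen (hW.prod isOpen_univ) (m := ∞) (by simp)).clm_comp contDiffOn_const

lemma JetFrame.eulerExpr {u : S → Model n → F} (hf : JetFrame u id W W)
    {A : Model n × JetCoord n p F → X} (hA : ContDiffOn ℝ ∞ A (W ×ˢ univ)) :
    JetFn u id W (p + n * p) fun z s => eulerExpr A (u s) z :=
  hf.eulerSum (Q := fun I z s => jetPartial A I (z, jetCoord p (u s) z)) fun I =>
    ⟨jetPartial A I, jetPartial_smooth hf.openW hA I, fun _ _ _ => rfl⟩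

/-- The expression differentiates `∂A/∂u_I` along the jet of `u`, so vanishing at the single point
`z` would not be enough. -/
lemma eulerExpr_zero_of_jetPartial {A : Model n × JetCoord n p F → X} {u : Model n → F}
    {z : Model n} (h : ∀ᶠ y in 𝓝 z, ∀ I, jetPartial A I (y, jetCoord p u y) = 0) :
    eulerExpr A u z = 0 := by
  unfold eulerExpr
  refine Finset.sum_eq_zero fun I _ => ?_
  have h1 : (fun z' => jetPartial A I (z', jetCoord p u z')) =ᶠ[𝓝 z] fun _ => 0 := by
    filter_upwards [h] with y hy using hy I
  rw [(partialMulti_eventuallyEq h1 _).self_of_nhds, partialMulti_eq_wordD, wordD_zero, smul_zero]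

lemma jetPartial_clm (hW : IsOpen W) {A : Model n × JetCoord n p F → X}
    (hA : ContDiffOn ℝ ∞ A (W ×ˢ univ)) (L : X →L[ℝ] Y) (I : Fin n → Fin (p + 1)) :
    EqOn (jetPartial (fun w => L (A w)) I) (fun w => L.comp (jetPartial A I w)) (W ×ˢ univ) := by
  intro w hw
  have h1 : DifferentiableAt ℝ A w :=
    (hA.contDiffAt ((hW.prod isOpen_univ).mem_nhds hw)).differentiableAt (by simp)
  have h2 : HasFDerivAt (fun w => L (A w)) (L.comp (fderiv ℝ A w)) w :=
    L.hasFDerivAt.comp w h1.hasFDerivAt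
  simp only [jetPartial, h2.fderiv]
  rfl

/-- The Euler operator differentiates but never multiplies values, so it commutes with constant
linear maps. This passes from form-valued to scalar Lagrangians. -/
lemma eulerExpr_clm [FiniteDimensional ℝ F] (hW : IsOpen W) {A : Model n × JetCoord n p F → X}
    (hA : ContDiffOn ℝ ∞ A (W ×ˢ univ)) {u : Model n → F} (hu : ContDiffOn ℝ ∞ u W)
    (L : X →L[ℝ] Y) {z : Model n} (hz : z ∈ W) :
    eulerExpr (fun w => L (A w)) u z = L.comp (eulerExpr A u z) := by
  have h0 : (ContinuousLinearMap.compL ℝ F X Y L) (eulerExpr A u z)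
      = eulerExpr (fun w => L (A w)) u z := by
    unfold eulerExpr
    rw [map_sum]
    refine Finset.sum_congr rfl fun I _ => ?_
    rw [map_smul]
    congr 1
    refine (partialMulti_clm_comp hW (jetPartial_contDiffOn hW hu hA I)
      (ContinuousLinearMap.compL ℝ F X Y L) _ hz).symm.trans ?_
    refine ((partialMulti_eventuallyEq ?_ _).self_of_nhds).symm
    filter_upwards [hW.mem_nhds hz] with y hy
    exact jetPartial_clm hW hA L I ⟨hy, mem_univ _⟩
  exact h0.symm

lemma fderiv_inr_eq_sum (A : Model n × JetCoord n p F → X) (w : Model n × JetCoord n p F)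
    (η : JetCoord n p F) :
    fderiv ℝ A w (0, η) = ∑ I, jetPartial A I w (η I) := by
  classical
  have h : η = ∑ I, Pi.single I (η I) := (Finset.univ_sum_single η).symm
  have h2 : ((0 : Model n), η) = ContinuousLinearMap.inr ℝ (Model n) (JetCoord n p F) η := rfl
  rw [h2]
  conv_lhs => rw [h]
  simp only [map_sum]
  rfl

end EulerExpr

/-! ### Integration by parts and the first variation formula -/

section Integration

variable {n : ℕ} {F X : Type*} [NormedAddCommGroup F] [NormedSpace ℝ F]
  [NormedAddCommGroup X] [NormedSpace ℝ X] {W : Set (Model n)} {p : ℕ}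

/-- Smooth functions with compact support in `W`. -/
structure IsTest (W : Set (Model n)) (v : Model n → X) : Prop where
  smooth : ContDiff ℝ ∞ v
  compact : HasCompactSupport v
  subset : tsupport v ⊆ W

lemma IsTest.mono {W' : Set (Model n)} {v : Model n → X} (h : IsTest W v) (hs : W ⊆ W') :
    IsTest W' v := ⟨h.smooth, h.compact, h.subset.trans hs⟩

lemma IsTest.smul_const {f : Model n → ℝ} (h : IsTest W f) (e : X) :
    IsTest W fun z => f z • e := by
  have hs : tsupport (fun z => f z • e) ⊆ tsupport f :=
    closure_mono fun z hz h0 => hz (by simp [h0])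
  exact ⟨h.smooth.smul contDiff_const,
    HasCompactSupport.of_support_subset_isCompact h.compact (subset_closure.trans hs),
    hs.trans h.subset⟩

lemma tsupport_wordD_subset (w : List (Fin n)) (v : Model n → X) :
    tsupport (wordD w v) ⊆ tsupport v := by
  refine closure_minimal (fun z hz => ?_) (isClosed_tsupport v)
  by_contra h
  refine hz ?_
  have h0 : v =ᶠ[𝓝 z] fun _ => 0 := notMem_tsupport_iff_eventuallyEq.1 h
  rw [(wordD_eventuallyEq h0 w).self_of_nhds, wordD_zero]

lemma IsTest.wordD {v : Model n → X} (h : IsTest W v) (w : List (Fin n)) :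
    IsTest W (wordD w v) :=
  ⟨contDiffOn_univ.1 (wordD_contDiffOn isOpen_univ h.smooth.contDiffOn w),
    HasCompactSupport.of_support_subset_isCompact h.compact
      (subset_closure.trans (tsupport_wordD_subset w v)),
    (tsupport_wordD_subset w v).trans h.subset⟩

lemma integrable_of_continuousOn_of_compact {K : Set (Model n)} (hK : IsCompact K) {g : Model n → X}
    (hg : ContinuousOn g K) (h0 : ∀ z ∉ K, g z = 0) : Integrable g := by
  rw [← integrableOn_iff_integrable_of_support_subset (s := K)]
  · exact hg.integrableOn_compact hK
  · intro z hz
    by_contra h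
    exact hz (h0 z h)

/-- Nothing is known about `Q` outside `W`, but there the test field vanishes. The same remark lets
the integrals below run over the whole space. -/
lemma integrable_apply_test {Q : Model n → F →L[ℝ] X} (hQ : ContinuousOn Q W) {v : Model n → F}
    (hv : IsTest W v) : Integrable fun z => Q z (v z) := by
  refine integrable_of_continuousOn_of_compact hv.compact
    ((hQ.mono hv.subset).clm_apply hv.smooth.continuous.continuousOn) fun z hz => ?_
  rw [image_eq_zero_of_notMem_tsupport hz, map_zero]

lemma integral_apply_partialD (hW : IsOpen W) {Q : Model n → F →L[ℝ] ℝ}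
    (hQ : ContDiffOn ℝ ∞ Q W) {v : Model n → F} (hv : IsTest W v) (i : Fin n) :
    ∫ z, Q z (partialD i v z) = - ∫ z, partialD i Q z (v z) := by
  refine integral_bilinear_fderiv_right_eq_neg_left_of_integrable
    (B := ContinuousLinearMap.id ℝ (F →L[ℝ] ℝ)) ?_ ?_ ?_ ?_ ?_
  · exact integrable_apply_test (partialD_contDiffOn hW hQ i).continuousOn hv
  · exact integrable_apply_test hQ.continuousOn (hv.wordD [i])
  · exact integrable_apply_test hQ.continuousOn hv
  · exact fun z hz =>
      (hQ.contDiffAt (hW.mem_nhds (hv.subset hz))).differentiableAt (by simp)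
  · exact fun z _ => hv.smooth.contDiffAt.differentiableAt (by simp)

lemma integral_apply_wordD (hW : IsOpen W) {Q : Model n → F →L[ℝ] ℝ}
    (hQ : ContDiffOn ℝ ∞ Q W) {v : Model n → F} (hv : IsTest W v) (w : List (Fin n)) :
    ∫ z, Q z (wordD w v z) = (-1) ^ w.length * ∫ z, wordD w Q z (v z) := by
  -- Moving the letters one at a time from `v` to `Q` reverses their order. The original order is
  -- restored afterwards by the symmetry of derivatives on `W`.
  have key : ∀ (w : List (Fin n)) (Q : Model n → F →L[ℝ] ℝ), ContDiffOn ℝ ∞ Q W →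
      ∫ z, Q z (wordD w v z) = (-1) ^ w.length * ∫ z, wordD w.reverse Q z (v z) := by
    intro w
    induction w with
    | nil => intro Q _; simp
    | cons i w ih =>
      intro Q hQ
      rw [wordD_cons, integral_apply_partialD hW hQ (hv.wordD w) i,
        ih _ (partialD_contDiffOn hW hQ i), List.reverse_cons, wordD_append, List.length_cons,
        pow_succ]
      simp only [wordD_cons, wordD_nil]
      ring
  rw [key w Q hQ]
  congr 1
  refine integral_congr_ae (Eventually.of_forall fun z => ?_)
  by_cases hz : z ∈ W
  · simp only [wordD_perm hW hQ w.reverse_perm hz]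
  · have : v z = 0 := image_eq_zero_of_notMem_tsupport fun h => hz (hv.subset h)
    simp [this]

/-- The first variation formula. -/
theorem integral_variation [FiniteDimensional ℝ F] (hW : IsOpen W)
    {A : Model n × JetCoord n p F → ℝ}
    (hA : ContDiffOn ℝ ∞ A (W ×ˢ univ)) {u v : Model n → F} (hu : ContDiffOn ℝ ∞ u W)
    (hv : IsTest W v) :
    ∫ z, fderiv ℝ A (z, jetCoord p u z) (0, jetCoord p v z) = ∫ z, eulerExpr A u z (v z) := by
  simp only [fderiv_inr_eq_sum, eulerExpr, sum_apply, smul_apply]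
  have hQ := fun I => jetPartial_contDiffOn hW hu hA I
  rw [integral_finsetSum, integral_finsetSum]
  · refine Finset.sum_congr rfl fun I _ => ?_
    rw [integral_smul]
    simp only [jetCoord, partialMulti_eq_wordD]
    have := integral_apply_wordD hW (hQ I) hv (multiWord fun i => (I i : ℕ))
    rw [length_multiWord] at this
    exact this
  · intro I _
    exact (integrable_apply_test (partialMulti_contDiffOn hW (hQ I) _).continuousOn hv).smul
      ((-1 : ℝ) ^ (∑ i, (I i : ℕ)))
  · intro I _
    have := integrable_apply_test (hQ I).continuousOn (hv.wordD (multiWord fun i => (I i : ℕ)))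
    simp only [← partialMulti_eq_wordD] at this
    exact this

/-- The fundamental lemma of the calculus of variations; continuity improves vanishing almost
everywhere to vanishing everywhere on the open set. -/
lemma eq_zero_of_integral_test (hW : IsOpen W) {g : Model n → ℝ} (hg : ContinuousOn g W)
    (h : ∀ f : Model n → ℝ, IsTest W f → ∫ z, f z * g z = 0) : ∀ z ∈ W, g z = 0 := by
  have h1 := hW.ae_eq_zero_of_integral_contDiff_smul_eq_zero (μ := volume)
    (hg.locallyIntegrableOn hW.measurableSet) fun f h1 h2 h3 => h f ⟨h1, h2, h3⟩
  have h2 : g =ᵐ[volume.restrict W] fun _ => 0 := by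
    rwa [Filter.EventuallyEq, ae_restrict_iff' hW.measurableSet]
  exact Measure.eqOn_open_of_ae_eq h2 hW hg continuousOn_const

/-- The first variation formula followed by the fundamental lemma, applied to test fields `f e` with
a constant vector `e`. All structural properties of the Euler operator below are derived from this
characterization. -/
lemma eulerExpr_eq_of_integral [FiniteDimensional ℝ F] (hW : IsOpen W)
    {A : Model n × JetCoord n p F → ℝ}
    (hA : ContDiffOn ℝ ∞ A (W ×ˢ univ)) {u : Model n → F} (hu : ContDiffOn ℝ ∞ u W)
    {Q : Model n → F →L[ℝ] ℝ} (hQ : ContinuousOn Q W)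
    (h : ∀ v : Model n → F, IsTest W v →
      ∫ z, fderiv ℝ A (z, jetCoord p u z) (0, jetCoord p v z) = ∫ z, Q z (v z)) :
    ∀ z ∈ W, eulerExpr A u z = Q z := by
  have hE : ContinuousOn (eulerExpr A u) W := by
    have hf : JetFrame (fun _ : Unit => u) id W W :=
      ⟨hW, hW, contDiffOn_id, mapsTo_id _, fun _ => hu⟩
    exact (hf.contDiffOn (hf.eulerExpr hA) ()).continuousOn
  intro z hz
  ext e
  rw [← sub_eq_zero]
  refine eq_zero_of_integral_test hW (g := fun z => eulerExpr A u z e - Q z e)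
    ((hE.clm_apply continuousOn_const).sub (hQ.clm_apply continuousOn_const)) (fun f hf => ?_) z hz
  have hv := hf.smul_const e
  have h1 := h _ hv
  rw [integral_variation hW hA hu hv, ← sub_eq_zero,
    ← integral_sub (integrable_apply_test hE hv) (integrable_apply_test hQ hv)] at h1
  rw [← h1]
  simp only [map_smul, smul_eq_mul, mul_sub]

end Integration

/-! ### One-parameter families and the Euler–Lagrange expression of a divergence -/

section Families

variable {n : ℕ} {F X S : Type*} [NormedAddCommGroup F] [NormedSpace ℝ F]
  [NormedAddCommGroup X] [NormedSpace ℝ X] {W U : Set (Model n)} {p q : ℕ}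

lemma isTest_of_contDiffOn (hW : IsOpen W) {g : Model n → X} (hg : ContDiffOn ℝ ∞ g W)
    {K : Set (Model n)} (hK : IsCompact K) (hKW : K ⊆ W) (h0 : ∀ z ∉ K, g z = 0) :
    IsTest W g := by
  have hs : tsupport g ⊆ K :=
    closure_minimal (fun z hz => by by_contra h; exact hz (h0 z h)) hK.isClosed
  refine ⟨contDiff_iff_contDiffAt.2 fun z => ?_,
    HasCompactSupport.of_support_subset_isCompact hK (subset_closure.trans hs), hs.trans hKW⟩
  by_cases hz : z ∈ W
  · exact hg.contDiffAt (hW.mem_nhds hz)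
  · have : g =ᶠ[𝓝 z] fun _ => 0 := by
      filter_upwards [hK.isClosed.isOpen_compl.mem_nhds fun h => hz (hKW h)] with y hy
      exact h0 y hy
    exact contDiffAt_const.congr_of_eventuallyEq this

lemma integral_partialD_eq_zero {g : Model n → ℝ} (hg : IsTest W g) (i : Fin n) :
    ∫ z, partialD i g z = 0 := by
  have h := integral_apply_partialD isOpen_univ (Q := fun _ => ContinuousLinearMap.id ℝ ℝ)
    contDiffOn_const (hg.mono (subset_univ W)) i
  simpa [partialD] using h

/-- The derivative in the parameter commutes with spatial derivatives by symmetry of mixed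
derivatives. Joint smoothness is carried along because the induction needs it at each letter. -/
lemma wordD_family (hU : IsOpen U) {G : ℝ × Model n → X} (hG : ContDiffOn ℝ ∞ G (univ ×ˢ U))
    (w : List (Fin n)) :
    ContDiffOn ℝ ∞ (fun a : ℝ × Model n => wordD w (fun y => G (a.1, y)) a.2) (univ ×ˢ U) ∧
    ∀ t, ∀ z ∈ U, fderiv ℝ (fun a : ℝ × Model n => wordD w (fun y => G (a.1, y)) a.2) (t, z) (1, 0)
      = wordD w (fun y => fderiv ℝ G (t, y) (1, 0)) z := by
  induction w with
  | nil => exact ⟨hG, fun t z _ => rfl⟩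
  | cons i w ih =>
    obtain ⟨h1, h2⟩ := ih
    set H : ℝ × Model n → X := fun a => wordD w (fun y => G (a.1, y)) a.2 with hH
    have hO : IsOpen ((univ : Set ℝ) ×ˢ U) := isOpen_univ.prod hU
    have hd : ∀ a ∈ (univ : Set ℝ) ×ˢ U, HasFDerivAt H (fderiv ℝ H a) a := fun a ha =>
      ((h1.contDiffAt (hO.mem_nhds ha)).differentiableAt (by simp)).hasFDerivAt
    have hpart : EqOn (fun a : ℝ × Model n => wordD (i :: w) (fun y => G (a.1, y)) a.2)
        (fun a => fderiv ℝ H a (0, EuclideanSpace.single i 1)) (univ ×ˢ U) := by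
      rintro ⟨t, z⟩ ha
      have h3 : HasFDerivAt (fun y => H (t, y))
          ((fderiv ℝ H (t, z)).comp (ContinuousLinearMap.inr ℝ ℝ (Model n))) z :=
        (hd _ ha).comp z (hasFDerivAt_prodMk_right t z)
      change fderiv ℝ (fun y => H (t, y)) z _ = _
      rw [h3.fderiv]
      rfl
    have hF : ContDiffOn ℝ ∞ (fderiv ℝ H) (univ ×ˢ U) :=
      h1.fderiv_of_isOpen hO (m := ∞) (by simp)
    refine ⟨(hF.clm_apply contDiffOn_const).congr hpart, fun t z hz => ?_⟩
    have ha : (t, z) ∈ (univ : Set ℝ) ×ˢ U := ⟨mem_univ _, hz⟩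
    have hF' : HasFDerivAt (fderiv ℝ H) (fderiv ℝ (fderiv ℝ H) (t, z)) (t, z) :=
      ((hF.contDiffAt (hO.mem_nhds ha)).differentiableAt (by simp)).hasFDerivAt
    rw [(hpart.eventuallyEq_of_mem (hO.mem_nhds ha)).fderiv_eq,
      (hF'.clm_apply (hasFDerivAt_const _ _)).fderiv, wordD_cons]
    have h4 : partialD i (wordD w fun y => fderiv ℝ G (t, y) (1, 0)) z
        = fderiv ℝ (fun y => fderiv ℝ H (t, y) (1, 0)) z (EuclideanSpace.single i 1) := by
      unfold partialD
      have : (wordD w fun y => fderiv ℝ G (t, y) (1, 0)) =ᶠ[𝓝 z]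
          fun y => fderiv ℝ H (t, y) (1, 0) := by
        filter_upwards [hU.mem_nhds hz] with y hy using (h2 t y hy).symm
      rw [this.fderiv_eq]
    have h5 : HasFDerivAt (fun y => fderiv ℝ H (t, y) (1, 0))
        (((fderiv ℝ (fderiv ℝ H) (t, z)).comp (ContinuousLinearMap.inr ℝ ℝ (Model n))).flip (1, 0))
        z := by
      have h6 := (hF'.comp z (hasFDerivAt_prodMk_right t z)).clm_apply
        (hasFDerivAt_const ((1, 0) : ℝ × Model n) z)
      refine h6.congr_fderiv ?_
      ext e
      simp
    rw [h4, h5.fderiv]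
    -- Symmetry of the second derivative in the parameter direction `(1, 0)` and the spatial
    -- direction `(0, e_i)`.
    have hsymm := (h1.contDiffAt (hO.mem_nhds ha)).isSymmSndFDerivAt (by simp; norm_cast)
    have := hsymm (1, 0) (0, EuclideanSpace.single i 1)
    simpa using this

lemma hasDerivAt_wordD (hU : IsOpen U) {G : ℝ × Model n → X} (hG : ContDiffOn ℝ ∞ G (univ ×ˢ U))
    (w : List (Fin n)) (t : ℝ) {z : Model n} (hz : z ∈ U) :
    HasDerivAt (fun t => wordD w (fun y => G (t, y)) z)
      (wordD w (fun y => fderiv ℝ G (t, y) (1, 0)) z) t := by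
  obtain ⟨h1, h2⟩ := wordD_family hU hG w
  have hd := ((h1.contDiffAt ((isOpen_univ.prod hU).mem_nhds
    (show (t, z) ∈ (univ : Set ℝ) ×ˢ U from ⟨mem_univ _, hz⟩))).differentiableAt
    (by simp)).hasFDerivAt
  have h3 : HasDerivAt (fun s : ℝ => (s, z)) ((1 : ℝ), (0 : Model n)) t :=
    (hasDerivAt_id t).prodMk (hasDerivAt_const t z)
  rw [← h2 t z hz]
  exact hd.comp_hasDerivAt t h3

lemma hasDerivAt_jetCoord (hU : IsOpen U) {G : ℝ × Model n → F}
    (hG : ContDiffOn ℝ ∞ G (univ ×ˢ U)) (t : ℝ) {z : Model n} (hz : z ∈ U) :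
    HasDerivAt (fun t => jetCoord p (fun y => G (t, y)) z)
      (jetCoord p (fun y => fderiv ℝ G (t, y) (1, 0)) z) t := by
  refine hasDerivAt_pi.2 fun I => ?_
  simp only [jetCoord, partialMulti_eq_wordD]
  exact hasDerivAt_wordD hU hG _ t hz

lemma hasDerivAt_comp_jet (hW : IsOpen W) {A : Model n × JetCoord n p F → X}
    (hA : ContDiffOn ℝ ∞ A (W ×ˢ univ)) {z : Model n} (hz : z ∈ W) {γ : ℝ → JetCoord n p F}
    {γ' : JetCoord n p F} {t : ℝ} (hγ : HasDerivAt γ γ' t) :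
    HasDerivAt (fun t => A (z, γ t)) (fderiv ℝ A (z, γ t) (0, γ')) t := by
  have hd : HasFDerivAt A (fderiv ℝ A (z, γ t)) (z, γ t) :=
    ((hA.contDiffAt ((hW.prod isOpen_univ).mem_nhds ⟨hz, mem_univ _⟩)).differentiableAt
      (by simp)).hasFDerivAt
  exact hd.comp_hasDerivAt t ((hasDerivAt_const t z).prodMk hγ)

/-- The Euler–Lagrange expression of a divergence vanishes. -/
theorem eulerExpr_divergence [FiniteDimensional ℝ F] {u : S → Model n → F}
    (hf : JetFrame u id W W) {b : Fin n → Model n → S → ℝ} (hb : ∀ i, JetFn u id W q (b i))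
    (c : Fin n → ℝ) {A : Model n × JetCoord n p F → ℝ} (hA : ContDiffOn ℝ ∞ A (W ×ˢ univ))
    (hAb : ∀ s, ∀ z ∈ W, A (z, jetCoord p (u s) z) = ∑ i, c i * partialD i (fun y => b i y s) z)
    (s : S) (hs : ∀ v : Model n → F, IsTest W v → ∀ t : ℝ, ∃ s', ∀ z ∈ W, u s' z = t • v z + u s z)
    {z : Model n} (hz : z ∈ W) : eulerExpr A (u s) z = 0 := by
  have hW := hf.openW
  -- By the characterization with `Q = 0` it suffices that every first variation of `A` integrates
  -- to zero. It will turn out to be a divergence of compactly supported functions.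
  refine eulerExpr_eq_of_integral hW hA (hf.fields s) (Q := fun _ => 0) continuousOn_const
    (fun v hv => ?_) z hz
  choose B hB hbB using hb
  choose s' hs' using hs v hv
  have hjet : ∀ (r : ℕ) t, ∀ z ∈ W, jetCoord r (u (s' t)) z
      = t • jetCoord r v z + jetCoord r (u s) z := by
    intro r t z hz
    rw [← jetCoord_comb hW (hv.smooth.contDiffOn) (hf.fields s) t r hz]
    exact (jetCoord_eventuallyEq (Filter.mem_of_superset (hW.mem_nhds hz) (hs' t)) r).self_of_nhds
  have hline : ∀ (r : ℕ) (z : Model n), HasDerivAt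
      (fun t : ℝ => t • jetCoord r v z + jetCoord r (u s) z) (jetCoord r v z) 0 := by
    intro r z
    simpa using ((hasDerivAt_id (0 : ℝ)).smul_const (jetCoord r v z)).add_const (jetCoord r (u s) z)
  -- `G i (t, z)` is the value of `b i` along the varied field `t v + u s`, written with the jets of
  -- `v` and `u s` so that joint smoothness in `(t, z)` is visible.
  let G : Fin n → ℝ × Model n → ℝ := fun i a =>
    B i (a.2, a.1 • jetCoord q v a.2 + jetCoord q (u s) a.2)
  have hG : ∀ i, ContDiffOn ℝ ∞ (G i) (univ ×ˢ W) := by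
    intro i
    have h1 : ContDiffOn ℝ ∞ (fun a : ℝ × Model n => jetCoord q v a.2) (univ ×ˢ W) :=
      (jetCoord_contDiffOn hW hv.smooth.contDiffOn q).comp contDiffOn_snd fun a ha => ha.2
    have h2 : ContDiffOn ℝ ∞ (fun a : ℝ × Model n => jetCoord q (u s) a.2) (univ ×ˢ W) :=
      (jetCoord_contDiffOn hW (hf.fields s) q).comp contDiffOn_snd fun a ha => ha.2
    exact (hB i).comp (contDiffOn_snd.prodMk ((contDiffOn_fst.smul h1).add h2))
      fun a ha => ⟨ha.2, mem_univ _⟩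
  have hGdot : ∀ i, ∀ z ∈ W, fderiv ℝ (G i) (0, z) (1, 0)
      = fderiv ℝ (B i) (z, jetCoord q (u s) z) (0, jetCoord q v z) := by
    intro i z hz
    have h1 := hasDerivAt_comp_jet hW (hB i) hz (hline q z)
    have h2 := hasDerivAt_wordD hW (hG i) [] 0 hz
    have h3 := h2.unique h1
    simpa using h3
  -- The variation of `b i`. It is linear in the jet of `v`, hence supported in the support of `v`,
  -- although `b i` itself need not have compact support.
  let g : Fin n → Model n → ℝ := fun i z =>
    fderiv ℝ (B i) (z, jetCoord q (u s) z) (0, jetCoord q v z)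
  have hv0 : ∀ (r : ℕ), ∀ z ∉ tsupport v, jetCoord r v z = 0 := by
    intro r z hz
    funext I
    simp only [jetCoord, partialMulti_eq_wordD]
    exact image_eq_zero_of_notMem_tsupport fun h => hz (tsupport_wordD_subset _ v h)
  have hg : ∀ i, IsTest W (g i) := by
    intro i
    refine isTest_of_contDiffOn hW ?_ hv.compact hv.subset fun z hz => ?_
    · have h1 : ContDiffOn ℝ ∞ (fderiv ℝ (B i)) (W ×ˢ univ) :=
        (hB i).fderiv_of_isOpen (hW.prod isOpen_univ) (m := ∞) (by simp)
      have h2 := h1.comp (contDiffOn_id.prodMk (jetCoord_contDiffOn hW (hf.fields s) q))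
        fun z hz => (⟨hz, mem_univ _⟩ : _ ∈ W ×ˢ univ)
      exact h2.clm_apply (contDiffOn_const.prodMk (jetCoord_contDiffOn hW hv.smooth.contDiffOn q))
    · simp only [g, hv0 q z hz]
      exact map_zero _
  -- Interchanging the derivative in `t` with the spatial derivatives turns the variation of the
  -- divergence into the divergence of the variations.
  have key : ∀ z, fderiv ℝ A (z, jetCoord p (u s) z) (0, jetCoord p v z)
      = ∑ i, c i * partialD i (g i) z := by
    intro z
    by_cases hz : z ∈ W
    · have h1 := hasDerivAt_comp_jet hW hA hz (hline p z)
      have h2 : HasDerivAt (fun t : ℝ => A (z, t • jetCoord p v z + jetCoord p (u s) z))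
          (∑ i, c i * partialD i (g i) z) 0 := by
        have h3 : ∀ t : ℝ, A (z, t • jetCoord p v z + jetCoord p (u s) z)
            = ∑ i, c i * wordD [i] (fun y => G i (t, y)) z := by
          intro t
          rw [← hjet p t z hz, hAb _ z hz]
          refine Finset.sum_congr rfl fun i _ => ?_
          congr 1
          refine wordD_eqOn hW (fun y hy => ?_) [i] hz
          simp only [hbB i _ y hy, id, hjet q t y hy, G]
        simp only [h3]
        refine HasDerivAt.fun_sum fun i _ => HasDerivAt.const_mul _ ?_
        have h4 := hasDerivAt_wordD hW (hG i) [i] 0 hz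
        have h5 : wordD [i] (fun y => fderiv ℝ (G i) (0, y) (1, 0)) z = partialD i (g i) z :=
          wordD_eqOn hW (fun y hy => hGdot i y hy) [i] hz
        rwa [h5] at h4
      have := h1.unique h2
      simpa using this
    · have hz' : z ∉ tsupport v := fun h => hz (hv.subset h)
      rw [hv0 p z hz']
      have h6 : ∀ i, partialD i (g i) z = 0 := by
        intro i
        refine image_eq_zero_of_notMem_tsupport fun h => hz ((hg i).subset ?_)
        exact tsupport_wordD_subset [i] (g i) h
      simp only [h6, mul_zero, Finset.sum_const_zero]
      exact map_zero _
  simp only [key]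
  rw [integral_finsetSum]
  · simp [integral_const_mul, integral_partialD_eq_zero (hg _)]
  · intro i _
    have := ((hg i).wordD [i])
    exact ((this.smooth.continuous.integrable_of_hasCompactSupport this.compact).const_mul _)

end Families

/-! ### Realizing finite jets by test functions -/

section Realization

variable {n : ℕ} {F X : Type*} [NormedAddCommGroup F] [NormedSpace ℝ F]
  [NormedAddCommGroup X] [NormedSpace ℝ X] {W : Set (Model n)} {p : ℕ}

lemma partialD_prod (g : Fin n → ℝ → ℝ) (hg : ∀ j, ContDiff ℝ ∞ (g j)) (c : X) (i : Fin n) :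
    partialD i (fun y : Model n => (∏ j, g j (y j)) • c)
      = fun y => (∏ j, (Function.update g i (deriv (g i))) j (y j)) • c := by
  funext y
  have h1 : ∀ j ∈ Finset.univ, HasFDerivAt (fun y : Model n => g j (y j))
      ((deriv (g j) (y j)) • (EuclideanSpace.proj j : Model n →L[ℝ] ℝ)) y := by
    intro j _
    exact (((hg j).differentiable (by simp)) (y j)).hasDerivAt.comp_hasFDerivAt y
      (EuclideanSpace.proj j : Model n →L[ℝ] ℝ).hasFDerivAt
  have h2 := (HasFDerivAt.finsetProd h1).smul_const c
  change fderiv ℝ _ y _ = _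
  rw [h2.fderiv]
  simp only [ContinuousLinearMap.smulRight_apply]
  congr 1
  rw [sum_apply, Finset.sum_eq_single i]
  · rw [← Finset.mul_prod_erase Finset.univ _ (Finset.mem_univ i)]
    simp only [smul_apply, smul_eq_mul, Function.update_self]
    simp only [PiLp.proj_apply, PiLp.single_apply, if_true, mul_one]
    rw [mul_comm]
    congr 1
    refine Finset.prod_congr rfl fun j hj => ?_
    rw [Function.update_of_ne (Finset.ne_of_mem_erase hj)]
  · intro j _ hj
    simp [hj]
  · simp

lemma contDiff_iterate_deriv {g : ℝ → ℝ} (hg : ContDiff ℝ ∞ g) (m : ℕ) :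
    ContDiff ℝ ∞ (deriv^[m] g) := hg.iterate_deriv m

lemma wordD_prod (g : Fin n → ℝ → ℝ) (hg : ∀ j, ContDiff ℝ ∞ (g j)) (c : X)
    (w : List (Fin n)) :
    wordD w (fun y : Model n => (∏ j, g j (y j)) • c)
      = fun y => (∏ j, (deriv^[w.count j] (g j)) (y j)) • c := by
  induction w with
  | nil => rfl
  | cons i w ih =>
    rw [wordD_cons, ih, partialD_prod _ fun j => contDiff_iterate_deriv (hg j) _]
    funext y
    congr 1
    refine Finset.prod_congr rfl fun j _ => ?_
    by_cases h : j = i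
    · subst h
      rw [Function.update_self, List.count_cons_self, Function.iterate_succ_apply']
    · rw [Function.update_of_ne h, List.count_cons_of_ne (Ne.symm h)]

lemma iterate_deriv_sub_pow (a : ℝ) (k m : ℕ) :
    deriv^[m] (fun t => (t - a) ^ k) = fun t => (k.descFactorial m : ℝ) * (t - a) ^ (k - m) := by
  induction m with
  | zero => simp
  | succ m ih =>
    rw [Function.iterate_succ_apply', ih]
    funext t
    have h : HasDerivAt (fun t : ℝ => (t - a) ^ (k - m))
        (((k - m : ℕ) : ℝ) * (t - a) ^ (k - m - 1) * 1) t :=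
      ((hasDerivAt_id t).sub_const a).pow (k - m)
    rw [(h.const_mul _).deriv, Nat.descFactorial_succ, ← Nat.sub_sub]
    push_cast
    ring

lemma iterate_deriv_sub_pow_self (a : ℝ) (k m : ℕ) :
    (deriv^[m] (fun t => (t - a) ^ k)) a = if m = k then (k.factorial : ℝ) else 0 := by
  rw [iterate_deriv_sub_pow]
  rcases lt_trichotomy m k with h | h | h
  · have : k - m ≠ 0 := by omega
    simp [this, h.ne]
  · subst h; simp [Nat.descFactorial_self]
  · simp [Nat.descFactorial_eq_zero_iff_lt.2 h, h.ne']

lemma partialMulti_monomial (z : Model n) (J I : Fin n → ℕ) (c : X) :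
    partialMulti I (fun y : Model n => (∏ j, (y j - z j) ^ J j) • c) z
      = if I = J then (∏ j, ((J j).factorial : ℝ)) • c else 0 := by
  rw [partialMulti_eq_wordD, wordD_prod (fun j t => (t - z j) ^ J j)
    (fun j => (contDiff_id.sub contDiff_const).pow _)]
  simp only [count_multiWord, iterate_deriv_sub_pow_self]
  by_cases h : I = J
  · subst h; simp
  · obtain ⟨j, hj⟩ := Function.ne_iff.1 h
    rw [if_neg h, Finset.prod_eq_zero (Finset.mem_univ j) (if_neg hj), zero_smul]

/-- Every finite jet is the jet of a test function. -/
theorem exists_test_jetCoord (hW : IsOpen W) {z : Model n} (hz : z ∈ W) (w : JetCoord n p X) :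
    ∃ v : Model n → X, IsTest W v ∧ jetCoord p v z = w := by
  -- Taylor monomials centred at `z`: only the derivative `∂_J` of the monomial with exponent `J`
  -- survives at `z`, and dividing by `J!` makes it equal to `w J`.
  let m : (Fin n → Fin (p + 1)) → Model n → X := fun J y =>
    (∏ j, (y j - z j) ^ (J j : ℕ)) • ((∏ j, ((J j : ℕ).factorial : ℝ))⁻¹ • w J)
  have hm : ∀ J, ContDiff ℝ ∞ (m J) := by
    intro J
    refine ContDiff.smul (contDiff_prod fun j _ => ?_) contDiff_const
    exact ((EuclideanSpace.proj j : Model n →L[ℝ] ℝ).contDiff.sub contDiff_const).pow _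
  have hsum : ∀ (I : Fin n → ℕ) (t : Finset (Fin n → Fin (p + 1))),
      partialMulti I (fun y => ∑ J ∈ t, m J y) z = ∑ J ∈ t, partialMulti I (m J) z := by
    intro I t
    induction t using Finset.induction_on with
    | empty => simp [partialMulti_eq_wordD, wordD_zero]
    | insert a t ha ih =>
      rw [Finset.sum_insert ha, ← ih]
      have hs : ContDiff ℝ ∞ fun y => ∑ J ∈ t, m J y := ContDiff.sum fun J _ => hm J
      have := partialMulti_comb isOpen_univ 1 (hm a).contDiffOn hs.contDiffOn
        (h := fun y => ∑ J ∈ insert a t, m J y)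
        (fun y _ => by simp [Finset.sum_insert ha]) I (mem_univ z)
      simpa using this
  -- The cut-off equals `1` near `z`, so multiplying the Taylor polynomial by it does not change the
  -- jet there.
  obtain ⟨f, hf⟩ : ∃ f : ContDiffBump z, Metric.closedBall z f.rOut ⊆ W := by
    obtain ⟨ε, hε, hb⟩ := Metric.isOpen_iff.1 hW z hz
    exact ⟨⟨ε / 4, ε / 2, by linarith, by linarith⟩,
      (Metric.closedBall_subset_ball (by change ε / 2 < ε; linarith)).trans hb⟩
  let v : Model n → X := fun y => f y • ∑ J, m J y
  have hs : tsupport v ⊆ tsupport f := closure_mono fun y hy h0 => hy (by simp [v, h0])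
  refine ⟨v, ⟨f.contDiff.smul (ContDiff.sum fun J _ => hm J),
    HasCompactSupport.of_support_subset_isCompact f.hasCompactSupport (subset_closure.trans hs),
    (hs.trans f.tsupport_eq.le).trans hf⟩, ?_⟩
  have hv : v =ᶠ[𝓝 z] fun y => ∑ J, m J y := by
    filter_upwards [f.eventuallyEq_one] with y hy
    simp [v, hy]
  rw [(jetCoord_eventuallyEq hv p).self_of_nhds]
  funext I
  change partialMulti _ _ z = _
  rw [hsum, Finset.sum_eq_single I]
  · rw [partialMulti_monomial z (fun j => (I j : ℕ)) _ _, if_pos rfl, smul_smul, mul_inv_cancel₀,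
      one_smul]
    exact Finset.prod_ne_zero_iff.2 fun j _ => by positivity
  · intro J _ hJ
    rw [partialMulti_monomial z (fun j => (J j : ℕ)) _ _, if_neg]
    intro h
    exact hJ (funext fun j => Fin.ext (congrFun h j).symm)
  · simp

end Realization

/-! ### Linear differential operators on test functions and integration by parts -/

section JointFields

variable {n : ℕ} {F F' X S S' T : Type*} [NormedAddCommGroup F] [NormedSpace ℝ F]
  [NormedAddCommGroup F'] [NormedSpace ℝ F']
  [NormedAddCommGroup X] [NormedSpace ℝ X] {W U : Set (Model n)} {p q N : ℕ}
  {u : S → Model n → F} {τ : Model n → Model n}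

lemma jetCoord_apply_zero (f : Model n → X) (z : Model n) :
    jetCoord p f z (fun _ => 0) = f z := by
  have h : multiWord (fun _ : Fin n => ((0 : Fin (p + 1)) : ℕ)) = [] := by
    rw [← List.length_eq_zero_iff, length_multiWord]
    simp
  simp only [jetCoord, partialMulti_eq_wordD, h, wordD_nil]

lemma JetFn.field : JetFn u τ W p fun z s => u s (τ z) :=
  (JetFn.clm JetFn.jet (ContinuousLinearMap.proj (fun _ => 0))).congr fun s z _ =>
    (jetCoord_apply_zero (u s) (τ z)).symm

/-- Constant linear maps commute with partial derivatives, so they act on jets coordinatewise. This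
is how a function of the jet of one component becomes a function of the jet of a joint field. -/
lemma JetFn.of_field (hf : JetFrame u τ W U) {c : Model n → S → X} (hc : JetFn u τ W p c)
    {v : S' → Model n → F'} (hv : JetFrame v τ W U) (L : F' →L[ℝ] F) (r : S' → S)
    (h : ∀ s, ∀ z ∈ U, u (r s) z = L (v s z)) : JetFn v τ W p fun z s => c z (r s) := by
  obtain ⟨A, hA, hcA⟩ := hc
  let Λ : JetCoord n p F' →L[ℝ] JetCoord n p F :=
    ContinuousLinearMap.pi fun I => L.comp (ContinuousLinearMap.proj I)
  refine ⟨fun w => A (w.1, Λ w.2), hA.comp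
    (contDiff_fst.prodMk (Λ.contDiff.comp contDiff_snd)).contDiffOn
    fun w hw => ⟨hw.1, mem_univ _⟩, fun s z hz => ?_⟩
  beta_reduce
  rw [hcA _ z hz]
  congr 2
  have hz' := hf.maps hz
  have h1 : u (r s) =ᶠ[𝓝 (τ z)] fun y => L (v s y) :=
    Filter.mem_of_superset (hf.openU.mem_nhds hz') (h s)
  rw [(jetCoord_eventuallyEq h1 p).self_of_nhds]
  exact funext fun I => partialMulti_clm_comp hf.openU (hv.fields s) L _ hz'

/-- The joint field of a scalar function and a field. -/
def pairField (f : T → Model n → ℝ) (u : S → Model n → F) (a : T × S) (z : Model n) : ℝ × F :=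
  (f a.1 z, u a.2 z)

lemma JetFrame.pair (hf : JetFrame u τ W U) {f : T → Model n → ℝ}
    (h : ∀ t, ContDiffOn ℝ ∞ (f t) U) : JetFrame (pairField f u) τ W U :=
  ⟨hf.openW, hf.openU, hf.smooth, hf.maps, fun a => (h a.1).prodMk (hf.fields a.2)⟩

lemma JetFn.pair_snd (hf : JetFrame u τ W U) {f : T → Model n → ℝ}
    (h : ∀ t, ContDiffOn ℝ ∞ (f t) U) {c : Model n → S → X} (hc : JetFn u τ W p c) :
    JetFn (pairField f u) τ W p fun z a => c z a.2 :=
  JetFn.of_field hf hc (hf.pair h) (ContinuousLinearMap.snd ℝ ℝ F) Prod.snd fun _ _ _ => rfl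

lemma JetFn.pair_fst {f : T → Model n → ℝ} :
    JetFn (pairField f u) τ W p fun z a => f a.1 (τ z) :=
  JetFn.clm JetFn.field (ContinuousLinearMap.fst ℝ ℝ F)

/-- The jet of a joint field. -/
def pairJet (n p : ℕ) (F : Type*) [NormedAddCommGroup F] [NormedSpace ℝ F] :
    JetCoord n p ℝ × JetCoord n p F →L[ℝ] JetCoord n p (ℝ × F) :=
  ContinuousLinearMap.pi fun I =>
    ((ContinuousLinearMap.proj I).comp (ContinuousLinearMap.fst ℝ _ _)).prod
      ((ContinuousLinearMap.proj I).comp (ContinuousLinearMap.snd ℝ _ _))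

lemma jetCoord_pair (hU : IsOpen U) {f : Model n → ℝ} (hf : ContDiffOn ℝ ∞ f U)
    {g : Model n → F} (hg : ContDiffOn ℝ ∞ g U) {z : Model n} (hz : z ∈ U) :
    jetCoord p (fun y => (f y, g y)) z = pairJet n p F (jetCoord p f z, jetCoord p g z) := by
  funext I
  refine Prod.ext ?_ ?_
  · exact (partialMulti_clm_comp hU (hf.prodMk hg) (ContinuousLinearMap.fst ℝ ℝ F) _ hz).symm
  · exact (partialMulti_clm_comp hU (hf.prodMk hg) (ContinuousLinearMap.snd ℝ ℝ F) _ hz).symm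

/-- Integration by parts of a linear differential operator of one term. -/
lemma JetFrame.exists_boundary (hf : JetFrame u id W W) (w : List (Fin n)) :
    ∀ {q : ℕ} {C : Model n → S → ℝ}, JetFn u id W q C →
    ∃ h : Model n → S → ℝ, JetFn u id W (q + w.length) h ∧
    ∀ f : Model n → ℝ, ContDiffOn ℝ ∞ f W → ∃ b : Fin n → Model n → S → ℝ,
      (∀ j, JetFn u id W (q + w.length) (b j)) ∧
      (∀ s, ∀ z ∈ W, C z s * LocalFunctionals.wordD w f z
        = h z s * f z + ∑ j, LocalFunctionals.partialD j (fun y => b j y s) z) ∧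
      (∀ s z, (f =ᶠ[𝓝 z] fun _ => 0) → ∀ j, b j z s = 0) ∧
      (∀ s z, (∀ᶠ y in 𝓝 z, C y s = 0) → ∀ j, b j z s = 0) := by
  induction w with
  | nil =>
    intro q C hC
    refine ⟨C, hC, fun f _ => ⟨fun _ _ _ => 0, fun _ => JetFn.of_base contDiffOn_const, ?_,
      fun _ _ _ _ => rfl, fun _ _ _ _ => rfl⟩⟩
    intro s z _
    simp [LocalFunctionals.partialD]
  | cons i w ih =>
    intro q C hC
    -- One integration by parts, `C ∂_i g = ∂_i (C g) - (∂_i C) g` with `g = ∂_w f`; the induction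
    -- hypothesis takes over with coefficient `-∂_i C`. Here `h` is fixed before `f` is introduced,
    -- and this independence is what matters later.
    obtain ⟨h, hh, hb⟩ := ih ((hf.partialD hC i).const_smul (-1))
    refine ⟨h, hh.mono (by simp; omega), fun f hfs => ?_⟩
    obtain ⟨b, h1, h2, h3, h4⟩ := hb f hfs
    have hw := wordD_contDiffOn hf.openW hfs w
    have hg : JetFn u id W q fun z s => C z s * LocalFunctionals.wordD w f z :=
      hC.mul (JetFn.of_base hw)
    refine ⟨fun j z s => (if j = i then C z s * LocalFunctionals.wordD w f z else 0) + b j z s,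
      fun j => JetFn.add ?_ ((h1 j).mono (by simp; omega)), fun s z hz => ?_, fun s z h0 j => ?_,
      fun s z h0 j => ?_⟩
    · by_cases hj : j = i
      · simpa [hj] using hg.mono (Nat.le_add_right _ _)
      · simpa [hj] using JetFn.of_base contDiffOn_const
    · have hbs : ∀ j, DifferentiableAt ℝ (fun y => b j y s) z := fun j =>
        ((hf.contDiffOn (h1 j) s).contDiffAt (hf.openW.mem_nhds hz)).differentiableAt (by simp)
      have hCd : DifferentiableAt ℝ (fun y => C y s) z :=
        ((hf.contDiffOn hC s).contDiffAt (hf.openW.mem_nhds hz)).differentiableAt (by simp)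
      have hwd : DifferentiableAt ℝ (LocalFunctionals.wordD w f) z :=
        (hw.contDiffAt (hf.openW.mem_nhds hz)).differentiableAt (by simp)
      have hsum : ∑ j, LocalFunctionals.partialD j (fun y =>
            (if j = i then C y s * LocalFunctionals.wordD w f y else 0) + b j y s) z
          = LocalFunctionals.partialD i (fun y => C y s * LocalFunctionals.wordD w f y) z
            + ∑ j, LocalFunctionals.partialD j (fun y => b j y s) z := by
        have hj : ∀ j, LocalFunctionals.partialD j (fun y =>
            (if j = i then C y s * LocalFunctionals.wordD w f y else 0) + b j y s) z
            = (if j = i then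
                LocalFunctionals.partialD i (fun y => C y s * LocalFunctionals.wordD w f y) z else 0)
              + LocalFunctionals.partialD j (fun y => b j y s) z := by
          intro j
          by_cases hj : j = i
          · subst hj
            simp only [if_true, LocalFunctionals.partialD]
            have hm : DifferentiableAt ℝ (fun y => C y s * LocalFunctionals.wordD w f y) z :=
              hCd.mul hwd
            rw [fderiv_fun_add hm (hbs j)]
            rfl
          · simp [hj]
        rw [Finset.sum_congr rfl fun j _ => hj j, Finset.sum_add_distrib]
        simp
      have hprod : LocalFunctionals.partialD i (fun y => C y s * LocalFunctionals.wordD w f y) z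
          = C z s * LocalFunctionals.wordD (i :: w) f z
            + LocalFunctionals.partialD i (fun y => C y s) z * LocalFunctionals.wordD w f z := by
        rw [wordD_cons]
        have hm : HasFDerivAt (fun y => C y s * LocalFunctionals.wordD w f y) _ z :=
          hCd.hasFDerivAt.mul hwd.hasFDerivAt
        simp only [LocalFunctionals.partialD]
        rw [hm.fderiv]
        simp [mul_comm]
      have h5 := h2 s z hz
      rw [hsum, hprod]
      simp only [smul_eq_mul] at h5
      linarith
    · beta_reduce
      rw [h3 s z h0 j, (wordD_eventuallyEq h0 w).self_of_nhds, wordD_zero]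
      simp
    · have h5 : ∀ᶠ y in 𝓝 z, (-1 : ℝ) • LocalFunctionals.partialD i (fun y' => C y' s) y = 0 := by
        have h6 : (fun y => C y s) =ᶠ[𝓝 z] fun _ => 0 := h0
        filter_upwards [partialD_eventuallyEq h6 i] with y hy
        rw [hy]
        simp [LocalFunctionals.partialD]
      beta_reduce
      rw [h4 s z h5 j, h0.self_of_nhds]
      simp

/-- Integration by parts of a linear differential operator acting on test functions, whose
coefficients are functions of the jets of the fields. -/
theorem JetFrame.exists_boundary_of_linear (hf : JetFrame u id W W)
    {c : Model n → ({f : Model n → ℝ // IsTest W f} × S) → ℝ}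
    (hc : JetFn (pairField Subtype.val u) id W N c)
    (hlin : ∀ s, ∀ z ∈ W, ∀ (f f' : {f : Model n → ℝ // IsTest W f}) (r : ℝ),
      (∀ y, f'.1 y = r * f.1 y) → c z (f', s) = r * c z (f, s)) :
    ∃ h : Model n → S → ℝ, JetFn u id W (N + n * N) h ∧
    ∀ f : {f : Model n → ℝ // IsTest W f}, ∃ b : Fin n → Model n → S → ℝ,
      (∀ j, JetFn u id W (N + n * N) (b j)) ∧
      (∀ s, ∀ z ∈ W, c z (f, s)
        = h z s * f.1 z + ∑ j, LocalFunctionals.partialD j (fun y => b j y s) z) ∧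
      (∀ s z, z ∉ tsupport f.1 → ∀ j, b j z s = 0) ∧
      (∀ s, ∀ z ∈ W, (∀ᶠ y in 𝓝 z, ∀ f', c y (f', s) = 0) → ∀ j, b j z s = 0) := by
  obtain ⟨A, hA, hcA⟩ := hc
  have hA' : ContDiffOn ℝ ∞ (_root_.fderiv ℝ A) (W ×ˢ univ) :=
    hA.fderiv_of_isOpen (hf.openW.prod isOpen_univ) (m := ∞) (by simp)
  -- The coefficient of `∂_K f`: the derivative of `A` in the jet coordinate `f_K`, taken where the
  -- jet of the test function is zero.
  let C : (Fin n → Fin (N + 1)) → Model n → S → ℝ := fun K z s =>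
    _root_.fderiv ℝ A (z, pairJet n N F (0, jetCoord N (u s) z))
      (0, pairJet n N F (Pi.single K 1, 0))
  have hC : ∀ K, JetFn u id W N (C K) := by
    intro K
    refine ⟨fun w => _root_.fderiv ℝ A (w.1, pairJet n N F (0, w.2))
      (0, pairJet n N F (Pi.single K 1, 0)), ?_, fun s z hz => rfl⟩
    refine ContDiffOn.clm_apply (hA'.comp (contDiff_fst.prodMk ((pairJet n N F).contDiff.comp
      (contDiff_const.prodMk contDiff_snd))).contDiffOn fun w hw => ⟨hw.1, mem_univ _⟩)
      contDiffOn_const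
  -- Only homogeneity in `f` is available, but along `t ↦ t f` the value of `A` is `t c`. A
  -- differentiable function that is homogeneous of degree one on a line equals its derivative at
  -- the origin, and the derivative is linear.
  have hcC : ∀ f s, ∀ z ∈ W, c z (f, s) = ∑ K, C K z s * jetCoord N f.1 z K := by
    intro f s z hz
    have hfs : ContDiffOn ℝ ∞ f.1 W := f.2.smooth.contDiffOn
    have h1 : ∀ t : ℝ, A (z, t • pairJet n N F (jetCoord N f.1 z, 0)
        + pairJet n N F (0, jetCoord N (u s) z)) = t * c z (f, s) := by
      intro t
      have ht : IsTest W fun y => t * f.1 y := by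
        have := f.2.smul_const t
        simpa [mul_comm] using this
      rw [← hlin s z hz f ⟨fun y => t * f.1 y, ht⟩ t fun _ => rfl, hcA _ z hz]
      congr 2
      have h2 := jetCoord_pair (p := N) hf.openW ht.smooth.contDiffOn (hf.fields s) hz
      refine Eq.trans ?_ h2.symm
      have h3 : jetCoord N (fun y => t * f.1 y) z = t • jetCoord N f.1 z := by
        have := jetCoord_comb hf.openW hfs (contDiffOn_const (c := (0 : ℝ))) t N hz
        simp only [smul_eq_mul, add_zero] at this
        rw [this]
        funext I
        simp [jetCoord, partialMulti_eq_wordD, wordD_zero]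
      rw [h3, ← map_smul, ← map_add]
      simp
    have hγ : HasDerivAt (fun t : ℝ => t • pairJet n N F (jetCoord N f.1 z, 0)
        + pairJet n N F (0, jetCoord N (u s) z)) (pairJet n N F (jetCoord N f.1 z, 0)) 0 := by
      simpa using ((hasDerivAt_id (0 : ℝ)).smul_const
        (pairJet n N F (jetCoord N f.1 z, 0))).add_const (pairJet n N F (0, jetCoord N (u s) z))
    have h2 := hasDerivAt_comp_jet hf.openW hA hz hγ
    simp only [h1] at h2
    have h3 : HasDerivAt (fun t : ℝ => t * c z (f, s)) (c z (f, s)) 0 := by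
      simpa using (hasDerivAt_id (0 : ℝ)).mul_const (c z (f, s))
    rw [h3.unique h2, zero_smul, zero_add]
    let L : JetCoord n N ℝ →L[ℝ] ℝ :=
      (_root_.fderiv ℝ A (z, pairJet n N F (0, jetCoord N (u s) z))).comp
      ((ContinuousLinearMap.inr ℝ (Model n) _).comp ((pairJet n N F).comp
        (ContinuousLinearMap.inl ℝ _ _)))
    have h4 : ∀ a, _root_.fderiv ℝ A (z, pairJet n N F (0, jetCoord N (u s) z))
      (0, pairJet n N F (a, 0)) = L a := fun a => rfl
    have h5 : L (jetCoord N f.1 z) = ∑ K, jetCoord N f.1 z K • L (Pi.single K 1) := by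
      conv_lhs => rw [pi_eq_sum_univ' (jetCoord N f.1 z)]
      rw [map_sum]
      refine Finset.sum_congr rfl fun K _ => ?_
      rw [map_smul]
    rw [h4, h5]
    exact Finset.sum_congr rfl fun K _ => mul_comm _ _
  -- Test functions realize the jet with `f_K = 1` and all other coordinates zero, so an operator
  -- that vanishes on all of them at `z` has no coefficient there.
  have hC0 : ∀ s, ∀ z ∈ W, (∀ f, c z (f, s) = 0) → ∀ K, C K z s = 0 := by
    intro s z hz h0 K
    obtain ⟨f, hft, hfj⟩ := exists_test_jetCoord hf.openW hz
      (Pi.single K 1 : JetCoord n N ℝ)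
    have := hcC ⟨f, hft⟩ s z hz
    rw [h0, hfj] at this
    simpa [Pi.single_apply] using this.symm
  choose h hh b hb using fun K : Fin n → Fin (N + 1) =>
    hf.exists_boundary (multiWord fun i => (K i : ℕ)) (hC K)
  have hlen : ∀ K : Fin n → Fin (N + 1), N + (multiWord fun i => (K i : ℕ)).length ≤ N + n * N :=
    fun K => by rw [length_multiWord]; exact Nat.add_le_add_left (sum_le_of_le K) N
  choose hb1 hb2 hb3 hb4 using hb
  refine ⟨fun z s => ∑ K, h K z s, JetFn.sum fun K _ => (hh K).mono (hlen K), fun f => ?_⟩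
  have hfs : ContDiffOn ℝ ∞ f.1 W := f.2.smooth.contDiffOn
  refine ⟨fun j z s => ∑ K, b K f.1 hfs j z s,
    fun j => JetFn.sum fun K _ => (hb1 K f.1 hfs j).mono (hlen K), fun s z hz => ?_,
    fun s z hz j => ?_, fun s z hz h0 j => ?_⟩
  · rw [hcC f s z hz, Finset.sum_mul]
    have h1 : ∀ j, LocalFunctionals.partialD j (fun y => ∑ K, b K f.1 hfs j y s) z
        = ∑ K, LocalFunctionals.partialD j (fun y => b K f.1 hfs j y s) z := by
      intro j
      simp only [LocalFunctionals.partialD]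
      rw [fderiv_fun_sum fun K _ => ((hf.contDiffOn (hb1 K f.1 hfs j) s).contDiffAt
        (hf.openW.mem_nhds hz)).differentiableAt (by simp), sum_apply]
    simp only [h1]
    rw [Finset.sum_comm, ← Finset.sum_add_distrib]
    refine Finset.sum_congr rfl fun K _ => ?_
    rw [← hb2 K f.1 hfs s z hz]
    simp only [jetCoord, partialMulti_eq_wordD]
  · exact Finset.sum_eq_zero fun K _ =>
      hb3 K f.1 hfs s z (notMem_tsupport_iff_eventuallyEq.1 hz) j
  · refine Finset.sum_eq_zero fun K _ => hb4 K f.1 hfs s z ?_ j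
    filter_upwards [h0, hf.openW.mem_nhds hz] with y hy hyW
    exact hC0 s y hyW hy K

end JointFields

/-! ### Coordinates of alternating forms -/

section AlternatingForms

variable {n k : ℕ}

/-- Evaluation of an alternating form on the tuples of standard basis vectors. -/
def altEval (n k : ℕ) : ((Model n) [⋀^Fin k]→L[ℝ] ℝ) →L[ℝ] ((Fin k → Fin n) → ℝ) :=
  ContinuousLinearMap.pi fun v =>
    ContinuousAlternatingMap.apply ℝ (Model n) ℝ fun i => EuclideanSpace.single (v i) 1

lemma altEval_apply (η : (Model n) [⋀^Fin k]→L[ℝ] ℝ) (v : Fin k → Fin n) :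
    altEval n k η v = η fun i => EuclideanSpace.single (v i) 1 := rfl

lemma altEval_injective : Function.Injective (altEval n k) := by
  intro η ζ h
  have h1 : η.toAlternatingMap.toMultilinearMap = ζ.toAlternatingMap.toMultilinearMap :=
    Module.Basis.ext_multilinear (fun _ => (EuclideanSpace.basisFun (Fin n) ℝ).toBasis) fun v => by
      have h2 := congrFun h v
      rw [altEval_apply, altEval_apply] at h2
      simpa using h2
  ext v
  exact DFunLike.congr_fun h1 v

/-- A continuous left inverse of `altEval`. -/
lemma exists_altEval_leftInverse :
    ∃ Λ : ((Fin k → Fin n) → ℝ) →L[ℝ] ((Model n) [⋀^Fin k]→L[ℝ] ℝ),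
      ∀ η, Λ (altEval n k η) = η := by
  obtain ⟨g, hg⟩ := (altEval n k).toLinearMap.exists_leftInverse_of_injective
    (LinearMap.ker_eq_bot.2 altEval_injective)
  exact ⟨g.toContinuousLinearMap, fun η => LinearMap.congr_fun hg η⟩

/-- The form is recovered from its components by a fixed continuous linear map, so smooth dependence
on jets may be checked on components. -/
lemma JetFn.alt {F S : Type*} [NormedAddCommGroup F] [NormedSpace ℝ F] {u : S → Model n → F}
    {τ : Model n → Model n} {W : Set (Model n)} {p : ℕ} {c : Model n → S → (Model n) [⋀^Fin k]→L[ℝ] ℝ}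
    (h : ∀ v : Fin k → Fin n, JetFn u τ W p fun z s => c z s fun i => EuclideanSpace.single (v i) 1) :
    JetFn u τ W p c := by
  obtain ⟨Λ, hΛ⟩ := exists_altEval_leftInverse (n := n) (k := k)
  exact ((JetFn.pi h).clm Λ).congr fun s z _ => (hΛ (c z s)).symm

/-- The volume element evaluation of a top degree form. -/
def topEval (n : ℕ) : ((Model n) [⋀^Fin n]→L[ℝ] ℝ) →L[ℝ] ℝ :=
  ContinuousAlternatingMap.apply ℝ (Model n) ℝ fun i => EuclideanSpace.single i 1

lemma topEval_apply (η : (Model n) [⋀^Fin n]→L[ℝ] ℝ) :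
    topEval n η = η fun i => EuclideanSpace.single i 1 := rfl

/-- Top forms are multiples of the determinant of the standard basis. -/
lemma top_apply_comp (η : (Model n) [⋀^Fin n]→L[ℝ] ℝ) (g : Model n →L[ℝ] Model n) :
    topEval n (η.compContinuousLinearMap g) = g.det * topEval n η := by
  let e := (EuclideanSpace.basisFun (Fin n) ℝ).toBasis
  have he : ∀ v, η v = topEval n η * e.det v := by
    intro v
    have := AlternatingMap.eq_smul_basis_det e η.toAlternatingMap
    have h2 := congrArg (fun f => f v) this
    simp only [AlternatingMap.smul_apply, smul_eq_mul] at h2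
    rw [show η v = η.toAlternatingMap v from rfl, h2]
    congr 1
    change η (fun i => e i) = η _
    congr 1
    funext i
    simp [e]
  rw [topEval_apply]
  have h3 : (fun i : Fin n => EuclideanSpace.single i (1 : ℝ)) = e := by
    funext i; simp [e]
  rw [h3]
  change η (g ∘ e) = _
  rw [he]
  have := Module.Basis.det_comp e g.toLinearMap e
  rw [Module.Basis.det_self, mul_one] at this
  have h4 : e.det (g ∘ e) = g.det := this
  rw [h4, mul_comm]

lemma topEval_injective : Function.Injective (topEval n) := by
  intro η ζ h
  refine ContinuousAlternatingMap.toAlternatingMap_injective ?_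
  let e := (EuclideanSpace.basisFun (Fin n) ℝ).toBasis
  rw [AlternatingMap.eq_smul_basis_det e η.toAlternatingMap,
    AlternatingMap.eq_smul_basis_det e ζ.toAlternatingMap]
  congr 1
  have h3 : (fun i : Fin n => EuclideanSpace.single i (1 : ℝ)) = e := by
    funext i; simp [e]
  rw [topEval_apply, topEval_apply, h3] at h
  exact h

/-- Pigeonhole on the indices of basis vectors. This is why brackets, being top forms, are closed.
-/
lemma alt_eq_zero_of_lt (h : n < k) (η : (Model n) [⋀^Fin k]→L[ℝ] ℝ) : η = 0 := by
  refine altEval_injective ?_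
  funext v
  obtain ⟨i, j, hij, hv⟩ := Fintype.exists_ne_map_eq_of_card_lt v (by simpa using h)
  rw [altEval_apply]
  exact η.map_eq_zero_of_eq _ (congrArg (fun a => EuclideanSpace.single a (1 : ℝ)) hv) hij

end AlternatingForms

/-! ### Coordinate changes of differential forms on the base -/

section Charts

variable {n k : ℕ} {M : Type*} [TopologicalSpace M] [ChartedSpace (Model n) M]

/-- The coordinate change from the chart at `x₀` to the chart at `x₁`. -/
def coordChange (x₀ x₁ : M) (z : Model n) : Model n :=
  extChartAt (𝓡 n) x₁ ((extChartAt (𝓡 n) x₀).symm z)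

/-- The domain of the coordinate change. -/
def overlap (x₀ x₁ : M) : Set (Model n) :=
  (extChartAt (𝓡 n) x₀).target ∩ (extChartAt (𝓡 n) x₀).symm ⁻¹' (extChartAt (𝓡 n) x₁).source

lemma isOpen_overlap (x₀ x₁ : M) : IsOpen (overlap (n := n) x₀ x₁) :=
  (continuousOn_extChartAt_symm x₀).isOpen_inter_preimage (isOpen_extChartAt_target x₀)
    (isOpen_extChartAt_source x₁)

lemma symm_coordChange {x₀ x₁ : M} {z : Model n} (hz : z ∈ overlap x₀ x₁) :
    (extChartAt (𝓡 n) x₁).symm (coordChange x₀ x₁ z) = (extChartAt (𝓡 n) x₀).symm z :=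
  (extChartAt (𝓡 n) x₁).left_inv hz.2

lemma coordChange_mem {x₀ x₁ : M} {z : Model n} (hz : z ∈ overlap x₀ x₁) :
    coordChange x₀ x₁ z ∈ overlap x₁ x₀ := by
  refine ⟨(extChartAt (𝓡 n) x₁).map_source hz.2, ?_⟩
  rw [mem_preimage, symm_coordChange hz]
  exact (extChartAt (𝓡 n) x₀).map_target hz.1

lemma coordChange_coordChange {x₀ x₁ : M} {z : Model n} (hz : z ∈ overlap x₀ x₁) :
    coordChange x₁ x₀ (coordChange x₀ x₁ z) = z := by
  rw [coordChange, symm_coordChange hz, (extChartAt (𝓡 n) x₀).right_inv hz.1]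

variable [IsManifold (𝓡 n) ∞ M]

lemma contDiffOn_coordChange (x₀ x₁ : M) :
    ContDiffOn ℝ ∞ (coordChange x₀ x₁ : Model n → Model n) (overlap x₀ x₁) := by
  refine (contDiffOn_ext_coord_change (I := 𝓡 n) (n := ∞) x₁ x₀).mono fun z hz => ?_
  rw [PartialEquiv.trans_source]
  exact hz

lemma hasFDerivAt_coordChange {x₀ x₁ : M} {z : Model n} (hz : z ∈ overlap x₀ x₁) :
    HasFDerivAt (coordChange x₀ x₁) (fderiv ℝ (coordChange x₀ x₁) z) z :=
  (((contDiffOn_coordChange x₀ x₁).contDiffAt ((isOpen_overlap x₀ x₁).mem_nhds hz)).differentiableAt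
    (by simp)).hasFDerivAt

lemma mdifferentiableAt_extChartAt_symm_target {x₀ : M} {z : Model n}
    (hz : z ∈ (extChartAt (𝓡 n) x₀).target) :
    MDifferentiableAt 𝓘(ℝ, Model n) (𝓡 n) (extChartAt (𝓡 n) x₀).symm z :=
  ((contMDiffOn_extChartAt_symm (n := ∞) x₀).contMDiffAt
    ((isOpen_extChartAt_target x₀).mem_nhds hz)).mdifferentiableAt (by simp)

/-- The derivative of the inverse of the chart at `x₀`. -/
def dSymm (x₀ : M) (z : Model n) : Model n →L[ℝ] Model n :=
  mfderiv 𝓘(ℝ, Model n) (𝓡 n) (extChartAt (𝓡 n) x₀).symm z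

/-- The derivative of the chart at `x₀`. -/
def dChart (x₀ x : M) : Model n →L[ℝ] Model n :=
  mfderiv (𝓡 n) 𝓘(ℝ, Model n) (extChartAt (𝓡 n) x₀) x

/-- A form as a function with values in a fixed space. -/
def plain (β : ∀ x : M, Cov n k x) (x : M) : (Model n) [⋀^Fin k]→L[ℝ] ℝ := β x

lemma chartForm_eq (x₀ : M) (β : ∀ x : M, Cov n k x) (z : Model n) :
    chartForm x₀ β z = (plain β ((extChartAt (𝓡 n) x₀).symm z)).compContinuousLinearMap
      (dSymm x₀ z) := rfl

lemma dSymm_coordChange {x₀ x₁ : M} {z : Model n} (hz : z ∈ overlap x₀ x₁) :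
    dSymm x₀ z = (dSymm x₁ (coordChange x₀ x₁ z)).comp (fderiv ℝ (coordChange x₀ x₁) z) := by
  have h1 : (extChartAt (𝓡 n) x₀).symm =ᶠ[𝓝 z]
      (extChartAt (𝓡 n) x₁).symm ∘ coordChange x₀ x₁ := by
    filter_upwards [(isOpen_overlap x₀ x₁).mem_nhds hz] with y hy
    exact (symm_coordChange hy).symm
  have h2 := (mdifferentiableAt_extChartAt_symm_target (coordChange_mem hz).1).hasMFDerivAt.comp z
    (hasFDerivAt_coordChange hz).hasMFDerivAt
  exact (h2.congr_of_eventuallyEq h1).mfderiv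

lemma chartForm_coordChange {x₀ x₁ : M} (β : ∀ x : M, Cov n k x) {z : Model n}
    (hz : z ∈ overlap x₀ x₁) :
    chartForm x₀ β z = (chartForm x₁ β (coordChange x₀ x₁ z)).compContinuousLinearMap
      (fderiv ℝ (coordChange x₀ x₁) z) := by
  rw [chartForm_eq, chartForm_eq, symm_coordChange hz, dSymm_coordChange hz]
  rfl

lemma chartCoeff_coordChange {x₀ x₁ : M} (β : ∀ x : M, Cov n n x) {z : Model n}
    (hz : z ∈ overlap x₀ x₁) :
    chartCoeff x₀ β z = (fderiv ℝ (coordChange x₀ x₁) z).det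
      * chartCoeff x₁ β (coordChange x₀ x₁ z) := by
  unfold chartCoeff
  rw [chartForm_coordChange β hz, ← topEval_apply, top_apply_comp]
  rfl

lemma mem_overlap_self {x₀ x₁ : M} {z : Model n} (hz : z ∈ (extChartAt (𝓡 n) x₀).target)
    (h : (extChartAt (𝓡 n) x₀).symm z = x₁) : z ∈ overlap x₀ x₁ :=
  ⟨hz, by rw [mem_preimage, h]; exact mem_extChartAt_source x₁⟩

/-- A covector with its expression in a chart prescribed. -/
def chartPull (x₀ : M) (x : M) (η : (Model n) [⋀^Fin k]→L[ℝ] ℝ) : Cov n k x :=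
  η.compContinuousLinearMap (mfderiv (𝓡 n) 𝓘(ℝ, Model n) (extChartAt (𝓡 n) x₀) x)

lemma dChart_comp_dSymm {x₀ : M} {z : Model n} (hz : z ∈ (extChartAt (𝓡 n) x₀).target) :
    (dChart x₀ ((extChartAt (𝓡 n) x₀).symm z)).comp (dSymm x₀ z)
      = ContinuousLinearMap.id ℝ (Model n) := by
  have hs : (extChartAt (𝓡 n) x₀).symm z ∈ (chartAt (Model n) x₀).source := by
    rw [← extChartAt_source (𝓡 n)]
    exact (extChartAt (𝓡 n) x₀).map_target hz
  have h0 := (mdifferentiableAt_extChartAt (I := 𝓡 n) hs).hasMFDerivAt.comp z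
    (mdifferentiableAt_extChartAt_symm_target hz).hasMFDerivAt
  have h1 : (extChartAt (𝓡 n) x₀ ∘ (extChartAt (𝓡 n) x₀).symm) =ᶠ[𝓝 z] id := by
    filter_upwards [(isOpen_extChartAt_target x₀).mem_nhds hz] with y hy
    exact (extChartAt (𝓡 n) x₀).right_inv hy
  exact hasMFDerivAt_unique (h0.congr_of_eventuallyEq h1.symm) (hasMFDerivAt_id z)

lemma dSymm_comp_dChart {x₀ x : M} (hx : x ∈ (extChartAt (𝓡 n) x₀).source) :
    (dSymm x₀ (extChartAt (𝓡 n) x₀ x)).comp (dChart x₀ x)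
      = ContinuousLinearMap.id ℝ (Model n) := by
  have hs : x ∈ (chartAt (Model n) x₀).source := by rwa [← extChartAt_source (𝓡 n)]
  have h0 := (mdifferentiableAt_extChartAt_symm_target
    ((extChartAt (𝓡 n) x₀).map_source hx)).hasMFDerivAt.comp x
    (mdifferentiableAt_extChartAt (I := 𝓡 n) hs).hasMFDerivAt
  have h1 : ((extChartAt (𝓡 n) x₀).symm ∘ extChartAt (𝓡 n) x₀) =ᶠ[𝓝 x] id := by
    filter_upwards [(isOpen_extChartAt_source (I := 𝓡 n) x₀).mem_nhds hx] with y hy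
    exact (extChartAt (𝓡 n) x₀).left_inv hy
  exact hasMFDerivAt_unique (h0.congr_of_eventuallyEq h1.symm) (hasMFDerivAt_id x)

lemma chartForm_eq_of_plain {x₀ : M} {β : ∀ x : M, Cov n k x} {z : Model n}
    (hz : z ∈ (extChartAt (𝓡 n) x₀).target) {η : (Model n) [⋀^Fin k]→L[ℝ] ℝ}
    (h : plain β ((extChartAt (𝓡 n) x₀).symm z)
      = η.compContinuousLinearMap (dChart x₀ ((extChartAt (𝓡 n) x₀).symm z))) :
    chartForm x₀ β z = η := by
  rw [chartForm_eq, h]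
  change η.compContinuousLinearMap ((dChart x₀ _).comp (dSymm x₀ z)) = η
  rw [dChart_comp_dSymm hz]
  rfl

lemma plain_eq_of_chartForm {x₀ x : M} (hx : x ∈ (extChartAt (𝓡 n) x₀).source)
    (β : ∀ x : M, Cov n k x) :
    plain β x = (chartForm x₀ β (extChartAt (𝓡 n) x₀ x)).compContinuousLinearMap (dChart x₀ x) := by
  rw [chartForm_eq, (extChartAt (𝓡 n) x₀).left_inv hx]
  change _ = (plain β x).compContinuousLinearMap
    ((dSymm x₀ (extChartAt (𝓡 n) x₀ x)).comp (dChart x₀ x))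
  rw [dSymm_comp_dChart hx]
  rfl

/-- A form is determined by its chart expression. -/
lemma eq_of_chartForm_eq {x₀ x : M} (hx : x ∈ (extChartAt (𝓡 n) x₀).source)
    {β γ : ∀ x : M, Cov n k x}
    (h : chartForm x₀ β (extChartAt (𝓡 n) x₀ x) = chartForm x₀ γ (extChartAt (𝓡 n) x₀ x)) :
    β x = γ x := by
  change plain β x = plain γ x
  rw [plain_eq_of_chartForm hx, plain_eq_of_chartForm hx, h]

/-- The definition of `dM` uses a different chart at each point. That one chart computes it on its
whole domain is the naturality of the exterior derivative under the coordinate change. -/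
lemma chartForm_dM {x₀ : M} {β : ∀ x : M, Cov n k x} {z : Model n}
    (hz : z ∈ (extChartAt (𝓡 n) x₀).target) (hβ : ContDiffAt ℝ ∞ (chartForm x₀ β) z) :
    chartForm x₀ (dM β) z = extDeriv (chartForm x₀ β) z := by
  set y := (extChartAt (𝓡 n) x₀).symm z with hy
  have hzo : z ∈ overlap x₀ y := mem_overlap_self hz rfl
  have hyz : coordChange x₀ y z = extChartAt (𝓡 n) y y := rfl
  have hmem := coordChange_mem hzo
  have h1 : chartForm x₀ (dM β) z = (extDeriv (chartForm y β)
      (coordChange x₀ y z)).compContinuousLinearMap (fderiv ℝ (coordChange x₀ y) z) := by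
    rw [chartForm_coordChange (dM β) hzo]
    congr 1
    have hzt : coordChange x₀ y z ∈ (extChartAt (𝓡 n) y).target := hmem.1
    have hs : (extChartAt (𝓡 n) y).symm (coordChange x₀ y z) = y := symm_coordChange hzo
    refine chartForm_eq_of_plain hzt ?_
    rw [hs]
    rfl
  have h2 : chartForm x₀ β =ᶠ[𝓝 z] fun a => (chartForm y β (coordChange x₀ y a)).compContinuousLinearMap
      (fderiv ℝ (coordChange x₀ y) a) := by
    filter_upwards [(isOpen_overlap x₀ y).mem_nhds hzo] with a ha
    exact chartForm_coordChange β ha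
  -- Smoothness is given only in the chart at `x₀`; it is transported to the chart at `y` by the
  -- inverse coordinate change.
  have hd : DifferentiableAt ℝ (chartForm y β) (coordChange x₀ y z) := by
    have h3 : chartForm y β =ᶠ[𝓝 (coordChange x₀ y z)] fun a =>
        (chartForm x₀ β (coordChange y x₀ a)).compContinuousLinearMap
          (fderiv ℝ (coordChange y x₀) a) := by
      filter_upwards [(isOpen_overlap y x₀).mem_nhds hmem] with a ha
      exact chartForm_coordChange β ha
    refine DifferentiableAt.congr_of_eventuallyEq ?_ h3
    have h4 : ContDiffAt ℝ ∞ (coordChange y x₀) (coordChange x₀ y z) :=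
      (contDiffOn_coordChange y x₀).contDiffAt ((isOpen_overlap y x₀).mem_nhds hmem)
    refine DifferentiableAt.continuousAlternatingMapCompContinuousLinearMap ?_ ?_
    · have h5 : DifferentiableAt ℝ (chartForm x₀ β) (coordChange y x₀ (coordChange x₀ y z)) := by
        rw [coordChange_coordChange hzo]
        exact hβ.differentiableAt (by simp)
      exact h5.comp _ (h4.differentiableAt (by simp))
    · exact (h4.fderiv_right (m := 1) (by norm_cast)).differentiableAt (by simp)
  have h6 : ContDiffAt ℝ ∞ (coordChange x₀ y) z :=
    (contDiffOn_coordChange x₀ y).contDiffAt ((isOpen_overlap x₀ y).mem_nhds hzo)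
  rw [h1, h2.extDeriv_eq, extDeriv_pullback hd h6 (by simp; norm_cast)]

end Charts

/-! ### Sections in coordinates and the coordinate independence of jets -/

section SectionCoordinates

variable {n : ℕ} {M : Type*} [TopologicalSpace M] [ChartedSpace (Model n) M]
  {F : Type*} [NormedAddCommGroup F] [NormedSpace ℝ F]
  {V : M → Type*} [TopologicalSpace (TotalSpace F V)] [∀ x, AddCommGroup (V x)]
  [∀ x, Module ℝ (V x)] [∀ x, TopologicalSpace (V x)] [FiberBundle F V] [VectorBundle ℝ F V]
  {X Y : Type*} [NormedAddCommGroup X] [NormedSpace ℝ X] [NormedAddCommGroup Y] [NormedSpace ℝ Y]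

variable (n F V) in
/-- The part of the coordinate domain at `x₀` that lies over the one at `x₁`. -/
def secOverlap (x₀ x₁ : M) : Set (Model n) :=
  chartDom n F V x₀ ∩ (extChartAt (𝓡 n) x₀).symm ⁻¹'
    ((extChartAt (𝓡 n) x₁).source ∩ (trivializationAt F V x₁).baseSet)

variable (n F V) in
/-- The coordinate domain at `x₀` as a subset of the manifold. -/
def chartRegion (x₀ : M) : Set M :=
  (extChartAt (𝓡 n) x₀).source ∩ (trivializationAt F V x₀).baseSet

lemma isOpen_chartRegion (x₀ : M) : IsOpen (chartRegion n F V x₀) :=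
  (isOpen_extChartAt_source x₀).inter (trivializationAt F V x₀).open_baseSet

lemma mem_chartRegion_self (x₀ : M) : x₀ ∈ chartRegion n F V x₀ :=
  ⟨mem_extChartAt_source x₀, mem_baseSet_trivializationAt F V x₀⟩

lemma symm_mem_chartRegion {x₀ : M} {z : Model n} (hz : z ∈ chartDom n F V x₀) :
    (extChartAt (𝓡 n) x₀).symm z ∈ chartRegion n F V x₀ :=
  ⟨(extChartAt (𝓡 n) x₀).map_target hz.1, hz.2⟩

lemma chart_mem_chartDom {x₀ x : M} (hx : x ∈ chartRegion n F V x₀) :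
    extChartAt (𝓡 n) x₀ x ∈ chartDom n F V x₀ := by
  refine ⟨(extChartAt (𝓡 n) x₀).map_source hx.1, ?_⟩
  rw [mem_preimage, (extChartAt (𝓡 n) x₀).left_inv hx.1]
  exact hx.2

lemma secOverlap_subset_overlap (x₀ x₁ : M) :
    secOverlap n F V x₀ x₁ ⊆ overlap (n := n) x₀ x₁ := fun _ hz => ⟨hz.1.1, hz.2.1⟩

lemma isOpen_secOverlap (x₀ x₁ : M) : IsOpen (secOverlap n F V x₀ x₁) :=
  ((continuousOn_extChartAt_symm x₀).mono inter_subset_left).isOpen_inter_preimage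
    (isOpen_chartDom x₀) (isOpen_chartRegion x₁)

lemma coordChange_mem_secOverlap {x₀ x₁ : M} {z : Model n} (hz : z ∈ secOverlap n F V x₀ x₁) :
    coordChange x₀ x₁ z ∈ secOverlap n F V x₁ x₀ := by
  refine ⟨chart_mem_chartDom hz.2, ?_⟩
  rw [mem_preimage, symm_coordChange (secOverlap_subset_overlap _ _ hz)]
  exact symm_mem_chartRegion hz.1

lemma secOverlap_self (x₀ : M) : secOverlap n F V x₀ x₀ = chartDom n F V x₀ :=
  inter_eq_left.2 fun _ hz => symm_mem_chartRegion hz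

lemma coordChange_self {x₀ : M} {z : Model n} (hz : z ∈ chartDom n F V x₀) :
    coordChange x₀ x₀ z = z := (extChartAt (𝓡 n) x₀).right_inv hz.1

lemma JetFn.comp_right {F S : Type*} [NormedAddCommGroup F] [NormedSpace ℝ F]
    {u : S → Model n → F} {τ σ : Model n → Model n} {W W' : Set (Model n)} {p : ℕ}
    {c : Model n → S → X} (h : JetFn u τ W p c) (hσ : ContDiffOn ℝ ∞ σ W') (hm : MapsTo σ W' W)
    (hτ : ∀ z ∈ W', τ (σ z) = z) : JetFn u id W' p fun z s => c (σ z) s := by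
  obtain ⟨A, hA, hc⟩ := h
  refine ⟨fun w => A (σ w.1, w.2), hA.comp ((hσ.comp contDiffOn_fst fun w hw => hw.1).prodMk
    contDiffOn_snd) fun w hw => ⟨hm hw.1, mem_univ _⟩, fun s z hz => ?_⟩
  beta_reduce
  rw [hc s _ (hm hz), hτ z hz, id]

variable [IsManifold (𝓡 n) ∞ M] [ContMDiffVectorBundle ∞ F V (𝓡 n)]

lemma secFrame (x₀ : M) : JetFrame (S := Sec n F V) (secCoord x₀) id
    (chartDom n F V x₀) (chartDom n F V x₀) :=
  ⟨isOpen_chartDom x₀, isOpen_chartDom x₀, contDiffOn_id, fun _ h => h,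
    fun φ => secCoord_contDiffOn φ x₀⟩

lemma secFrame_mono {x₀ : M} {W : Set (Model n)} (hW : IsOpen W) (h : W ⊆ chartDom n F V x₀) :
    JetFrame (S := Sec n F V) (secCoord x₀) id W W :=
  ⟨hW, hW, contDiffOn_id, fun _ h => h, fun φ => (secCoord_contDiffOn φ x₀).mono h⟩

/-- The linear change of the fibre coordinates. -/
def fibreChange (F : Type*) [NormedAddCommGroup F] [NormedSpace ℝ F]
    (V : M → Type*) [TopologicalSpace (TotalSpace F V)] [∀ x, AddCommGroup (V x)]
    [∀ x, Module ℝ (V x)] [∀ x, TopologicalSpace (V x)] [FiberBundle F V] [VectorBundle ℝ F V]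
    (x₀ x₁ : M) (z : Model n) : F →L[ℝ] F :=
  (trivializationAt F V x₀).coordChangeL ℝ (trivializationAt F V x₁)
    ((extChartAt (𝓡 n) x₀).symm z)

lemma contDiffOn_fibreChange (x₀ x₁ : M) :
    ContDiffOn ℝ ∞ (fibreChange (n := n) F V x₀ x₁) (secOverlap n F V x₀ x₁) := by
  rw [← contMDiffOn_iff_contDiffOn]
  have h1 := contMDiffOn_coordChangeL (n := ∞) (IB := 𝓡 n) (𝕜 := ℝ) (trivializationAt F V x₀)
    (trivializationAt F V x₁)
  exact h1.comp ((contMDiffOn_extChartAt_symm x₀).mono fun z hz => hz.1.1)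
    (fun z hz => ⟨hz.1.2, hz.2.2⟩)

lemma triv_eq_fibreChange {x₀ x₁ : M} {z : Model n} (hz : z ∈ secOverlap n F V x₀ x₁)
    (v : V ((extChartAt (𝓡 n) x₀).symm z)) :
    (trivializationAt F V x₁ ⟨(extChartAt (𝓡 n) x₀).symm z, v⟩).2
      = fibreChange F V x₀ x₁ z
        (trivializationAt F V x₀ ⟨(extChartAt (𝓡 n) x₀).symm z, v⟩).2 := by
  have hb : (extChartAt (𝓡 n) x₀).symm z ∈ (trivializationAt F V x₀).baseSet := hz.1.2
  rw [fibreChange]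
  have := (trivializationAt F V x₀).coordChangeL_apply (R := ℝ) (trivializationAt F V x₁)
    ⟨hb, hz.2.2⟩ (trivializationAt F V x₀ ⟨(extChartAt (𝓡 n) x₀).symm z, v⟩).2
  refine Eq.trans ?_ this.symm
  rw [(trivializationAt F V x₀).symm_apply_apply_mk hb]

lemma secCoord_coordChange {x₀ x₁ : M} {z : Model n} (hz : z ∈ secOverlap n F V x₀ x₁)
    (φ : Sec n F V) :
    secCoord x₁ φ (coordChange x₀ x₁ z) = fibreChange F V x₀ x₁ z (secCoord x₀ φ z) := by
  rw [secCoord, symm_coordChange (secOverlap_subset_overlap _ _ hz)]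
  exact triv_eq_fibreChange hz _

lemma fibreChange_fibreChange {x₀ x₁ : M} {z : Model n} (hz : z ∈ secOverlap n F V x₀ x₁) (v : F) :
    fibreChange F V x₁ x₀ (coordChange x₀ x₁ z) (fibreChange F V x₀ x₁ z v) = v := by
  have hb : (extChartAt (𝓡 n) x₀).symm z ∈ (trivializationAt F V x₀).baseSet := hz.1.2
  have h1 := (trivializationAt F V x₀).apply_mk_symm hb v
  have h2 := triv_eq_fibreChange hz ((trivializationAt F V x₀).symm _ v)
  rw [h1] at h2
  have h3 := triv_eq_fibreChange (coordChange_mem_secOverlap hz)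
    (show V ((extChartAt (𝓡 n) x₁).symm (coordChange x₀ x₁ z)) from
      (symm_coordChange (secOverlap_subset_overlap _ _ hz)).symm ▸
        (trivializationAt F V x₀).symm ((extChartAt (𝓡 n) x₀).symm z) v)
  -- Transport of a fibre vector along an equality of base points leaves the point of the total
  -- space unchanged.
  have key : ∀ (y : M) (hy : y = (extChartAt (𝓡 n) x₀).symm z) (e : V ((extChartAt (𝓡 n) x₀).symm z)),
      (⟨y, hy ▸ e⟩ : TotalSpace F V) = ⟨(extChartAt (𝓡 n) x₀).symm z, e⟩ := by
    rintro _ rfl e; rfl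
  have h4 := key _ (symm_coordChange (secOverlap_subset_overlap _ _ hz))
    ((trivializationAt F V x₀).symm ((extChartAt (𝓡 n) x₀).symm z) v)
  erw [h4] at h3
  rw [h2, h1] at h3
  exact h3.symm

lemma transFrame (x₀ x₁ : M) : JetFrame (S := Sec n F V) (secCoord x₁) (coordChange x₀ x₁)
    (secOverlap n F V x₀ x₁) (chartDom n F V x₁) :=
  ⟨isOpen_secOverlap x₀ x₁, isOpen_chartDom x₁,
    (contDiffOn_coordChange x₀ x₁).mono (secOverlap_subset_overlap x₀ x₁),
    fun _ hz => (coordChange_mem_secOverlap hz).1, fun φ => secCoord_contDiffOn φ x₁⟩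

/-- The expression at `x₁`, taken at the transformed point, is mapped back by the inverse change of
fibre coordinates. No derivative occurs, so any order will do. -/
lemma jetFn_secCoord_trans (x₀ x₁ : M) {p : ℕ} :
    JetFn (S := Sec n F V) (secCoord x₁) (coordChange x₀ x₁) (secOverlap n F V x₀ x₁) p
      fun z φ => secCoord x₀ φ z := by
  have h : JetFn (S := Sec n F V) (secCoord x₁) (coordChange x₀ x₁) (secOverlap n F V x₀ x₁) p
      fun z φ => secCoord x₁ φ (coordChange x₀ x₁ z) := JetFn.field
  have hT : ContDiffOn ℝ ∞ (fun z => fibreChange F V x₁ x₀ (coordChange x₀ x₁ z))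
      (secOverlap n F V x₀ x₁) := (contDiffOn_fibreChange x₁ x₀).comp
    ((contDiffOn_coordChange x₀ x₁).mono (secOverlap_subset_overlap x₀ x₁))
    fun z hz => coordChange_mem_secOverlap hz
  refine (h.comp (Φ := fun w => fibreChange F V x₁ x₀ (coordChange x₀ x₁ w.1) w.2)
    ((hT.comp contDiffOn_fst fun w hw => hw.1).clm_apply contDiffOn_snd)).congr fun φ z hz => ?_
  rw [secCoord_coordChange hz, fibreChange_fibreChange hz]

/-- A coordinate change mixes derivatives of the same total order, so the entrywise bound `p` has to
be relaxed to the bound `n * p` on total orders. -/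
lemma JetFn.trans {x₀ x₁ : M} {W : Set (Model n)} (hW : W ⊆ secOverlap n F V x₀ x₁) {p : ℕ}
    {c : Model n → Sec n F V → X} (h : JetFn (secCoord x₀) id W p c) :
    JetFn (secCoord x₁) (coordChange x₀ x₁) W (n * p) c := by
  have hJ : JetFn (S := Sec n F V) (secCoord x₁) (coordChange x₀ x₁) (secOverlap n F V x₀ x₁)
      (n * p) fun z φ => jetCoord p (secCoord x₀ φ) z := by
    refine JetFn.pi fun I => ?_
    have := (transFrame (F := F) (V := V) x₀ x₁).partialMulti (jetFn_secCoord_trans x₀ x₁ (p := 0))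
      (fun i => (I i : ℕ))
    exact this.mono (by rw [zero_add]; exact sum_le_of_le I)
  obtain ⟨A, hA, hc⟩ := h
  refine ((hJ.mono_set hW).comp hA).congr fun φ z hz => hc φ z hz

/-- A local quantity in the coordinates at `x₀` is one in the coordinates at `x₁`. -/
lemma JetFn.change {x₀ x₁ : M} {W W' : Set (Model n)} {p : ℕ}
    {c : Model n → Sec n F V → X} (h : JetFn (secCoord x₀) id W p c)
    (hW' : W' ⊆ secOverlap n F V x₁ x₀) (hm : MapsTo (coordChange x₁ x₀) W' W) :
    JetFn (secCoord x₁) id W' (n * p) fun z φ => c (coordChange x₁ x₀ z) φ := by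
  have h1 := (h.mono_set (W' := W ∩ secOverlap n F V x₀ x₁) inter_subset_left).trans
    inter_subset_right
  exact h1.comp_right ((contDiffOn_coordChange x₁ x₀).mono
    (hW'.trans (secOverlap_subset_overlap x₁ x₀)))
    (fun z hz => ⟨hm hz, coordChange_mem_secOverlap (hW' hz)⟩)
    fun z hz => coordChange_coordChange (secOverlap_subset_overlap _ _ (hW' hz))

lemma jetCode_eq_of_jet_eq {x : M} {φ χ : Sec n F V} (h : jet φ x = jet χ x) (p : ℕ) :
    jetCoord p (secCoord x φ) (extChartAt (𝓡 n) x x)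
      = jetCoord p (secCoord x χ) (extChartAt (𝓡 n) x x) := by
  have h1 : jetCode (x, φ) = jetCode (x, χ) := Quotient.exact h
  funext I
  exact congrFun (congrArg Prod.snd h1) fun i => (I i : ℕ)

/-- Equality of jets is defined in the coordinates at the base point. Derivatives in other
coordinates are functions of the jet there, hence agree as well. -/
lemma jetCoord_eq_of_jet_eq {x₀ : M} {z : Model n} (hz : z ∈ chartDom n F V x₀) {φ χ : Sec n F V}
    (h : jet φ ((extChartAt (𝓡 n) x₀).symm z) = jet χ ((extChartAt (𝓡 n) x₀).symm z)) (p : ℕ) :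
    jetCoord p (secCoord x₀ φ) z = jetCoord p (secCoord x₀ χ) z := by
  have hz' : z ∈ secOverlap n F V x₀ ((extChartAt (𝓡 n) x₀).symm z) :=
    ⟨hz, mem_chartRegion_self _⟩
  obtain ⟨A, -, hA⟩ := JetFn.trans (x₀ := x₀) (x₁ := (extChartAt (𝓡 n) x₀).symm z) subset_rfl
    (JetFn.jet (u := fun φ : Sec n F V => secCoord x₀ φ) (τ := id) (p := p))
  have h1 := hA φ z hz'
  have h2 := hA χ z hz'
  have := jetCode_eq_of_jet_eq h (n * p)
  rw [coordChange] at h1 h2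
  exact h1.trans ((congrArg (fun w => A (z, w)) this).trans h2.symm)

/-- Well-definedness on `J^∞E`: constructions that evaluate at the chosen representative
`InfJet.section` may be computed with any other section of the same jet. -/
lemma JetFn.eq_of_jet_eq {x₀ : M} {W : Set (Model n)} (hW : W ⊆ chartDom n F V x₀) {p : ℕ}
    {c : Model n → Sec n F V → X} (h : JetFn (secCoord x₀) id W p c) {z : Model n} (hz : z ∈ W)
    {φ χ : Sec n F V}
    (hj : LocalFunctionals.jet φ ((extChartAt (𝓡 n) x₀).symm z) = LocalFunctionals.jet χ ((extChartAt (𝓡 n) x₀).symm z)) :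
    c z φ = c z χ := by
  obtain ⟨A, -, hA⟩ := h
  rw [hA φ z hz, hA χ z hz, id, jetCoord_eq_of_jet_eq (hW hz) hj]

lemma jet_eq_of_jetCoord {x : M} {φ χ : Sec n F V}
    (h : ∀ p, jetCoord p (secCoord x φ) (extChartAt (𝓡 n) x x)
      = jetCoord p (secCoord x χ) (extChartAt (𝓡 n) x x)) : jet φ x = jet χ x := by
  refine Quotient.sound (show jetCode (x, φ) = jetCode (x, χ) from Prod.ext rfl ?_)
  funext I
  have hI : ∀ i, I i < (∑ i, I i) + 1 := fun i =>
    Nat.lt_succ_of_le (Finset.single_le_sum (fun _ _ => Nat.zero_le _) (Finset.mem_univ i))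
  exact congrFun (h (∑ i, I i)) fun i => ⟨I i, hI i⟩

lemma secCoord_eventuallyEq {x₀ x : M} (hx : x ∈ (extChartAt (𝓡 n) x₀).source) {φ χ : Sec n F V}
    (h : ∀ᶠ y in 𝓝 x, φ y = χ y) :
    secCoord x₀ φ =ᶠ[𝓝 (extChartAt (𝓡 n) x₀ x)] secCoord x₀ χ := by
  have hc := continuousAt_extChartAt_symm' (I := 𝓡 n) hx
  have : ∀ᶠ y in 𝓝 ((extChartAt (𝓡 n) x₀).symm (extChartAt (𝓡 n) x₀ x)), φ y = χ y := by
    rwa [(extChartAt (𝓡 n) x₀).left_inv hx]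
  filter_upwards [hc.eventually this] with y hy
  rw [secCoord, secCoord, hy]

lemma jet_eq_of_eventuallyEq {x : M} {φ χ : Sec n F V} (h : ∀ᶠ y in 𝓝 x, φ y = χ y) :
    jet φ x = jet χ x :=
  jet_eq_of_jetCoord fun p =>
    (jetCoord_eventuallyEq (secCoord_eventuallyEq (mem_extChartAt_source x) h) p).self_of_nhds

lemma secCoord_comb {x₀ : M} (c : ℝ) (φ χ : Sec n F V) {z : Model n}
    (hz : z ∈ chartDom n F V x₀) :
    secCoord x₀ (c • φ + χ) z = c • secCoord x₀ φ z + secCoord x₀ χ z := by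
  have h := (trivializationAt F V x₀).coe_linearMapAt_of_mem (R := ℝ) hz.2
  have h' : ∀ v, (trivializationAt F V x₀ ⟨(extChartAt (𝓡 n) x₀).symm z, v⟩).2
    = (trivializationAt F V x₀).linearMapAt ℝ ((extChartAt (𝓡 n) x₀).symm z) v :=
    fun v => (congrFun h v).symm
  simp only [secCoord, h']
  rw [← map_smul, ← map_add]
  rfl

/-- A representation of some order is one of every higher order, so "for all large orders" and "for
some order" agree. The order is the same in all charts. -/
lemma isLocalForm_iff {k : ℕ} {α : HForm n F V k} :
    IsLocalForm α ↔ ∃ p, ∀ x₀ : M, JetFn (secCoord x₀) id (chartDom n F V x₀) p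
      fun z φ => chartForm x₀ (pullSec α φ) z := by
  refine ⟨fun h => h.exists, fun ⟨p, h⟩ => ?_⟩
  filter_upwards [eventually_ge_atTop p] with q hq x₀
  exact (h x₀).mono hq

lemma isLocalFunction_iff {P : InfJet n F V → ℝ} :
    IsLocalFunction P ↔ ∃ p, ∀ x₀ : M, JetFn (S := Sec n F V) (secCoord x₀) id (chartDom n F V x₀) p
      fun z φ => P (jet φ ((extChartAt (𝓡 n) x₀).symm z)) := by
  refine ⟨fun h => h.exists, fun ⟨p, h⟩ => ?_⟩
  filter_upwards [eventually_ge_atTop p] with q hq x₀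
  exact (h x₀).mono hq

end SectionCoordinates

/-! ### Extension of test fields by zero and locality of jet functions -/

section Extension

variable {n : ℕ} {M : Type*} [TopologicalSpace M] [ChartedSpace (Model n) M]
  {F : Type*} [NormedAddCommGroup F] [NormedSpace ℝ F]
  {V : M → Type*} [TopologicalSpace (TotalSpace F V)] [∀ x, AddCommGroup (V x)]
  [∀ x, Module ℝ (V x)] [∀ x, TopologicalSpace (V x)] [FiberBundle F V] [VectorBundle ℝ F V]
  {X Y : Type*} [NormedAddCommGroup X] [NormedSpace ℝ X] [NormedAddCommGroup Y] [NormedSpace ℝ Y]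
  [IsManifold (𝓡 n) ∞ M] [ContMDiffVectorBundle ∞ F V (𝓡 n)] [T2Space M]

lemma isCompact_symm_image {x₀ : M} {K : Set (Model n)} (hK : IsCompact K)
    (h : K ⊆ (extChartAt (𝓡 n) x₀).target) : IsCompact ((extChartAt (𝓡 n) x₀).symm '' K) :=
  hK.image_of_continuousOn ((continuousOn_extChartAt_symm x₀).mono h)

lemma mem_symm_image {x₀ x : M} {K : Set (Model n)} (hx : x ∈ (extChartAt (𝓡 n) x₀).source)
    (h : extChartAt (𝓡 n) x₀ x ∈ K) : x ∈ (extChartAt (𝓡 n) x₀).symm '' K :=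
  ⟨_, h, (extChartAt (𝓡 n) x₀).left_inv hx⟩

lemma symm_mem_symm_image {x₀ : M} {K : Set (Model n)} (h : K ⊆ (extChartAt (𝓡 n) x₀).target)
    {z : Model n} (hz : z ∈ (extChartAt (𝓡 n) x₀).target) :
    (extChartAt (𝓡 n) x₀).symm z ∈ (extChartAt (𝓡 n) x₀).symm '' K ↔ z ∈ K := by
  refine ⟨fun ⟨y, hy, e⟩ => ?_, fun h => ⟨z, h, rfl⟩⟩
  rwa [← (extChartAt (𝓡 n) x₀).symm.injOn (h hy) hz e]

/-- Extension by zero of a function on a chart. -/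
def extendFn (x₀ : M) (f : Model n → ℝ) (x : M) : ℝ :=
  open Classical in if x ∈ (extChartAt (𝓡 n) x₀).source then f (extChartAt (𝓡 n) x₀ x) else 0

lemma extendFn_symm (x₀ : M) (f : Model n → ℝ) {z : Model n}
    (hz : z ∈ (extChartAt (𝓡 n) x₀).target) :
    extendFn x₀ f ((extChartAt (𝓡 n) x₀).symm z) = f z := by
  rw [extendFn, if_pos ((extChartAt (𝓡 n) x₀).map_target hz), (extChartAt (𝓡 n) x₀).right_inv hz]

lemma extendFn_eq_zero {x₀ : M} {f : Model n → ℝ} {x : M}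
    (hx : x ∉ (extChartAt (𝓡 n) x₀).symm '' tsupport f) : extendFn x₀ f x = 0 := by
  rw [extendFn]
  split_ifs with h
  · by_contra h0
    exact hx (mem_symm_image h (subset_tsupport _ h0))
  · rfl

lemma contMDiff_extendFn {x₀ : M} {f : Model n → ℝ}
    (hf : IsTest (extChartAt (𝓡 n) x₀).target f) :
    ContMDiff (𝓡 n) 𝓘(ℝ, ℝ) ∞ (extendFn x₀ f) := by
  intro x
  by_cases hx : x ∈ (extChartAt (𝓡 n) x₀).source
  · have h1 : ContMDiffAt (𝓡 n) 𝓘(ℝ, ℝ) ∞ (fun y => f (extChartAt (𝓡 n) x₀ y)) x :=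
      hf.smooth.contMDiff.contMDiffAt.comp x
        (contMDiffAt_extChartAt' (by rwa [extChartAt_source] at hx))
    refine h1.congr_of_eventuallyEq ?_
    filter_upwards [(isOpen_extChartAt_source x₀).mem_nhds hx] with y hy
    rw [extendFn, if_pos hy]
  · have hK := (isCompact_symm_image hf.compact hf.subset).isClosed
    have hx' : x ∉ (extChartAt (𝓡 n) x₀).symm '' tsupport f := by
      rintro ⟨z, hz, rfl⟩
      exact hx ((extChartAt (𝓡 n) x₀).map_target (hf.subset hz))
    refine (contMDiffAt_const (c := (0 : ℝ))).congr_of_eventuallyEq ?_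
    filter_upwards [hK.isOpen_compl.mem_nhds hx'] with y hy using extendFn_eq_zero hy

open Classical in
/-- Extension by zero of a section over a coordinate domain. -/
def extendRaw (F : Type*) [NormedAddCommGroup F] [NormedSpace ℝ F]
    (V : M → Type*) [TopologicalSpace (TotalSpace F V)] [∀ x, AddCommGroup (V x)]
    [∀ x, Module ℝ (V x)] [∀ x, TopologicalSpace (V x)] [FiberBundle F V]
    (x₀ : M) (v : Model n → F) (x : M) : V x :=
  if x ∈ chartRegion n F V x₀ then (trivializationAt F V x₀).symm x (v (extChartAt (𝓡 n) x₀ x))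
  else 0

lemma extendRaw_eq_zero {x₀ : M} {v : Model n → F} {x : M}
    (hx : x ∉ (extChartAt (𝓡 n) x₀).symm '' tsupport v) : extendRaw F V x₀ v x = 0 := by
  rw [extendRaw]
  split_ifs with h
  · have : v (extChartAt (𝓡 n) x₀ x) = 0 := by
      by_contra h0
      exact hx (mem_symm_image h.1 (subset_tsupport _ h0))
    rw [this, ← Trivialization.symmₗ_apply (R := ℝ) _ h.2, map_zero]
  · rfl

lemma triv_extendRaw {x₀ x : M} {v : Model n → F} (hx : x ∈ chartRegion n F V x₀) :
    (trivializationAt F V x₀ ⟨x, extendRaw F V x₀ v x⟩).2 = v (extChartAt (𝓡 n) x₀ x) := by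
  rw [extendRaw, if_pos hx, Trivialization.apply_mk_symm _ hx.2]

/-- Extension by zero of a section over a coordinate domain. -/
def extendSec (x₀ : M) (v : Model n → F) (hv : IsTest (chartDom n F V x₀) v) : Sec n F V where
  toFun := extendRaw F V x₀ v
  contMDiff_toFun := by
    intro x
    by_cases hx : x ∈ chartRegion n F V x₀
    · have h1 : ContMDiffOn (𝓡 n) 𝓘(ℝ, F) ∞
          (fun y => (trivializationAt F V x₀ ⟨y, extendRaw F V x₀ v y⟩).2)
          (chartRegion n F V x₀) := by
        refine ContMDiffOn.congr (f := fun y => v (extChartAt (𝓡 n) x₀ y)) ?_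
          fun y hy => triv_extendRaw hy
        refine hv.smooth.contMDiff.comp_contMDiffOn
          ((contMDiffOn_extChartAt (x := x₀)).mono fun y hy => ?_)
        rw [← extChartAt_source (𝓡 n)]
        exact hy.1
      exact (((trivializationAt F V x₀).contMDiffOn_section_iff (isOpen_chartRegion x₀)
        inter_subset_right).2 h1).contMDiffAt ((isOpen_chartRegion x₀).mem_nhds hx)
    · have hK := (isCompact_symm_image hv.compact (hv.subset.trans inter_subset_left)).isClosed
      have hx' : x ∉ (extChartAt (𝓡 n) x₀).symm '' tsupport v := by
        rintro ⟨z, hz, rfl⟩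
        exact hx (symm_mem_chartRegion (hv.subset hz))
      refine ((0 : Sec n F V).contMDiff x).congr_of_eventuallyEq ?_
      filter_upwards [hK.isOpen_compl.mem_nhds hx'] with y hy
      exact congrArg (TotalSpace.mk' F y) (extendRaw_eq_zero hy)

lemma secCoord_extendSec {x₀ : M} {v : Model n → F} (hv : IsTest (chartDom n F V x₀) v)
    {z : Model n} (hz : z ∈ chartDom n F V x₀) : secCoord x₀ (extendSec x₀ v hv) z = v z := by
  refine (triv_extendRaw (symm_mem_chartRegion hz)).trans ?_
  rw [(extChartAt (𝓡 n) x₀).right_inv hz.1]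

lemma isCompactlySupported_extendSec {x₀ : M} {v : Model n → F}
    (hv : IsTest (chartDom n F V x₀) v) : IsCompactlySupported (extendSec x₀ v hv) := by
  refine (isCompact_symm_image hv.compact (hv.subset.trans inter_subset_left)).closure_of_subset ?_
  intro x hx
  by_contra h
  exact hx (extendRaw_eq_zero h)

lemma exists_test_eq_one [FiniteDimensional ℝ F] {W : Set (Model n)} (hW : IsOpen W)
    {z : Model n} (hz : z ∈ W) :
    ∃ f : Model n → ℝ, IsTest W f ∧ ∀ᶠ y in 𝓝 z, f y = 1 := by
  obtain ⟨r, hr, hrW⟩ := Metric.nhds_basis_closedBall.mem_iff.1 (hW.mem_nhds hz)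
  let f : ContDiffBump z := ⟨r / 2, r, by positivity, by linarith⟩
  refine ⟨f, ⟨f.contDiff, f.hasCompactSupport, ?_⟩, f.eventuallyEq_one⟩
  rw [f.tsupport_eq]
  exact hrW

/-- Near a given point every section agrees with a compactly supported one. -/
lemma exists_compactlySupported_eq [FiniteDimensional ℝ F] (φ : Sec n F V) (x : M) :
    ∃ χ : Sec n F V, IsCompactlySupported χ ∧ ∀ᶠ y in 𝓝 x, χ y = φ y := by
  have hx := chart_mem_chartDom (mem_chartRegion_self (n := n) (F := F) (V := V) x)
  obtain ⟨f, hf, h1⟩ := exists_test_eq_one (F := F) (isOpen_chartDom x) hx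
  have hv : IsTest (chartDom n F V x) fun z => f z • secCoord x φ z := by
    refine isTest_of_contDiffOn (isOpen_chartDom x)
      (hf.smooth.contDiffOn.smul (secCoord_contDiffOn φ x)) hf.compact hf.subset fun z hz => ?_
    rw [image_eq_zero_of_notMem_tsupport hz, zero_smul]
  refine ⟨extendSec x _ hv, isCompactlySupported_extendSec hv, ?_⟩
  have h2 : ∀ᶠ y in 𝓝 x, f (extChartAt (𝓡 n) x y) = 1 :=
    (continuousAt_extChartAt x).eventually h1
  filter_upwards [h2, (isOpen_chartRegion x).mem_nhds (mem_chartRegion_self (n := n) (F := F) (V := V) x)]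
    with y hy hy'
  change extendRaw F V x (fun z => f z • secCoord x φ z) y = φ y
  rw [extendRaw, if_pos hy', hy, one_smul, secCoord, (extChartAt (𝓡 n) x).left_inv hy'.1,
    Trivialization.symm_apply_apply_mk _ hy'.2]

lemma exists_sec_jetCoord [FiniteDimensional ℝ F] {x₀ : M} {z : Model n}
    (hz : z ∈ chartDom n F V x₀) {p : ℕ} (w : JetCoord n p F) :
    ∃ φ : Sec n F V, IsCompactlySupported φ ∧ jetCoord p (secCoord x₀ φ) z = w := by
  obtain ⟨v, hv, h⟩ := exists_test_jetCoord (isOpen_chartDom x₀) hz w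
  refine ⟨extendSec x₀ v hv, isCompactlySupported_extendSec hv, ?_⟩
  rw [← h]
  refine (jetCoord_eventuallyEq ?_ p).self_of_nhds
  filter_upwards [(isOpen_chartDom x₀).mem_nhds hz] with y hy using secCoord_extendSec hv hy

/-- Being a smooth function of the jet is a local property. -/
lemma JetFn.of_locally [FiniteDimensional ℝ F] {x₀ : M} {W : Set (Model n)}
    (hW : W ⊆ chartDom n F V x₀) {p : ℕ} {c : Model n → Sec n F V → X}
    (h : ∀ z ∈ W, ∃ N ∈ 𝓝 z, JetFn (secCoord x₀) id (N ∩ W) p c) :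
    JetFn (secCoord x₀) id W p c := by
  classical
  -- Every finite jet is realized by a section `s z w`, so the representing function is unique and
  -- can be defined by evaluation at it. The local representations agree with this function, and no
  -- partition of unity is needed.
  choose! s hs using fun z (hz : z ∈ W) (w : JetCoord n p F) => exists_sec_jetCoord (hW hz) w
  refine ⟨fun w => c w.1 (s w.1 w.2), ?_, fun φ z hz => ?_⟩
  · rintro ⟨z, w⟩ ⟨hz, -⟩
    obtain ⟨N, hN, A, hA, hc⟩ := h z hz
    have hzN : z ∈ N := mem_of_mem_nhds hN
    have h1 := hA (z, w) ⟨⟨hzN, hz⟩, mem_univ _⟩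
    have h2 : ContDiffWithinAt ℝ ∞ A (W ×ˢ univ) (z, w) := by
      refine h1.mono_of_mem_nhdsWithin ?_
      have : (N ×ˢ univ : Set (Model n × JetCoord n p F)) ∈ 𝓝 (z, w) :=
        prod_mem_nhds hN univ_mem
      filter_upwards [mem_nhdsWithin_of_mem_nhds this, self_mem_nhdsWithin] with a ha hb
      exact ⟨⟨ha.1, hb.1⟩, mem_univ _⟩
    refine h2.congr_of_eventuallyEq_of_mem ?_ ⟨hz, mem_univ _⟩
    have : (N ×ˢ univ : Set (Model n × JetCoord n p F)) ∈ 𝓝 (z, w) := prod_mem_nhds hN univ_mem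
    filter_upwards [mem_nhdsWithin_of_mem_nhds this, self_mem_nhdsWithin] with a ha hb
    rw [hc _ _ ⟨ha.1, hb.1⟩, id, (hs a.1 hb.1 a.2).2]
  · obtain ⟨N, hN, A, hA, hc⟩ := h z hz
    have hzN : z ∈ N := mem_of_mem_nhds hN
    beta_reduce
    rw [hc _ _ ⟨hzN, hz⟩, hc _ _ ⟨hzN, hz⟩, id, (hs z hz _).2]

end Extension

/-! ### Local pieces and locally finite sums of horizontal forms -/

section Glue

variable {n : ℕ} {M : Type*} [TopologicalSpace M] [ChartedSpace (Model n) M]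
  {F : Type*} [NormedAddCommGroup F] [NormedSpace ℝ F]
  {V : M → Type*} [TopologicalSpace (TotalSpace F V)] [∀ x, AddCommGroup (V x)]
  [∀ x, Module ℝ (V x)] [∀ x, TopologicalSpace (V x)] [FiberBundle F V] [VectorBundle ℝ F V]
  {k : ℕ}

/-- Multilinear expansion: the components of a pull-back are polynomial in the entries of `D`, which
shows smooth dependence on the point. -/
lemma alt_comp_apply (η : (Model n) [⋀^Fin k]→L[ℝ] ℝ) (D : Model n →L[ℝ] Model n)
    (v : Fin k → Fin n) :
    (η.compContinuousLinearMap D) (fun i => EuclideanSpace.single (v i) 1)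
      = ∑ r : Fin k → Fin n, (∏ i, D (EuclideanSpace.single (v i) 1) (r i)) *
        altEval n k η r := by
  have h1 : ∀ i, D (EuclideanSpace.single (v i) 1)
      = ∑ a, D (EuclideanSpace.single (v i) 1) a • EuclideanSpace.single a (1 : ℝ) :=
    fun i => eq_sum_single _
  have h2 : (η.compContinuousLinearMap D) (fun i => EuclideanSpace.single (v i) 1)
      = η.toMultilinearMap fun i => ∑ a, D (EuclideanSpace.single (v i) 1) a •
        EuclideanSpace.single a (1 : ℝ) :=
    congrArg η (funext fun i => h1 i)
  rw [h2, MultilinearMap.map_sum]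
  refine Finset.sum_congr rfl fun r _ => ?_
  rw [MultilinearMap.map_smul_univ]
  rfl

lemma JetFn.altComp {F S : Type*} [NormedAddCommGroup F] [NormedSpace ℝ F] {u : S → Model n → F}
    {τ : Model n → Model n} {W : Set (Model n)} {p : ℕ} {c : Model n → S → (Model n) [⋀^Fin k]→L[ℝ] ℝ}
    (h : JetFn u τ W p c) {D : Model n → Model n →L[ℝ] Model n} (hD : ContDiffOn ℝ ∞ D W) :
    JetFn u τ W p fun z s => (c z s).compContinuousLinearMap (D z) := by
  refine JetFn.alt fun v => ?_
  simp only [alt_comp_apply]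
  refine JetFn.sum fun r _ => JetFn.mul (JetFn.of_base ?_) ?_
  · refine contDiffOn_prod fun i _ => ?_
    have := (hD.clm_apply (contDiffOn_const (c := EuclideanSpace.single (v i) (1 : ℝ))))
    exact (contDiffOn_euclidean.1 this) (r i)
  · exact h.clm ((ContinuousLinearMap.proj (R := ℝ) (φ := fun _ : Fin k → Fin n => ℝ) r).comp
      (altEval n k))

lemma chartForm_sum {ι : Type*} (t : Finset ι) (x₀ : M) (β : ι → ∀ x : M, Cov n k x)
    (z : Model n) :
    chartForm x₀ (fun x => ∑ i ∈ t, β i x) z = ∑ i ∈ t, chartForm x₀ (β i) z := by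
  classical
  induction t using Finset.induction_on with
  | empty => simpa using chartForm_zero x₀ z
  | insert a t ha ih =>
    rw [Finset.sum_insert ha, ← ih]
    have := chartForm_comb x₀ 1 (β a) (fun x => ∑ i ∈ t, β i x) z
    simp only [one_smul] at this
    rw [← this]
    congr 1
    funext x
    exact Finset.sum_insert ha

lemma chartForm_smul (x₀ : M) (f : M → ℝ) (β : ∀ x : M, Cov n k x) (z : Model n) :
    chartForm x₀ (fun x => f x • β x) z
      = f ((extChartAt (𝓡 n) x₀).symm z) • chartForm x₀ β z := by
  ext v
  rfl

lemma chartForm_eq_zero {x₀ : M} {β : ∀ x : M, Cov n k x} {z : Model n}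
    (h : β ((extChartAt (𝓡 n) x₀).symm z) = 0) : chartForm x₀ β z = 0 := by
  ext v
  change β ((extChartAt (𝓡 n) x₀).symm z) _ = 0
  rw [h]
  rfl

lemma chartForm_congr {x₀ : M} {β γ : ∀ x : M, Cov n k x} {z : Model n}
    (h : β ((extChartAt (𝓡 n) x₀).symm z) = γ ((extChartAt (𝓡 n) x₀).symm z)) :
    chartForm x₀ β z = chartForm x₀ γ z := by
  rw [chartForm, chartForm, h]

variable [IsManifold (𝓡 n) ∞ M]

lemma eq_zero_of_chartForm {x₀ : M} {β : ∀ x : M, Cov n k x} {z : Model n}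
    (hz : z ∈ (extChartAt (𝓡 n) x₀).target) (h : chartForm x₀ β z = 0) :
    β ((extChartAt (𝓡 n) x₀).symm z) = 0 := by
  refine eq_of_chartForm_eq (γ := fun x => (0 : Cov n k x))
    ((extChartAt (𝓡 n) x₀).map_target hz) ?_
  rw [(extChartAt (𝓡 n) x₀).right_inv hz, h, chartForm_zero]

open Classical in
/-- The form which is `η` over the set `K` in the chart at `x₀`, and zero elsewhere. -/
def localPiece (x₀ : M) (K : Set (Model n)) (η : Model n → Sec n F V → (Model n) [⋀^Fin k]→L[ℝ] ℝ) :
    HForm n F V k :=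
  fun j => if j.base ∈ (extChartAt (𝓡 n) x₀).symm '' K then
    chartPull x₀ j.base (η (extChartAt (𝓡 n) x₀ j.base) j.section) else 0

lemma localPiece_eq_zero {x₀ : M} {K : Set (Model n)}
    {η : Model n → Sec n F V → (Model n) [⋀^Fin k]→L[ℝ] ℝ} {j : InfJet n F V}
    (h : j.base ∉ (extChartAt (𝓡 n) x₀).symm '' K) : localPiece x₀ K η j = 0 := if_neg h

variable [ContMDiffVectorBundle ∞ F V (𝓡 n)] [T2Space M]

/-- `localPiece` evaluates `η` on the chosen representative of a jet. As `η` depends on the jet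
only, any section gives the same value, and off `K` both sides vanish. -/
lemma chartForm_localPiece {x₀ : M} {K W : Set (Model n)}
    {η : Model n → Sec n F V → (Model n) [⋀^Fin k]→L[ℝ] ℝ} {p : ℕ}
    (hη : JetFn (secCoord x₀) id W p η) (hW : W ⊆ chartDom n F V x₀) (hK : K ⊆ W)
    (h0 : ∀ z ∈ W, z ∉ K → ∀ φ, η z φ = 0) {z : Model n} (hz : z ∈ W) (φ : Sec n F V) :
    chartForm x₀ (pullSec (localPiece x₀ K η) φ) z = η z φ := by
  have hKt : K ⊆ (extChartAt (𝓡 n) x₀).target := fun y hy => (hW (hK hy)).1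
  by_cases hzK : z ∈ K
  · refine chartForm_eq_of_plain (hW hz).1 ?_
    have h1 : (jet φ ((extChartAt (𝓡 n) x₀).symm z)).base ∈ (extChartAt (𝓡 n) x₀).symm '' K :=
      ⟨z, hzK, rfl⟩
    have h2 : localPiece x₀ K η (jet φ ((extChartAt (𝓡 n) x₀).symm z))
      = chartPull x₀ _ (η (extChartAt (𝓡 n) x₀ ((extChartAt (𝓡 n) x₀).symm z))
        (jet φ ((extChartAt (𝓡 n) x₀).symm z)).section) := if_pos h1
    rw [(extChartAt (𝓡 n) x₀).right_inv (hW hz).1,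
      hη.eq_of_jet_eq hW hz (jet_section (jet φ ((extChartAt (𝓡 n) x₀).symm z)))] at h2
    exact h2
  · rw [h0 z hz hzK]
    refine chartForm_eq_zero (localPiece_eq_zero fun h => hzK ?_)
    exact (symm_mem_symm_image hKt (hW hz).1).1 h

variable [FiniteDimensional ℝ F]

/-- Over the image of `W` the piece is transported from the chart at `x₀`; over the complement of
the image of `K`, which is closed because `M` is Hausdorff, it is zero. The two open sets cover `M`.
-/
lemma jetFn_localPiece {x₀ : M} {K W : Set (Model n)}
    {η : Model n → Sec n F V → (Model n) [⋀^Fin k]→L[ℝ] ℝ} {p : ℕ}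
    (hη : JetFn (secCoord x₀) id W p η) (hW : W ⊆ chartDom n F V x₀) (hWo : IsOpen W)
    (hKc : IsCompact K) (hK : K ⊆ W)
    (h0 : ∀ z ∈ W, z ∉ K → ∀ φ, η z φ = 0) (x₁ : M) :
    JetFn (secCoord x₁) id (chartDom n F V x₁) (n * p)
      fun z φ => chartForm x₁ (pullSec (localPiece x₀ K η) φ) z := by
  have hKt : K ⊆ (extChartAt (𝓡 n) x₀).target := fun y hy => (hW (hK hy)).1
  refine JetFn.of_locally subset_rfl fun z hz => ?_
  by_cases hzK : (extChartAt (𝓡 n) x₁).symm z ∈ (extChartAt (𝓡 n) x₀).symm '' K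
  · let N : Set (Model n) := secOverlap n F V x₁ x₀ ∩ coordChange x₁ x₀ ⁻¹' W
    have hN : IsOpen N := ((contDiffOn_coordChange x₁ x₀).continuousOn.mono
      (secOverlap_subset_overlap x₁ x₀)).isOpen_inter_preimage (isOpen_secOverlap x₁ x₀) hWo
    have hzN : z ∈ N := by
      obtain ⟨y, hy, e⟩ := hzK
      refine ⟨⟨hz, ?_⟩, ?_⟩
      · rw [mem_preimage, ← e]
        exact symm_mem_chartRegion (hW (hK hy))
      · rw [mem_preimage, coordChange, ← e, (extChartAt (𝓡 n) x₀).right_inv (hKt hy)]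
        exact hK hy
    refine ⟨N, hN.mem_nhds hzN, JetFn.mono_set ?_ inter_subset_left⟩
    have h1 := hη.change (x₁ := x₁) (W' := N) inter_subset_left fun y hy => hy.2
    have h2 : ContDiffOn ℝ ∞ (fderiv ℝ (coordChange x₁ x₀ : Model n → Model n)) N :=
      ((contDiffOn_coordChange x₁ x₀).fderiv_of_isOpen (isOpen_overlap x₁ x₀) (m := ∞)
        (by simp)).mono fun y hy => secOverlap_subset_overlap x₁ x₀ hy.1
    refine (h1.altComp h2).congr fun φ y hy => ?_
    rw [chartForm_coordChange _ (secOverlap_subset_overlap x₁ x₀ hy.1),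
      chartForm_localPiece hη hW hK h0 hy.2]
  · have hcl := (isCompact_symm_image hKc hKt).isClosed
    let N : Set (Model n) := chartDom n F V x₁ ∩ (extChartAt (𝓡 n) x₁).symm ⁻¹'
      ((extChartAt (𝓡 n) x₀).symm '' K)ᶜ
    have hN : IsOpen N := ((continuousOn_extChartAt_symm x₁).mono
      inter_subset_left).isOpen_inter_preimage (isOpen_chartDom x₁) hcl.isOpen_compl
    refine ⟨N, hN.mem_nhds ⟨hz, hzK⟩, JetFn.mono_set ?_ inter_subset_left⟩
    refine (JetFn.of_base (contDiffOn_const (c := 0))).congr fun φ y hy => ?_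
    exact chartForm_eq_zero (localPiece_eq_zero hy.2)

/-- A locally finite sum of forms. -/
def glue {ι : Type*} (P : ι → HForm n F V k) : HForm n F V k := fun j => ∑ᶠ i, P i j

/-- Supports are controlled over the base, so one finite index set serves all sections and all
points near `x`. Larger sets are allowed in order to combine this with other local finiteness
statements. -/
lemma glue_eventually {ι : Type*} {P : ι → HForm n F V k} {C : ι → Set M}
    (hC : LocallyFinite C) (hP : ∀ i j, j.base ∉ C i → P i j = 0) (x : M) :
    ∃ t : Finset ι, ∀ᶠ y in 𝓝 x, ∀ t' : Finset ι, t ⊆ t' → ∀ φ : Sec n F V,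
      glue P (jet φ y) = ∑ i ∈ t', P i (jet φ y) := by
  obtain ⟨N, hN, hfin⟩ := hC x
  refine ⟨hfin.toFinset, ?_⟩
  filter_upwards [hN] with y hy t' ht' φ
  refine finsum_eq_sum_of_support_subset _ fun i hi => ht' ?_
  refine hfin.mem_toFinset.2 ⟨y, ?_, hy⟩
  by_contra h
  exact hi (hP i _ h)

/-- Near each point the sum is finite, but the result has finite order only because all pieces share
the order `p`. This is why uniform orders are needed later. -/
lemma isLocalForm_glue {ι : Type*} {P : ι → HForm n F V k} {C : ι → Set M}
    (hC : LocallyFinite C) (hP : ∀ i j, j.base ∉ C i → P i j = 0) {p : ℕ}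
    (h : ∀ i x₁, JetFn (secCoord x₁) id (chartDom n F V x₁) p
      fun z φ => chartForm x₁ (pullSec (P i) φ) z) : IsLocalForm (glue P) := by
  refine isLocalForm_iff.2 ⟨p, fun x₁ => JetFn.of_locally subset_rfl fun z hz => ?_⟩
  obtain ⟨t, ht⟩ := glue_eventually hC hP ((extChartAt (𝓡 n) x₁).symm z)
  refine ⟨_, (continuousOn_extChartAt_symm x₁).continuousAt
    ((isOpen_extChartAt_target x₁).mem_nhds hz.1) ht, ?_⟩
  refine JetFn.congr (JetFn.sum (t := t) fun i _ => (h i x₁).mono_set inter_subset_right) ?_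
  intro φ y hy
  rw [← chartForm_sum]
  exact chartForm_congr (hy.1 t subset_rfl φ)

/-- Multiplication of a form by a function on the base. -/
def smulForm (f : M → ℝ) (α : HForm n F V k) : HForm n F V k := fun j => f j.base • α j

lemma IsLocalForm.smulForm {f : M → ℝ} (hf : ContMDiff (𝓡 n) 𝓘(ℝ, ℝ) ∞ f) {α : HForm n F V k}
    (hα : IsLocalForm α) : IsLocalForm (smulForm f α) := by
  obtain ⟨p, h⟩ := isLocalForm_iff.1 hα
  refine isLocalForm_iff.2 ⟨p, fun x₀ => ?_⟩
  have h1 : ContDiffOn ℝ ∞ (fun z => f ((extChartAt (𝓡 n) x₀).symm z)) (chartDom n F V x₀) := by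
    rw [← contMDiffOn_iff_contDiffOn]
    exact hf.comp_contMDiffOn ((contMDiffOn_extChartAt_symm x₀).mono inter_subset_left)
  refine (JetFn.smul (JetFn.of_base h1) (h x₀)).congr fun φ z _ => ?_
  exact chartForm_smul x₀ f (pullSec α φ) z

end Glue

/-! ### The horizontal differential -/

section Differential

variable {n : ℕ} {M : Type*} [TopologicalSpace M] [ChartedSpace (Model n) M]
  {F : Type*} [NormedAddCommGroup F] [NormedSpace ℝ F]
  {V : M → Type*} [TopologicalSpace (TotalSpace F V)] [∀ x, AddCommGroup (V x)]
  [∀ x, Module ℝ (V x)] [∀ x, TopologicalSpace (V x)] [FiberBundle F V] [VectorBundle ℝ F V]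
  [IsManifold (𝓡 n) ∞ M] [ContMDiffVectorBundle ∞ F V (𝓡 n)] {k : ℕ}

lemma IsLocalForm.contDiffOn {α : HForm n F V k} (hα : IsLocalForm α) (φ : Sec n F V) (x₀ : M) :
    ContDiffOn ℝ ∞ (chartForm x₀ (pullSec α φ)) (chartDom n F V x₀) := by
  obtain ⟨p, h⟩ := isLocalForm_iff.1 hα
  exact (secFrame x₀).contDiffOn (h x₀) φ

/-- `dH` is defined with a chosen section through the jet. The derivative of a local form along a
section is a function of the next jet, so the choice does not matter. -/
lemma dH_jet {α : HForm n F V k} (hα : IsLocalForm α) (φ : Sec n F V) (x : M) :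
    dH α (jet φ x) = dM (pullSec α φ) x := by
  obtain ⟨p, h⟩ := isLocalForm_iff.1 hα
  have h1 := ((secFrame x).fderiv (h x)).eq_of_jet_eq subset_rfl
    (chart_mem_chartDom (mem_chartRegion_self (n := n) (F := F) (V := V) x))
    (φ := (jet φ x).section) (χ := φ) (by
      rw [(extChartAt (𝓡 n) x).left_inv (mem_extChartAt_source x)]
      exact jet_section (jet φ x))
  have h2 : extDeriv (chartForm x (pullSec α (jet φ x).section)) (extChartAt (𝓡 n) x x)
      = extDeriv (chartForm x (pullSec α φ)) (extChartAt (𝓡 n) x x) := by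
    unfold extDeriv
    exact congrArg _ h1
  change dM (pullSec α (jet φ x).section) x = _
  rw [dM, dM, h2]

lemma pullSec_dH {α : HForm n F V k} (hα : IsLocalForm α) (φ : Sec n F V) :
    pullSec (dH α) φ = dM (pullSec α φ) := funext fun x => dH_jet hα φ x

lemma chartForm_dH {α : HForm n F V k} (hα : IsLocalForm α) (φ : Sec n F V) {x₀ : M}
    {z : Model n} (hz : z ∈ chartDom n F V x₀) :
    chartForm x₀ (pullSec (dH α) φ) z = extDeriv (chartForm x₀ (pullSec α φ)) z := by
  rw [pullSec_dH hα]
  exact chartForm_dM hz.1 ((hα.contDiffOn φ x₀).contDiffAt ((isOpen_chartDom x₀).mem_nhds hz))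

lemma IsLocalForm.dH {α : HForm n F V k} (hα : IsLocalForm α) : IsLocalForm (dH α) := by
  obtain ⟨p, h⟩ := isLocalForm_iff.1 hα
  refine isLocalForm_iff.2 ⟨p + 1, fun x₀ => ?_⟩
  refine (((secFrame x₀).fderiv (h x₀)).clm
    (ContinuousAlternatingMap.alternatizeUncurryFinCLM ℝ (Model n) ℝ)).congr fun φ z hz => ?_
  rw [chartForm_dH hα φ hz]
  rfl

lemma jet_base_section (j : InfJet n F V) {P : InfJet n F V → Prop}
    (h : ∀ φ x, P (jet φ x)) : P j := by
  rw [← jet_section j]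
  exact h _ _

lemma dH_dH {α : HForm n F V k} (hα : IsLocalForm α) : dH (dH α) = 0 := by
  funext j
  refine jet_base_section j (P := fun j => dH (dH α) j = 0) fun φ x => ?_
  have hx := chart_mem_chartDom (mem_chartRegion_self (n := n) (F := F) (V := V) x)
  refine eq_of_chartForm_eq (x₀ := x) (β := pullSec (dH (dH α)) φ)
    (γ := fun x => (0 : Cov n (k + 1 + 1) x)) (mem_extChartAt_source x) ?_
  rw [chartForm_dH hα.dH φ hx, chartForm_zero]
  have h1 : chartForm x (pullSec (dH α) φ) =ᶠ[𝓝 (extChartAt (𝓡 n) x x)]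
      extDeriv (chartForm x (pullSec α φ)) := by
    filter_upwards [(isOpen_chartDom x).mem_nhds hx] with z hz using chartForm_dH hα φ hz
  rw [h1.extDeriv_eq]
  exact extDeriv_extDeriv_apply (r := ∞) ((hα.contDiffOn φ x).contDiffAt
    ((isOpen_chartDom x).mem_nhds hx)) (by simp; norm_cast)

lemma dH_eq_zero_of_eventually {α : HForm n F V k} (hα : IsLocalForm α) {φ : Sec n F V} {x : M}
    (h : ∀ᶠ y in 𝓝 x, α (jet φ y) = 0) : dH α (jet φ x) = 0 := by
  have hx := chart_mem_chartDom (mem_chartRegion_self (n := n) (F := F) (V := V) x)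
  refine eq_of_chartForm_eq (x₀ := x) (β := pullSec (dH α) φ)
    (γ := fun x => (0 : Cov n (k + 1) x)) (mem_extChartAt_source x) ?_
  rw [chartForm_dH hα φ hx, chartForm_zero]
  have h0 : ∀ᶠ y in 𝓝 ((extChartAt (𝓡 n) x).symm (extChartAt (𝓡 n) x x)), α (jet φ y) = 0 := by
    rwa [(extChartAt (𝓡 n) x).left_inv (mem_extChartAt_source x)]
  have h1 : chartForm x (pullSec α φ) =ᶠ[𝓝 (extChartAt (𝓡 n) x x)] fun _ => 0 := by
    filter_upwards [(continuousAt_extChartAt_symm (I := 𝓡 n) x).eventually h0] with z hz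
    exact chartForm_eq_zero hz
  rw [h1.extDeriv_eq, extDeriv, fderiv_fun_const]
  exact map_zero (ContinuousAlternatingMap.alternatizeUncurryFinCLM ℝ (Model n) ℝ)

lemma HasCompactPull.dH {α : HForm n F V k} (hα : IsLocalForm α) (h : HasCompactPull α) :
    HasCompactPull (dH α) := by
  intro φ hφ
  refine (h φ hφ).of_isClosed_subset isClosed_closure (closure_minimal ?_ isClosed_closure)
  intro x hx
  by_contra hc
  refine hx (dH_eq_zero_of_eventually hα ?_)
  filter_upwards [isClosed_closure.isOpen_compl.mem_nhds hc] with y hy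
  by_contra h0
  exact hy (subset_closure h0)

lemma dH_comb {α β : HForm n F V k} (c : ℝ) (hα : IsLocalForm α) (hβ : IsLocalForm β) :
    dH (c • α + β) = c • dH α + dH β := by
  funext j
  refine jet_base_section j (P := fun j => dH (c • α + β) j = c • dH α j + dH β j) fun φ x => ?_
  have hx := chart_mem_chartDom (mem_chartRegion_self (n := n) (F := F) (V := V) x)
  refine eq_of_chartForm_eq (x₀ := x) (β := pullSec (dH (c • α + β)) φ)
    (γ := fun x => c • pullSec (dH α) φ x + pullSec (dH β) φ x) (mem_extChartAt_source x) ?_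
  rw [chartForm_comb, chartForm_dH hα φ hx, chartForm_dH hβ φ hx,
    chartForm_dH (hα.comb c hβ) φ hx]
  have h1 : chartForm x (pullSec (c • α + β) φ)
      = fun z => c • chartForm x (pullSec α φ) z + chartForm x (pullSec β φ) z :=
    funext fun z => chartForm_comb x c _ _ z
  have hd : ∀ {γ : HForm n F V k}, IsLocalForm γ →
      DifferentiableAt ℝ (chartForm x (pullSec γ φ)) (extChartAt (𝓡 n) x x) := fun hγ =>
    ((hγ.contDiffOn φ x).contDiffAt ((isOpen_chartDom x).mem_nhds hx)).differentiableAt (by simp)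
  rw [h1, ← extDeriv_smul]
  exact extDeriv_fun_add ((hd hα).const_smul c) (hd hβ)

lemma dH_finset_sum {ι : Type*} (t : Finset ι) {P : ι → HForm n F V k}
    [FiniteDimensional ℝ F] (hP : ∀ i ∈ t, IsLocalForm (P i)) :
    IsLocalForm (∑ i ∈ t, P i) ∧ dH (∑ i ∈ t, P i) = ∑ i ∈ t, dH (P i) := by
  classical
  have h0 : IsLocalForm (0 : HForm n F V k) := (IsCompactForm.zero).1
  have hz : dH (0 : HForm n F V k) = 0 := by
    have := dH_comb (-1) h0 h0
    simpa using this
  induction t using Finset.induction_on with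
  | empty => exact ⟨by simpa using h0, by simpa using hz⟩
  | insert a t ha ih =>
    obtain ⟨h1, h2⟩ := ih fun i hi => hP i (Finset.mem_insert_of_mem hi)
    have h3 := hP a (Finset.mem_insert_self a t)
    rw [Finset.sum_insert ha, Finset.sum_insert ha, ← h2]
    exact ⟨by simpa using h3.comb 1 h1, by simpa using dH_comb 1 h3 h1⟩

/-- Linearity is always stated for combinations `c • x + y`; with `c = -1` equalities reduce to the
vanishing of a difference. -/
lemma neg_one_smul_add_eq_zero {Y : Type*} [AddCommGroup Y] [Module ℝ Y] {a b : Y} :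
    (-1 : ℝ) • b + a = 0 ↔ a = b := by
  rw [neg_one_smul, neg_add_eq_zero, eq_comm]

lemma dH_congr {α β : HForm n F V k} (hα : IsLocalForm α) (hβ : IsLocalForm β)
    {φ : Sec n F V} {x : M} (h : ∀ᶠ y in 𝓝 x, α (jet φ y) = β (jet φ y)) :
    dH α (jet φ x) = dH β (jet φ x) := by
  have h1 := dH_eq_zero_of_eventually (hβ.comb (-1) hα) (φ := φ) (x := x) (by
    filter_upwards [h] with y hy
    exact neg_one_smul_add_eq_zero.2 hy)
  rw [dH_comb (-1) hβ hα] at h1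
  exact neg_one_smul_add_eq_zero.1 h1

end Differential

lemma chartCoeff_eq_topEval {n : ℕ} {M : Type*} [TopologicalSpace M] [ChartedSpace (Model n) M]
    (x₀ : M) (β : ∀ x : M, Cov n n x) (z : Model n) :
    chartCoeff x₀ β z = topEval n (chartForm x₀ β z) := rfl

/-! ### Integrals over the base in a single chart -/

section Integration

variable {n : ℕ} {M : Type*} [TopologicalSpace M] [ChartedSpace (Model n) M]
  [IsManifold (𝓡 n) ∞ M] [T2Space M] [SigmaCompactSpace M]

/-- The sign of the volume form in the chart at `x₀`. -/
def orientSign (ν : VolumeForm n M) (x₀ : M) (z : Model n) : ℝ :=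
  (SignType.sign (chartCoeff x₀ ν.toForm z) : ℝ)

lemma VolumeForm.contDiffOn_coeff (ν : VolumeForm n M) (x₀ : M) :
    ContDiffOn ℝ ∞ (chartCoeff x₀ ν.toForm) (extChartAt (𝓡 n) x₀).target :=
  (topEval n).contDiff.comp_contDiffOn (ν.smooth x₀)

lemma VolumeForm.coeff_ne_zero (ν : VolumeForm n M) {x₀ : M} {z : Model n}
    (hz : z ∈ (extChartAt (𝓡 n) x₀).target) : chartCoeff x₀ ν.toForm z ≠ 0 := by
  intro h
  refine ν.ne_zero _ (eq_zero_of_chartForm hz (topEval_injective ?_))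
  rw [map_zero]
  exact h

lemma continuousOn_orientSign (ν : VolumeForm n M) (x₀ : M) :
    ContinuousOn (orientSign ν x₀) (extChartAt (𝓡 n) x₀).target := by
  intro z hz
  have h1 : ContinuousAt SignType.sign (chartCoeff x₀ ν.toForm z) :=
    continuousAt_sign_of_ne_zero (ν.coeff_ne_zero hz)
  have h2 : ContinuousAt (fun r : ℝ => ((SignType.sign r : SignType) : ℝ))
      (chartCoeff x₀ ν.toForm z) :=
    (continuous_of_discreteTopology (f := fun s : SignType => (s : ℝ))).continuousAt.comp h1
  exact h2.comp_continuousWithinAt ((ν.contDiffOn_coeff x₀).continuousOn z hz)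

/-- The coefficients of `β` and of `ν` both acquire the Jacobian determinant, and the sign of the
latter converts the determinant of the former into its absolute value, as the change of variables
formula requires. -/
lemma orientSign_mul_coordChange (ν : VolumeForm n M) {x₀ x₁ : M} {z : Model n}
    (hz : z ∈ overlap x₀ x₁) (β : ∀ x : M, Cov n n x) :
    |(fderiv ℝ (coordChange x₀ x₁ : Model n → Model n) z).det| *
        (orientSign ν x₁ (coordChange x₀ x₁ z) * chartCoeff x₁ β (coordChange x₀ x₁ z))
      = orientSign ν x₀ z * chartCoeff x₀ β z := by
  rw [orientSign, orientSign, chartCoeff_coordChange _ hz, chartCoeff_coordChange β hz, sign_mul,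
    ← sign_mul_self]
  push_cast
  ring

lemma overlap_image (x₀ x₁ : M) :
    coordChange x₀ x₁ '' overlap x₀ x₁ = (overlap x₁ x₀ : Set (Model n)) := by
  ext y
  refine ⟨?_, fun hy => ⟨_, coordChange_mem hy, coordChange_coordChange hy⟩⟩
  rintro ⟨z, hz, rfl⟩
  exact coordChange_mem hz

lemma integral_coordChange {x₀ x₁ : M} {W : Set (Model n)} (hW : IsOpen W)
    (h : W ⊆ overlap x₀ x₁) (g : Model n → ℝ) :
    ∫ y in coordChange x₀ x₁ '' W, g y
      = ∫ z in W, |(fderiv ℝ (coordChange x₀ x₁ : Model n → Model n) z).det|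
        * g (coordChange x₀ x₁ z) := by
  refine integral_image_eq_integral_abs_det_fderiv_smul volume hW.measurableSet
    (fun z hz => (hasFDerivAt_coordChange (h hz)).hasFDerivWithinAt) ?_ g
  intro a ha b hb e
  rw [← coordChange_coordChange (h ha), ← coordChange_coordChange (h hb), e]

/-- Each summand of the definition is moved to the chart at `x₀` by the change of variables formula,
and there the weights of the partition of unity add up to one. -/
theorem integralM_eq (ν : VolumeForm n M) {x₀ : M} {β : ∀ x : M, Cov n n x} {K : Set (Model n)}
    (hK : IsCompact K) (hKt : K ⊆ (extChartAt (𝓡 n) x₀).target)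
    (hβ : ContinuousOn (chartCoeff x₀ β) K)
    (h0 : ∀ x ∉ (extChartAt (𝓡 n) x₀).symm '' K, β x = 0) :
    integralM ν β = ∫ z in K, orientSign ν x₀ z * chartCoeff x₀ β z := by
  set ρ := (SmoothPartitionOfUnity.exists_isSubordinate_chartAt_source (𝓡 n) M).choose with hρ
  have hsub := (SmoothPartitionOfUnity.exists_isSubordinate_chartAt_source (𝓡 n) M).choose_spec
  rw [← hρ] at hsub
  have hρ0 : ∀ (i x : M), x ∉ (extChartAt (𝓡 n) i).source → ρ i x = 0 := by
    intro i x hx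
    by_contra h
    rw [extChartAt_source] at hx
    exact hx (hsub i (subset_tsupport _ h))
  have hcoeff : ∀ (i : M) (z : Model n), (extChartAt (𝓡 n) i).symm z ∉
      (extChartAt (𝓡 n) x₀).symm '' K → chartCoeff i β z = 0 := by
    intro i z hz
    rw [chartCoeff_eq_topEval, chartForm_eq_zero (h0 _ hz), map_zero]
  have key : ∀ i : M, ∫ z in (extChartAt (𝓡 n) i).target,
      ρ i ((extChartAt (𝓡 n) i).symm z) *
        (SignType.sign (chartCoeff i ν.toForm z) : ℝ) * chartCoeff i β z
      = ∫ z in K, ρ i ((extChartAt (𝓡 n) x₀).symm z) *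
        (orientSign ν x₀ z * chartCoeff x₀ β z) := by
    intro i
    have hm : MeasurableSet (extChartAt (𝓡 n) i).target :=
      (isOpen_extChartAt_target i).measurableSet
    have e1 := setIntegral_eq_of_subset_of_forall_sdiff_eq_zero (μ := volume) hm
      (s := overlap i x₀) (f := fun z => ρ i ((extChartAt (𝓡 n) i).symm z) *
        (SignType.sign (chartCoeff i ν.toForm z) : ℝ) * chartCoeff i β z)
      (fun z hz => hz.1) (by
        intro z hz
        rw [hcoeff i z, mul_zero]
        rintro ⟨y, hy, e⟩
        exact hz.2 ⟨hz.1, by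
          rw [mem_preimage, ← e]; exact (extChartAt (𝓡 n) x₀).map_target (hKt hy)⟩)
    rw [e1, ← overlap_image x₀ i, integral_coordChange (isOpen_overlap x₀ i) subset_rfl]
    have e2 : ∫ z in overlap x₀ i, |(fderiv ℝ (coordChange x₀ i : Model n → Model n) z).det| *
        (ρ i ((extChartAt (𝓡 n) i).symm (coordChange x₀ i z)) *
        (SignType.sign (chartCoeff i ν.toForm (coordChange x₀ i z)) : ℝ) *
          chartCoeff i β (coordChange x₀ i z))
        = ∫ z in overlap x₀ i, ρ i ((extChartAt (𝓡 n) x₀).symm z) *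
        (orientSign ν x₀ z * chartCoeff x₀ β z) := by
      refine setIntegral_congr_fun (isOpen_overlap x₀ i).measurableSet fun z hz => ?_
      beta_reduce
      rw [symm_coordChange hz, ← orientSign_mul_coordChange ν hz β, orientSign]
      ring
    rw [e2]
    have hmt : MeasurableSet (extChartAt (𝓡 n) x₀).target :=
      (isOpen_extChartAt_target x₀).measurableSet
    rw [← setIntegral_eq_of_subset_of_forall_sdiff_eq_zero hmt (s := overlap x₀ i)
      (fun z hz => hz.1), ← setIntegral_eq_of_subset_of_forall_sdiff_eq_zero hmt (s := K) hKt]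
    · intro z hz
      rw [hcoeff x₀ z, mul_zero, mul_zero]
      rw [symm_mem_symm_image hKt hz.1]
      exact hz.2
    · intro z hz
      rw [hρ0 i, zero_mul]
      exact fun h => hz.2 ⟨hz.1, h⟩
  have hKM : IsCompact ((extChartAt (𝓡 n) x₀).symm '' K) := isCompact_symm_image hK hKt
  -- Only finitely many weights meet the compact support, so the `finsum` is a finite sum and may be
  -- exchanged with the integral.
  have hfin := ρ.locallyFinite.finite_nonempty_inter_compact hKM
  have hsupp : (Function.support fun i : M => ∫ z in K, ρ i ((extChartAt (𝓡 n) x₀).symm z) *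
        (orientSign ν x₀ z * chartCoeff x₀ β z)) ⊆ hfin.toFinset := by
    intro i hi
    simp only [Finite.coe_toFinset, mem_ofPred_eq]
    by_contra hne
    refine hi ?_
    beta_reduce
    rw [setIntegral_congr_fun (g := fun _ => (0 : ℝ)) hK.measurableSet, integral_zero]
    intro z hz
    have : ρ i ((extChartAt (𝓡 n) x₀).symm z) = 0 := by
      by_contra h
      exact hne ⟨_, h, z, hz, rfl⟩
    beta_reduce
    rw [this, zero_mul]
  have hint : integralM ν β = ∑ᶠ i : M, ∫ z in K, ρ i ((extChartAt (𝓡 n) x₀).symm z) *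
        (orientSign ν x₀ z * chartCoeff x₀ β z) := by
    unfold integralM
    exact finsum_congr key
  have hc1 : ContinuousOn (fun z => orientSign ν x₀ z * chartCoeff x₀ β z) K :=
    ((continuousOn_orientSign ν x₀).mono hKt).mul hβ
  rw [hint, finsum_eq_sum_of_support_subset _ hsupp, ← integral_finsetSum]
  · refine setIntegral_congr_fun hK.measurableSet fun z hz => ?_
    rw [← Finset.sum_mul]
    have h1 := ρ.sum_eq_one (mem_univ ((extChartAt (𝓡 n) x₀).symm z))
    rw [finsum_eq_sum_of_support_subset (s := hfin.toFinset)] at h1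
    · rw [h1, one_mul]
    · intro i hi
      simp only [Finite.coe_toFinset, mem_ofPred_eq]
      exact ⟨_, hi, z, hz, rfl⟩
  · intro i _
    refine ContinuousOn.integrableOn_compact hK (ContinuousOn.mul ?_ hc1)
    exact (ρ i).contMDiff.continuous.comp_continuousOn ((continuousOn_extChartAt_symm x₀).mono hKt)

theorem integralM_eq_of_sign (ν : VolumeForm n M) {x₀ : M} {β : ∀ x : M, Cov n n x}
    {K : Set (Model n)} (hK : IsCompact K) (hKt : K ⊆ (extChartAt (𝓡 n) x₀).target)
    (h0 : ∀ x ∉ (extChartAt (𝓡 n) x₀).symm '' K, β x = 0) {s : ℝ}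
    (hs : ∀ z ∈ K, orientSign ν x₀ z = s) {g : Model n → ℝ} (hg : ContinuousOn g K)
    (hgβ : ∀ z ∈ K, chartCoeff x₀ β z = g z) (hg0 : ∀ z ∉ K, g z = 0) :
    integralM ν β = s * ∫ z, g z := by
  rw [integralM_eq ν hK hKt (hg.congr hgβ) h0, ← setIntegral_eq_integral_of_forall_compl_eq_zero hg0,
    ← integral_const_mul]
  exact setIntegral_congr_fun hK.measurableSet fun z hz => by
    rw [hs z hz, hgβ z hz]

/-- The part of the chart on which the volume form has sign `s`. -/
def signSet (ν : VolumeForm n M) (x₀ : M) (s : ℝ) : Set (Model n) :=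
  (extChartAt (𝓡 n) x₀).target ∩ {z | 0 < s * chartCoeff x₀ ν.toForm z}

lemma isOpen_signSet (ν : VolumeForm n M) (x₀ : M) (s : ℝ) : IsOpen (signSet ν x₀ s) :=
  (continuousOn_const.mul (ν.contDiffOn_coeff x₀).continuousOn).isOpen_inter_preimage
    (isOpen_extChartAt_target x₀) isOpen_Ioi

/-- A chart domain need not be connected, so the sign of `ν` may vary on it. Every local argument is
therefore made on one of these two open pieces. -/
lemma exists_mem_signSet (ν : VolumeForm n M) {x₀ : M} {z : Model n}
    (hz : z ∈ (extChartAt (𝓡 n) x₀).target) :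
    ∃ s : ℝ, (s = 1 ∨ s = -1) ∧ z ∈ signSet ν x₀ s := by
  rcases lt_or_gt_of_ne (ν.coeff_ne_zero hz) with h | h
  · exact ⟨-1, Or.inr rfl, hz, by simpa using h⟩
  · exact ⟨1, Or.inl rfl, hz, by simpa using h⟩

lemma orientSign_eq (ν : VolumeForm n M) {x₀ : M} {s : ℝ} (hs : s = 1 ∨ s = -1) {z : Model n}
    (hz : z ∈ signSet ν x₀ s) : orientSign ν x₀ z = s := by
  have h := hz.2
  rw [orientSign]
  rcases hs with rfl | rfl
  · rw [sign_pos (by simpa using h)]; simp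
  · rw [sign_neg (by simpa using h)]; simp

end Integration

/-! ### Covariance of the Euler–Lagrange expression -/

section Transform

variable {n : ℕ} {F : Type*} [NormedAddCommGroup F] [NormedSpace ℝ F] [FiniteDimensional ℝ F]

lemma jetCoord_eq_zero_of_notMem {p : ℕ} {v : Model n → F} {z : Model n} (hz : z ∉ tsupport v) :
    jetCoord p v z = 0 := by
  have h : v =ᶠ[𝓝 z] fun _ => 0 := notMem_tsupport_iff_eventuallyEq.1 hz
  rw [(jetCoord_eventuallyEq h p).self_of_nhds]
  funext I
  simp only [jetCoord, partialMulti_eq_wordD, wordD_zero]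
  rfl

/-- Transformation of the Euler–Lagrange expression under a change of the independent and the
dependent variables. -/
theorem eulerExpr_transform {W₀ W₁ : Set (Model n)} (hW₀ : IsOpen W₀) (hW₁ : IsOpen W₁)
    {T R : Model n → Model n} (hT : ContDiffOn ℝ ∞ T W₀) (hR : ContDiffOn ℝ ∞ R W₁)
    (hTm : MapsTo T W₀ W₁) (hRT : ∀ z ∈ W₀, R (T z) = z)
    (hTR : ∀ y ∈ W₁, T (R y) = y) {p q : ℕ} {L₀ : Model n × JetCoord n p F → ℝ}
    {L₁ : Model n × JetCoord n q F → ℝ} (hL₀ : ContDiffOn ℝ ∞ L₀ (W₀ ×ˢ univ))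
    (hL₁ : ContDiffOn ℝ ∞ L₁ (W₁ ×ˢ univ)) {u₀ u₁ : Model n → F} (hu₀ : ContDiffOn ℝ ∞ u₀ W₀)
    (hu₁ : ContDiffOn ℝ ∞ u₁ W₁) {Θ : Model n → F →L[ℝ] F} (hΘ : ContDiffOn ℝ ∞ Θ W₀)
    (hvar : ∀ v v₁ : Model n → F, IsTest W₀ v → IsTest W₁ v₁ →
      (∀ z ∈ W₀, v₁ (T z) = Θ z (v z)) → ∀ z ∈ W₀,
      fderiv ℝ L₀ (z, jetCoord p u₀ z) (0, jetCoord p v z)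
        = (fderiv ℝ T z).det * fderiv ℝ L₁ (T z, jetCoord q u₁ (T z)) (0, jetCoord q v₁ (T z)))
    {z : Model n} (hz : z ∈ W₀) (e : F) :
    eulerExpr L₀ u₀ z e = (fderiv ℝ T z).det * eulerExpr L₁ u₁ (T z) (Θ z e) := by
  have hTd : ∀ z ∈ W₀, HasFDerivAt T (fderiv ℝ T z) z := fun z hz =>
    ((hT.contDiffAt (hW₀.mem_nhds hz)).differentiableAt (by simp)).hasFDerivAt
  have hdet : ContinuousOn (fun z => (fderiv ℝ T z).det) W₀ :=
    ContinuousLinearMap.continuous_det.comp_continuousOn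
      (hT.fderiv_of_isOpen hW₀ (m := ∞) (by simp)).continuousOn
  -- `R ∘ T` is the identity near `z`, so the determinants of the two derivatives multiply to one.
  have hne : (fderiv ℝ T z).det ≠ 0 := by
    have h1 := ((hR.contDiffAt (hW₁.mem_nhds (hTm hz))).differentiableAt (by simp)).hasFDerivAt.comp
      z (hTd z hz)
    have h2 : (R ∘ T) =ᶠ[𝓝 z] id := by
      filter_upwards [hW₀.mem_nhds hz] with y hy using hRT y hy
    have h3 := (h1.congr_of_eventuallyEq h2.symm).unique (hasFDerivAt_id z)
    intro h0
    have h4 := congrArg (fun g : Model n →L[ℝ] Model n => LinearMap.det (g : Model n →ₗ[ℝ] Model n)) h3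
    have h5 : LinearMap.det ((fderiv ℝ T z : Model n →L[ℝ] Model n) : Model n →ₗ[ℝ] Model n) = 0 := h0
    simp [LinearMap.det_comp, h5] at h4
  obtain ⟨s, hs, hsz⟩ : ∃ s : ℝ, (s = 1 ∨ s = -1) ∧ 0 < s * (fderiv ℝ T z).det := by
    rcases lt_or_gt_of_ne hne with h | h
    · exact ⟨-1, Or.inr rfl, by linarith⟩
    · exact ⟨1, Or.inl rfl, by linarith⟩
  -- The law involves the determinant and the change of variables its absolute value. They differ by
  -- the constant sign `s` on this neighbourhood of `z`.
  let W' : Set (Model n) := W₀ ∩ {z | 0 < s * (fderiv ℝ T z).det}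
  have hW' : IsOpen W' := (continuousOn_const.mul hdet).isOpen_inter_preimage hW₀ isOpen_Ioi
  have habs : ∀ z ∈ W', |(fderiv ℝ T z).det| = s * (fderiv ℝ T z).det := by
    intro z hz
    have : 0 < s * (fderiv ℝ T z).det := hz.2
    rcases hs with rfl | rfl
    · rw [abs_of_pos (by linarith)]; ring
    · rw [abs_of_neg (by linarith)]; ring
  have hss : s * s = 1 := by rcases hs with rfl | rfl <;> norm_num
  let W₁' : Set (Model n) := W₁ ∩ R ⁻¹' W'
  have hW₁' : IsOpen W₁' := hR.continuousOn.isOpen_inter_preimage hW₁ hW'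
  have himg : T '' W' = W₁' := by
    ext y
    refine ⟨?_, fun hy => ⟨R y, hy.2, hTR y hy.1⟩⟩
    rintro ⟨z, hz, rfl⟩
    exact ⟨hTm hz.1, by rw [mem_preimage, hRT z hz.1]; exact hz⟩
  have hcv : ∀ g : Model n → ℝ, ∫ y in W₁', g y
      = ∫ z in W', |(fderiv ℝ T z).det| * g (T z) := by
    intro g
    rw [← himg]
    refine integral_image_eq_integral_abs_det_fderiv_smul volume hW'.measurableSet
      (fun z hz => (hTd z hz.1).hasFDerivWithinAt) ?_ g
    intro a ha b hb e
    rw [← hRT a ha.1, ← hRT b hb.1, e]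
  have hE : ContinuousOn (eulerExpr L₁ u₁) W₁ := by
    have hf : JetFrame (fun _ : Unit => u₁) id W₁ W₁ :=
      ⟨hW₁, hW₁, contDiffOn_id, mapsTo_id _, fun _ => hu₁⟩
    exact (hf.contDiffOn (hf.eulerExpr hL₁) ()).continuousOn
  have hQ : ContinuousOn (fun z => (fderiv ℝ T z).det • (eulerExpr L₁ u₁ (T z)).comp (Θ z)) W' :=
    (hdet.smul ((hE.comp hT.continuousOn hTm).clm_comp hΘ.continuousOn)).mono inter_subset_left
  have hzW' : z ∈ W' := ⟨hz, hsz⟩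
  rw [eulerExpr_eq_of_integral hW' (hL₀.mono (prod_mono_left inter_subset_left))
    (hu₀.mono inter_subset_left) hQ ?_ z hzW']
  · rfl
  intro v hv
  classical
  -- The test field corresponding to `v` in the new coordinates, extended by zero; its support is
  -- contained in the image of that of `v`.
  let v₁ : Model n → F := fun y => if y ∈ W₁' then Θ (R y) (v (R y)) else 0
  have hv₁ : IsTest W₁' v₁ := by
    refine isTest_of_contDiffOn hW₁' (K := T '' tsupport v) ?_ ?_ ?_ ?_
    · refine ContDiffOn.congr (f := fun y => Θ (R y) (v (R y))) ?_ fun y hy => if_pos hy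
      have h1 : ContDiffOn ℝ ∞ R W₁' := hR.mono inter_subset_left
      exact (hΘ.comp h1 fun y hy => hy.2.1).clm_apply (hv.smooth.comp_contDiffOn h1)
    · exact hv.compact.image_of_continuousOn (hT.continuousOn.mono
        (hv.subset.trans inter_subset_left))
    · rw [← himg]
      exact image_mono hv.subset
    · intro y hy
      by_cases h : y ∈ W₁'
      · have : v (R y) = 0 := by
          refine image_eq_zero_of_notMem_tsupport fun h' => hy ⟨_, h', hTR y h.1⟩
        simp [v₁, this]
      · exact if_neg h
  have hv₁T : ∀ z ∈ W₀, v₁ (T z) = Θ z (v z) := by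
    intro z hz
    by_cases h : T z ∈ W₁'
    · simp only [v₁, if_pos h, hRT z hz]
    · have : v z = 0 := by
        refine image_eq_zero_of_notMem_tsupport fun h' => h ?_
        rw [← himg]
        exact ⟨z, hv.subset h', rfl⟩
      simp [v₁, if_neg h, this]
  have hv0 := hv.mono (inter_subset_left : W' ⊆ W₀)
  have hpt := hvar v v₁ hv0 (hv₁.mono inter_subset_left) hv₁T
  have e1 : ∫ z, fderiv ℝ L₀ (z, jetCoord p u₀ z) (0, jetCoord p v z)
      = ∫ z in W', (fderiv ℝ T z).det *
        fderiv ℝ L₁ (T z, jetCoord q u₁ (T z)) (0, jetCoord q v₁ (T z)) := by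
    rw [← setIntegral_eq_integral_of_forall_compl_eq_zero (s := W')]
    · exact setIntegral_congr_fun hW'.measurableSet fun z hz => hpt z hz.1
    · intro z hz
      rw [jetCoord_eq_zero_of_notMem fun h => hz (hv.subset h)]
      exact map_zero _
  have e2 : ∫ z, ((fderiv ℝ T z).det • (eulerExpr L₁ u₁ (T z)).comp (Θ z)) (v z)
      = ∫ z in W', (fderiv ℝ T z).det * eulerExpr L₁ u₁ (T z) (v₁ (T z)) := by
    rw [← setIntegral_eq_integral_of_forall_compl_eq_zero (s := W')]
    · refine setIntegral_congr_fun hW'.measurableSet fun z hz => ?_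
      beta_reduce
      rw [hv₁T z hz.1]
      rfl
    · intro z hz
      rw [image_eq_zero_of_notMem_tsupport fun h => hz (hv.subset h), map_zero]
  -- Both sides of the variation identity become `s` times an integral in the new variables, where
  -- the first variation formula for `L₁` applies.
  have e3 : ∀ g : Model n → ℝ, (∀ y ∉ W₁', g y = 0) →
      ∫ z in W', (fderiv ℝ T z).det * g (T z) = s * ∫ y, g y := by
    intro g hg
    rw [← setIntegral_eq_integral_of_forall_compl_eq_zero hg, hcv, ← integral_const_mul]
    refine setIntegral_congr_fun hW'.measurableSet fun z hz => ?_
    beta_reduce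
    rw [habs z hz, ← mul_assoc, ← mul_assoc, hss, one_mul]
  rw [e1, e2, e3 (fun y => fderiv ℝ L₁ (y, jetCoord q u₁ y) (0, jetCoord q v₁ y)),
    e3 (fun y => eulerExpr L₁ u₁ y (v₁ y)),
    integral_variation hW₁ hL₁ hu₁ (hv₁.mono inter_subset_left)]
  · intro y hy
    rw [image_eq_zero_of_notMem_tsupport fun h => hy (hv₁.subset h), map_zero]
  · intro y hy
    beta_reduce
    rw [jetCoord_eq_zero_of_notMem fun h => hy (hv₁.subset h)]
    exact map_zero _

end Transform

/-! ### Existence and uniqueness of the Euler–Lagrange form -/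

section EulerForm

variable {n : ℕ} {M : Type*} [TopologicalSpace M] [ChartedSpace (Model n) M]
  {F : Type*} [NormedAddCommGroup F] [NormedSpace ℝ F]
  {V : M → Type*} [TopologicalSpace (TotalSpace F V)] [∀ x, AddCommGroup (V x)]
  [∀ x, Module ℝ (V x)] [∀ x, TopologicalSpace (V x)] [FiberBundle F V] [VectorBundle ℝ F V]

/-- `L` is over `W` the Lagrangian function of `α` in the coordinates at `x₀`. -/
structure IsLagrangian (α : HForm n F V n) (x₀ : M) (W : Set (Model n)) {p : ℕ}
    (L : Model n × JetCoord n p F → ℝ) : Prop where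
  isOpen : IsOpen W
  subset : W ⊆ chartDom n F V x₀
  smooth : ContDiffOn ℝ ∞ L (W ×ˢ univ)
  eq : ∀ (φ : Sec n F V), ∀ z ∈ W,
    chartCoeff x₀ (pullSec α φ) z = L (z, jetCoord p (secCoord x₀ φ) z)

lemma IsLagrangian.mono {α : HForm n F V n} {x₀ : M} {W W' : Set (Model n)} {p : ℕ}
    {L : Model n × JetCoord n p F → ℝ} (h : IsLagrangian α x₀ W L) (hW' : IsOpen W')
    (hs : W' ⊆ W) : IsLagrangian α x₀ W' L :=
  ⟨hW', hs.trans h.subset, h.smooth.mono (prod_mono_left hs), fun φ z hz => h.eq φ z (hs hz)⟩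

/-- The component of a source form along the constant direction `v`. -/
def srcCoeff (ε : Src n F V n) (x₀ : M) (v : F) (z : Model n) (φ : Sec n F V) : ℝ :=
  topEval n (srcCoord ε x₀ v z φ)

variable [IsManifold (𝓡 n) ∞ M] [ContMDiffVectorBundle ∞ F V (𝓡 n)]

lemma triv_symm_eq_fibreChange {x₀ x₁ : M} {z : Model n} (hz : z ∈ secOverlap n F V x₀ x₁)
    (v : F) :
    (trivializationAt F V x₁ ⟨(extChartAt (𝓡 n) x₀).symm z,
      (trivializationAt F V x₀).symm ((extChartAt (𝓡 n) x₀).symm z) v⟩).2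
      = fibreChange F V x₀ x₁ z v := by
  rw [triv_eq_fibreChange hz, (trivializationAt F V x₀).apply_mk_symm hz.1.2 v]

/-- A source form evaluated on a constant direction. -/
def srcField {k : ℕ} (ε : Src n F V k) (x₀ : M) (v : F) (φ : Sec n F V) (y : M) : Cov n k y :=
  ε (jet φ y) (show V (jet φ y).base from (trivializationAt F V x₀).symm y v)

lemma srcCoord_eq_chartForm {k : ℕ} (ε : Src n F V k) (x₀ : M) (v : F) (z : Model n)
    (φ : Sec n F V) : srcCoord ε x₀ v z φ = chartForm x₀ (srcField ε x₀ v φ) z := rfl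

/-- The Euler–Lagrange form will be defined at each jet in the coordinates at its own base point.
This converts such a definition into components in a fixed chart. -/
lemma srcCoord_eq_chart_self {k : ℕ} (ε : Src n F V k) {x₀ : M} (v : F) {z : Model n}
    (hz : z ∈ chartDom n F V x₀) (φ : Sec n F V) {A : F →L[ℝ] (Model n) [⋀^Fin k]→L[ℝ] ℝ}
    (hA : ∀ w : V ((extChartAt (𝓡 n) x₀).symm z),
      (show (Model n) [⋀^Fin k]→L[ℝ] ℝ from ε (jet φ ((extChartAt (𝓡 n) x₀).symm z)) w) =
        (A (trivializationAt F V ((extChartAt (𝓡 n) x₀).symm z)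
          ⟨(extChartAt (𝓡 n) x₀).symm z, w⟩).2).compContinuousLinearMap
            (dChart ((extChartAt (𝓡 n) x₀).symm z) ((extChartAt (𝓡 n) x₀).symm z))) :
    srcCoord ε x₀ v z φ = (A (fibreChange F V x₀ ((extChartAt (𝓡 n) x₀).symm z) z v)
      ).compContinuousLinearMap
        (fderiv ℝ (coordChange x₀ ((extChartAt (𝓡 n) x₀).symm z)) z) := by
  have hzo : z ∈ secOverlap n F V x₀ ((extChartAt (𝓡 n) x₀).symm z) :=
    ⟨hz, mem_chartRegion_self _⟩
  have hov := secOverlap_subset_overlap _ _ hzo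
  rw [srcCoord_eq_chartForm, chartForm_coordChange _ hov]
  congr 1
  refine chartForm_eq_of_plain (coordChange_mem hov).1 ?_
  rw [symm_coordChange hov, ← triv_symm_eq_fibreChange hzo v]
  exact hA _

/-- Every fibre vector is the value of a constant direction in the trivialization, and a top form is
determined by its single coefficient. -/
lemma src_eq_of_srcCoeff {ε δ : Src n F V n} {x₀ x : M} (hx : x ∈ chartRegion n F V x₀)
    {φ : Sec n F V} (h : ∀ v : F, srcCoeff ε x₀ v (extChartAt (𝓡 n) x₀ x) φ
      = srcCoeff δ x₀ v (extChartAt (𝓡 n) x₀ x) φ) : ε (jet φ x) = δ (jet φ x) := by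
  refine LinearMap.ext fun w => ?_
  have h1 := eq_of_chartForm_eq hx.1 (topEval_injective
    (h (trivializationAt F V x₀ ⟨x, w⟩).2))
  have h2 : (trivializationAt F V x₀).symm x (trivializationAt F V x₀ ⟨x, w⟩).2 = w :=
    (trivializationAt F V x₀).symm_apply_apply_mk hx.2 w
  rw [h2] at h1
  exact h1

lemma exists_isLagrangian {α : HForm n F V n} (hα : IsLocalForm α) : ∃ p, ∀ x₀ : M,
    ∃ L : Model n × JetCoord n p F → ℝ, IsLagrangian α x₀ (chartDom n F V x₀) L := by
  obtain ⟨p, h⟩ := isLocalForm_iff.1 hα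
  refine ⟨p, fun x₀ => ?_⟩
  obtain ⟨A, hA, hc⟩ := h x₀
  exact ⟨fun w => topEval n (A w), isOpen_chartDom x₀, subset_rfl,
    (topEval n).contDiff.comp_contDiffOn hA, fun φ z hz => congrArg (topEval n) (hc φ z hz)⟩

variable [FiniteDimensional ℝ F] [T2Space M]

/-- Both Lagrangian functions describe the form `α`, so they change by the Jacobian determinant
along every section. Differentiating along a line of sections gives the hypothesis of
`eulerExpr_transform`. -/
theorem IsLagrangian.eulerExpr_eq {α : HForm n F V n} {x₀ x₁ : M} {W₀ W₁ : Set (Model n)}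
    {p q : ℕ} {L₀ : Model n × JetCoord n p F → ℝ} {L₁ : Model n × JetCoord n q F → ℝ}
    (h₀ : IsLagrangian α x₀ W₀ L₀) (h₁ : IsLagrangian α x₁ W₁ L₁) {z : Model n} (hz : z ∈ W₀)
    (hzo : z ∈ secOverlap n F V x₀ x₁) (hz1 : coordChange x₀ x₁ z ∈ W₁) (φ : Sec n F V) (e : F) :
    eulerExpr L₀ (secCoord x₀ φ) z e
      = (fderiv ℝ (coordChange x₀ x₁ : Model n → Model n) z).det
        * eulerExpr L₁ (secCoord x₁ φ) (coordChange x₀ x₁ z) (fibreChange F V x₀ x₁ z e) := by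
  have hTs : ∀ a b : M, ContDiffOn ℝ ∞ (coordChange a b : Model n → Model n)
      (secOverlap n F V a b) :=
    fun a b => (contDiffOn_coordChange a b).mono (secOverlap_subset_overlap a b)
  let U₀ : Set (Model n) := secOverlap n F V x₀ x₁ ∩ (coordChange x₀ x₁ ⁻¹' W₁) ∩ W₀
  have hU₀ : IsOpen U₀ := ((hTs x₀ x₁).continuousOn.isOpen_inter_preimage
    (isOpen_secOverlap x₀ x₁) h₁.isOpen).inter h₀.isOpen
  let U₁ : Set (Model n) := secOverlap n F V x₁ x₀ ∩ (coordChange x₁ x₀ ⁻¹' W₀) ∩ W₁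
  have hU₁ : IsOpen U₁ := ((hTs x₁ x₀).continuousOn.isOpen_inter_preimage
    (isOpen_secOverlap x₁ x₀) h₀.isOpen).inter h₁.isOpen
  have hRT : ∀ z ∈ U₀, coordChange x₁ x₀ (coordChange x₀ x₁ z) = z := fun z hz =>
    coordChange_coordChange (secOverlap_subset_overlap _ _ hz.1.1)
  have hTR : ∀ z ∈ U₁, coordChange x₀ x₁ (coordChange x₁ x₀ z) = z := fun z hz =>
    coordChange_coordChange (secOverlap_subset_overlap _ _ hz.1.1)
  refine eulerExpr_transform (W₀ := U₀) (W₁ := U₁) hU₀ hU₁ (R := coordChange x₁ x₀)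
    ((hTs x₀ x₁).mono fun z hz => hz.1.1) ((hTs x₁ x₀).mono fun z hz => hz.1.1)
    (fun z hz => ⟨⟨coordChange_mem_secOverlap hz.1.1, by
      rw [mem_preimage, hRT z hz]; exact hz.2⟩, hz.1.2⟩)
    hRT hTR
    (h₀.mono hU₀ inter_subset_right).smooth (h₁.mono hU₁ inter_subset_right).smooth
    ((secCoord_contDiffOn φ x₀).mono fun z hz => hz.1.1.1)
    ((secCoord_contDiffOn φ x₁).mono fun z hz => hz.1.1.1)
    ((contDiffOn_fibreChange x₀ x₁).mono fun z hz => hz.1.1) ?_ ⟨⟨hzo, hz1⟩, hz⟩ e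
  intro v v₁ hv hv₁ hvv z hz
  have hvd : IsTest (chartDom n F V x₀) v := hv.mono fun z hz => hz.1.1.1
  -- `L₀` and `L₁` are tied to `α` only along global sections, so the variation `v` must be realized
  -- by one.
  let χ : Sec n F V := extendSec x₀ v hvd
  have hzU₁ : coordChange x₀ x₁ z ∈ U₁ := ⟨⟨coordChange_mem_secOverlap hz.1.1, by
      rw [mem_preimage, hRT z hz]; exact hz.2⟩, hz.1.2⟩
  have hj0 : ∀ t : ℝ, jetCoord p (secCoord x₀ (t • χ + φ)) z
      = t • jetCoord p v z + jetCoord p (secCoord x₀ φ) z := by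
    intro t
    rw [← jetCoord_comb (isOpen_chartDom x₀) hvd.smooth.contDiffOn (secCoord_contDiffOn φ x₀) t p
      hz.1.1.1]
    refine (jetCoord_eventuallyEq ?_ p).self_of_nhds
    filter_upwards [(isOpen_chartDom x₀).mem_nhds hz.1.1.1] with y hy
    rw [secCoord_comb t χ φ hy, secCoord_extendSec hvd hy]
  have hj1 : ∀ t : ℝ, jetCoord q (secCoord x₁ (t • χ + φ)) (coordChange x₀ x₁ z)
      = t • jetCoord q v₁ (coordChange x₀ x₁ z)
        + jetCoord q (secCoord x₁ φ) (coordChange x₀ x₁ z) := by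
    intro t
    rw [← jetCoord_comb hU₁ hv₁.smooth.contDiffOn
      ((secCoord_contDiffOn φ x₁).mono fun z hz => hz.1.1.1) t q hzU₁]
    refine (jetCoord_eventuallyEq ?_ q).self_of_nhds
    filter_upwards [hU₁.mem_nhds hzU₁] with y hy
    have hy0 : coordChange x₁ x₀ y ∈ U₀ := ⟨⟨coordChange_mem_secOverlap hy.1.1, by
      rw [mem_preimage, hTR y hy]; exact hy.2⟩, hy.1.2⟩
    rw [secCoord_comb t χ φ hy.1.1.1]
    congr 2
    have h2 := secCoord_coordChange hy0.1.1 χ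
    rw [hTR y hy, secCoord_extendSec hvd hy0.1.1.1, ← hvv _ hy0, hTR y hy] at h2
    exact h2
  have hd : ∀ {W : Type _} [NormedAddCommGroup W] [NormedSpace ℝ W] (a b : W),
      HasDerivAt (fun t : ℝ => t • a + b) a 0 := by
    intro W _ _ a b
    simpa using ((hasDerivAt_id (0 : ℝ)).smul_const a).add_const b
  have d0 := hasDerivAt_comp_jet h₀.isOpen h₀.smooth hz.2 (hd (jetCoord p v z)
    (jetCoord p (secCoord x₀ φ) z))
  have d1 := (hasDerivAt_comp_jet h₁.isOpen h₁.smooth hz.1.2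
    (hd (jetCoord q v₁ (coordChange x₀ x₁ z))
    (jetCoord q (secCoord x₁ φ) (coordChange x₀ x₁ z)))).const_mul
      (fderiv ℝ (coordChange x₀ x₁ : Model n → Model n) z).det
  simp only [zero_smul, zero_add] at d0 d1
  refine d0.unique (d1.congr_of_eventuallyEq (Eventually.of_forall fun t => ?_))
  beta_reduce
  rw [← hj0, ← hj1, ← h₀.eq _ z hz.2, ← h₁.eq _ _ hz.1.2,
    chartCoeff_coordChange _ (secOverlap_subset_overlap _ _ hz.1.1)]

/-- Every local Lagrangian form has an Euler–Lagrange form. -/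
theorem exists_isEulerLagrange {α : HForm n F V n} (hα : IsLocalForm α) :
    ∃ ε, IsEulerLagrange α ε := by
  obtain ⟨p, h⟩ := isLocalForm_iff.1 hα
  choose A hA hc using h
  -- Pointwise definition in the coordinates at the base point of the jet; the transformation law
  -- shows that it has the required components in every chart.
  let ε : Src n F V n := fun j => ({
    toFun := fun v => (chartPull j.base j.base (eulerExpr (A j.base) (secCoord j.base j.section)
      (extChartAt (𝓡 n) j.base j.base)
      (((trivializationAt F V j.base).linearMapAt ℝ j.base) v)) : Cov n n j.base)
    map_add' := fun v w => by rw [map_add, map_add]; rfl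
    map_smul' := fun c v => by rw [map_smul, map_smul]; rfl } : V j.base →ₗ[ℝ] Cov n n j.base)
  have hL : ∀ {q : ℕ} {x₀ : M} {B : Model n × JetCoord n q F → (Model n) [⋀^Fin n]→L[ℝ] ℝ},
      IsJetRep x₀ (fun z φ => chartForm x₀ (pullSec α φ) z) B →
      IsLagrangian α x₀ (chartDom n F V x₀) fun w => topEval n (B w) := fun hB =>
    ⟨isOpen_chartDom _, subset_rfl, (topEval n).contDiff.comp_contDiffOn hB.1,
      fun φ z hz => congrArg (topEval n) (hB.2 φ z hz)⟩
  refine ⟨ε, ?_⟩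
  filter_upwards [eventually_ge_atTop p] with q hq x₀
  obtain ⟨B, hB⟩ : ∃ B : Model n × JetCoord n q F → (Model n) [⋀^Fin n]→L[ℝ] ℝ,
      IsJetRep x₀ (fun z φ => chartForm x₀ (pullSec α φ) z) B :=
    JetFn.mono ⟨A x₀, hA x₀, hc x₀⟩ hq
  refine ⟨B, hB, fun φ z hz v => ?_⟩
  set x := (extChartAt (𝓡 n) x₀).symm z with hx
  have hzo : z ∈ secOverlap n F V x₀ x := ⟨hz, mem_chartRegion_self x⟩
  have hcx : coordChange x₀ x z = extChartAt (𝓡 n) x x := rfl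
  have hdom : extChartAt (𝓡 n) x x ∈ chartDom n F V x :=
    chart_mem_chartDom (mem_chartRegion_self x)
  have h1 := srcCoord_eq_chart_self ε v hz φ
    (A := eulerExpr (A x) (secCoord x φ) (extChartAt (𝓡 n) x x)) (by
      intro w
      have e1 := ((secFrame x).eulerExpr (hA x)).eq_of_jet_eq subset_rfl hdom
        (φ := (jet φ x).section) (χ := φ) (by
          rw [(extChartAt (𝓡 n) x).left_inv (mem_extChartAt_source x)]
          exact jet_section (jet φ x))
      have e2 : (trivializationAt F V x).linearMapAt ℝ x w = (trivializationAt F V x ⟨x, w⟩).2 :=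
        congrFun ((trivializationAt F V x).coe_linearMapAt_of_mem (R := ℝ)
          (mem_baseSet_trivializationAt F V x)) w
      rw [← e2, ← e1]
      rfl)
  refine topEval_injective ?_
  rw [h1, top_apply_comp]
  have e3 := (hL hB).eulerExpr_eq (hL ⟨hA x, hc x⟩) hz hzo hdom φ v
  rw [hcx, eulerExpr_clm (isOpen_chartDom x₀) hB.1 (secCoord_contDiffOn φ x₀) _ hz,
    eulerExpr_clm (isOpen_chartDom x) (hA x) (secCoord_contDiffOn φ x) _ hdom] at e3
  exact e3.symm

lemma isEulerLagrange_eulerLagrange {α : HForm n F V n} (hα : IsLocalForm α) :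
    IsEulerLagrange α (eulerLagrange α) := by
  have h := exists_isEulerLagrange hα
  rw [eulerLagrange, dif_pos h]
  exact h.choose_spec

/-- The components of an Euler–Lagrange form, from any Lagrangian function on any
part of a coordinate domain. -/
theorem IsEulerLagrange.srcCoeff_eq {α : HForm n F V n} {ε : Src n F V n}
    (hε : IsEulerLagrange α ε) {x₀ : M} {W : Set (Model n)} {p : ℕ}
    {L : Model n × JetCoord n p F → ℝ} (hL : IsLagrangian α x₀ W L) {z : Model n} (hz : z ∈ W)
    (φ : Sec n F V) (v : F) :
    srcCoeff ε x₀ v z φ = eulerExpr L (secCoord x₀ φ) z v := by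
  obtain ⟨q, hq⟩ := hε.exists
  obtain ⟨B, hB, h⟩ := hq x₀
  have hzd := hL.subset hz
  have hLB : IsLagrangian α x₀ (chartDom n F V x₀) fun w => topEval n (B w) :=
    ⟨isOpen_chartDom _, subset_rfl, (topEval n).contDiff.comp_contDiffOn hB.1,
      fun φ z hz => congrArg (topEval n) (hB.2 φ z hz)⟩
  -- The transformation law for the identity coordinate change compares two Lagrangian functions in
  -- one chart. They may have different orders and domains.
  have hself : z ∈ secOverlap n F V x₀ x₀ := by rwa [secOverlap_self]
  have h1 := hLB.eulerExpr_eq hL hzd hself (by rwa [coordChange_self hzd]) φ v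
  have h2 : (coordChange x₀ x₀ : Model n → Model n) =ᶠ[𝓝 z] id := by
    filter_upwards [(isOpen_chartDom x₀).mem_nhds hzd] with y hy using coordChange_self hy
  have h3 : fibreChange F V x₀ x₀ z v = v := by
    rw [← triv_symm_eq_fibreChange hself, (trivializationAt F V x₀).apply_mk_symm hzd.2 v]
  rw [coordChange_self hzd, h3, h2.fderiv_eq, fderiv_id] at h1
  rw [srcCoeff, h φ z hzd v]
  rw [eulerExpr_clm (isOpen_chartDom x₀) hB.1 (secCoord_contDiffOn φ x₀) _ hzd] at h1
  refine Eq.trans h1 ?_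
  have : (ContinuousLinearMap.id ℝ (Model n)).det = 1 := LinearMap.det_id
  rw [this, one_mul]

lemma IsEulerLagrange.unique {α : HForm n F V n} {ε δ : Src n F V n} (hα : IsLocalForm α)
    (hε : IsEulerLagrange α ε) (hδ : IsEulerLagrange α δ) : ε = δ := by
  obtain ⟨p, h⟩ := exists_isLagrangian hα
  funext j
  refine jet_base_section j (P := fun j => ε j = δ j) fun φ x => ?_
  obtain ⟨L, hL⟩ := h x
  have hx := mem_chartRegion_self (n := n) (F := F) (V := V) x
  refine src_eq_of_srcCoeff hx fun v => ?_
  rw [hε.srcCoeff_eq hL (chart_mem_chartDom hx), hδ.srcCoeff_eq hL (chart_mem_chartDom hx)]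

lemma srcCoeff_eulerLagrange {α : HForm n F V n} (hα : IsLocalForm α) {x₀ : M}
    {W : Set (Model n)} {p : ℕ}
    {L : Model n × JetCoord n p F → ℝ} (hL : IsLagrangian α x₀ W L) {z : Model n} (hz : z ∈ W)
    (φ : Sec n F V) (v : F) :
    srcCoeff (eulerLagrange α) x₀ v z φ = eulerExpr L (secCoord x₀ φ) z v :=
  (isEulerLagrange_eulerLagrange hα).srcCoeff_eq hL hz φ v

lemma eulerLagrange_comb {α β : HForm n F V n} (c : ℝ) (hα : IsLocalForm α) (hβ : IsLocalForm β) :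
    eulerLagrange (c • α + β) = c • eulerLagrange α + eulerLagrange β :=
  (isEulerLagrange_eulerLagrange (hα.comb c hβ)).unique (hα.comb c hβ)
    ((isEulerLagrange_eulerLagrange hα).comb c (isEulerLagrange_eulerLagrange hβ))

lemma isCompactForm_iff {α : HForm n F V n} : IsCompactForm α ↔ IsLocalForm α ∧
    HasCompactPull α ∧ ∀ φ : Sec n F V, IsCompactlySupported φ →
      IsCompact (closure {x : M | eulerLagrange α (jet φ x) ≠ 0}) := by
  refine ⟨fun h => ⟨h.1, h.2.1, ?_⟩, fun h => ⟨h.1, h.2.1, fun _ =>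
    ⟨_, isEulerLagrange_eulerLagrange h.1, h.2.2⟩⟩⟩
  obtain ⟨ε, h1, h2⟩ := h.2.2 rfl
  rwa [(isEulerLagrange_eulerLagrange h.1).unique h.1 h1]

lemma isLocalSrc_eulerLagrange {α : HForm n F V n} (hα : IsLocalForm α) :
    IsLocalSrc (eulerLagrange α) := by
  obtain ⟨p, hp⟩ := (isEulerLagrange_eulerLagrange hα).exists
  intro v
  filter_upwards [eventually_ge_atTop (p + n * p)] with q hq x₀
  obtain ⟨B, hB, h⟩ := hp x₀
  refine JetFn.mono (p := p + n * p) ?_ hq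
  refine (((secFrame x₀).eulerExpr hB.1).clm (ContinuousLinearMap.apply ℝ _ v)).congr ?_
  intro φ z hz
  exact h φ z hz v

end EulerForm

/-! ### Locality, compact supports, and vanishing on exact forms -/

section Locality

variable {n : ℕ} {M : Type*} [TopologicalSpace M] [ChartedSpace (Model n) M]
  {F : Type*} [NormedAddCommGroup F] [NormedSpace ℝ F]
  {V : M → Type*} [TopologicalSpace (TotalSpace F V)] [∀ x, AddCommGroup (V x)]
  [∀ x, Module ℝ (V x)] [∀ x, TopologicalSpace (V x)] [FiberBundle F V] [VectorBundle ℝ F V]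
  [IsManifold (𝓡 n) ∞ M] [ContMDiffVectorBundle ∞ F V (𝓡 n)] [FiniteDimensional ℝ F] [T2Space M]

/-- The Euler–Lagrange form is local. -/
lemma eulerLagrange_congr {α β : HForm n F V n} (hα : IsLocalForm α) (hβ : IsLocalForm β)
    {N : Set M} (hN : IsOpen N) (h : ∀ j : InfJet n F V, j.base ∈ N → α j = β j)
    {φ : Sec n F V} {x : M} (hx : x ∈ N) :
    eulerLagrange α (jet φ x) = eulerLagrange β (jet φ x) := by
  obtain ⟨p, hp⟩ := exists_isLagrangian hα
  obtain ⟨L, hL⟩ := hp x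
  have hxr := mem_chartRegion_self (n := n) (F := F) (V := V) x
  have hzd := chart_mem_chartDom hxr
  -- Over `N` one function `L` is a Lagrangian for both forms, so their components agree there.
  let W : Set (Model n) := chartDom n F V x ∩ (extChartAt (𝓡 n) x).symm ⁻¹' N
  have hW : IsOpen W := ((continuousOn_extChartAt_symm x).mono
    inter_subset_left).isOpen_inter_preimage (isOpen_chartDom x) hN
  have hzW : extChartAt (𝓡 n) x x ∈ W :=
    ⟨hzd, by rwa [mem_preimage, (extChartAt (𝓡 n) x).left_inv hxr.1]⟩
  have hLα := hL.mono hW inter_subset_left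
  have hLβ : IsLagrangian β x W L := ⟨hW, inter_subset_left, hLα.smooth, fun φ z hz => by
    rw [← hLα.eq φ z hz, chartCoeff_eq_topEval, chartCoeff_eq_topEval]
    exact congrArg (topEval n) (chartForm_congr (β := pullSec β φ) (γ := pullSec α φ) (h (jet φ _) hz.2).symm)⟩
  refine src_eq_of_srcCoeff hxr fun v => ?_
  rw [srcCoeff_eulerLagrange hα hLα hzW, srcCoeff_eulerLagrange hβ hLβ hzW]

lemma eulerLagrange_zero : eulerLagrange (0 : HForm n F V n) = 0 := by
  have h0 : IsLocalForm (0 : HForm n F V n) := (IsCompactForm.zero).1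
  have h := eulerLagrange_comb (-1) h0 h0
  rw [smul_zero, add_zero] at h
  rw [h]
  exact (neg_one_smul_add_eq_zero (Y := Src n F V n)).2 rfl

lemma eulerLagrange_eq_zero {α : HForm n F V n} (hα : IsLocalForm α)
    {N : Set M} (hN : IsOpen N) (h : ∀ j : InfJet n F V, j.base ∈ N → α j = 0)
    {φ : Sec n F V} {x : M} (hx : x ∈ N) : eulerLagrange α (jet φ x) = 0 := by
  rw [eulerLagrange_congr hα (IsCompactForm.zero).1 hN h hx, eulerLagrange_zero]
  rfl

lemma isCompact_closure_of_subset {X : Type*} [TopologicalSpace X] [T2Space X] {K s : Set X}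
    (hK : IsCompact K) (h : s ⊆ K) : IsCompact (closure s) :=
  hK.of_isClosed_subset isClosed_closure (closure_minimal h hK.isClosed)

/-- A local Lagrangian form supported over a compact subset of the base. -/
lemma IsLocalForm.isCompactForm {α : HForm n F V n} (hα : IsLocalForm α) {K : Set M}
    (hK : IsCompact K) (h0 : ∀ j : InfJet n F V, j.base ∉ K → α j = 0) : IsCompactForm α := by
  refine isCompactForm_iff.2 ⟨hα, fun φ _ => ?_, fun φ _ => ?_⟩
  · refine isCompact_closure_of_subset hK fun x hx => ?_
    by_contra hc
    exact hx (h0 _ hc)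
  · refine isCompact_closure_of_subset hK fun x hx => ?_
    by_contra hc
    exact hx (eulerLagrange_eq_zero hα hK.isClosed.isOpen_compl h0 hc)

lemma smulForm_eq_zero {k : ℕ} {f : M → ℝ} {α : HForm n F V k} {j : InfJet n F V}
    (h : f j.base = 0) : smulForm f α j = 0 := by
  rw [smulForm, h]
  exact zero_smul ℝ (α j)

/-- The Euler–Lagrange form of an exact Lagrangian vanishes. -/
theorem eulerLagrange_dH {k : ℕ} {M : Type*} [TopologicalSpace M]
    [ChartedSpace (Model (k + 1)) M] {V : M → Type*} [TopologicalSpace (TotalSpace F V)]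
    [∀ x, AddCommGroup (V x)] [∀ x, Module ℝ (V x)] [∀ x, TopologicalSpace (V x)]
    [FiberBundle F V] [VectorBundle ℝ F V] [IsManifold (𝓡 (k + 1)) ∞ M]
    [ContMDiffVectorBundle ∞ F V (𝓡 (k + 1))] [T2Space M] {β : HForm (k + 1) F V k}
    (hβ : IsLocalForm β) : eulerLagrange (dH β) = 0 := by
  obtain ⟨p, hp⟩ := exists_isLagrangian hβ.dH
  obtain ⟨q, hq⟩ := isLocalForm_iff.1 hβ
  funext j
  refine jet_base_section j (P := fun j => eulerLagrange (dH β) j = 0) fun φ x => ?_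
  obtain ⟨L, hL⟩ := hp x
  have hxr := mem_chartRegion_self (n := k + 1) (F := F) (V := V) x
  have hzd := chart_mem_chartDom hxr
  refine src_eq_of_srcCoeff (δ := 0) hxr fun v => ?_
  rw [srcCoeff_eulerLagrange hβ.dH hL hzd]
  have h0 : srcCoeff (0 : Src (k + 1) F V (k + 1)) x v (extChartAt (𝓡 (k + 1)) x x) φ = 0 := by
    rw [srcCoeff, srcCoord_eq_chartForm, chartForm_eq_zero, map_zero]
    rfl
  rw [h0]
  -- The coefficients of `β` with `dxⁱ` omitted. The exterior derivative is their divergence with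
  -- the signs `(-1)^i`.
  let b : Fin (k + 1) → Model (k + 1) → Sec (k + 1) F V → ℝ := fun i z φ =>
    chartForm x (pullSec β φ) z (i.removeNth fun a => EuclideanSpace.single a (1 : ℝ))
  have hb : ∀ i, JetFn (secCoord x) id (chartDom (k + 1) F V x) q (b i) := fun i =>
    (hq x).clm (ContinuousAlternatingMap.apply ℝ (Model (k + 1)) ℝ
      (i.removeNth fun a => EuclideanSpace.single a (1 : ℝ)))
  have := eulerExpr_divergence (secFrame x) hb (fun i => (-1 : ℝ) ^ (i : ℕ)) hL.smooth
    (fun s z hz => ?_) φ (fun w hw t => ⟨t • extendSec x w hw + φ, fun z hz => by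
      rw [secCoord_comb t _ φ hz, secCoord_extendSec hw hz]⟩) hzd
  · rw [this]; rfl
  · rw [← hL.eq s z hz, chartCoeff, chartForm_dH hβ s hz, extDeriv_apply
      (((hβ.contDiffOn s x).contDiffAt ((isOpen_chartDom x).mem_nhds hz)).differentiableAt
        (by simp))]
    refine Finset.sum_congr rfl fun i _ => ?_
    rw [zsmul_eq_mul]
    push_cast
    rfl

end Locality

/-! ### Local frames of source forms and the components of `ω` -/

section Frames

variable {n : ℕ} {F : Type*} [NormedAddCommGroup F] [NormedSpace ℝ F]

lemma fderiv_fibre_direction {p : ℕ} {W : Set (Model n)} (hW : IsOpen W)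
    {A : Model n × JetCoord n p F → ℝ}
    (hA : ContDiffOn ℝ ∞ A (W ×ˢ univ)) {z : Model n} (hz : z ∈ W) (η η' : JetCoord n p F)
    {d : ℝ} (h : HasDerivAt (fun t : ℝ => A (z, t • η' + η)) d 0) :
    fderiv ℝ A (z, η) (0, η') = d := by
  have hd : HasDerivAt (fun t : ℝ => t • η' + η) η' 0 := by
    simpa using ((hasDerivAt_id (0 : ℝ)).smul_const η').add_const η
  have d0 := hasDerivAt_comp_jet hW hA hz hd
  simp only [zero_smul, zero_add] at d0
  exact d0.unique h

/-- The Euler–Lagrange expression of a Lagrangian `g(x) ℓ(u)`. -/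
lemma eulerExpr_linear {W : Set (Model n)} (hW : IsOpen W) {g : Model n → ℝ}
    (hg : ContDiffOn ℝ ∞ g W) (ℓ : F →L[ℝ] ℝ) (u : Model n → F) {z : Model n} (hz : z ∈ W)
    (v : F) :
    eulerExpr (fun w : Model n × JetCoord n 0 F => g w.1 * ℓ (w.2 fun _ => 0)) u z v
      = g z * ℓ v := by
  have hA : ContDiffOn ℝ ∞ (fun w : Model n × JetCoord n 0 F => g w.1 * ℓ (w.2 fun _ => 0))
      (W ×ˢ univ) := (hg.comp contDiffOn_fst fun w hw => hw.1).mul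
    (ℓ.contDiff.comp ((contDiff_apply ℝ F fun _ => 0).comp contDiff_snd)).contDiffOn
  have h1 : ∀ f : Model n → F →L[ℝ] ℝ, partialMulti (fun _ : Fin n => 0) f = f := by
    intro f
    funext z
    exact jetCoord_apply_zero (p := 0) f z
  rw [eulerExpr, Fintype.sum_eq_single (fun _ => 0) fun I hI =>
    (hI (funext fun i => Fin.ext (by omega))).elim]
  change ((-1 : ℝ) ^ (∑ _ : Fin n, 0) • partialMulti (W := F →L[ℝ] ℝ) (fun _ : Fin n => 0) _ z :
    F →L[ℝ] ℝ) v = _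
  rw [h1, Finset.sum_const_zero, pow_zero, one_smul]
  refine fderiv_fibre_direction hW hA hz _ _ ?_
  have h2 : ∀ t : ℝ, (t • Pi.single (M := fun _ : Fin n → Fin (0 + 1) => F) (fun _ => 0) v
      + jetCoord 0 u z : JetCoord n 0 F) (fun _ => 0) = t • v + u z := by
    intro t
    rw [Pi.add_apply, Pi.smul_apply, Pi.single_eq_same, jetCoord_apply_zero]
  change HasDerivAt (fun t : ℝ => g z * ℓ ((t • Pi.single (M := fun _ : Fin n → Fin (0 + 1) => F)
    (fun _ => 0) v + jetCoord 0 u z : JetCoord n 0 F) fun _ => 0)) _ 0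
  simp only [h2, map_add, map_smul, smul_eq_mul]
  simpa using (((hasDerivAt_id (0 : ℝ)).mul_const (ℓ v)).add_const (ℓ (u z))).const_mul (g z)

variable {M : Type*} [TopologicalSpace M] [ChartedSpace (Model n) M]
  {V : M → Type*} [TopologicalSpace (TotalSpace F V)] [∀ x, AddCommGroup (V x)]
  [∀ x, Module ℝ (V x)] [∀ x, TopologicalSpace (V x)] [FiberBundle F V] [VectorBundle ℝ F V]
  [IsManifold (𝓡 n) ∞ M] [ContMDiffVectorBundle ∞ F V (𝓡 n)] [FiniteDimensional ℝ F] [T2Space M]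
  [SigmaCompactSpace M]

/-- The coordinate expression of the Lagrangian form `f ℓ(u) ν`. -/
def frameEta (ν : VolumeForm n M) (x₀ : M) (f : Model n → ℝ) (ℓ : F →L[ℝ] ℝ)
    (z : Model n) (φ : Sec n F V) : (Model n) [⋀^Fin n]→L[ℝ] ℝ :=
  (f z * ℓ (secCoord x₀ φ z)) • chartForm x₀ ν.toForm z

variable (F V) in
/-- The Lagrangian form `f ℓ(u) ν` in the coordinates at `x₀`, extended by zero. -/
def frameForm (ν : VolumeForm n M) (x₀ : M) (f : Model n → ℝ) (ℓ : F →L[ℝ] ℝ) : HForm n F V n :=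
  localPiece x₀ (tsupport f) (frameEta ν x₀ f ℓ)

variable {ν : VolumeForm n M} {x₀ : M} {f : Model n → ℝ}

lemma jetFn_frameEta (hf : IsTest (chartDom n F V x₀) f) (ℓ : F →L[ℝ] ℝ) :
    JetFn (S := Sec n F V) (secCoord x₀) id (chartDom n F V x₀) 0 (frameEta ν x₀ f ℓ) := by
  refine JetFn.smul (JetFn.mul (JetFn.of_base hf.smooth.contDiffOn) (JetFn.field.clm ℓ))
    (JetFn.of_base ((ν.smooth x₀).mono inter_subset_left))

lemma frameEta_eq_zero (ℓ : F →L[ℝ] ℝ) {z : Model n} (hz : z ∉ tsupport f) (φ : Sec n F V) :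
    frameEta ν x₀ f ℓ z φ = 0 := by
  rw [frameEta, image_eq_zero_of_notMem_tsupport hz, zero_mul, zero_smul]

lemma jetFn_frameForm (hf : IsTest (chartDom n F V x₀) f) (ℓ : F →L[ℝ] ℝ) (x₁ : M) :
    JetFn (secCoord x₁) id (chartDom n F V x₁) 0
      fun z φ => chartForm x₁ (pullSec (frameForm F V ν x₀ f ℓ) φ) z := by
  have := jetFn_localPiece (jetFn_frameEta (ν := ν) hf ℓ) subset_rfl (isOpen_chartDom x₀)
    hf.compact hf.subset (fun z _ h φ => frameEta_eq_zero ℓ h φ) x₁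
  rwa [mul_zero] at this

lemma isLocalForm_frameForm (hf : IsTest (chartDom n F V x₀) f) (ℓ : F →L[ℝ] ℝ) :
    IsLocalForm (frameForm F V ν x₀ f ℓ) := isLocalForm_iff.2 ⟨0, jetFn_frameForm hf ℓ⟩

lemma chartForm_frameForm (hf : IsTest (chartDom n F V x₀) f) (ℓ : F →L[ℝ] ℝ) {z : Model n}
    (hz : z ∈ chartDom n F V x₀) (φ : Sec n F V) :
    chartForm x₀ (pullSec (frameForm F V ν x₀ f ℓ) φ) z = frameEta ν x₀ f ℓ z φ :=
  chartForm_localPiece (jetFn_frameEta hf ℓ) subset_rfl hf.subset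
    (fun _ _ h φ => frameEta_eq_zero ℓ h φ) hz φ

lemma isLagrangian_frameForm (hf : IsTest (chartDom n F V x₀) f) (ℓ : F →L[ℝ] ℝ) :
    IsLagrangian (frameForm F V ν x₀ f ℓ) x₀ (chartDom n F V x₀)
      fun w : Model n × JetCoord n 0 F =>
        (f w.1 * chartCoeff x₀ ν.toForm w.1) * ℓ (w.2 fun _ => 0) := by
  refine ⟨isOpen_chartDom x₀, subset_rfl, ?_, fun φ z hz => ?_⟩
  · refine ContDiffOn.mul (ContDiffOn.comp (g := fun z => f z * chartCoeff x₀ ν.toForm z)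
      (hf.smooth.contDiffOn.mul ((ν.contDiffOn_coeff x₀).mono inter_subset_left)) contDiffOn_fst
      fun w hw => hw.1) (ℓ.contDiff.comp ((contDiff_apply ℝ F fun _ => 0).comp contDiff_snd)).contDiffOn
  · rw [chartCoeff_eq_topEval, chartForm_frameForm hf ℓ hz, frameEta, map_smul, smul_eq_mul,
      ← chartCoeff_eq_topEval]
    change _ = f z * chartCoeff x₀ ν.toForm z * ℓ (jetCoord 0 (secCoord x₀ φ) z fun _ => 0)
    rw [jetCoord_apply_zero]
    ring

/-- The Lagrangian is of order zero and linear in the field, so no derivative of `f` appears and the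
result does not depend on the section. Where `f` is nonzero, these Euler–Lagrange forms therefore
span the source forms. -/
lemma srcCoeff_frameForm (hf : IsTest (chartDom n F V x₀) f) (ℓ : F →L[ℝ] ℝ) {z : Model n}
    (hz : z ∈ chartDom n F V x₀) (φ : Sec n F V) (v : F) :
    srcCoeff (eulerLagrange (frameForm F V ν x₀ f ℓ)) x₀ v z φ
      = f z * chartCoeff x₀ ν.toForm z * ℓ v := by
  rw [srcCoeff_eulerLagrange (isLocalForm_frameForm hf ℓ) (isLagrangian_frameForm hf ℓ) hz]
  exact eulerExpr_linear (isOpen_chartDom x₀)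
    (hf.smooth.contDiffOn.mul ((ν.contDiffOn_coeff x₀).mono inter_subset_left)) ℓ _ hz v

lemma frameForm_eq_zero {ℓ : F →L[ℝ] ℝ} {j : InfJet n F V}
    (h : j.base ∉ (extChartAt (𝓡 n) x₀).symm '' tsupport f) : frameForm F V ν x₀ f ℓ j = 0 :=
  localPiece_eq_zero h

lemma isCompactForm_frameForm (hf : IsTest (chartDom n F V x₀) f) (ℓ : F →L[ℝ] ℝ) :
    IsCompactForm (frameForm F V ν x₀ f ℓ) :=
  (isLocalForm_frameForm hf ℓ).isCompactForm
    (isCompact_symm_image hf.compact (hf.subset.trans inter_subset_left))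
    fun _ h => frameForm_eq_zero h

lemma srcCoeff_comb (c : ℝ) (ε δ : Src n F V n) (x₀ : M) (v : F) (z : Model n) (φ : Sec n F V) :
    srcCoeff (c • ε + δ) x₀ v z φ = c * srcCoeff ε x₀ v z φ + srcCoeff δ x₀ v z φ := by
  simp only [srcCoeff, srcCoord_eq_chartForm, ← smul_eq_mul, ← map_smul, ← map_add]
  exact congrArg _ (chartForm_comb x₀ c _ _ z)

lemma srcCoeff_zero (x₀ : M) (v : F) (z : Model n) (φ : Sec n F V) :
    srcCoeff 0 x₀ v z φ = 0 := by
  rw [srcCoeff, srcCoord_eq_chartForm, chartForm_eq_zero, map_zero]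
  rfl

lemma srcCoeff_combination {ι : Type*} (t : Finset ι) (c : ι → ℝ) (δ : ι → Src n F V n) (x₀ : M)
    (v : F) (z : Model n) (φ : Sec n F V) :
    srcCoeff (∑ i ∈ t, c i • δ i) x₀ v z φ = ∑ i ∈ t, c i * srcCoeff (δ i) x₀ v z φ := by
  classical
  induction t using Finset.induction_on with
  | empty => simp [srcCoeff_zero]
  | insert a t ha ih => rw [Finset.sum_insert ha, Finset.sum_insert ha, srcCoeff_comb, ih]

/-- The coordinate functions of a basis of the fibre. -/
def fibreCoord (F : Type*) [NormedAddCommGroup F] [NormedSpace ℝ F] [FiniteDimensional ℝ F]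
    (a : Fin (Module.finrank ℝ F)) : F →L[ℝ] ℝ :=
  LinearMap.toContinuousLinearMap ((Module.finBasis ℝ F).coord a)

variable (F V) in
/-- The source form `f ν ∧ θ^a` in the coordinates at `x₀`. -/
def frameSrc (ν : VolumeForm n M) (x₀ : M) (f : Model n → ℝ) (a : Fin (Module.finrank ℝ F)) :
    Src n F V n := eulerLagrange (frameForm F V ν x₀ f (fibreCoord F a))

/-- Both sides have the same components in the chart, by linearity in the direction and expansion in
a basis of the fibre. Arbitrary source forms are thus expressed through Euler–Lagrange forms. -/
lemma src_eq_sum_frame (hf : IsTest (chartDom n F V x₀) f) {z : Model n}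
    (hz : z ∈ chartDom n F V x₀) (hfz : f z ≠ 0) (φ : Sec n F V) (ε : Src n F V n) :
    ε (jet φ ((extChartAt (𝓡 n) x₀).symm z)) = ∑ a,
      (srcCoeff ε x₀ (Module.finBasis ℝ F a) z φ / (f z * chartCoeff x₀ ν.toForm z)) •
        frameSrc F V ν x₀ f a (jet φ ((extChartAt (𝓡 n) x₀).symm z)) := by
  have hN : chartCoeff x₀ ν.toForm z ≠ 0 := ν.coeff_ne_zero hz.1
  have h1 := src_eq_of_srcCoeff (ε := ε) (δ := ∑ a, (srcCoeff ε x₀ (Module.finBasis ℝ F a) z φ /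
    (f z * chartCoeff x₀ ν.toForm z)) • frameSrc F V ν x₀ f a) (symm_mem_chartRegion hz) (φ := φ) ?_
  · rw [h1]
    simp only [Finset.sum_apply]
    rfl
  intro v
  rw [(extChartAt (𝓡 n) x₀).right_inv hz.1, srcCoeff_combination]
  simp only [frameSrc, srcCoeff_frameForm hf _ hz]
  have h2 : ∀ a, srcCoeff ε x₀ (Module.finBasis ℝ F a) z φ / (f z * chartCoeff x₀ ν.toForm z) *
      (f z * chartCoeff x₀ ν.toForm z * fibreCoord F a v)
      = fibreCoord F a v * srcCoeff ε x₀ (Module.finBasis ℝ F a) z φ := by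
    intro a
    field_simp
  simp only [h2]
  -- The coefficient is linear in the constant direction; the composition is spelled out so that its
  -- value on `v` can be expanded in the basis.
  have h3 : ∃ Λ : F →ₗ[ℝ] ℝ, ∀ v, Λ v = srcCoeff ε x₀ v z φ := by
    let x := (extChartAt (𝓡 n) x₀).symm z
    have hb : x ∈ (trivializationAt F V x₀).baseSet := hz.2
    let Λ₀ : ((TangentSpace (𝓡 n) x) [⋀^Fin n]→L[ℝ] ℝ) →ₗ[ℝ] ℝ :=
      { toFun := fun b => topEval n (chartCov x₀ z b)
        map_add' := fun b c => rfl
        map_smul' := fun r b => rfl }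
    refine ⟨Λ₀ ∘ₗ (ε (jet φ x)) ∘ₗ ((trivializationAt F V x₀).symmₗ ℝ x), fun v => ?_⟩
    change topEval n (chartCov x₀ z (ε (jet φ x)
      ((trivializationAt F V x₀).symmₗ ℝ x v))) = _
    rw [Trivialization.symmₗ_apply _ hb]
    rfl
  obtain ⟨Λ, hΛ⟩ := h3
  simp only [← hΛ]
  conv_lhs => rw [← (Module.finBasis ℝ F).sum_repr v, map_sum]
  refine Finset.sum_congr rfl fun a _ => ?_
  rw [map_smul, smul_eq_mul]
  rfl

/-- The components of the bracket tensor in the coordinates at `x₀`. -/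
def omegaCoeff (ν : VolumeForm n M) (Ω : BracketTensor n F V) (x₀ : M) (f : Model n → ℝ)
    (a b : Fin (Module.finrank ℝ F)) (z : Model n) (φ : Sec n F V) : ℝ :=
  ((f z * chartCoeff x₀ ν.toForm z) * (f z * chartCoeff x₀ ν.toForm z))⁻¹ *
    Ω.form (jet φ ((extChartAt (𝓡 n) x₀).symm z))
      (frameSrc F V ν x₀ f a (jet φ ((extChartAt (𝓡 n) x₀).symm z)))
      (frameSrc F V ν x₀ f b (jet φ ((extChartAt (𝓡 n) x₀).symm z)))

/-- Pointwise bilinearity of `ω` applied to the frame expansion of both arguments. The bracket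
becomes polynomial in the Euler–Lagrange components. -/
lemma bracketTensor_eq_sum (Ω : BracketTensor n F V) (hf : IsTest (chartDom n F V x₀) f)
    {z : Model n} (hz : z ∈ chartDom n F V x₀) (hfz : f z ≠ 0) (φ : Sec n F V)
    (ε δ : Src n F V n) :
    Ω.form (jet φ ((extChartAt (𝓡 n) x₀).symm z)) (ε (jet φ ((extChartAt (𝓡 n) x₀).symm z)))
      (δ (jet φ ((extChartAt (𝓡 n) x₀).symm z))) = ∑ a, ∑ b, omegaCoeff ν Ω x₀ f a b z φ *
        (srcCoeff ε x₀ (Module.finBasis ℝ F a) z φ * srcCoeff δ x₀ (Module.finBasis ℝ F b) z φ) := by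
  rw [src_eq_sum_frame (ν := ν) hf hz hfz φ ε, src_eq_sum_frame (ν := ν) hf hz hfz φ δ]
  simp only [map_sum, LinearMap.sum_apply, map_smul, LinearMap.smul_apply, smul_eq_mul,
    Finset.mul_sum, omegaCoeff]
  rw [Finset.sum_comm]
  refine Finset.sum_congr rfl fun a _ => Finset.sum_congr rfl fun b _ => ?_
  rw [mul_inv]
  ring

lemma jetFn_omegaCoeff (Ω : BracketTensor n F V) (hf : IsTest (chartDom n F V x₀) f)
    (a b : Fin (Module.finrank ℝ F)) {p : ℕ}
    (hp : JetFn (S := Sec n F V) (secCoord x₀) id (chartDom n F V x₀ ∩ {z | f z ≠ 0}) p fun z φ =>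
      Ω.form (jet φ ((extChartAt (𝓡 n) x₀).symm z))
      (frameSrc F V ν x₀ f a (jet φ ((extChartAt (𝓡 n) x₀).symm z)))
      (frameSrc F V ν x₀ f b (jet φ ((extChartAt (𝓡 n) x₀).symm z)))) :
    JetFn (secCoord x₀) id (chartDom n F V x₀ ∩ {z | f z ≠ 0}) p (omegaCoeff ν Ω x₀ f a b) := by
  refine JetFn.mul (JetFn.of_base ?_) hp
  have h1 : ContDiffOn ℝ ∞ (fun z => f z * chartCoeff x₀ ν.toForm z)
      (chartDom n F V x₀ ∩ {z | f z ≠ 0}) := (hf.smooth.contDiffOn.mul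
        ((ν.contDiffOn_coeff x₀).mono inter_subset_left)).mono inter_subset_left
  refine (h1.mul h1).inv fun z hz => ?_
  have hN : chartCoeff x₀ ν.toForm z ≠ 0 := ν.coeff_ne_zero hz.1.1
  exact mul_ne_zero (mul_ne_zero hz.2 hN) (mul_ne_zero hz.2 hN)

/-- Locality of `ω` is assumed on global local source forms; the frames are such forms, as
Euler–Lagrange forms of Lagrangians extended by zero. The order may still depend on the frame. -/
lemma exists_jetFn_omegaCoeff (Ω : BracketTensor n F V) (hf : IsTest (chartDom n F V x₀) f) :
    ∃ p, ∀ a b, JetFn (secCoord x₀) id (chartDom n F V x₀ ∩ {z | f z ≠ 0}) p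
      (omegaCoeff ν Ω x₀ f a b) := by
  have h : ∀ᶠ p in (atTop : Filter ℕ), ∀ a b, JetFn (secCoord x₀) id
      (chartDom n F V x₀ ∩ {z | f z ≠ 0}) p (omegaCoeff ν Ω x₀ f a b) := by
    refine eventually_all.2 fun a => eventually_all.2 fun b => ?_
    filter_upwards [Ω.isLocal _ _ (isLocalSrc_eulerLagrange (isLocalForm_frameForm (ν := ν) hf
      (fibreCoord F a))) (isLocalSrc_eulerLagrange (isLocalForm_frameForm (ν := ν) hf
      (fibreCoord F b)))] with p hp
    exact jetFn_omegaCoeff Ω hf a b (JetFn.mono_set (hp x₀) inter_subset_left)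
  exact h.exists

end Frames

/-! ### Locality, bilinearity and compact support of the bracket -/

section Bracket

variable {n : ℕ} {F : Type*} [NormedAddCommGroup F] [NormedSpace ℝ F]
  {M : Type*} [TopologicalSpace M] [ChartedSpace (Model n) M]
  {V : M → Type*} [TopologicalSpace (TotalSpace F V)] [∀ x, AddCommGroup (V x)]
  [∀ x, Module ℝ (V x)] [∀ x, TopologicalSpace (V x)] [FiberBundle F V] [VectorBundle ℝ F V]
  [IsManifold (𝓡 n) ∞ M] [ContMDiffVectorBundle ∞ F V (𝓡 n)] [FiniteDimensional ℝ F] [T2Space M]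
  [SigmaCompactSpace M]

lemma exists_jetFn_srcCoeff {α : HForm n F V n} (hα : IsLocalForm α) :
    ∃ p, ∀ (x₀ : M) (v : F), JetFn (secCoord x₀) id (chartDom n F V x₀) p
      fun z φ => srcCoeff (eulerLagrange α) x₀ v z φ := by
  obtain ⟨p, h⟩ := exists_isLagrangian hα
  refine ⟨p + n * p, fun x₀ v => ?_⟩
  obtain ⟨L, hL⟩ := h x₀
  refine (((secFrame x₀).eulerExpr hL.smooth).clm (ContinuousLinearMap.apply ℝ ℝ v)).congr ?_
  intro φ z hz
  exact srcCoeff_eulerLagrange hα hL hz φ v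

lemma srcCoeff_eq_zero {ε : Src n F V n} {x₀ : M} {z : Model n} {φ : Sec n F V} (v : F)
    (h : ε (jet φ ((extChartAt (𝓡 n) x₀).symm z)) = 0) : srcCoeff ε x₀ v z φ = 0 := by
  rw [srcCoeff, srcCoord_eq_chartForm, chartForm_eq_zero, map_zero]
  rw [srcField, h]
  rfl

variable (ν : VolumeForm n M) (Ω : BracketTensor n F V)

lemma chartForm_bracketForm (α β : HForm n F V n) (x₀ : M) (z : Model n) (φ : Sec n F V) :
    chartForm x₀ (pullSec (bracketForm ν Ω α β) φ) z
      = Ω.form (jet φ ((extChartAt (𝓡 n) x₀).symm z))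
        (eulerLagrange α (jet φ ((extChartAt (𝓡 n) x₀).symm z)))
        (eulerLagrange β (jet φ ((extChartAt (𝓡 n) x₀).symm z))) • chartForm x₀ ν.toForm z :=
  chartForm_smul x₀ (fun x => Ω.form (jet φ x) (eulerLagrange α (jet φ x))
    (eulerLagrange β (jet φ x))) ν.toForm z

lemma chartCoeff_bracketForm (α β : HForm n F V n) (x₀ : M) (z : Model n) (φ : Sec n F V) :
    chartCoeff x₀ (pullSec (bracketForm ν Ω α β) φ) z
      = Ω.form (jet φ ((extChartAt (𝓡 n) x₀).symm z))
        (eulerLagrange α (jet φ ((extChartAt (𝓡 n) x₀).symm z)))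
        (eulerLagrange β (jet φ ((extChartAt (𝓡 n) x₀).symm z))) * chartCoeff x₀ ν.toForm z := by
  rw [chartCoeff_eq_topEval, chartForm_bracketForm, map_smul, smul_eq_mul, chartCoeff_eq_topEval]

lemma isLocalForm_bracketForm {α β : HForm n F V n} (hα : IsLocalForm α) (hβ : IsLocalForm β) :
    IsLocalForm (bracketForm ν Ω α β) := by
  obtain ⟨p, h⟩ := isLocalFunction_iff.1
    (Ω.isLocal _ _ (isLocalSrc_eulerLagrange hα) (isLocalSrc_eulerLagrange hβ))
  refine isLocalForm_iff.2 ⟨p, fun x₀ => ?_⟩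
  exact ((h x₀).smul (JetFn.of_base ((ν.smooth x₀).mono inter_subset_left))).congr
    fun φ z _ => chartForm_bracketForm ν Ω α β x₀ z φ

lemma bracketForm_skew (α β : HForm n F V n) :
    bracketForm ν Ω α β = - bracketForm ν Ω β α := by
  funext j
  have h : ∀ ε δ : SrcFiber (k := n) j, Ω.form j ε δ • ν.toForm j.base
      = -(Ω.form j δ ε • ν.toForm j.base) := by
    intro ε δ
    rw [Ω.skew]
    ext v
    exact neg_mul _ _
  exact h _ _

lemma bracketForm_comb {α α' : HForm n F V n} (c : ℝ) (hα : IsLocalForm α) (hα' : IsLocalForm α')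
    (β : HForm n F V n) : bracketForm ν Ω (c • α + α') β
      = c • bracketForm ν Ω α β + bracketForm ν Ω α' β := by
  funext j
  have h : ∀ ε δ η : SrcFiber (k := n) j, Ω.form j (c • ε + δ) η • ν.toForm j.base
      = c • (Ω.form j ε η • ν.toForm j.base) + Ω.form j δ η • ν.toForm j.base := by
    intro ε δ η
    rw [map_add, map_smul, LinearMap.add_apply, LinearMap.smul_apply, add_smul, smul_assoc]
  have h2 : eulerLagrange (c • α + α') j = c • eulerLagrange α j + eulerLagrange α' j := by
    rw [eulerLagrange_comb c hα hα']
    rfl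
  change Ω.form j (eulerLagrange (c • α + α') j) _ • ν.toForm j.base = _
  rw [h2]
  exact h _ _ _

lemma bracketForm_eq_zero_left {α β : HForm n F V n} {j : InfJet n F V}
    (h : eulerLagrange α j = 0) : bracketForm ν Ω α β j = 0 := by
  change Ω.form j _ _ • ν.toForm j.base = 0
  rw [h, map_zero, LinearMap.zero_apply, zero_smul]

lemma bracketForm_eq_zero_right {α β : HForm n F V n} {j : InfJet n F V}
    (h : eulerLagrange β j = 0) : bracketForm ν Ω α β j = 0 := by
  change Ω.form j _ _ • ν.toForm j.base = 0
  rw [h, map_zero, zero_smul]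

variable {Ω} in
-- The Lagrangian is displayed as a product of representing functions so that the product rule can
-- be applied to its jet derivatives.
lemma exists_isLagrangian_bracketForm {x₀ : M} {f : Model n → ℝ}
    (hf : IsTest (chartDom n F V x₀) f) {p : ℕ}
    {O : Fin (Module.finrank ℝ F) → Fin (Module.finrank ℝ F) → Model n × JetCoord n p F → ℝ}
    {A B : Fin (Module.finrank ℝ F) → Model n × JetCoord n p F → ℝ}
    {α β : HForm n F V n}
    {W : Set (Model n)} (hW : IsOpen W) (hWs : W ⊆ chartDom n F V x₀ ∩ {z | f z ≠ 0})
    (hO : ∀ a b, ContDiffOn ℝ ∞ (O a b) (W ×ˢ univ))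
    (hA : ∀ a, ContDiffOn ℝ ∞ (A a) (W ×ˢ univ)) (hB : ∀ a, ContDiffOn ℝ ∞ (B a) (W ×ˢ univ))
    (hO' : ∀ a b, ∀ φ, ∀ z ∈ W,
      omegaCoeff ν Ω x₀ f a b z φ = O a b (z, jetCoord p (secCoord x₀ φ) z))
    (hA' : ∀ a, ∀ φ, ∀ z ∈ W, srcCoeff (eulerLagrange α) x₀ (Module.finBasis ℝ F a) z φ
      = A a (z, jetCoord p (secCoord x₀ φ) z))
    (hB' : ∀ a, ∀ φ, ∀ z ∈ W, srcCoeff (eulerLagrange β) x₀ (Module.finBasis ℝ F a) z φ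
      = B a (z, jetCoord p (secCoord x₀ φ) z)) :
    IsLagrangian (bracketForm ν Ω α β) x₀ W fun w =>
      (∑ a, ∑ b, O a b w * (A a w * B b w)) * chartCoeff x₀ ν.toForm w.1 := by
  refine ⟨hW, hWs.trans inter_subset_left, ?_, fun φ z hz => ?_⟩
  · refine ContDiffOn.mul (ContDiffOn.sum fun a _ => ContDiffOn.sum fun b _ =>
      (hO a b).mul ((hA a).mul (hB b))) ?_
    exact ((ν.contDiffOn_coeff x₀).mono fun z hz => (hWs hz).1.1).comp contDiffOn_fst
      fun w hw => hw.1
  · rw [chartCoeff_bracketForm, bracketTensor_eq_sum (ν := ν) Ω hf (hWs hz).1 (hWs hz).2 φ]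
    simp only [hO' _ _ φ z hz, hA' _ φ z hz, hB' _ φ z hz]

/-- Each summand contains a product `A a * B b` of two factors that vanish at `w`, so it vanishes
there to second order. -/
lemma fderiv_mul_mul_eq_zero {E : Type*} [NormedAddCommGroup E] [NormedSpace ℝ E] {ι : Type*}
    [Fintype ι] {O : ι → ι → E → ℝ} {A B : ι → E → ℝ} {N : E → ℝ} {w : E}
    (hO : ∀ a b, DifferentiableAt ℝ (O a b) w) (hA : ∀ a, DifferentiableAt ℝ (A a) w)
    (hB : ∀ a, DifferentiableAt ℝ (B a) w) (hN : DifferentiableAt ℝ N w)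
    (hA0 : ∀ a, A a w = 0) (hB0 : ∀ a, B a w = 0) :
    fderiv ℝ (fun w => (∑ a, ∑ b, O a b w * (A a w * B b w)) * N w) w = 0 := by
  have h1 : ∀ a b, HasFDerivAt (fun w => O a b w * (A a w * B b w)) (0 : E →L[ℝ] ℝ) w := by
    intro a b
    have := (hO a b).hasFDerivAt.mul ((hA a).hasFDerivAt.mul (hB b).hasFDerivAt)
    rw [Pi.mul_apply, hA0, hB0] at this
    simp only [mul_zero, zero_smul, add_zero, smul_zero] at this
    exact this
  have h2 := (HasFDerivAt.fun_sum fun a (_ : a ∈ Finset.univ) =>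
    HasFDerivAt.fun_sum fun b (_ : b ∈ Finset.univ) => h1 a b).mul hN.hasFDerivAt
  refine HasFDerivAt.fderiv ?_
  have h3 : ∑ a, ∑ b, O a b w * (A a w * B b w) = 0 := by simp [hA0]
  have h4 : (0 : E →L[ℝ] ℝ) = (∑ a, ∑ b, O a b w * (A a w * B b w)) • fderiv ℝ N w
      + N w • ∑ a : ι, ∑ b : ι, (0 : E →L[ℝ] ℝ) := by rw [h3]; simp
  rw [h4]
  exact h2

/-- The Lagrangian is bilinear in the components of `E(α)` and `E(β)`, so its derivatives in jet
directions vanish along the section where both do. Vanishing of one alone would not suffice, since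
jet directions leave the given section. -/
lemma eulerLagrange_bracketForm_eq_zero {α β : HForm n F V n} (hα : IsLocalForm α)
    (hβ : IsLocalForm β) {φ : Sec n F V} {x : M} (h1 : ∀ᶠ y in 𝓝 x, eulerLagrange α (jet φ y) = 0)
    (h2 : ∀ᶠ y in 𝓝 x, eulerLagrange β (jet φ y) = 0) :
    eulerLagrange (bracketForm ν Ω α β) (jet φ x) = 0 := by
  have hxr := mem_chartRegion_self (n := n) (F := F) (V := V) x
  have hzd := chart_mem_chartDom hxr
  obtain ⟨f, hf, hf1⟩ := exists_test_eq_one (F := F) (isOpen_chartDom (F := F) (V := V) x) hzd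
  obtain ⟨p₁, hp₁⟩ := exists_jetFn_omegaCoeff (ν := ν) Ω hf
  obtain ⟨p₂, hp₂⟩ := exists_jetFn_srcCoeff hα
  obtain ⟨p₃, hp₃⟩ := exists_jetFn_srcCoeff hβ
  let W : Set (Model n) := chartDom n F V x ∩ {z | f z ≠ 0}
  have hW : IsOpen W := (isOpen_chartDom x).inter
    (isOpen_ne_fun hf.smooth.continuous continuous_const)
  have hzW : extChartAt (𝓡 n) x x ∈ W :=
    ⟨hzd, by rw [mem_ofPred_eq, hf1.self_of_nhds]; exact one_ne_zero⟩
  choose O hO hO' using fun a b => (hp₁ a b).mono (le_max_left p₁ (max p₂ p₃))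
  choose A hA hA' using fun a => ((hp₂ x (Module.finBasis ℝ F a)).mono
    ((le_max_left p₂ p₃).trans (le_max_right p₁ (max p₂ p₃)))).mono_set
    (inter_subset_left : W ⊆ _)
  choose B hB hB' using fun a => ((hp₃ x (Module.finBasis ℝ F a)).mono
    ((le_max_right p₂ p₃).trans (le_max_right p₁ (max p₂ p₃)))).mono_set
    (inter_subset_left : W ⊆ _)
  have hL := exists_isLagrangian_bracketForm ν hf (α := α) (β := β) hW subset_rfl hO hA hB
    hO' hA' hB'
  refine src_eq_of_srcCoeff (δ := 0) hxr fun v => ?_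
  rw [srcCoeff_eulerLagrange (isLocalForm_bracketForm ν Ω hα hβ) hL hzW, srcCoeff_zero,
    eulerExpr_zero_of_jetPartial]
  · rfl
  have hcont := continuousAt_extChartAt_symm (I := 𝓡 n) x
  have hback : (extChartAt (𝓡 n) x).symm (extChartAt (𝓡 n) x x) = x :=
    (extChartAt (𝓡 n) x).left_inv hxr.1
  rw [ContinuousAt, hback] at hcont
  filter_upwards [hW.mem_nhds hzW, hcont.eventually h1, hcont.eventually h2] with y hy hy1 hy2 I
  have hm : W ×ˢ (univ : Set (JetCoord n (max p₁ (max p₂ p₃)) F)) ∈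
      𝓝 (y, jetCoord (max p₁ (max p₂ p₃)) (secCoord x φ) y) :=
    (hW.prod isOpen_univ).mem_nhds ⟨hy, mem_univ _⟩
  rw [jetPartial, fderiv_mul_mul_eq_zero]
  · rfl
  · exact fun a b => ((hO a b).contDiffAt hm).differentiableAt (by simp)
  · exact fun a => ((hA a).contDiffAt hm).differentiableAt (by simp)
  · exact fun a => ((hB a).contDiffAt hm).differentiableAt (by simp)
  · have h3 : ContDiffOn ℝ ∞ (fun w : Model n × JetCoord n (max p₁ (max p₂ p₃)) F =>
        chartCoeff x ν.toForm w.1) (W ×ˢ univ) :=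
      ((ν.contDiffOn_coeff x).mono fun z hz => hz.1.1).comp contDiffOn_fst fun w hw => hw.1
    exact (h3.contDiffAt hm).differentiableAt (by simp)
  · exact fun a => (hA' a φ y hy).symm.trans (srcCoeff_eq_zero _ hy1)
  · exact fun a => (hB' a φ y hy).symm.trans (srcCoeff_eq_zero _ hy2)

lemma eventually_eq_zero_of_notMem_closure {Y : M → Type*} [∀ x, Zero (Y x)] {b : ∀ x, Y x}
    {x : M} (h : x ∉ closure {y | b y ≠ 0}) : ∀ᶠ y in 𝓝 x, b y = 0 := by
  filter_upwards [isClosed_closure.isOpen_compl.mem_nhds h] with y hy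
  by_contra h0
  exact hy (subset_closure h0)

/-- The bracket of compactly supported forms is compactly supported. -/
theorem isCompactForm_bracketForm {α β : HForm n F V n} (hα : IsCompactForm α)
    (hβ : IsCompactForm β) : IsCompactForm (bracketForm ν Ω α β) := by
  rw [isCompactForm_iff] at hα hβ ⊢
  refine ⟨isLocalForm_bracketForm ν Ω hα.1 hβ.1, fun φ hφ => ?_, fun φ hφ => ?_⟩
  · refine isCompact_closure_of_subset (hα.2.2 φ hφ) fun x hx => subset_closure ?_
    exact fun h => hx (bracketForm_eq_zero_left ν Ω h)
  · refine isCompact_closure_of_subset ((hα.2.2 φ hφ).union (hβ.2.2 φ hφ)) fun x hx => ?_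
    by_contra hc
    rw [mem_union, not_or] at hc
    exact hx (eulerLagrange_bracketForm_eq_zero ν Ω hα.1 hβ.1
      (eventually_eq_zero_of_notMem_closure (b := fun y => eulerLagrange α (jet φ y)) hc.1)
      (eventually_eq_zero_of_notMem_closure (b := fun y => eulerLagrange β (jet φ y)) hc.2))

end Bracket

/-! ### Naturality under bundle automorphisms -/

section Equivariance

variable {n : ℕ} {F : Type*} [NormedAddCommGroup F] [NormedSpace ℝ F]
  {M : Type*} [TopologicalSpace M] [ChartedSpace (Model n) M]
  {V : M → Type*} [TopologicalSpace (TotalSpace F V)] [∀ x, AddCommGroup (V x)]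
  [∀ x, Module ℝ (V x)] [∀ x, TopologicalSpace (V x)] [FiberBundle F V] [VectorBundle ℝ F V]
  {X : Type*} [NormedAddCommGroup X] [NormedSpace ℝ X]
  {G : Type*} [Group G] (ρ : FiberAction n F V G)

lemma apply_jet_congr {k : ℕ} (α : HForm n F V k) {φ χ : Sec n F V} {x : M}
    (h : jet φ x = jet χ x) : (α (jet φ x) : Cov n k x) = α (jet χ x) :=
  eq_of_heq (congr_arg_heq α h)

namespace FiberAction

/-- The automorphism `ψ_g` in the coordinates at `x₀`. -/
def actCoord (g : G) (x₀ : M) (w : Model n × F) : F :=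
  (trivializationAt F V x₀ ⟨(extChartAt (𝓡 n) x₀).symm w.1,
    ρ.act g _ ((trivializationAt F V x₀).symm ((extChartAt (𝓡 n) x₀).symm w.1) w.2)⟩).2

lemma secCoord_onSec (g : G) {x₀ : M} (φ : Sec n F V) {z : Model n}
    (hz : z ∈ chartDom n F V x₀) :
    secCoord x₀ (ρ.onSec g φ) z = ρ.actCoord g x₀ (z, secCoord x₀ φ z) := by
  have h := (trivializationAt F V x₀).symm_apply_apply_mk hz.2 (φ ((extChartAt (𝓡 n) x₀).symm z))
  unfold actCoord secCoord
  rw [h]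
  rfl

lemma onSec_one (φ : Sec n F V) : ρ.onSec 1 φ = φ := by
  ext x
  exact ρ.one_act x _

variable [IsManifold (𝓡 n) ∞ M] [ContMDiffVectorBundle ∞ F V (𝓡 n)]

lemma contDiffOn_actCoord (g : G) (x₀ : M) :
    ContDiffOn ℝ ∞ (ρ.actCoord g x₀) (chartDom n F V x₀ ×ˢ univ) := by
  rw [← contMDiffOn_iff_contDiffOn]
  have h1 : ContMDiffOn 𝓘(ℝ, Model n × F) ((𝓡 n).prod 𝓘(ℝ, F)) ∞
      (fun w : Model n × F => ((extChartAt (𝓡 n) x₀).symm w.1, w.2)) (chartDom n F V x₀ ×ˢ univ) :=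
    ((contMDiffOn_extChartAt_symm x₀).comp contDiff_fst.contMDiff.contMDiffOn
      fun w hw => hw.1.1).prodMk contDiff_snd.contMDiff.contMDiffOn
  have h2 : ContMDiffOn 𝓘(ℝ, Model n × F) ((𝓡 n).prod 𝓘(ℝ, F)) ∞
      (fun w : Model n × F => (⟨(extChartAt (𝓡 n) x₀).symm w.1,
        (trivializationAt F V x₀).symm ((extChartAt (𝓡 n) x₀).symm w.1) w.2⟩ : TotalSpace F V))
      (chartDom n F V x₀ ×ˢ univ) := by
    have := (Trivialization.contMDiffOn_symm (IB := 𝓡 n) (n := ∞) (trivializationAt F V x₀)).comp h1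
      (fun w hw => (trivializationAt F V x₀).mem_target.2 hw.1.2)
    refine this.congr fun w hw => ?_
    exact (trivializationAt F V x₀).mk_symm hw.1.2 w.2
  have h3 := (Trivialization.contMDiffOn (IB := 𝓡 n) (n := ∞) (trivializationAt F V x₀)).comp
    ((ρ.smooth g).comp_contMDiffOn h2)
    (fun w hw => (trivializationAt F V x₀).mem_source.2 hw.1.2)
  exact contMDiff_snd.comp_contMDiffOn h3

lemma jetFn_jetCoord_onSec (g : G) (x₀ : M) (p : ℕ) :
    JetFn (S := Sec n F V) (secCoord x₀) id (chartDom n F V x₀) (n * p)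
      fun z φ => jetCoord p (secCoord x₀ (ρ.onSec g φ)) z := by
  have h0 : JetFn (S := Sec n F V) (secCoord x₀) id (chartDom n F V x₀) 0
      fun z φ => ρ.actCoord g x₀ (z, secCoord x₀ φ z) :=
    JetFn.field.comp (ρ.contDiffOn_actCoord g x₀)
  refine JetFn.pi fun I => ?_
  have h1 := ((secFrame x₀).partialMulti h0 fun i => (I i : ℕ)).mono
    (show 0 + ∑ i, (I i : ℕ) ≤ n * p by rw [zero_add]; exact sum_le_of_le I)
  refine h1.congr fun φ z hz => ?_
  exact (partialMulti_eventuallyEq (eventuallyEq_of_mem ((isOpen_chartDom x₀).mem_nhds hz)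
    fun y hy => ρ.secCoord_onSec g φ hy) _).self_of_nhds

lemma jetFn_onSec (g : G) {x₀ : M} {p : ℕ} {W : Set (Model n)} (hW : W ⊆ chartDom n F V x₀)
    {c : Model n → Sec n F V → X}
    (h : JetFn (secCoord x₀) id W p c) :
    JetFn (secCoord x₀) id W (n * p) fun z φ => c z (ρ.onSec g φ) := by
  obtain ⟨A, hA, hA'⟩ := h
  exact (((ρ.jetFn_jetCoord_onSec g x₀ p).mono_set hW).comp hA).congr
    fun φ z hz => hA' (ρ.onSec g φ) z hz

/-- By the chain rule the derivatives of `ψ_g ∘ φ` are functions of the jet of `φ`, so the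
prolongation is independent of the representing section. -/
lemma jet_onSec_congr (g : G) {φ χ : Sec n F V} {x : M} (h : jet φ x = jet χ x) :
    jet (ρ.onSec g φ) x = jet (ρ.onSec g χ) x := by
  have hx := mem_chartRegion_self (n := n) (F := F) (V := V) x
  refine jet_eq_of_jetCoord fun p => ?_
  refine (ρ.jetFn_jetCoord_onSec g x p).eq_of_jet_eq subset_rfl (chart_mem_chartDom hx) ?_
  rw [(extChartAt (𝓡 n) x).left_inv hx.1, h]

lemma prolong_jet (g : G) (φ : Sec n F V) (x : M) :
    ρ.prolong g (jet φ x) = jet (ρ.onSec g φ) x :=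
  ρ.jet_onSec_congr g (jet_section (jet φ x))

lemma pull_jet {k : ℕ} (g : G) (α : HForm n F V k) (φ : Sec n F V) (x : M) :
    (ρ.pull g α (jet φ x) : Cov n k x) = α (jet (ρ.onSec g φ) x) :=
  apply_jet_congr α (ρ.prolong_jet g φ x)

lemma pullSec_pull {k : ℕ} (g : G) (α : HForm n F V k) (φ : Sec n F V) :
    pullSec (ρ.pull g α) φ = pullSec α (ρ.onSec g φ) := funext fun x => ρ.pull_jet g α φ x

lemma pull_one {k : ℕ} (α : HForm n F V k) : ρ.pull 1 α = α := by
  funext j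
  refine jet_base_section j (P := fun j => ρ.pull 1 α j = α j) fun φ x => ?_
  refine (ρ.pull_jet 1 α φ x).trans ?_
  rw [ρ.onSec_one]

lemma isLocalForm_pull {k : ℕ} (g : G) {α : HForm n F V k} (hα : IsLocalForm α) :
    IsLocalForm (ρ.pull g α) := by
  obtain ⟨p, hp⟩ := isLocalForm_iff.1 hα
  refine isLocalForm_iff.2 ⟨n * p, fun x₀ => ?_⟩
  refine (ρ.jetFn_onSec g subset_rfl (hp x₀)).congr fun φ z _ => ?_
  rw [ρ.pullSec_pull]

lemma dH_pull {k : ℕ} (g : G) {α : HForm n F V k} (hα : IsLocalForm α) :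
    dH (ρ.pull g α) = ρ.pull g (dH α) := by
  funext j
  refine jet_base_section j (P := fun j => dH (ρ.pull g α) j = ρ.pull g (dH α) j) fun φ x => ?_
  refine (dH_jet (ρ.isLocalForm_pull g hα) φ x).trans ?_
  refine Eq.trans ?_ (ρ.pull_jet g (dH α) φ x).symm
  rw [dH_jet hα, ρ.pullSec_pull]

/-- The derivative of `ψ_g` along the fibres at `φ`, in the coordinates at `x₀`. -/
def fibreDeriv (g : G) (x₀ : M) (φ : Sec n F V) (z : Model n) : F →L[ℝ] F :=
  (fderiv ℝ (ρ.actCoord g x₀) (z, secCoord x₀ φ z)).comp (ContinuousLinearMap.inr ℝ (Model n) F)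

lemma contDiffOn_fibreDeriv (g : G) (x₀ : M) (φ : Sec n F V) :
    ContDiffOn ℝ ∞ (ρ.fibreDeriv g x₀ φ) (chartDom n F V x₀) := by
  have h1 : ContDiffOn ℝ ∞ (fderiv ℝ (ρ.actCoord g x₀)) (chartDom n F V x₀ ×ˢ univ) :=
    (ρ.contDiffOn_actCoord g x₀).fderiv_of_isOpen ((isOpen_chartDom x₀).prod isOpen_univ)
      (m := ∞) (by simp)
  have h2 : ContDiffOn ℝ ∞ (fun z => fderiv ℝ (ρ.actCoord g x₀) (z, secCoord x₀ φ z))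
      (chartDom n F V x₀) :=
    h1.comp (contDiffOn_id.prodMk (secCoord_contDiffOn φ x₀)) (fun z hz => ⟨hz, mem_univ _⟩)
  exact h2.clm_comp contDiffOn_const

variable [FiniteDimensional ℝ F] [T2Space M]

/-- The Euler–Lagrange operator is natural under `ψ_g`. -/
theorem srcCoeff_eulerLagrange_pull (g : G) {α : HForm n F V n} (hα : IsLocalForm α) {x₀ : M}
    {z : Model n} (hz : z ∈ chartDom n F V x₀) (φ : Sec n F V) (e : F) :
    srcCoeff (eulerLagrange (ρ.pull g α)) x₀ e z φ
      = srcCoeff (eulerLagrange α) x₀ (ρ.fibreDeriv g x₀ φ z e) z (ρ.onSec g φ) := by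
  have hdet : (ContinuousLinearMap.id ℝ (Model n)).det = 1 := LinearMap.det_id
  obtain ⟨q, hq⟩ := exists_isLagrangian hα
  obtain ⟨p, hp⟩ := exists_isLagrangian (ρ.isLocalForm_pull g hα)
  obtain ⟨L₁, h₁⟩ := hq x₀
  obtain ⟨L₀, h₀⟩ := hp x₀
  rw [srcCoeff_eulerLagrange hα h₁ hz, srcCoeff_eulerLagrange (ρ.isLocalForm_pull g hα) h₀ hz]
  have hW := isOpen_chartDom (n := n) (F := F) (V := V) x₀
  have hu := secCoord_contDiffOn φ x₀
  -- The automorphism covers the identity, so only the dependent variable changes, and a variation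
  -- `v` of `φ` becomes the variation of `ψ_g ∘ φ` given by the fibre derivative.
  have key := eulerExpr_transform hW hW (T := fun z => z) (R := fun z => z) contDiffOn_id
    contDiffOn_id (mapsTo_id _) (fun _ _ => rfl) (fun _ _ => rfl) h₀.smooth h₁.smooth hu
    (secCoord_contDiffOn (ρ.onSec g φ) x₀) (ρ.contDiffOn_fibreDeriv g x₀ φ) ?_ hz e
  · simpa [hdet] using key
  intro v v₁ hv hv₁ hvv y hy
  rw [fderiv_fun_id]
  rw [hdet, one_mul]
  let χ : ℝ → Sec n F V := fun t => t • extendSec x₀ v hv + φ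
  have hχ : ∀ t, EqOn (secCoord x₀ (χ t)) (fun y => t • v y + secCoord x₀ φ y)
      (chartDom n F V x₀) := fun t y hy => by
    rw [secCoord_comb t _ φ hy, secCoord_extendSec hv hy]
  -- The coordinates of `ψ_g` applied to the family `φ + t v`. It is not affine in `t`, because the
  -- automorphism need not be linear on fibres, so only its derivative at `t = 0` is used.
  let H : ℝ × Model n → F := fun a =>
    ρ.actCoord g x₀ (a.2, a.1 • v a.2 + secCoord x₀ φ a.2)
  have hin : ContDiffOn ℝ ∞ (fun a : ℝ × Model n => (a.2, a.1 • v a.2 + secCoord x₀ φ a.2))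
      (univ ×ˢ chartDom n F V x₀) :=
    contDiffOn_snd.prodMk ((contDiffOn_fst.smul (hv.smooth.comp contDiff_snd).contDiffOn).add
      (hu.comp contDiffOn_snd fun a ha => ha.2))
  have hH : ContDiffOn ℝ ∞ H (univ ×ˢ chartDom n F V x₀) :=
    (ρ.contDiffOn_actCoord g x₀).comp hin fun a ha => ⟨ha.2, mem_univ _⟩
  have hHd : ∀ y ∈ chartDom n F V x₀, fderiv ℝ H (0, y) (1, 0) = v₁ y := by
    intro y hy
    have ha : DifferentiableAt ℝ (ρ.actCoord g x₀) (y, secCoord x₀ φ y) :=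
      ((ρ.contDiffOn_actCoord g x₀).contDiffAt ((hW.prod isOpen_univ).mem_nhds
        ⟨hy, mem_univ _⟩)).differentiableAt (by simp)
    have hHy : DifferentiableAt ℝ H (0, y) :=
      (hH.contDiffAt ((isOpen_univ.prod hW).mem_nhds ⟨mem_univ _, hy⟩)).differentiableAt (by simp)
    have hd1 : HasDerivAt (fun t : ℝ => H (t, y)) (fderiv ℝ H (0, y) (1, 0)) 0 := by
      have hc : HasDerivAt (fun t : ℝ => (t, y)) ((1 : ℝ), (0 : Model n)) 0 :=
        (hasDerivAt_id (0 : ℝ)).prodMk (hasDerivAt_const (0 : ℝ) y)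
      exact hHy.hasFDerivAt.comp_hasDerivAt (0 : ℝ) hc
    have hd2 : HasDerivAt (fun t : ℝ => H (t, y)) (ρ.fibreDeriv g x₀ φ y (v y)) 0 := by
      have hl : HasDerivAt (fun t : ℝ => t • v y + secCoord x₀ φ y) (v y) 0 := by
        simpa using ((hasDerivAt_id (0 : ℝ)).smul_const (v y)).add_const (secCoord x₀ φ y)
      have hc : HasDerivAt (fun t : ℝ => (y, t • v y + secCoord x₀ φ y)) ((0 : Model n), v y) 0 :=
        (hasDerivAt_const (0 : ℝ) y).prodMk hl
      have ha' : HasFDerivAt (ρ.actCoord g x₀) (fderiv ℝ (ρ.actCoord g x₀) (y, secCoord x₀ φ y))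
          ((fun t : ℝ => (y, t • v y + secCoord x₀ φ y)) 0) := by
        simpa using ha.hasFDerivAt
      exact ha'.comp_hasDerivAt (0 : ℝ) hc
    rw [hd1.unique hd2, hvv y hy]
  have hjet1 : jetCoord q (fun y => fderiv ℝ H (0, y) (1, 0)) y = jetCoord q v₁ y :=
    (jetCoord_eventuallyEq (eventuallyEq_of_mem (hW.mem_nhds hy) hHd) q).self_of_nhds
  have hH0 : jetCoord q (fun y => H (0, y)) y = jetCoord q (secCoord x₀ (ρ.onSec g φ)) y := by
    refine (jetCoord_eventuallyEq (eventuallyEq_of_mem (hW.mem_nhds hy) fun y hy => ?_)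
      q).self_of_nhds
    rw [ρ.secCoord_onSec g φ hy]
    simp [H]
  have hR := hasDerivAt_comp_jet hW h₁.smooth hy (hasDerivAt_jetCoord (p := q) hW hH 0 hy)
  rw [hH0, hjet1] at hR
  have hγ : HasDerivAt (fun t : ℝ => t • jetCoord p v y + jetCoord p (secCoord x₀ φ) y)
      (jetCoord p v y) 0 := by
    simpa using ((hasDerivAt_id (0 : ℝ)).smul_const (jetCoord p v y)).add_const
      (jetCoord p (secCoord x₀ φ) y)
  have hL := hasDerivAt_comp_jet hW h₀.smooth hy hγ
  rw [zero_smul, zero_add] at hL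
  refine hL.unique (hR.congr_of_eventuallyEq (Eventually.of_forall fun t => ?_))
  have e1 : t • jetCoord p v y + jetCoord p (secCoord x₀ φ) y
      = jetCoord p (secCoord x₀ (χ t)) y := by
    rw [← jetCoord_comb hW hv.smooth.contDiffOn hu t p hy]
    exact (jetCoord_eventuallyEq (eventuallyEq_of_mem (hW.mem_nhds hy) (hχ t)) p).self_of_nhds.symm
  have e2 : jetCoord q (fun y => H (t, y)) y = jetCoord q (secCoord x₀ (ρ.onSec g (χ t))) y := by
    refine (jetCoord_eventuallyEq (eventuallyEq_of_mem (hW.mem_nhds hy) fun y hy => ?_)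
      q).self_of_nhds
    rw [ρ.secCoord_onSec g _ hy, hχ t hy]
  beta_reduce
  rw [e1, e2, ← h₀.eq (χ t) y hy, ← h₁.eq (ρ.onSec g (χ t)) y hy, ρ.pullSec_pull]

end FiberAction

end Equivariance

/-! ### From canonical automorphisms to pointwise equivariance of the bracket -/

section Canonical

variable {n : ℕ} {F : Type*} [NormedAddCommGroup F] [NormedSpace ℝ F]
  {M : Type*} [TopologicalSpace M] [ChartedSpace (Model n) M]
  {V : M → Type*} [TopologicalSpace (TotalSpace F V)] [∀ x, AddCommGroup (V x)]
  [∀ x, Module ℝ (V x)] [∀ x, TopologicalSpace (V x)] [FiberBundle F V] [VectorBundle ℝ F V]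
  [IsManifold (𝓡 n) ∞ M] [ContMDiffVectorBundle ∞ F V (𝓡 n)] [FiniteDimensional ℝ F] [T2Space M]
  [SigmaCompactSpace M] (ν : VolumeForm n M) (Ω : BracketTensor n F V)

lemma functional_eq_integral {γ : HForm n F V n} {φ : Sec n F V} {x₀ : M} {s : ℝ}
    (hs : s = 1 ∨ s = -1) {W : Set (Model n)} (hW : W ⊆ chartDom n F V x₀ ∩ signSet ν x₀ s)
    {f h : Model n → ℝ} (hf : IsTest W f) (hh : ContinuousOn h W)
    (hγ : ∀ z ∈ W, chartCoeff x₀ (pullSec γ φ) z = f z * h z)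
    (h0 : ∀ x ∉ (extChartAt (𝓡 n) x₀).symm '' tsupport f, γ (jet φ x) = 0) :
    functional ν γ φ = s * ∫ z, f z * h z := by
  refine integralM_eq_of_sign ν (x₀ := x₀) (K := tsupport f) hf.compact
    (fun z hz => (hW (hf.subset hz)).1.1) h0
    (fun z hz => orientSign_eq ν hs (hW (hf.subset hz)).2)
    (hf.smooth.continuous.continuousOn.mul (hh.mono hf.subset))
    (fun z hz => hγ z (hf.subset hz)) fun z hz => ?_
  rw [image_eq_zero_of_notMem_tsupport hz, zero_mul]

lemma IsLocalForm.contDiffOn_chartCoeff {γ : HForm n F V n} (hγ : IsLocalForm γ) (φ : Sec n F V)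
    (x₀ : M) : ContDiffOn ℝ ∞ (chartCoeff x₀ (pullSec γ φ)) (chartDom n F V x₀) :=
  (topEval n).contDiff.comp_contDiffOn (hγ.contDiffOn φ x₀)

namespace FiberAction

variable {ν Ω} {G : Type*} [Group G] (ρ : FiberAction n F V G) {x₀ : M} {f f₁ : Model n → ℝ}

/-- By naturality the cut-off enters the pulled-back Euler–Lagrange form as a mere factor, so
changing it from `f` to `f₁` multiplies by the quotient. -/
lemma eulerLagrange_pull_frameForm (g : G) (hf : IsTest (chartDom n F V x₀) f)
    (hf₁ : IsTest (chartDom n F V x₀) f₁) (ℓ : F →L[ℝ] ℝ) {z : Model n}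
    (hz : z ∈ chartDom n F V x₀) (hfz : f z ≠ 0) (φ : Sec n F V) :
    eulerLagrange (ρ.pull g (frameForm F V ν x₀ f₁ ℓ)) (jet φ ((extChartAt (𝓡 n) x₀).symm z))
      = (f₁ z / f z) • eulerLagrange (ρ.pull g (frameForm F V ν x₀ f ℓ))
        (jet φ ((extChartAt (𝓡 n) x₀).symm z)) := by
  have hb : extChartAt (𝓡 n) x₀ ((extChartAt (𝓡 n) x₀).symm z) = z :=
    (extChartAt (𝓡 n) x₀).right_inv hz.1
  have := src_eq_of_srcCoeff (ε := eulerLagrange (ρ.pull g (frameForm F V ν x₀ f₁ ℓ)))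
    (δ := (f₁ z / f z) • eulerLagrange (ρ.pull g (frameForm F V ν x₀ f ℓ)) + 0)
    (symm_mem_chartRegion hz) (φ := φ) fun v => by
      rw [hb, srcCoeff_comb, srcCoeff_zero,
        ρ.srcCoeff_eulerLagrange_pull g (isLocalForm_frameForm hf₁ ℓ) hz,
        ρ.srcCoeff_eulerLagrange_pull g (isLocalForm_frameForm hf ℓ) hz,
        srcCoeff_frameForm hf₁ ℓ hz, srcCoeff_frameForm hf ℓ hz]
      field_simp
      ring
  rw [add_zero] at this
  exact this

/-- The functional is exhibited as an integral of the test function `f₁` against a coefficient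
independent of `f₁`. This is the shape required by the fundamental lemma. -/
lemma functional_bracketForm_pull (g : G) {s : ℝ} (hs : s = 1 ∨ s = -1) {W : Set (Model n)}
    (hW : W ⊆ (chartDom n F V x₀ ∩ signSet ν x₀ s) ∩ {z | f z ≠ 0})
    (hf : IsTest (chartDom n F V x₀) f) (hf₁ : IsTest W f₁) (ℓ : F →L[ℝ] ℝ) {β : HForm n F V n}
    (hβ : IsLocalForm β) (φ : Sec n F V) :
    functional ν (bracketForm ν Ω (ρ.pull g (frameForm F V ν x₀ f₁ ℓ)) (ρ.pull g β)) φ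
      = s * ∫ z, f₁ z * (chartCoeff x₀ (pullSec (bracketForm ν Ω
        (ρ.pull g (frameForm F V ν x₀ f ℓ)) (ρ.pull g β)) φ) z / f z) := by
  have hf₁' := hf₁.mono (hW.trans (inter_subset_left.trans inter_subset_left))
  refine functional_eq_integral ν hs (hW.trans inter_subset_left) hf₁ ?_ ?_ ?_
  · refine ((isLocalForm_bracketForm ν Ω (ρ.isLocalForm_pull g (isLocalForm_frameForm hf ℓ))
      (ρ.isLocalForm_pull g hβ)).contDiffOn_chartCoeff φ x₀).continuousOn.mono
      (hW.trans (inter_subset_left.trans inter_subset_left)) |>.div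
      hf.smooth.continuous.continuousOn fun z hz => (hW hz).2
  · intro z hz
    rw [chartCoeff_bracketForm, chartCoeff_bracketForm,
      ρ.eulerLagrange_pull_frameForm g hf hf₁' ℓ (hW hz).1.1 (hW hz).2, map_smul,
      LinearMap.smul_apply, smul_eq_mul]
    have := (hW hz).2
    rw [mem_ofPred_eq] at this
    field_simp
  · intro x hx
    refine bracketForm_eq_zero_left ν Ω ?_
    have hN : IsOpen ((extChartAt (𝓡 n) x₀).symm '' tsupport f₁)ᶜ :=
      (isCompact_symm_image hf₁.compact fun z hz => (hf₁'.subset hz).1).isClosed.isOpen_compl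
    refine eulerLagrange_eq_zero (ρ.isLocalForm_pull g (isLocalForm_frameForm hf₁' ℓ)) hN
      (fun j hj => ?_) hx
    exact frameForm_eq_zero (j := ρ.prolong g j) hj

/-- The canonical property is applied with an arbitrary cut-off `f₁` in the first argument and `f`
fixed in the second. Both sides are then integrals against `f₁`, so the integrands coincide. -/
lemma chartCoeff_bracketForm_pull_frameForm {g : G} (hcan : ρ.IsCanonical ν Ω g)
    (hf : IsTest (chartDom n F V x₀) f) (ℓ ℓ' : F →L[ℝ] ℝ) {z : Model n}
    (hz : z ∈ chartDom n F V x₀) (hfz : f z ≠ 0) {φ : Sec n F V} (hφ : IsCompactlySupported φ) :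
    chartCoeff x₀ (pullSec (bracketForm ν Ω (ρ.pull g (frameForm F V ν x₀ f ℓ))
        (ρ.pull g (frameForm F V ν x₀ f ℓ'))) φ) z
      = chartCoeff x₀ (pullSec (bracketForm ν Ω (frameForm F V ν x₀ f ℓ)
        (frameForm F V ν x₀ f ℓ')) (ρ.onSec g φ)) z := by
  obtain ⟨s, hs, hzs⟩ := exists_mem_signSet ν hz.1
  have hs0 : s ≠ 0 := by rcases hs with rfl | rfl <;> norm_num
  let W : Set (Model n) := (chartDom n F V x₀ ∩ signSet ν x₀ s) ∩ {z | f z ≠ 0}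
  have hW : IsOpen W := ((isOpen_chartDom x₀).inter (isOpen_signSet ν x₀ s)).inter
    (isOpen_ne_fun hf.smooth.continuous continuous_const)
  have hWd : W ⊆ chartDom n F V x₀ := inter_subset_left.trans inter_subset_left
  have hloc := fun ℓ => isLocalForm_frameForm (ν := ν) hf ℓ
  have hc1 : ContinuousOn (fun z => chartCoeff x₀ (pullSec (bracketForm ν Ω
      (ρ.pull g (frameForm F V ν x₀ f ℓ)) (ρ.pull g (frameForm F V ν x₀ f ℓ'))) φ) z / f z) W :=
    (((isLocalForm_bracketForm ν Ω (ρ.isLocalForm_pull g (hloc ℓ))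
      (ρ.isLocalForm_pull g (hloc ℓ'))).contDiffOn_chartCoeff φ x₀).continuousOn.mono hWd).div
      hf.smooth.continuous.continuousOn fun z hz => hz.2
  have hc2 : ContinuousOn (fun z => chartCoeff x₀ (pullSec (bracketForm ν Ω
      (frameForm F V ν x₀ f ℓ) (frameForm F V ν x₀ f ℓ')) (ρ.onSec g φ)) z / f z) W :=
    (((isLocalForm_bracketForm ν Ω (hloc ℓ) (hloc ℓ')).contDiffOn_chartCoeff
      (ρ.onSec g φ) x₀).continuousOn.mono hWd).div
      hf.smooth.continuous.continuousOn fun z hz => hz.2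
  have key := eq_zero_of_integral_test hW (hc1.sub hc2) (fun f₁ hf₁ => ?_) z ⟨⟨hz, hzs⟩, hfz⟩
  · have h2 : _ / f z = _ / f z := sub_eq_zero.1 key
    field_simp at h2
    exact h2
  have hint : ∀ {g : Model n → ℝ}, ContinuousOn g W → Integrable fun z => f₁ z * g z := by
    intro g hg
    refine integrable_of_continuousOn_of_compact hf₁.compact
      (hf₁.smooth.continuous.continuousOn.mul (hg.mono hf₁.subset)) fun z hz => ?_
    rw [image_eq_zero_of_notMem_tsupport hz, zero_mul]
  have h1 := ρ.functional_bracketForm_pull (Ω := Ω) g hs (W := W) subset_rfl hf hf₁ ℓ (hloc ℓ') φ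
  -- The right-hand side is the same formula for the neutral element, evaluated at the transformed
  -- section.
  have h2 := ρ.functional_bracketForm_pull (Ω := Ω) 1 hs (W := W) subset_rfl hf hf₁ ℓ (hloc ℓ')
    (ρ.onSec g φ)
  simp only [ρ.pull_one] at h2
  have h3 := hcan _ (isCompactForm_frameForm (ν := ν) (hf₁.mono hWd) ℓ) _
    (isCompactForm_frameForm (ν := ν) hf ℓ') φ hφ
  rw [h1, h2] at h3
  have h4 := mul_left_cancel₀ hs0 h3
  simp only [Pi.sub_apply, mul_sub]
  rw [integral_sub (hint hc1) (hint hc2), h4, sub_self]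

/-- Compact support of the section is removed by replacing it near the point by a compactly
supported one with the same jet. -/
lemma form_pull_frameForm {g : G} (hcan : ρ.IsCanonical ν Ω g)
    (hf : IsTest (chartDom n F V x₀) f) (ℓ ℓ' : F →L[ℝ] ℝ) {z : Model n}
    (hz : z ∈ chartDom n F V x₀) (hfz : f z ≠ 0) (φ : Sec n F V) :
    Ω.form (jet φ ((extChartAt (𝓡 n) x₀).symm z))
        (eulerLagrange (ρ.pull g (frameForm F V ν x₀ f ℓ)) _)
        (eulerLagrange (ρ.pull g (frameForm F V ν x₀ f ℓ')) _)
      = Ω.form (jet (ρ.onSec g φ) ((extChartAt (𝓡 n) x₀).symm z))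
        (eulerLagrange (frameForm F V ν x₀ f ℓ) _) (eulerLagrange (frameForm F V ν x₀ f ℓ') _) := by
  obtain ⟨χ, hχ, hχφ⟩ := exists_compactlySupported_eq φ ((extChartAt (𝓡 n) x₀).symm z)
  have h := ρ.chartCoeff_bracketForm_pull_frameForm hcan hf ℓ ℓ' hz hfz hχ
  rw [chartCoeff_bracketForm, chartCoeff_bracketForm] at h
  have h2 := mul_right_cancel₀ (ν.coeff_ne_zero hz.1) h
  rwa [jet_eq_of_eventuallyEq hχφ, ρ.jet_onSec_congr g (jet_eq_of_eventuallyEq hχφ)] at h2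

lemma _root_.LocalFunctionals.srcCoeff_congr {ε δ : Src n F V n} {x₀ : M} {z : Model n}
    {φ : Sec n F V} (v : F) (h : ε (jet φ ((extChartAt (𝓡 n) x₀).symm z))
      = δ (jet φ ((extChartAt (𝓡 n) x₀).symm z))) : srcCoeff ε x₀ v z φ = srcCoeff δ x₀ v z φ := by
  have h0 : ((-1 : ℝ) • δ + ε) (jet φ ((extChartAt (𝓡 n) x₀).symm z)) = 0 :=
    (neg_one_smul_add_eq_zero (Y := SrcFiber (k := n) (jet φ ((extChartAt (𝓡 n) x₀).symm z)))).2 h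
  have := srcCoeff_eq_zero v h0
  rw [srcCoeff_comb] at this
  linarith

/-- The bracket is equivariant under canonical automorphisms. -/
theorem bracketForm_pull {g : G} (hcan : ρ.IsCanonical ν Ω g) {α β : HForm n F V n}
    (hα : IsLocalForm α) (hβ : IsLocalForm β) :
    bracketForm ν Ω (ρ.pull g α) (ρ.pull g β) = ρ.pull g (bracketForm ν Ω α β) := by
  funext j
  refine jet_base_section j (P := fun j => bracketForm ν Ω (ρ.pull g α) (ρ.pull g β) j
    = ρ.pull g (bracketForm ν Ω α β) j) fun φ x => ?_
  refine Eq.trans ?_ (ρ.pull_jet g _ φ x).symm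
  have hxr := mem_chartRegion_self (n := n) (F := F) (V := V) x
  have hz := chart_mem_chartDom hxr
  have hb : (extChartAt (𝓡 n) x).symm (extChartAt (𝓡 n) x x) = x :=
    (extChartAt (𝓡 n) x).left_inv hxr.1
  set z := extChartAt (𝓡 n) x x with hzdef
  obtain ⟨f, hf, hf1⟩ := exists_test_eq_one (F := F) (isOpen_chartDom (F := F) (V := V) x) hz
  have hfz : f z ≠ 0 := by rw [hf1.self_of_nhds]; exact one_ne_zero
  -- The coefficients of `E(α)` in the frame at the transformed section. By naturality of `E` the
  -- same numbers express `E` of the pull-back of `α` at `φ` in the pulled-back frame, so the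
  -- identity for frames gives the general one.
  let c : HForm n F V n → Fin (Module.finrank ℝ F) → ℝ := fun α a =>
    srcCoeff (eulerLagrange α) x (Module.finBasis ℝ F a) z (ρ.onSec g φ)
      / (f z * chartCoeff x ν.toForm z)
  have h1 : ∀ α : HForm n F V n, eulerLagrange α (jet (ρ.onSec g φ) x)
      = ∑ a, c α a • frameSrc F V ν x f a (jet (ρ.onSec g φ) x) := by
    intro α
    have := src_eq_sum_frame (ν := ν) hf hz hfz (ρ.onSec g φ) (eulerLagrange α)
    rwa [hb] at this
  have h2 : ∀ {α : HForm n F V n}, IsLocalForm α → eulerLagrange (ρ.pull g α) (jet φ x)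
      = ∑ a, c α a • eulerLagrange (ρ.pull g (frameForm F V ν x f (fibreCoord F a))) (jet φ x) := by
    intro α hα
    have := src_eq_of_srcCoeff (ε := eulerLagrange (ρ.pull g α))
      (δ := ∑ a, c α a • eulerLagrange (ρ.pull g (frameForm F V ν x f (fibreCoord F a)))) hxr
      (φ := φ) fun v => by
        rw [srcCoeff_combination, ← hzdef, ρ.srcCoeff_eulerLagrange_pull g hα hz]
        have h3 := srcCoeff_congr (ε := eulerLagrange α)
          (δ := ∑ a, c α a • frameSrc F V ν x f a) (x₀ := x) (z := z) (φ := ρ.onSec g φ)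
          (ρ.fibreDeriv g x φ z v) (by
            rw [hb, h1 α]
            simp only [Finset.sum_apply]
            rfl)
        rw [h3, srcCoeff_combination]
        refine Finset.sum_congr rfl fun a _ => ?_
        rw [ρ.srcCoeff_eulerLagrange_pull g (isLocalForm_frameForm hf _) hz]
        rfl
    rw [this]
    simp only [Finset.sum_apply]
    rfl
  have h3 : Ω.form (jet φ x) (eulerLagrange (ρ.pull g α) _) (eulerLagrange (ρ.pull g β) _)
      = Ω.form (jet (ρ.onSec g φ) x) (eulerLagrange α _) (eulerLagrange β _) := by
    rw [h1 α, h1 β, h2 hα, h2 hβ]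
    simp only [map_sum, map_smul, LinearMap.sum_apply, LinearMap.smul_apply]
    refine Finset.sum_congr rfl fun a _ => congrArg _ (Finset.sum_congr rfl fun b _ =>
      congrArg _ ?_)
    have := ρ.form_pull_frameForm hcan hf (fibreCoord F b) (fibreCoord F a) hz hfz φ
    rw [hb] at this
    exact this
  change Ω.form (jet φ x) _ _ • ν.toForm x = Ω.form (jet (ρ.onSec g φ) x) _ _ • ν.toForm x
  rw [h3]

end FiberAction

end Canonical

/-! ### The Jacobiator: linearity and locality -/

section Jacobiator

variable {n : ℕ} {F : Type*} [NormedAddCommGroup F] [NormedSpace ℝ F]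
  {M : Type*} [TopologicalSpace M] [ChartedSpace (Model n) M]
  {V : M → Type*} [TopologicalSpace (TotalSpace F V)] [∀ x, AddCommGroup (V x)]
  [∀ x, Module ℝ (V x)] [∀ x, TopologicalSpace (V x)] [FiberBundle F V] [VectorBundle ℝ F V]
  [IsManifold (𝓡 n) ∞ M] [ContMDiffVectorBundle ∞ F V (𝓡 n)] [FiniteDimensional ℝ F] [T2Space M]
  [SigmaCompactSpace M] (ν : VolumeForm n M) (Ω : BracketTensor n F V)

lemma bracketForm_comb_right {β β' : HForm n F V n} (c : ℝ) (hβ : IsLocalForm β)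
    (hβ' : IsLocalForm β') (α : HForm n F V n) : bracketForm ν Ω α (c • β + β')
      = c • bracketForm ν Ω α β + bracketForm ν Ω α β' := by
  rw [bracketForm_skew, bracketForm_comb ν Ω c hβ hβ', bracketForm_skew ν Ω β α,
    bracketForm_skew ν Ω β' α, neg_add, smul_neg, neg_neg, neg_neg]

lemma bracketForm_congr {α α' β β' : HForm n F V n} (hα : IsLocalForm α) (hα' : IsLocalForm α')
    (hβ : IsLocalForm β) (hβ' : IsLocalForm β') {N : Set M} (hN : IsOpen N)
    (h : ∀ j : InfJet n F V, j.base ∈ N → α j = α' j)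
    (h' : ∀ j : InfJet n F V, j.base ∈ N → β j = β' j) (j : InfJet n F V) (hj : j.base ∈ N) :
    bracketForm ν Ω α β j = bracketForm ν Ω α' β' j := by
  revert hj
  refine jet_base_section j (P := fun j => j.base ∈ N → bracketForm ν Ω α β j
    = bracketForm ν Ω α' β' j) fun φ x hx => ?_
  have hx' : x ∈ N := hx
  change Ω.form _ _ _ • _ = Ω.form _ _ _ • _
  rw [eulerLagrange_congr hα hα' hN h hx', eulerLagrange_congr hβ hβ' hN h' hx']

/-- The Jacobiator of the bracket `l̃₂`. -/
def jacobiator (α β γ : HForm n F V n) : HForm n F V n :=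
  bracketForm ν Ω (bracketForm ν Ω α β) γ + bracketForm ν Ω (bracketForm ν Ω β γ) α
    + bracketForm ν Ω (bracketForm ν Ω γ α) β

variable {ν Ω} {α α' β γ : HForm n F V n}

lemma isLocalForm_zero {k : ℕ} : IsLocalForm (0 : HForm n F V k) := IsCompactForm.zero.1

lemma jacobiator_comb (c : ℝ) (hα : IsLocalForm α) (hα' : IsLocalForm α') (hβ : IsLocalForm β)
    (hγ : IsLocalForm γ) : jacobiator ν Ω (c • α + α') β γ
      = c • jacobiator ν Ω α β γ + jacobiator ν Ω α' β γ := by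
  unfold jacobiator
  rw [bracketForm_comb ν Ω c hα hα', bracketForm_comb_right ν Ω c hα hα',
    bracketForm_comb_right ν Ω c hα hα',
    bracketForm_comb ν Ω c (isLocalForm_bracketForm ν Ω hα hβ) (isLocalForm_bracketForm ν Ω hα' hβ),
    bracketForm_comb ν Ω c (isLocalForm_bracketForm ν Ω hγ hα) (isLocalForm_bracketForm ν Ω hγ hα')]
  simp only [smul_add]
  abel

lemma jacobiator_apply (α β γ : HForm n F V n) (j : InfJet n F V) : jacobiator ν Ω α β γ j
    = bracketForm ν Ω (bracketForm ν Ω α β) γ j + bracketForm ν Ω (bracketForm ν Ω β γ) α j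
      + bracketForm ν Ω (bracketForm ν Ω γ α) β j := rfl

lemma jacobiator_congr (hα : IsLocalForm α) (hα' : IsLocalForm α') (hβ : IsLocalForm β)
    (hγ : IsLocalForm γ) {N : Set M} (hN : IsOpen N)
    (h : ∀ j : InfJet n F V, j.base ∈ N → α j = α' j) (j : InfJet n F V) (hj : j.base ∈ N) :
    jacobiator ν Ω α β γ j = jacobiator ν Ω α' β γ j := by
  have h1 := bracketForm_congr ν Ω (isLocalForm_bracketForm ν Ω hα hβ)
    (isLocalForm_bracketForm ν Ω hα' hβ) hγ hγ hN (bracketForm_congr ν Ω hα hα' hβ hβ hN h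
      fun _ _ => rfl) (fun _ _ => rfl) j hj
  have h2 := bracketForm_congr ν Ω (isLocalForm_bracketForm ν Ω hβ hγ)
    (isLocalForm_bracketForm ν Ω hβ hγ) hα hα' hN (fun _ _ => rfl) h j hj
  have h3 := bracketForm_congr ν Ω (isLocalForm_bracketForm ν Ω hγ hα)
    (isLocalForm_bracketForm ν Ω hγ hα') hβ hβ hN (bracketForm_congr ν Ω hγ hγ hα hα' hN
      (fun _ _ => rfl) h) (fun _ _ => rfl) j hj
  rw [jacobiator_apply, jacobiator_apply, h1, h2, h3]

lemma jacobiator_zero : jacobiator ν Ω 0 β γ = 0 := by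
  have h0 : ∀ β : HForm n F V n, bracketForm ν Ω 0 β = 0 := fun β => by
    funext j
    refine bracketForm_eq_zero_left ν Ω ?_
    rw [eulerLagrange_zero]
    rfl
  unfold jacobiator
  rw [bracketForm_skew ν Ω γ 0, bracketForm_skew ν Ω _ 0, h0, h0, h0, neg_zero, h0]
  simp

/-- The three terms contain `E(γ)`, `E` of the bracket of `β` and `γ`, and `E(β)`, respectively.
Since `α` plays no role, `β` and `γ` alone control the support of the primitive. -/
lemma jacobiator_eq_zero_of_eventually (hβ : IsLocalForm β) (hγ : IsLocalForm γ) {φ : Sec n F V}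
    {x : M} (h1 : ∀ᶠ y in 𝓝 x, eulerLagrange β (jet φ y) = 0)
    (h2 : ∀ᶠ y in 𝓝 x, eulerLagrange γ (jet φ y) = 0) (α : HForm n F V n) :
    jacobiator ν Ω α β γ (jet φ x) = 0 := by
  rw [jacobiator_apply, bracketForm_eq_zero_right ν Ω h2.self_of_nhds, bracketForm_eq_zero_right ν Ω h1.self_of_nhds,
    bracketForm_eq_zero_left ν Ω (eulerLagrange_bracketForm_eq_zero ν Ω hβ hγ h1 h2)]
  simp

end Jacobiator

/-! ### Dependence of the Jacobiator on the jet of a test function -/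

section JointEuler

variable {n : ℕ} {F : Type*} [NormedAddCommGroup F] [NormedSpace ℝ F]
  {M : Type*} [TopologicalSpace M] [ChartedSpace (Model n) M]
  {V : M → Type*} [TopologicalSpace (TotalSpace F V)] [∀ x, AddCommGroup (V x)]
  [∀ x, Module ℝ (V x)] [∀ x, TopologicalSpace (V x)] [FiberBundle F V] [VectorBundle ℝ F V]
  [IsManifold (𝓡 n) ∞ M] [ContMDiffVectorBundle ∞ F V (𝓡 n)]
  {x₀ : M} {W : Set (Model n)}

/-- The joint field formed by a test function and a section, in the coordinates at `x₀`. -/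
abbrev testField (n : ℕ) {M : Type*} [TopologicalSpace M] [ChartedSpace (Model n) M]
    (F : Type*) [NormedAddCommGroup F] [NormedSpace ℝ F]
    (V : M → Type*) [TopologicalSpace (TotalSpace F V)] [∀ x, AddCommGroup (V x)]
    [∀ x, TopologicalSpace (V x)] [FiberBundle F V] (x₀ : M) (W : Set (Model n)) :
    ({f : Model n → ℝ // IsTest W f} × Sec n F V) → Model n → ℝ × F :=
  pairField Subtype.val (secCoord x₀)

lemma testFrame (hW : IsOpen W) (hWd : W ⊆ chartDom n F V x₀) :
    JetFrame (testField n F V x₀ W) id W W :=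
  (secFrame_mono hW hWd).pair fun t => t.2.smooth.contDiffOn

lemma JetFn.testField_snd {X : Type*} [NormedAddCommGroup X] [NormedSpace ℝ X]
    (hW : IsOpen W) (hWd : W ⊆ chartDom n F V x₀) {p : ℕ}
    {c : Model n → Sec n F V → X} (hc : JetFn (secCoord x₀) id W p c) :
    JetFn (testField n F V x₀ W) id W p fun z s => c z s.2 :=
  JetFn.pair_snd (secFrame_mono hW hWd) (fun t => t.2.smooth.contDiffOn) hc

variable [FiniteDimensional ℝ F] [T2Space M]

/-- If the coefficient of a Lagrangian depends on the jets of a test function and of the section,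
so do the coefficients of its Euler–Lagrange form. -/
lemma jetFn_srcCoeff_testField (hW : IsOpen W) (hWd : W ⊆ chartDom n F V x₀) {q : ℕ}
    {Θ : {f : Model n → ℝ // IsTest W f} → HForm n F V n} (hΘ : ∀ f, IsLocalForm (Θ f))
    (hc : JetFn (testField n F V x₀ W) id W q fun z s => chartCoeff x₀ (pullSec (Θ s.1) s.2) z)
    (v : F) : JetFn (testField n F V x₀ W) id W (q + n * q)
      fun z s => srcCoeff (eulerLagrange (Θ s.1)) x₀ v z s.2 := by
  obtain ⟨A, hA, h⟩ := hc
  -- Freezing `f` turns a function of the joint jet into a Lagrangian in the section alone. Only the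
  -- section is varied by the Euler operator; `f` is a parameter.
  let L : {f : Model n → ℝ // IsTest W f} → Model n × JetCoord n q F → ℝ :=
    fun f w => A (w.1, pairJet n q F (jetCoord q f.1 w.1, w.2))
  have hpair : ∀ (s : {f : Model n → ℝ // IsTest W f} × Sec n F V), ∀ z ∈ W,
      jetCoord q (testField n F V x₀ W s) z
        = pairJet n q F (jetCoord q s.1.1 z, jetCoord q (secCoord x₀ s.2) z) := fun s z hz =>
    jetCoord_pair hW s.1.2.smooth.contDiffOn ((secCoord_contDiffOn s.2 x₀).mono hWd) hz
  have hL : ∀ f, IsLagrangian (Θ f) x₀ W (L f) := by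
    intro f
    refine ⟨hW, hWd, ?_, fun φ z hz => ?_⟩
    · have h1 : ContDiffOn ℝ ∞ (fun w : Model n × JetCoord n q F => jetCoord q f.1 w.1)
          (W ×ˢ univ) :=
        (jetCoord_contDiffOn hW f.2.smooth.contDiffOn q).comp contDiffOn_fst fun w hw => hw.1
      exact hA.comp (contDiffOn_fst.prodMk ((pairJet n q F).contDiff.comp_contDiffOn
        (h1.prodMk contDiffOn_snd))) fun w hw => ⟨hw.1, mem_univ _⟩
    · have := h (f, φ) z hz
      rw [id, hpair (f, φ) z hz] at this
      exact this
  let C : (Fin n → Fin (q + 1)) → F →L[ℝ] Model n × JetCoord n q (ℝ × F) := fun I =>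
    (ContinuousLinearMap.inr ℝ (Model n) _).comp ((pairJet n q F).comp
      ((ContinuousLinearMap.inr ℝ _ _).comp
        (ContinuousLinearMap.single ℝ (fun _ : Fin n → Fin (q + 1) => F) I)))
  -- The frozen jet derivative is a partial derivative of `A` and hence again a function of the
  -- joint jet; only afterwards are total derivatives taken, and those act on `f` too.
  have hJ : ∀ f I, ∀ z ∈ W, ∀ η, jetPartial (L f) I (z, η)
      = (fderiv ℝ A (z, pairJet n q F (jetCoord q f.1 z, η))).comp (C I) := by
    intro f I z hz η
    ext v
    refine fderiv_fibre_direction hW (hL f).smooth hz η _ ?_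
    have hγ : HasDerivAt (fun t : ℝ => pairJet n q F (jetCoord q f.1 z,
        t • ContinuousLinearMap.single ℝ (fun _ : Fin n → Fin (q + 1) => F) I v + η))
        (pairJet n q F (0, ContinuousLinearMap.single ℝ (fun _ : Fin n → Fin (q + 1) => F) I v))
        0 := by
      refine (pairJet n q F).hasFDerivAt.comp_hasDerivAt (0 : ℝ)
        ((hasDerivAt_const (0 : ℝ) _).prodMk ?_)
      simpa using ((hasDerivAt_id (0 : ℝ)).smul_const
        (ContinuousLinearMap.single ℝ (fun _ : Fin n → Fin (q + 1) => F) I v)).add_const η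
    have := hasDerivAt_comp_jet hW hA hz hγ
    rw [zero_smul, zero_add] at this
    exact this
  have hQ : ∀ I, JetFn (testField n F V x₀ W) id W q fun z s =>
      jetPartial (L s.1) I (z, jetCoord q (secCoord x₀ s.2) z) := by
    intro I
    refine ⟨fun w => (fderiv ℝ A w).comp (C I), ?_, fun s z hz => ?_⟩
    · exact (hA.fderiv_of_isOpen (hW.prod isOpen_univ) (m := ∞) (by simp)).clm_comp
        contDiffOn_const
    · beta_reduce
      rw [hJ _ _ z hz, id, hpair s z hz]
  have hE := ((testFrame hW hWd).eulerSum hQ).clm (ContinuousLinearMap.apply ℝ ℝ v)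
  refine hE.congr fun s z hz => ?_
  exact srcCoeff_eulerLagrange (hΘ s.1) (hL s.1) hz s.2 v

variable [SigmaCompactSpace M] {ν : VolumeForm n M} {Ω : BracketTensor n F V}

/-- Polynomial in the components by the frame expansion, so the order does not grow; only the Euler
operators raise it. -/
lemma jetFn_chartCoeff_bracketForm {f₀ : Model n → ℝ} (hf₀ : IsTest (chartDom n F V x₀) f₀)
    (hW : W ⊆ chartDom n F V x₀ ∩ {z | f₀ z ≠ 0}) {q : ℕ}
    {Θ Θ' : {f : Model n → ℝ // IsTest W f} → HForm n F V n}
    (hO : ∀ a b, JetFn (testField n F V x₀ W) id W q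
      fun z s => omegaCoeff ν Ω x₀ f₀ a b z s.2)
    (hA : ∀ v, JetFn (testField n F V x₀ W) id W q
      fun z s => srcCoeff (eulerLagrange (Θ s.1)) x₀ v z s.2)
    (hB : ∀ v, JetFn (testField n F V x₀ W) id W q
      fun z s => srcCoeff (eulerLagrange (Θ' s.1)) x₀ v z s.2) :
    JetFn (testField n F V x₀ W) id W q
      fun z s => chartCoeff x₀ (pullSec (bracketForm ν Ω (Θ s.1) (Θ' s.1)) s.2) z := by
  have h : JetFn (testField n F V x₀ W) id W q fun z s =>
      (∑ a, ∑ b, omegaCoeff ν Ω x₀ f₀ a b z s.2 *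
        (srcCoeff (eulerLagrange (Θ s.1)) x₀ (Module.finBasis ℝ F a) z s.2 *
          srcCoeff (eulerLagrange (Θ' s.1)) x₀ (Module.finBasis ℝ F b) z s.2)) *
        chartCoeff x₀ ν.toForm z := by
    refine JetFn.mul (JetFn.sum fun a _ => JetFn.sum fun b _ => (hO a b).mul
      ((hA _).mul (hB _))) (JetFn.of_base ?_)
    exact (ν.contDiffOn_coeff x₀).mono fun z hz => (hW hz).1.1
  refine h.congr fun s z hz => ?_
  rw [chartCoeff_bracketForm, bracketTensor_eq_sum (ν := ν) Ω hf₀ (hW hz).1 (hW hz).2 s.2]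

lemma chartCoeff_pullSec_add (α β : HForm n F V n) (φ : Sec n F V) (z : Model n) :
    chartCoeff x₀ (pullSec (α + β) φ) z
      = chartCoeff x₀ (pullSec α φ) z + chartCoeff x₀ (pullSec β φ) z := rfl

lemma IsLocalForm.smul_extendFn {α : HForm n F V n} (hα : IsLocalForm α)
    (hWd : W ⊆ chartDom n F V x₀) {f : Model n → ℝ} (hf : IsTest W f) :
    IsLocalForm (LocalFunctionals.smulForm (extendFn x₀ f) α) :=
  hα.smulForm (contMDiff_extendFn (hf.mono fun _ hz => (hWd hz).1))

/-- The Jacobiator of `fα, β, γ` depends in coordinates on the jets of `f` and of the section. -/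
lemma jetFn_jacobiator {f₀ : Model n → ℝ} (hf₀ : IsTest (chartDom n F V x₀) f₀) (hWo : IsOpen W)
    (hW : W ⊆ chartDom n F V x₀ ∩ {z | f₀ z ≠ 0}) {p : ℕ} {α β γ : HForm n F V n}
    (hα : IsLocalForm α) (hβ : IsLocalForm β) (hγ : IsLocalForm γ)
    (hO : ∀ a b, JetFn (secCoord x₀) id W p (omegaCoeff ν Ω x₀ f₀ a b))
    (hL : JetFn (secCoord x₀) id W p fun z φ => chartCoeff x₀ (pullSec α φ) z)
    (hB : ∀ v, JetFn (secCoord x₀) id W p fun z φ => srcCoeff (eulerLagrange β) x₀ v z φ)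
    (hC : ∀ v, JetFn (secCoord x₀) id W p fun z φ => srcCoeff (eulerLagrange γ) x₀ v z φ)
    (hD : ∀ v, JetFn (secCoord x₀) id W p
      fun z φ => srcCoeff (eulerLagrange (bracketForm ν Ω β γ)) x₀ v z φ) :
    JetFn (testField n F V x₀ W) id W (p + n * p + n * (p + n * p)) fun z s =>
      chartCoeff x₀ (pullSec (jacobiator ν Ω (smulForm (extendFn x₀ s.1.1) α) β γ) s.2) z := by
  have hWd : W ⊆ chartDom n F V x₀ := hW.trans inter_subset_left
  -- The Jacobiator nests two Euler operators, and each raises the order from `q` to `q + n * q`.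
  have h01 : p ≤ p + n * p := Nat.le_add_right _ _
  have h12 : p + n * p ≤ p + n * p + n * (p + n * p) := Nat.le_add_right _ _
  have up : ∀ {c : Model n → Sec n F V → ℝ} {q : ℕ}, p ≤ q → JetFn (secCoord x₀) id W p c →
      JetFn (testField n F V x₀ W) id W q fun z s => c z s.2 := fun hq hc =>
    (hc.testField_snd hWo hWd).mono hq
  let Θ : {f : Model n → ℝ // IsTest W f} → HForm n F V n :=
    fun f => smulForm (extendFn x₀ f.1) α
  have hΘ : ∀ f, IsLocalForm (Θ f) := fun f => hα.smul_extendFn hWd f.2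
  have hΘc : JetFn (testField n F V x₀ W) id W p
      fun z s => chartCoeff x₀ (pullSec (Θ s.1) s.2) z := by
    refine (JetFn.mul (JetFn.pair_fst (f := Subtype.val) (u := secCoord x₀) (τ := id) (W := W))
      (up le_rfl hL)).congr fun s z hz => ?_
    rw [chartCoeff_eq_topEval]
    change topEval n (chartForm x₀ (fun x => extendFn x₀ s.1.1 x • pullSec α s.2 x) z) = _
    rw [chartForm_smul, extendFn_symm x₀ _ (hWd hz).1, map_smul]
    rfl
  have h1 := jetFn_srcCoeff_testField (Θ := Θ) hWo hWd hΘ hΘc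
  have h2 : ∀ v, JetFn (testField n F V x₀ W) id W (p + n * p + n * (p + n * p)) fun z s =>
      srcCoeff (eulerLagrange (bracketForm ν Ω (Θ s.1) β)) x₀ v z s.2 :=
    jetFn_srcCoeff_testField (Θ := fun f => bracketForm ν Ω (Θ f) β) hWo hWd
      (fun f => isLocalForm_bracketForm ν Ω (hΘ f) hβ)
      (jetFn_chartCoeff_bracketForm (Θ := Θ) (Θ' := fun _ => β) hf₀ hW
        (fun a b => up h01 (hO a b)) h1 fun v => up h01 (hB v))
  have h3 : ∀ v, JetFn (testField n F V x₀ W) id W (p + n * p + n * (p + n * p)) fun z s =>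
      srcCoeff (eulerLagrange (bracketForm ν Ω γ (Θ s.1))) x₀ v z s.2 :=
    jetFn_srcCoeff_testField (Θ := fun f => bracketForm ν Ω γ (Θ f)) hWo hWd
      (fun f => isLocalForm_bracketForm ν Ω hγ (hΘ f))
      (jetFn_chartCoeff_bracketForm (Θ := fun _ => γ) (Θ' := Θ) hf₀ hW
        (fun a b => up h01 (hO a b)) (fun v => up h01 (hC v)) h1)
  have hO2 := fun a b => up (h01.trans h12) (hO a b)
  have e1 := jetFn_chartCoeff_bracketForm (Θ := fun f => bracketForm ν Ω (Θ f) β)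
    (Θ' := fun _ => γ) hf₀ hW hO2 h2 fun v => up (h01.trans h12) (hC v)
  have e2 := jetFn_chartCoeff_bracketForm (Θ := fun _ => bracketForm ν Ω β γ)
    (Θ' := Θ) hf₀ hW hO2 (fun v => up (h01.trans h12) (hD v)) fun v => (h1 v).mono h12
  have e3 := jetFn_chartCoeff_bracketForm (Θ := fun f => bracketForm ν Ω γ (Θ f))
    (Θ' := fun _ => β) hf₀ hW hO2 h3 fun v => up (h01.trans h12) (hB v)
  refine ((e1.add e2).add e3).congr fun s z _ => ?_
  unfold jacobiator
  rw [chartCoeff_pullSec_add, chartCoeff_pullSec_add]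

end JointEuler

/-! ### A common finite order for the components of `ω` -/

section UniformOrder

variable {n : ℕ} {F : Type*} [NormedAddCommGroup F] [NormedSpace ℝ F]
  {M : Type*} [TopologicalSpace M] [ChartedSpace (Model n) M]
  {V : M → Type*} [TopologicalSpace (TotalSpace F V)] [∀ x, AddCommGroup (V x)]
  [∀ x, Module ℝ (V x)] [∀ x, TopologicalSpace (V x)] [FiberBundle F V] [VectorBundle ℝ F V]
  [IsManifold (𝓡 n) ∞ M]

/-- A function on `M` in the coordinates at `x₀`. -/
def chartRep (x₀ : M) (r : M → ℝ) : Model n → ℝ :=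
  (extChartAt (𝓡 n) x₀).target.indicator (r ∘ (extChartAt (𝓡 n) x₀).symm)

lemma chartRep_eq_zero {x₀ : M} {r : M → ℝ} {z : Model n}
    (hz : z ∉ extChartAt (𝓡 n) x₀ '' tsupport r) : chartRep x₀ r z = 0 := by
  refine indicator_apply_eq_zero.2 fun h => ?_
  refine image_eq_zero_of_notMem_tsupport (f := r) fun h' => hz ⟨_, h', ?_⟩
  exact (extChartAt (𝓡 n) x₀).right_inv h

lemma isTest_chartRep {x₀ : M} {r : M → ℝ} (hr : ContMDiff (𝓡 n) 𝓘(ℝ, ℝ) ∞ r)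
    (hc : IsCompact (tsupport r)) {W : Set (Model n)} (hW : IsOpen W)
    (hWt : W ⊆ (extChartAt (𝓡 n) x₀).target) (hs : tsupport r ⊆ (extChartAt (𝓡 n) x₀).source)
    (h : MapsTo (extChartAt (𝓡 n) x₀) (tsupport r) W) : IsTest W (chartRep x₀ r) := by
  refine isTest_of_contDiffOn hW ?_ (hc.image_of_continuousOn
    ((continuousOn_extChartAt x₀).mono hs)) h.image_subset fun z hz => chartRep_eq_zero hz
  have h1 : ContDiffOn ℝ ∞ (r ∘ (extChartAt (𝓡 n) x₀).symm) W :=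
    contMDiffOn_iff_contDiffOn.1 (hr.comp_contMDiffOn ((contMDiffOn_extChartAt_symm x₀).mono hWt))
  exact h1.congr fun z hz => indicator_of_mem (hWt hz) _

lemma extendFn_chartRep {x₀ : M} {r : M → ℝ} (hs : tsupport r ⊆ (extChartAt (𝓡 n) x₀).source) :
    extendFn x₀ (chartRep (n := n) x₀ r) = r := by
  funext x
  by_cases hx : x ∈ (extChartAt (𝓡 n) x₀).source
  · rw [extendFn, if_pos hx, chartRep, indicator_of_mem ((extChartAt (𝓡 n) x₀).map_source hx),
      Function.comp, (extChartAt (𝓡 n) x₀).left_inv hx]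
  · rw [extendFn, if_neg hx, image_eq_zero_of_notMem_tsupport fun h => hx (hs h)]

lemma symm_image_tsupport_chartRep [T2Space M] {x₀ : M} {r : M → ℝ} (hc : IsCompact (tsupport r))
    (hs : tsupport r ⊆ (extChartAt (𝓡 n) x₀).source) :
    (extChartAt (𝓡 n) x₀).symm '' tsupport (chartRep (n := n) x₀ r) ⊆ tsupport r := by
  have h1 : tsupport (chartRep (n := n) x₀ r) ⊆ extChartAt (𝓡 n) x₀ '' tsupport r :=
    closure_minimal (fun z hz => by_contra fun h => hz (chartRep_eq_zero h))
      (hc.image_of_continuousOn ((continuousOn_extChartAt x₀).mono hs)).isClosed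
  rintro _ ⟨z, hz, rfl⟩
  obtain ⟨x, hx, rfl⟩ := h1 hz
  rwa [(extChartAt (𝓡 n) x₀).left_inv (hs hx)]

/-- Partitions of unity with compact supports. -/
lemma exists_compact_partition [T2Space M] [SigmaCompactSpace M] {U K : M → Set M}
    (hU : ∀ m, IsOpen (U m)) (hc : ∀ x, ∃ m, x ∈ U m) (hUK : ∀ m, U m ⊆ K m)
    (hK : ∀ m, IsCompact (K m)) : ∃ r : M → M → ℝ, (∀ m, ContMDiff (𝓡 n) 𝓘(ℝ, ℝ) ∞ (r m)) ∧
      (∀ m, IsCompact (tsupport (r m))) ∧ (∀ m, tsupport (r m) ⊆ U m) ∧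
      LocallyFinite (fun m => tsupport (r m)) ∧ ∀ x, ∑ᶠ m, r m x = 1 := by
  obtain ⟨r, hr⟩ := SmoothPartitionOfUnity.exists_isSubordinate (𝓡 n) isClosed_univ U hU
    fun x _ => mem_iUnion.2 (hc x)
  refine ⟨fun m => r m, fun m => (r m).contMDiff, fun m => (hK m).of_isClosed_subset
    (isClosed_tsupport _) ((hr m).trans (hUK m)), hr, r.locallyFinite.closure,
    fun x => r.sum_eq_one (mem_univ x)⟩

variable [ContMDiffVectorBundle ∞ F V (𝓡 n)] [FiniteDimensional ℝ F] [T2Space M]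
  [SigmaCompactSpace M] {ν : VolumeForm n M}

/-- The components of the bracket tensor along a locally finite family of frames are functions on a
jet bundle of some finite order. -/
theorem exists_uniform_omegaCoeff (Ω : BracketTensor n F V) {f : M → Model n → ℝ}
    (hf : ∀ m, IsTest (chartDom n F V m) (f m))
    (hfin : LocallyFinite fun m : M => (extChartAt (𝓡 n) m).symm '' tsupport (f m)) :
    ∃ p, ∀ m a b, JetFn (secCoord m) id (chartDom n F V m ∩ {z | f m z ≠ 0}) p
      (omegaCoeff ν Ω m (f m) a b) := by
  classical
  let C : M → Set M := fun m => (extChartAt (𝓡 n) m).symm '' tsupport (f m)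
  have hC : ∀ m, IsCompact (C m) := fun m =>
    isCompact_symm_image (hf m).compact fun z hz => ((hf m).subset hz).1
  let Q : ℕ → M → Fin (Module.finrank ℝ F) → Fin (Module.finrank ℝ F) → Prop := fun p m a b =>
    JetFn (S := Sec n F V) (secCoord m) id (chartDom n F V m ∩ {z | f m z ≠ 0}) p fun z φ =>
      Ω.form (jet φ ((extChartAt (𝓡 n) m).symm z))
        (frameSrc F V ν m (f m) a (jet φ ((extChartAt (𝓡 n) m).symm z)))
        (frameSrc F V ν m (f m) b (jet φ ((extChartAt (𝓡 n) m).symm z)))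
  have hQm : ∀ {p q m a b}, p ≤ q → Q p m a b → Q q m a b := fun h hQ => JetFn.mono hQ h
  suffices h : ∀ a b, ∃ p, ∀ m, Q p m a b by
    choose P hP using h
    refine ⟨Finset.univ.sup fun a => Finset.univ.sup (P a), fun m a b =>
      jetFn_omegaCoeff Ω (hf m) a b (hQm ?_ (hP a b m))⟩
    exact (Finset.le_sup (f := P a) (Finset.mem_univ b)).trans
      (Finset.le_sup (f := fun a => Finset.univ.sup (P a)) (Finset.mem_univ a))
  intro a b
  by_contra hcon
  -- If no common order exists, frames of arbitrarily large order occur. Infinitely many of them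
  -- with disjoint supports will be glued into one pair of local source forms.
  push Not at hcon
  have hloc : ∀ m c, IsLocalForm (frameForm F V ν m (f m) (fibreCoord F c)) := fun m c =>
    isLocalForm_frameForm (hf m) _
  have hlev : ∀ m, ∃ p, Q p m a b := by
    intro m
    obtain ⟨p, hp⟩ := isLocalFunction_iff.1 (Ω.isLocal _ _ (isLocalSrc_eulerLagrange (hloc m a))
      (isLocalSrc_eulerLagrange (hloc m b)))
    exact ⟨p, (hp m).mono_set inter_subset_left⟩
  choose lev hlev using hlev
  -- A sequence of levels and base points with strictly increasing levels and pairwise disjoint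
  -- supports. The earlier supports form a compact set that meets only finitely many others, and a
  -- level above the known orders of those frames forces a new base point.
  obtain ⟨g, hg, hgr⟩ := exists_seq_of_forall_finset_exists (α := ℕ × M)
    (fun x => ¬ Q x.1 x.2 a b)
    (fun x y => x.1 < y.1 ∧ x.2 ≠ y.2 ∧ Disjoint (C x.2) (C y.2)) (by
      intro s _
      have hK : IsCompact (⋃ x ∈ s, C x.2) := s.isCompact_biUnion fun x _ => hC x.2
      have hT := hfin.finite_nonempty_inter_compact hK
      let T : Finset M := hT.toFinset ∪ s.image Prod.snd
      obtain ⟨m, hm⟩ := hcon (T.sup lev + s.sup Prod.fst + 1)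
      have hmT : m ∉ T := fun h => hm (hQm ((Finset.le_sup h).trans (by omega)) (hlev m))
      refine ⟨⟨_, m⟩, hm, fun x hx => ⟨?_, ?_, ?_⟩⟩
      · have : x.1 ≤ s.sup Prod.fst := Finset.le_sup (f := Prod.fst) hx
        change x.1 < _
        omega
      · rintro rfl
        exact hmT (Finset.mem_union_right _ (Finset.mem_image_of_mem _ hx))
      · refine Set.disjoint_left.2 fun y hy hy' => hmT (Finset.mem_union_left _ ?_)
        exact hT.mem_toFinset.2 ⟨y, hy', mem_biUnion hx hy⟩)
  have hinj : Function.Injective fun i => (g i).2 := by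
    intro i j hij
    rcases lt_trichotomy i j with h | h | h
    · exact absurd hij (hgr _ _ h).2.1
    · exact h
    · exact absurd hij.symm (hgr _ _ h).2.1
  have hdis : ∀ i j, i ≠ j → Disjoint (C (g i).2) (C (g j).2) := by
    intro i j hij
    rcases lt_or_gt_of_ne hij with h | h
    · exact (hgr _ _ h).2.2
    · exact (hgr _ _ h).2.2.symm
  have hmono : StrictMono fun i => (g i).1 := fun i j h => (hgr _ _ h).1
  let P : Fin (Module.finrank ℝ F) → ℕ → HForm n F V n := fun c i =>
    frameForm F V ν (g i).2 (f (g i).2) (fibreCoord F c)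
  have hP0 : ∀ c i (j : InfJet n F V), j.base ∉ C (g i).2 → P c i j = 0 := fun c i j h =>
    frameForm_eq_zero h
  -- All frame Lagrangians have order zero in every chart, so the glued one is a legitimate local
  -- form, however large the orders of `ω` along the frames are.
  have hΛ : ∀ c, IsLocalForm (glue (P c)) := fun c =>
    isLocalForm_glue (hfin.comp_injective hinj) (hP0 c) fun i x₁ =>
      jetFn_frameForm (hf (g i).2) (fibreCoord F c) x₁
  obtain ⟨p₀, hp₀⟩ := isLocalFunction_iff.1 (Ω.isLocal _ _ (isLocalSrc_eulerLagrange (hΛ a))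
    (isLocalSrc_eulerLagrange (hΛ b)))
  -- `ω` on the glued forms has a finite order `p₀`. The frame with index `p₀` violates a level at
  -- least `p₀`, although near it the glued forms agree with that frame.
  refine hg p₀ (hQm (hmono.le_apply (x := p₀)) ?_)
  refine ((hp₀ (g p₀).2).mono_set inter_subset_left).congr fun φ z hz => ?_
  have hN : IsOpen {x | extendFn (g p₀).2 (f (g p₀).2) x ≠ 0} :=
    isOpen_ne_fun (contMDiff_extendFn ((hf (g p₀).2).mono fun z hz => hz.1)).continuous
      continuous_const
  have hzN : (extChartAt (𝓡 n) (g p₀).2).symm z ∈ {x | extendFn (g p₀).2 (f (g p₀).2) x ≠ 0} := by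
    change extendFn _ _ _ ≠ 0
    rw [extendFn_symm _ _ hz.1.1]
    exact hz.2
  have hE : ∀ c, eulerLagrange (glue (P c)) (jet φ ((extChartAt (𝓡 n) (g p₀).2).symm z))
      = frameSrc F V ν (g p₀).2 (f (g p₀).2) c
        (jet φ ((extChartAt (𝓡 n) (g p₀).2).symm z)) := by
    intro c
    refine eulerLagrange_congr (hΛ c) (hloc (g p₀).2 c) hN (fun j hj => ?_) hzN
    refine finsum_eq_single _ p₀ fun i hi => hP0 c i j fun h => ?_
    refine Set.disjoint_left.1 (hdis i p₀ hi) h ?_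
    by_contra h'
    exact hj (extendFn_eq_zero h')
  rw [hE a, hE b]

end UniformOrder

/-! ### The Jacobiator as a divergence in coordinates -/

section LocalPrimitive

variable {n : ℕ} {F : Type*} [NormedAddCommGroup F] [NormedSpace ℝ F]
  {M : Type*} [TopologicalSpace M] [ChartedSpace (Model n) M]
  {V : M → Type*} [TopologicalSpace (TotalSpace F V)] [∀ x, AddCommGroup (V x)]
  [∀ x, Module ℝ (V x)] [∀ x, TopologicalSpace (V x)] [FiberBundle F V] [VectorBundle ℝ F V]
  [IsManifold (𝓡 n) ∞ M] [ContMDiffVectorBundle ∞ F V (𝓡 n)] [FiniteDimensional ℝ F] [T2Space M]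
  [SigmaCompactSpace M] {ν : VolumeForm n M} {Ω : BracketTensor n F V}

lemma functional_eq_setIntegral {γ : HForm n F V n} {φ : Sec n F V}
    {x₀ : M} {s : ℝ} (hs : s = 1 ∨ s = -1) {K : Set (Model n)} (hKc : IsCompact K)
    (hK : K ⊆ chartDom n F V x₀ ∩ signSet ν x₀ s)
    (hc : ContinuousOn (chartCoeff x₀ (pullSec γ φ)) K)
    (h0 : ∀ x ∉ (extChartAt (𝓡 n) x₀).symm '' K, γ (jet φ x) = 0) :
    functional ν γ φ = s * ∫ z in K, chartCoeff x₀ (pullSec γ φ) z := by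
  rw [functional, integralM_eq ν hKc (fun z hz => (hK hz).1.1) hc h0, ← integral_const_mul]
  exact setIntegral_congr_fun hKc.measurableSet fun z hz => by
    rw [orientSign_eq ν hs (hK hz).2]

lemma bracketForm_zero_left (β : HForm n F V n) : bracketForm ν Ω 0 β = 0 := by
  funext j
  refine bracketForm_eq_zero_left ν Ω ?_
  rw [eulerLagrange_zero]
  rfl

lemma bracketForm_zero_right (β : HForm n F V n) : bracketForm ν Ω β 0 = 0 := by
  rw [bracketForm_skew, bracketForm_zero_left, neg_zero]

lemma smulForm_extendFn_eq_zero {α : HForm n F V n} {x₀ : M} {f : Model n → ℝ}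
    {j : InfJet n F V} (h : j.base ∈ ((extChartAt (𝓡 n) x₀).symm '' tsupport f)ᶜ) :
    smulForm (extendFn x₀ f) α j = 0 := smulForm_eq_zero (extendFn_eq_zero h)

lemma chartCoeff_eq_zero {γ : HForm n F V n} {φ : Sec n F V} {x₀ : M} {z : Model n}
    (h : γ (jet φ ((extChartAt (𝓡 n) x₀).symm z)) = 0) :
    chartCoeff x₀ (pullSec γ φ) z = 0 := by
  rw [chartCoeff_eq_topEval, chartForm_eq_zero (β := pullSec γ φ) h, map_zero]

lemma chartCoeff_pullSec_comb (c : ℝ) (α β : HForm n F V n) (φ : Sec n F V) (x₀ : M)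
    (z : Model n) : chartCoeff x₀ (pullSec (c • α + β) φ) z
      = c * chartCoeff x₀ (pullSec α φ) z + chartCoeff x₀ (pullSec β φ) z := rfl

/-- Supplies the homogeneity in `f` demanded by `JetFrame.exists_boundary_of_linear`. -/
lemma chartCoeff_jacobiator_smul {α β γ : HForm n F V n} (hα : IsLocalForm α)
    (hβ : IsLocalForm β) (hγ : IsLocalForm γ) {x₀ : M} {W : Set (Model n)}
    (hWd : W ⊆ chartDom n F V x₀) {f f' : Model n → ℝ} (hf : IsTest W f) {r : ℝ}
    (h : ∀ y, f' y = r * f y) (z : Model n) (φ : Sec n F V) :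
    chartCoeff x₀ (pullSec (jacobiator ν Ω (smulForm (extendFn x₀ f') α) β γ) φ) z
      = r * chartCoeff x₀ (pullSec (jacobiator ν Ω (smulForm (extendFn x₀ f) α) β γ) φ) z := by
  have h1 : smulForm (extendFn x₀ f') α = r • smulForm (extendFn x₀ f) α + 0 := by
    funext j
    have h2 : extendFn x₀ f' j.base = r * extendFn x₀ f j.base := by
      unfold extendFn
      split_ifs
      · exact h _
      · rw [mul_zero]
    have h3 : ∀ (a b : ℝ) (c : Cov n n j.base), (a * b) • c = a • (b • c) + 0 := by
      intro a b c
      rw [mul_smul, add_zero]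
    change extendFn x₀ f' j.base • α j = _
    rw [h2]
    exact h3 _ _ _
  rw [h1, jacobiator_comb r (hα.smul_extendFn hWd hf) isLocalForm_zero hβ hγ,
    jacobiator_zero, chartCoeff_pullSec_comb]
  have h4 : chartCoeff x₀ (pullSec (0 : HForm n F V n) φ) z = 0 := chartCoeff_eq_zero rfl
  rw [h4, add_zero]

variable {x₀ : M} {W : Set (Model n)}

/-- The integral of the Jacobiator of `fα, β, γ` vanishes. -/
lemma setIntegral_jacobiator (hJ : SatisfiesJacobi ν Ω) {s : ℝ} (hs : s = 1 ∨ s = -1)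
    (hW : W ⊆ chartDom n F V x₀ ∩ signSet ν x₀ s) {f : Model n → ℝ} (hf : IsTest W f)
    {α β γ : HForm n F V n} (hα : IsLocalForm α) (hβ : IsCompactForm β) (hγ : IsCompactForm γ)
    {φ : Sec n F V} (hφ : IsCompactlySupported φ) :
    ∫ z in tsupport f, chartCoeff x₀ (pullSec (jacobiator ν Ω
      (smulForm (extendFn x₀ f) α) β γ) φ) z = 0 := by
  have hWd : W ⊆ chartDom n F V x₀ := hW.trans inter_subset_left
  have hloc := hα.smul_extendFn hWd hf
  have hKc : IsCompact ((extChartAt (𝓡 n) x₀).symm '' tsupport f) :=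
    isCompact_symm_image hf.compact fun z hz => (hWd (hf.subset hz)).1
  have hN := hKc.isClosed.isOpen_compl
  have hcomp : IsCompactForm (smulForm (extendFn x₀ f) α) :=
    hloc.isCompactForm hKc fun j hj => smulForm_extendFn_eq_zero hj
  have hz : ∀ j : InfJet n F V, j.base ∈ ((extChartAt (𝓡 n) x₀).symm '' tsupport f)ᶜ →
      smulForm (extendFn x₀ f) α j = (0 : HForm n F V n) j := fun j hj =>
    smulForm_extendFn_eq_zero hj
  have h0 : IsLocalForm (0 : HForm n F V n) := isLocalForm_zero
  -- Off the support of `f` the form `fα` coincides with zero on an open set, so locality of the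
  -- bracket makes each of the three terms vanish. The functionals thus reduce to integrals in one
  -- chart.
  have z1 : ∀ x ∉ (extChartAt (𝓡 n) x₀).symm '' tsupport f,
      bracketForm ν Ω (bracketForm ν Ω (smulForm (extendFn x₀ f) α) β) γ (jet φ x) = 0 := by
    intro x hx
    have := bracketForm_congr ν Ω (isLocalForm_bracketForm ν Ω hloc hβ.1)
      (isLocalForm_bracketForm ν Ω h0 hβ.1) hγ.1 hγ.1 hN (bracketForm_congr ν Ω hloc h0 hβ.1 hβ.1
        hN hz fun _ _ => rfl) (fun _ _ => rfl) (jet φ x) hx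
    rw [this, bracketForm_zero_left, bracketForm_zero_left]
    rfl
  have z2 : ∀ x ∉ (extChartAt (𝓡 n) x₀).symm '' tsupport f,
      bracketForm ν Ω (bracketForm ν Ω β γ) (smulForm (extendFn x₀ f) α) (jet φ x) = 0 := by
    intro x hx
    have := bracketForm_congr ν Ω (isLocalForm_bracketForm ν Ω hβ.1 hγ.1)
      (isLocalForm_bracketForm ν Ω hβ.1 hγ.1) hloc h0 hN (fun _ _ => rfl) hz (jet φ x) hx
    rw [this, bracketForm_zero_right]
    rfl
  have z3 : ∀ x ∉ (extChartAt (𝓡 n) x₀).symm '' tsupport f,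
      bracketForm ν Ω (bracketForm ν Ω γ (smulForm (extendFn x₀ f) α)) β (jet φ x) = 0 := by
    intro x hx
    have := bracketForm_congr ν Ω (isLocalForm_bracketForm ν Ω hγ.1 hloc)
      (isLocalForm_bracketForm ν Ω hγ.1 h0) hβ.1 hβ.1 hN (bracketForm_congr ν Ω hγ.1 hγ.1 hloc h0
        hN (fun _ _ => rfl) hz) (fun _ _ => rfl) (jet φ x) hx
    rw [this, bracketForm_zero_right, bracketForm_zero_left]
    rfl
  have hcont : ∀ {δ : HForm n F V n}, IsLocalForm δ →
      ContinuousOn (chartCoeff x₀ (pullSec δ φ)) (tsupport f) := fun hδ =>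
    (hδ.contDiffOn_chartCoeff φ x₀).continuousOn.mono (hf.subset.trans hWd)
  have c1 := hcont (isLocalForm_bracketForm ν Ω (isLocalForm_bracketForm ν Ω hloc hβ.1) hγ.1)
  have c2 := hcont (isLocalForm_bracketForm ν Ω (isLocalForm_bracketForm ν Ω hβ.1 hγ.1) hloc)
  have c3 := hcont (isLocalForm_bracketForm ν Ω (isLocalForm_bracketForm ν Ω hγ.1 hloc) hβ.1)
  have key := hJ _ hcomp β hβ γ hγ φ hφ
  rw [functional_eq_setIntegral hs hf.compact (hf.subset.trans hW) c1 z1,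
    functional_eq_setIntegral hs hf.compact (hf.subset.trans hW) c2 z2,
    functional_eq_setIntegral hs hf.compact (hf.subset.trans hW) c3 z3, ← mul_add, ← mul_add] at key
  have hs0 : s ≠ 0 := by rcases hs with rfl | rfl <;> norm_num
  have key2 := (mul_eq_zero.1 key).resolve_left hs0
  have i1 := c1.integrableOn_compact (μ := volume) hf.compact
  have i2 := c2.integrableOn_compact (μ := volume) hf.compact
  have i3 := c3.integrableOn_compact (μ := volume) hf.compact
  have i12 := integral_add i1 i2
  have i123 := integral_add (i1.add i2) i3
  simp only [Pi.add_apply] at i123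
  rw [← i12, ← i123] at key2
  exact key2

/-- In coordinates the Jacobiator of `fα, β, γ` is a divergence. -/
theorem exists_local_primitive (hJ : SatisfiesJacobi ν Ω) {f₀ : Model n → ℝ}
    (hf₀ : IsTest (chartDom n F V x₀) f₀) (hWo : IsOpen W)
    (hW : W ⊆ chartDom n F V x₀ ∩ {z | f₀ z ≠ 0}) {p : ℕ} {α β γ : HForm n F V n}
    (hα : IsLocalForm α) (hβ : IsCompactForm β) (hγ : IsCompactForm γ)
    (hO : ∀ a b, JetFn (secCoord x₀) id W p (omegaCoeff ν Ω x₀ f₀ a b))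
    (hL : JetFn (secCoord x₀) id W p fun z φ => chartCoeff x₀ (pullSec α φ) z)
    (hB : ∀ v, JetFn (secCoord x₀) id W p fun z φ => srcCoeff (eulerLagrange β) x₀ v z φ)
    (hC : ∀ v, JetFn (secCoord x₀) id W p fun z φ => srcCoeff (eulerLagrange γ) x₀ v z φ)
    (hD : ∀ v, JetFn (secCoord x₀) id W p
      fun z φ => srcCoeff (eulerLagrange (bracketForm ν Ω β γ)) x₀ v z φ) {N : ℕ}
    (hN : p + n * p + n * (p + n * p) = N) {f : Model n → ℝ} (hf : IsTest W f) :
    ∃ b : Fin n → Model n → Sec n F V → ℝ,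
      (∀ j, JetFn (secCoord x₀) id W (N + n * N) (b j)) ∧
      (∀ φ, ∀ z ∈ W, chartCoeff x₀ (pullSec (jacobiator ν Ω
        (smulForm (extendFn x₀ f) α) β γ) φ) z = ∑ j, partialD j (fun y => b j y φ) z) ∧
      (∀ φ z, z ∉ tsupport f → ∀ j, b j z φ = 0) ∧
      (∀ φ, ∀ z ∈ W, (∀ᶠ x in 𝓝 ((extChartAt (𝓡 n) x₀).symm z), eulerLagrange β (jet φ x) = 0) →
        (∀ᶠ x in 𝓝 ((extChartAt (𝓡 n) x₀).symm z), eulerLagrange γ (jet φ x) = 0) →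
        ∀ j, b j z φ = 0) := by
  subst hN
  have hWd : W ⊆ chartDom n F V x₀ := hW.trans inter_subset_left
  have hfr := secFrame_mono (n := n) (F := F) (V := V) hWo hWd
  obtain ⟨h, hh, hb⟩ := hfr.exists_boundary_of_linear
    (c := fun z s => chartCoeff x₀ (pullSec (jacobiator ν Ω
      (smulForm (extendFn x₀ s.1.1) α) β γ) s.2) z)
    (jetFn_jacobiator hf₀ hWo hW hα hβ.1 hγ.1 hO hL hB hC hD)
    (fun φ z _ f f' r hff' => chartCoeff_jacobiator_smul hα hβ.1 hγ.1 hWd f.2 hff' z φ)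
  -- The Jacobi identity for `fα, β, γ` and the vanishing integral of the divergence leave `∫ f h =
  -- 0` for all test functions `f` on a piece of constant orientation sign.
  have hcompact : ∀ φ, IsCompactlySupported φ → ∀ z ∈ W, h z φ = 0 := by
    intro φ hφ z hz
    obtain ⟨s, hs, hzs⟩ := exists_mem_signSet ν (hWd hz).1
    have hW' : IsOpen (W ∩ signSet ν x₀ s) := hWo.inter (isOpen_signSet ν x₀ s)
    have hhc : ContinuousOn (fun z => h z φ) W := (hfr.contDiffOn hh φ).continuousOn
    refine eq_zero_of_integral_test hW' (hhc.mono inter_subset_left)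
      (fun f hf => ?_) z ⟨hz, hzs⟩
    have hfW := hf.mono (inter_subset_left : W ∩ signSet ν x₀ s ⊆ W)
    obtain ⟨b, hbj, hbe, hb0, -⟩ := hb ⟨f, hfW⟩
    have hbt : ∀ j, IsTest W fun y => b j y φ := fun j =>
      isTest_of_contDiffOn hWo (hfr.contDiffOn (hbj j) φ) hfW.compact hfW.subset
        fun z hz => hb0 φ z hz j
    have h1 := setIntegral_jacobiator hJ hs (inter_subset_inter_left _ hWd) hf hα hβ hγ hφ
    have h2 : ∫ z in tsupport f, (f z * h z φ + ∑ j, partialD j (fun y => b j y φ) z) = 0 := by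
      rw [← h1]
      refine setIntegral_congr_fun hf.compact.measurableSet fun z hz => ?_
      have := hbe φ z (hfW.subset hz)
      beta_reduce at this ⊢
      rw [this, mul_comm]
    rw [setIntegral_eq_integral_of_forall_compl_eq_zero] at h2
    · have hi : Integrable fun z => f z * h z φ :=
        integrable_of_continuousOn_of_compact hf.compact (hf.smooth.continuous.continuousOn.mul
          (hhc.mono hfW.subset)) fun z hz => by
            rw [image_eq_zero_of_notMem_tsupport hz, zero_mul]
      have hj : ∀ j, Integrable (partialD j fun y => b j y φ) := fun j =>
        have := (hbt j).wordD [j]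
        this.smooth.continuous.integrable_of_hasCompactSupport this.compact
      rw [integral_add hi (integrable_finsetSum _ fun j _ => hj j),
        integral_finsetSum _ fun j _ => hj j] at h2
      simpa [integral_partialD_eq_zero (hbt _)] using h2
    · intro z hz
      have hzb : ∀ j, partialD j (fun y => b j y φ) z = 0 := fun j => by
        have : (fun y => b j y φ) =ᶠ[𝓝 z] fun _ => 0 := by
          filter_upwards [(isClosed_tsupport f).isOpen_compl.mem_nhds hz] with y hy
          exact hb0 φ y hy j
        rw [(partialD_eventuallyEq this j).self_of_nhds]
        simp [partialD]
      simp [hzb, image_eq_zero_of_notMem_tsupport hz]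
  -- `h` depends on the jet only, and every jet comes from a compactly supported section.
  have hzero : ∀ φ, ∀ z ∈ W, h z φ = 0 := by
    intro φ z hz
    obtain ⟨χ, hχ, hχφ⟩ := exists_compactlySupported_eq φ ((extChartAt (𝓡 n) x₀).symm z)
    rw [← hcompact χ hχ z hz]
    exact hh.eq_of_jet_eq hWd hz (jet_eq_of_eventuallyEq hχφ).symm
  obtain ⟨b, hbj, hbe, hb0, hb1⟩ := hb ⟨f, hf⟩
  refine ⟨b, hbj, fun φ z hz => ?_, hb0, fun φ z hz h1 h2 => hb1 φ z hz ?_⟩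
  · have := hbe φ z hz
    beta_reduce at this
    rw [this, hzero φ z hz, zero_mul, zero_add]
  · have hcont : ContinuousAt (extChartAt (𝓡 n) x₀).symm z :=
      continuousAt_extChartAt_symm'' (hWd hz).1
    filter_upwards [hcont.eventually (eventually_eventually_nhds.2 h1),
      hcont.eventually (eventually_eventually_nhds.2 h2)] with y hy1 hy2 f'
    exact chartCoeff_eq_zero (jacobiator_eq_zero_of_eventually hβ.1 hγ.1 hy1 hy2 _)

end LocalPrimitive

/-! ### Partition of unity and local primitives of common order -/

section Pieces

variable {n : ℕ} {F : Type*} [NormedAddCommGroup F] [NormedSpace ℝ F]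
  {M : Type*} [TopologicalSpace M] [ChartedSpace (Model n) M]
  {V : M → Type*} [TopologicalSpace (TotalSpace F V)] [∀ x, AddCommGroup (V x)]
  [∀ x, Module ℝ (V x)] [∀ x, TopologicalSpace (V x)] [FiberBundle F V] [VectorBundle ℝ F V]
  [IsManifold (𝓡 n) ∞ M] [ContMDiffVectorBundle ∞ F V (𝓡 n)] [FiniteDimensional ℝ F] [T2Space M]
  [SigmaCompactSpace M] {ν : VolumeForm n M} {Ω : BracketTensor n F V}

lemma jacobiator_finset_sum {ι : Type*} (t : Finset ι) {P : ι → HForm n F V n}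
    {β γ : HForm n F V n} (hP : ∀ i, IsLocalForm (P i)) (hβ : IsLocalForm β)
    (hγ : IsLocalForm γ) :
    jacobiator ν Ω (∑ i ∈ t, P i) β γ = ∑ i ∈ t, jacobiator ν Ω (P i) β γ := by
  classical
  induction t using Finset.induction_on with
  | empty => rw [Finset.sum_empty, Finset.sum_empty, jacobiator_zero]
  | insert a t ha ih =>
    rw [Finset.sum_insert ha, Finset.sum_insert ha, ← ih]
    have := jacobiator_comb (ν := ν) (Ω := Ω) 1 (hP a)
      (dH_finset_sum t fun i _ => hP i).1 hβ hγ
    simpa only [one_smul] using this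

lemma smulForm_sum {ι : Type*} (t : Finset ι) (r : ι → M → ℝ) (α : HForm n F V n)
    (j : InfJet n F V) (h : ∑ i ∈ t, r i j.base = 1) : (∑ i ∈ t, smulForm (r i) α) j = α j := by
  have h1 : ∀ c : Cov n n j.base, ∑ i ∈ t, r i j.base • c = c := fun c => by
    rw [← Finset.sum_smul, h, one_smul]
  rw [Finset.sum_apply]
  exact h1 (α j)

lemma jacobiator_eq_sum {r : M → M → ℝ} (hr : ∀ m, ContMDiff (𝓡 n) 𝓘(ℝ, ℝ) ∞ (r m))
    (hfin : LocallyFinite fun m => tsupport (r m)) (h1 : ∀ x, ∑ᶠ m, r m x = 1)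
    {α β γ : HForm n F V n} (hα : IsLocalForm α) (hβ : IsLocalForm β) (hγ : IsLocalForm γ)
    (x : M) : ∃ t : Finset M, ∀ t', t ⊆ t' → ∀ φ : Sec n F V, jacobiator ν Ω α β γ (jet φ x)
      = ∑ m ∈ t', jacobiator ν Ω (smulForm (r m) α) β γ (jet φ x) := by
  obtain ⟨N', hN', hN'f⟩ := hfin x
  obtain ⟨N, hNN, hN, hxN⟩ := mem_nhds_iff.1 hN'
  refine ⟨hN'f.toFinset, fun t' ht' φ => ?_⟩
  have hP : ∀ m, IsLocalForm (smulForm (r m) α) := fun m => hα.smulForm (hr m)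
  have h2 := jacobiator_congr (ν := ν) (Ω := Ω) hα (dH_finset_sum t' fun m _ => hP m).1 hβ hγ hN
    (fun j hj => (smulForm_sum t' r α j (by
      rw [← h1 j.base]
      refine (finsum_eq_sum_of_support_subset _ fun m hm => ht' ?_).symm
      exact hN'f.mem_toFinset.2 ⟨_, subset_tsupport _ hm, hNN hj⟩)).symm) (jet φ x) hxN
  rw [h2, jacobiator_finset_sum t' hP hβ hγ, Finset.sum_apply]

lemma jacobiator_smulForm_eq_zero {r : M → ℝ} (hr : ContMDiff (𝓡 n) 𝓘(ℝ, ℝ) ∞ r)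
    {α β γ : HForm n F V n} (hα : IsLocalForm α) (hβ : IsLocalForm β) (hγ : IsLocalForm γ)
    {φ : Sec n F V} {x : M} (hx : x ∉ tsupport r) :
    jacobiator ν Ω (smulForm r α) β γ (jet φ x) = 0 := by
  have := jacobiator_congr (ν := ν) (Ω := Ω) (hα.smulForm hr) isLocalForm_zero hβ hγ
    (isClosed_tsupport r).isOpen_compl
    (fun j hj => smulForm_eq_zero (image_eq_zero_of_notMem_tsupport hj)) (jet φ x) hx
  rw [this, jacobiator_zero]
  rfl

variable (F V) in
/-- Local primitives of the pieces of a form with respect to a partition of unity, all of them of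
the same order. -/
theorem exists_primitive_pieces (hJ : SatisfiesJacobi ν Ω) {α β γ : HForm n F V n}
    (hα : IsLocalForm α) (hβ : IsCompactForm β) (hγ : IsCompactForm γ) :
    ∃ (r : M → M → ℝ) (W : M → Set (Model n)) (P : ℕ)
      (b : M → Fin n → Model n → Sec n F V → ℝ),
      (∀ m, ContMDiff (𝓡 n) 𝓘(ℝ, ℝ) ∞ (r m)) ∧ (∀ m, IsCompact (tsupport (r m))) ∧
      LocallyFinite (fun m => tsupport (r m)) ∧ (∀ x, ∑ᶠ m, r m x = 1) ∧
      (∀ m, IsOpen (W m)) ∧ (∀ m, W m ⊆ chartDom n F V m) ∧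
      (∀ m, tsupport (r m) ⊆ (extChartAt (𝓡 n) m).source) ∧
      (∀ m, IsTest (W m) (chartRep m (r m))) ∧
      (∀ m, MapsTo (extChartAt (𝓡 n) m) (tsupport (r m)) (W m)) ∧
      (∀ m j, JetFn (secCoord m) id (W m) P (b m j)) ∧
      (∀ m φ, ∀ z ∈ W m, chartCoeff m (pullSec (jacobiator ν Ω (smulForm (r m) α) β γ) φ) z
        = ∑ j, partialD j (fun y => b m j y φ) z) ∧
      (∀ m φ z, z ∉ tsupport (chartRep m (r m)) → ∀ j, b m j z φ = 0) ∧
      (∀ m φ, ∀ z ∈ W m,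
        (∀ᶠ x in 𝓝 ((extChartAt (𝓡 n) m).symm z), eulerLagrange β (jet φ x) = 0) →
        (∀ᶠ x in 𝓝 ((extChartAt (𝓡 n) m).symm z), eulerLagrange γ (jet φ x) = 0) →
        ∀ j, b m j z φ = 0) := by
  have : LocallyCompactSpace M := Manifold.locallyCompact_of_finiteDimensional (𝓡 n)
  have hK := fun m : M => exists_compact_subset (isOpen_chartRegion (n := n) (F := F) (V := V) m)
    (mem_chartRegion_self (n := n) (F := F) (V := V) m)
  choose K hKc hKm hKs using hK
  -- Two partitions are needed. The first provides the cut-offs of the frames; the second is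
  -- subordinate to the sets where these cut-offs do not vanish, so that the frames span over its
  -- supports.
  obtain ⟨r₀, hr₀, hc₀, hs₀, hfin₀, hsum₀⟩ := exists_compact_partition (n := n)
    (fun m => isOpen_interior (s := K m)) (fun x => ⟨x, hKm x⟩) (fun m => interior_subset) hKc
  have hreg₀ : ∀ m, tsupport (r₀ m) ⊆ chartRegion n F V m := fun m =>
    (hs₀ m).trans (interior_subset.trans (hKs m))
  obtain ⟨r, hr, hc, hs, hfin, hsum⟩ := exists_compact_partition (M := M) (n := n)
    (U := fun m => {x | r₀ m x ≠ 0}) (K := fun m => tsupport (r₀ m))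
    (fun m => isOpen_ne_fun (hr₀ m).continuous continuous_const) (fun x => by
      by_contra h
      push Not at h
      have h0 : ∀ m, r₀ m x = 0 := fun m => not_not.1 (h m)
      have := hsum₀ x
      simp [h0] at this) (fun m => subset_tsupport _) hc₀
  let f₀ : M → Model n → ℝ := fun m => chartRep m (r₀ m)
  have hf₀ : ∀ m, IsTest (chartDom n F V m) (f₀ m) := fun m =>
    isTest_chartRep (hr₀ m) (hc₀ m) (isOpen_chartDom m) inter_subset_left
      (fun x hx => (hreg₀ m hx).1) fun x hx => chart_mem_chartDom (hreg₀ m hx)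
  obtain ⟨p₁, hp₁⟩ := exists_uniform_omegaCoeff (ν := ν) Ω hf₀
    (hfin₀.subset fun m => symm_image_tsupport_chartRep (hc₀ m) fun x hx => (hreg₀ m hx).1)
  obtain ⟨p₂, hp₂⟩ := isLocalForm_iff.1 hα
  obtain ⟨p₃, hp₃⟩ := exists_jetFn_srcCoeff hβ.1
  obtain ⟨p₄, hp₄⟩ := exists_jetFn_srcCoeff hγ.1
  obtain ⟨p₅, hp₅⟩ := exists_jetFn_srcCoeff (isLocalForm_bracketForm ν Ω hβ.1 hγ.1)
  -- One order for all indices `m`; only `p₁` required the diagonal argument, since the others come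
  -- from global local forms.
  let p := p₁ + p₂ + p₃ + p₄ + p₅
  let W : M → Set (Model n) := fun m => chartDom n F V m ∩ {z | f₀ m z ≠ 0}
  have hWo : ∀ m, IsOpen (W m) := fun m => (isOpen_chartDom m).inter
    (isOpen_ne_fun (hf₀ m).smooth.continuous continuous_const)
  have hreg : ∀ m, tsupport (r m) ⊆ chartRegion n F V m := fun m =>
    (hs m).trans ((subset_tsupport _).trans (hreg₀ m))
  have hsrc : ∀ m, tsupport (r m) ⊆ (extChartAt (𝓡 n) m).source := fun m x hx => (hreg m hx).1
  have hmap : ∀ m, MapsTo (extChartAt (𝓡 n) m) (tsupport (r m)) (W m) := by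
    intro m x hx
    refine ⟨chart_mem_chartDom (hreg m hx), ?_⟩
    change chartRep m (r₀ m) _ ≠ 0
    rw [chartRep, indicator_of_mem ((extChartAt (𝓡 n) m).map_source (hsrc m hx)),
      Function.comp, (extChartAt (𝓡 n) m).left_inv (hsrc m hx)]
    exact hs m hx
  have hf : ∀ m, IsTest (W m) (chartRep m (r m)) := fun m =>
    isTest_chartRep (hr m) (hc m) (hWo m) (fun z hz => hz.1.1) (hsrc m) (hmap m)
  have hloc := fun m => exists_local_primitive hJ (hf₀ m) (hWo m) subset_rfl hα hβ hγ
    (p := p) (fun a b => (hp₁ m a b).mono (by omega))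
    (((hp₂ m).clm (topEval n)).mono_set inter_subset_left |>.mono (by omega))
    (fun v => ((hp₃ m v).mono_set inter_subset_left).mono (by omega))
    (fun v => ((hp₄ m v).mono_set inter_subset_left).mono (by omega))
    (fun v => ((hp₅ m v).mono_set inter_subset_left).mono (by omega)) rfl (hf m)
  choose b hb1 hb2 hb3 hb4 using hloc
  refine ⟨r, W, _, b, hr, hc, hfin, hsum, hWo, fun m => inter_subset_left, hsrc, hf, hmap, hb1,
    fun m φ z hz => ?_, hb3, hb4⟩
  rw [← hb2 m φ z hz, extendFn_chartRep (hsrc m)]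

end Pieces

/-! ### The global primitive of the Jacobiator -/

section Primitive

/-- The coordinate forms `ι_{∂ᵢ} (dx¹ ∧ ⋯ ∧ dxⁿ)`. -/
lemma exists_dual_forms {k : ℕ} {M : Type*} [TopologicalSpace M]
    [ChartedSpace (Model (k + 1)) M] [IsManifold (𝓡 (k + 1)) ∞ M] [T2Space M] [SigmaCompactSpace M]
    (ν : VolumeForm (k + 1) M)
    (x₀ : M) : ∃ ζ : Fin (k + 1) → (Model (k + 1)) [⋀^Fin k]→L[ℝ] ℝ, ∀ i l : Fin (k + 1),
      ζ i (l.removeNth fun a => EuclideanSpace.single a (1 : ℝ))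
        = if i = l then (-1) ^ (l : ℕ) else 0 := by
  have hN := ν.coeff_ne_zero (mem_extChartAt_target (I := 𝓡 (k + 1)) x₀)
  -- The standard volume element, obtained by normalizing the value of `ν` at one point; only this
  -- constant form is used.
  let vol : (Model (k + 1)) [⋀^Fin (k + 1)]→L[ℝ] ℝ :=
    (chartCoeff x₀ ν.toForm (extChartAt (𝓡 (k + 1)) x₀ x₀))⁻¹ •
      chartForm x₀ ν.toForm (extChartAt (𝓡 (k + 1)) x₀ x₀)
  have hvol : vol (fun a => EuclideanSpace.single a (1 : ℝ)) = 1 := inv_mul_cancel₀ hN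
  refine ⟨fun i => vol.curryLeft (EuclideanSpace.single i 1), fun i l => ?_⟩
  have h := vol.neg_one_pow_smul_map_insertNth l (EuclideanSpace.single i (1 : ℝ))
    (l.removeNth fun a => EuclideanSpace.single a (1 : ℝ))
  rw [Fin.insertNth_removeNth] at h
  refine h.symm.trans ?_
  split_ifs with hil
  · subst hil
    rw [Function.update_eq_self, hvol]
    simp
  · rw [vol.map_eq_zero_of_eq _ (i := i) (j := l) ?_ hil, smul_zero]
    rw [Function.update_self, Function.update_of_ne hil]

/-- The sign in the dual forms cancels the sign in the exterior derivative, so contraction with the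
volume element turns a divergence into an exterior derivative. -/
lemma topEval_extDeriv {k : ℕ} {ζ : Fin (k + 1) → (Model (k + 1)) [⋀^Fin k]→L[ℝ] ℝ}
    (hζ : ∀ i l : Fin (k + 1), ζ i (l.removeNth fun a => EuclideanSpace.single a (1 : ℝ))
        = if i = l then (-1) ^ (l : ℕ) else 0) {b : Fin (k + 1) → Model (k + 1) → ℝ}
    {z : Model (k + 1)} (hb : ∀ i, DifferentiableAt ℝ (b i) z) :
    topEval (k + 1) (extDeriv (fun y => ∑ i, b i y • ζ i) z) = ∑ i, partialD i (b i) z := by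
  rw [topEval_apply, extDeriv_apply (DifferentiableAt.fun_sum fun i _ => (hb i).smul_const _)]
  refine Finset.sum_congr rfl fun l _ => ?_
  have h1 : (fun y => (∑ i, b i y • ζ i) (l.removeNth fun a => EuclideanSpace.single a (1 : ℝ)))
      = fun y => b l y * (-1) ^ (l : ℕ) := by
    funext y
    rw [ContinuousAlternatingMap.sum_apply]
    simp [hζ]
  rw [h1, ((hb l).hasFDerivAt.mul_const _).fderiv, partialD, smul_apply,
    smul_eq_mul, zsmul_eq_mul]
  push_cast
  rw [← mul_assoc, ← mul_pow]
  simp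

variable {F : Type*} [NormedAddCommGroup F] [NormedSpace ℝ F] [FiniteDimensional ℝ F]

/-- On a point the Jacobiator vanishes. -/
theorem jacobiator_eq_zero_of_dim_zero {M : Type*} [TopologicalSpace M]
    [ChartedSpace (Model 0) M] {V : M → Type*} [TopologicalSpace (TotalSpace F V)]
    [∀ x, AddCommGroup (V x)] [∀ x, Module ℝ (V x)] [∀ x, TopologicalSpace (V x)]
    [FiberBundle F V] [VectorBundle ℝ F V] [IsManifold (𝓡 0) ∞ M]
    [ContMDiffVectorBundle ∞ F V (𝓡 0)] [T2Space M] [SigmaCompactSpace M]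
    {ν : VolumeForm 0 M} {Ω : BracketTensor 0 F V} (hJ : SatisfiesJacobi ν Ω)
    {α β γ : HForm 0 F V 0} (hα : IsLocalForm α) (hβ : IsCompactForm β) (hγ : IsCompactForm γ) :
    jacobiator ν Ω α β γ = 0 := by
  obtain ⟨r, W, P, b, hr, hc, hfin, hsum, hWo, hWd, hsrc, hf, hmap, hb1, hb2, -, -⟩ :=
    exists_primitive_pieces F V hJ hα hβ hγ
  funext j
  refine jet_base_section j (P := fun j => jacobiator ν Ω α β γ j = 0) fun φ x => ?_
  obtain ⟨t, ht⟩ := jacobiator_eq_sum (ν := ν) (Ω := Ω) hr hfin hsum hα hβ.1 hγ.1 x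
  rw [ht t subset_rfl φ]
  refine Finset.sum_eq_zero fun m _ => ?_
  by_cases hx : x ∈ tsupport (r m)
  · refine eq_of_chartForm_eq (hsrc m hx) (β := pullSec (jacobiator ν Ω (smulForm (r m) α) β γ) φ)
      (γ := fun x => 0) (topEval_injective ?_)
    -- In dimension zero the divergence is an empty sum.
    rw [← chartCoeff_eq_topEval, hb2 m φ _ (hmap m hx), chartForm_zero]
    simp
  · exact jacobiator_smulForm_eq_zero (hr m) hα hβ.1 hγ.1 hx

/-- The Jacobiator is `d_H`-exact. -/
theorem exists_primitive_jacobiator {k : ℕ} {M : Type*} [TopologicalSpace M]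
    [ChartedSpace (Model (k + 1)) M] {V : M → Type*} [TopologicalSpace (TotalSpace F V)]
    [∀ x, AddCommGroup (V x)] [∀ x, Module ℝ (V x)] [∀ x, TopologicalSpace (V x)]
    [FiberBundle F V] [VectorBundle ℝ F V] [IsManifold (𝓡 (k + 1)) ∞ M]
    [ContMDiffVectorBundle ∞ F V (𝓡 (k + 1))] [T2Space M] [SigmaCompactSpace M]
    {ν : VolumeForm (k + 1) M} {Ω : BracketTensor (k + 1) F V} (hJ : SatisfiesJacobi ν Ω)
    {α β γ : HForm (k + 1) F V (k + 1)} (hα : IsLocalForm α) (hβ : IsCompactForm β)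
    (hγ : IsCompactForm γ) :
    ∃ B : HForm (k + 1) F V k, IsCompactForm B ∧ dH B = jacobiator ν Ω α β γ := by
  classical
  obtain ⟨r, W, P, b, hr, hc, hfin, hsum, hWo, hWd, hsrc, hf, hmap, hb1, hb2, hb3, hb4⟩ :=
    exists_primitive_pieces F V hJ hα hβ hγ
  choose ζ hζ using fun m : M => exists_dual_forms ν m
  let η : M → Model (k + 1) → Sec (k + 1) F V → (Model (k + 1)) [⋀^Fin k]→L[ℝ] ℝ :=
    fun m z φ => ∑ i, b m i z φ • ζ m i
  have hη : ∀ m, JetFn (secCoord m) id (W m) P (η m) := fun m =>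
    JetFn.sum fun i _ => (hb1 m i).smul (JetFn.of_base contDiffOn_const)
  have hη0 : ∀ m, ∀ z ∈ W m, z ∉ tsupport (chartRep m (r m)) → ∀ φ, η m z φ = 0 :=
    fun m z _ hz φ => Finset.sum_eq_zero fun i _ => by rw [hb3 m φ z hz i, zero_smul]
  let B : M → HForm (k + 1) F V k := fun m =>
    localPiece m (tsupport (chartRep m (r m))) (η m)
  have hB0 : ∀ m (j : InfJet (k + 1) F V), j.base ∉ tsupport (r m) → B m j = 0 := fun m j hj =>
    localPiece_eq_zero fun h => hj (symm_image_tsupport_chartRep (hc m) (hsrc m) h)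
  have hBj : ∀ m x₁, JetFn (secCoord x₁) id (chartDom (k + 1) F V x₁) ((k + 1) * P)
      fun z φ => chartForm x₁ (pullSec (B m) φ) z := fun m x₁ =>
    jetFn_localPiece (hη m) (hWd m) (hWo m) (hf m).compact (hf m).subset (hη0 m) x₁
  have hBl : ∀ m, IsLocalForm (B m) := fun m => isLocalForm_iff.2 ⟨_, hBj m⟩
  have hBc : ∀ m φ, ∀ z ∈ W m, chartForm m (pullSec (B m) φ) z = η m z φ := fun m φ z hz =>
    chartForm_localPiece (hη m) (hWd m) (hf m).subset (hη0 m) hz φ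
  have hG : IsLocalForm (glue B) := isLocalForm_glue hfin hB0 hBj
  have hdB : ∀ m (φ : Sec (k + 1) F V) x, dH (B m) (jet φ x)
      = jacobiator ν Ω (smulForm (r m) α) β γ (jet φ x) := by
    intro m φ x
    by_cases hx : x ∈ tsupport (r m)
    · have hz := hmap m hx
      refine eq_of_chartForm_eq (hsrc m hx) (β := pullSec (dH (B m)) φ)
        (γ := pullSec (jacobiator ν Ω (smulForm (r m) α) β γ) φ) (topEval_injective ?_)
      rw [chartForm_dH (hBl m) φ (hWd m hz), ← chartCoeff_eq_topEval, hb2 m φ _ hz]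
      have he : chartForm m (pullSec (B m) φ) =ᶠ[𝓝 (extChartAt (𝓡 (k + 1)) m x)]
          fun y => ∑ i, b m i y φ • ζ m i :=
        eventuallyEq_of_mem ((hWo m).mem_nhds hz) fun y hy => hBc m φ y hy
      rw [he.extDeriv_eq]
      exact topEval_extDeriv (hζ m) fun i => ((((secFrame_mono (hWo m) (hWd m)).contDiffOn
        (hb1 m i) φ).contDiffAt ((hWo m).mem_nhds hz)).differentiableAt (by simp))
    · rw [jacobiator_smulForm_eq_zero (hr m) hα hβ.1 hγ.1 hx]
      refine dH_eq_zero_of_eventually (hBl m) ?_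
      filter_upwards [(isClosed_tsupport (r m)).isOpen_compl.mem_nhds hx] with y hy
      exact hB0 m _ hy
  -- The primitive has degree one below the top, so there is no condition on an Euler–Lagrange form.
  -- Its support along `φ` lies in the union of the supports of `E(β)` and `E(γ)`.
  refine ⟨glue B, ⟨hG, fun φ hφ => ?_, fun h => absurd h (by omega)⟩, ?_⟩
  · refine isCompact_closure_of_subset (((isCompactForm_iff.1 hβ).2.2 φ hφ).union
      ((isCompactForm_iff.1 hγ).2.2 φ hφ)) fun x hx => ?_
    by_contra hcon
    rw [mem_union, not_or] at hcon
    refine hx (finsum_eq_zero_of_forall_eq_zero fun m => ?_)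
    by_cases hxm : x ∈ tsupport (r m)
    · have hz := hmap m hxm
      have hback : (extChartAt (𝓡 (k + 1)) m).symm (extChartAt (𝓡 (k + 1)) m x) = x :=
        (extChartAt (𝓡 (k + 1)) m).left_inv (hsrc m hxm)
      refine eq_of_chartForm_eq (hsrc m hxm) (β := pullSec (B m) φ) (γ := fun x => 0) ?_
      rw [hBc m φ _ hz, chartForm_zero]
      refine Finset.sum_eq_zero fun i _ => ?_
      rw [hb4 m φ _ hz, zero_smul]
      · rw [hback]
        exact eventually_eq_zero_of_notMem_closure (b := fun y => eulerLagrange β (jet φ y)) hcon.1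
      · rw [hback]
        exact eventually_eq_zero_of_notMem_closure (b := fun y => eulerLagrange γ (jet φ y)) hcon.2
    · exact hB0 m _ hxm
  · funext j
    refine jet_base_section j (P := fun j => dH (glue B) j = jacobiator ν Ω α β γ j)
      fun φ x => ?_
    obtain ⟨t₁, ht₁⟩ := glue_eventually hfin hB0 x
    obtain ⟨t₂, ht₂⟩ := jacobiator_eq_sum (ν := ν) (Ω := Ω) hr hfin hsum hα hβ.1 hγ.1 x
    obtain ⟨hS, hdS⟩ := dH_finset_sum (t₁ ∪ t₂) fun m _ => hBl m
    -- A common finite index set serves both the glued form and the decomposition of the Jacobiator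
    -- near `x`.
    rw [ht₂ (t₁ ∪ t₂) Finset.subset_union_right φ, dH_congr hG hS (φ := φ) (x := x), hdS,
      Finset.sum_apply]
    · exact Finset.sum_congr rfl fun m _ => hdB m φ x
    · filter_upwards [ht₁] with y hy
      rw [hy (t₁ ∪ t₂) Finset.subset_union_left φ, Finset.sum_apply]

end Primitive

/-! ### Algebra of a bracket whose Jacobiator is a boundary -/

section ShLieAlgebra

variable {T : Type*} [AddCommGroup T] [Module ℝ T]

/-- The Jacobiator of a bilinear bracket. -/
def jac (B : T →ₗ[ℝ] T →ₗ[ℝ] T) (x y z : T) : T := B (B x y) z + B (B y z) x + B (B z x) y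

/-- A linear map as a multilinear map in one variable. -/
def multilinearOne (D : T →ₗ[ℝ] T) : MultilinearMap ℝ (fun _ : Fin 1 => T) T where
  toFun x := D (x 0)
  map_update_add' x i u v := by fin_cases i; simp
  map_update_smul' x i c u := by fin_cases i; simp

/-- A bilinear map as a multilinear map in two variables. -/
def multilinearTwo (B : T →ₗ[ℝ] T →ₗ[ℝ] T) : MultilinearMap ℝ (fun _ : Fin 2 => T) T where
  toFun x := B (x 0) (x 1)
  map_update_add' x i u v := by fin_cases i <;> simp [Function.update]
  map_update_smul' x i c u := by fin_cases i <;> simp [Function.update]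

/-- The map `S ∘ jac B` as a multilinear map in three variables. -/
def multilinearJac (B : T →ₗ[ℝ] T →ₗ[ℝ] T) (S : T →ₗ[ℝ] T) :
    MultilinearMap ℝ (fun _ : Fin 3 => T) T where
  toFun x := S (jac B (x 0) (x 1) (x 2))
  map_update_add' {inst} x i u v := by
    obtain rfl := Subsingleton.elim inst (instDecidableEqFin 3)
    fin_cases i <;> simp [Function.update, jac] <;> abel
  map_update_smul' {inst} x i c u := by
    obtain rfl := Subsingleton.elim inst (instDecidableEqFin 3)
    fin_cases i <;> simp [Function.update, jac]

/-- The brackets `D`, `B`, `S ∘ jac B`, `0`, `0`, …. -/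
def shBracket (D : T →ₗ[ℝ] T) (B : T →ₗ[ℝ] T →ₗ[ℝ] T) (S : T →ₗ[ℝ] T) :
    ∀ k : ℕ, MultilinearMap ℝ (fun _ : Fin k => T) T
  | 0 => 0
  | 1 => multilinearOne D
  | 2 => multilinearTwo B
  | 3 => multilinearJac B S
  | _ + 4 => 0

variable {D : T →ₗ[ℝ] T} {B : T →ₗ[ℝ] T →ₗ[ℝ] T} {S : T →ₗ[ℝ] T}

lemma shBracket_one {k : ℕ} (h : k = 1) (x : Fin k → T) :
    shBracket D B S k x = D (x ⟨0, by omega⟩) := by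
  subst h; rfl

lemma shBracket_two {k : ℕ} (h : k = 2) (x : Fin k → T) :
    shBracket D B S k x = B (x ⟨0, by omega⟩) (x ⟨1, by omega⟩) := by
  subst h; rfl

lemma shBracket_three {k : ℕ} (h : k = 3) (x : Fin k → T) :
    shBracket D B S k x
      = S (jac B (x ⟨0, by omega⟩) (x ⟨1, by omega⟩) (x ⟨2, by omega⟩)) := by
  subst h; rfl

lemma shBracket_of_four_le {k : ℕ} (h : 4 ≤ k) (x : Fin k → T) : shBracket D B S k x = 0 := by
  obtain ⟨k, rfl⟩ := Nat.exists_eq_add_of_le' h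
  rfl

lemma shSign_zero {m : ℕ} {d : Fin m → ℤ} (hd : ∀ a, d a = 0) (σ : Equiv.Perm (Fin m)) :
    shSign d σ = ((Equiv.Perm.sign σ : ℤˣ) : ℤ) := by
  simp [shSign, koszulSign, hd]

lemma perm_fin_two_cases (σ : Equiv.Perm (Fin 2)) : σ = 1 ∨ σ = Equiv.swap 0 1 := by
  revert σ; decide

lemma perm_fin_three_cases (σ : Equiv.Perm (Fin 3)) :
    (σ 0 = 0 ∧ σ 1 = 1 ∧ σ 2 = 2 ∧ Equiv.Perm.sign σ = 1) ∨
    (σ 0 = 0 ∧ σ 1 = 2 ∧ σ 2 = 1 ∧ Equiv.Perm.sign σ = -1) ∨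
    (σ 0 = 1 ∧ σ 1 = 0 ∧ σ 2 = 2 ∧ Equiv.Perm.sign σ = -1) ∨
    (σ 0 = 1 ∧ σ 1 = 2 ∧ σ 2 = 0 ∧ Equiv.Perm.sign σ = 1) ∨
    (σ 0 = 2 ∧ σ 1 = 0 ∧ σ 2 = 1 ∧ Equiv.Perm.sign σ = 1) ∨
    (σ 0 = 2 ∧ σ 1 = 1 ∧ σ 2 = 0 ∧ Equiv.Perm.sign σ = -1) := by
  revert σ; decide

lemma unshuffle_three : (Finset.univ.filter fun σ : Equiv.Perm (Fin 3) => IsUnshuffle 2 σ)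
    = {1, Equiv.swap 1 2, Equiv.swap 0 2 * Equiv.swap 0 1} := by
  decide

lemma unshuffle_four : (Finset.univ.filter fun σ : Equiv.Perm (Fin 4) => IsUnshuffle 2 σ)
    = {1, Equiv.swap 1 2, Equiv.swap 1 2 * Equiv.swap 1 3, Equiv.swap 0 1 * Equiv.swap 1 2,
      Equiv.swap 0 1 * Equiv.swap 1 2 * Equiv.swap 1 3, Equiv.swap 0 2 * Equiv.swap 1 3} := by
  decide

lemma sum_unshuffle_three (g : Fin 3 → Fin 3 → Fin 3 → T) :
    ∑ σ : Equiv.Perm (Fin 3) with IsUnshuffle 2 σ,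
      (((Equiv.Perm.sign σ : ℤˣ) : ℤ) : ℝ) • g (σ 0) (σ 1) (σ 2)
      = g 0 1 2 - g 0 2 1 + g 1 2 0 := by
  rw [unshuffle_three, Finset.sum_insert (by decide), Finset.sum_insert (by decide),
    Finset.sum_singleton]
  have h1 : Equiv.Perm.sign (Equiv.swap (1 : Fin 3) 2) = -1 := by decide
  have h2 : Equiv.Perm.sign (Equiv.swap (0 : Fin 3) 2 * Equiv.swap 0 1) = 1 := by decide
  rw [h1, h2]
  change _ • g 0 1 2 + (_ • g 0 2 1 + _ • g 1 2 0) = _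
  simp
  abel

lemma sum_unshuffle_four (g : Fin 4 → Fin 4 → Fin 4 → Fin 4 → T) :
    ∑ σ : Equiv.Perm (Fin 4) with IsUnshuffle 2 σ,
      (((Equiv.Perm.sign σ : ℤˣ) : ℤ) : ℝ) • g (σ 0) (σ 1) (σ 2) (σ 3)
      = g 0 1 2 3 - g 0 2 1 3 + g 0 3 1 2 + g 1 2 0 3 - g 1 3 0 2 + g 2 3 0 1 := by
  rw [unshuffle_four, Finset.sum_insert (by decide), Finset.sum_insert (by decide),
    Finset.sum_insert (by decide), Finset.sum_insert (by decide), Finset.sum_insert (by decide),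
    Finset.sum_singleton]
  have h1 : Equiv.Perm.sign (Equiv.swap (1 : Fin 4) 2) = -1 := by decide
  have h2 : Equiv.Perm.sign (Equiv.swap (1 : Fin 4) 2 * Equiv.swap 1 3) = 1 := by decide
  have h3 : Equiv.Perm.sign (Equiv.swap (0 : Fin 4) 1 * Equiv.swap 1 2) = 1 := by decide
  have h4 : Equiv.Perm.sign (Equiv.swap (0 : Fin 4) 1 * Equiv.swap 1 2 * Equiv.swap 1 3) = -1 := by
    decide
  have h5 : Equiv.Perm.sign (Equiv.swap (0 : Fin 4) 2 * Equiv.swap 1 3) = 1 := by decide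
  rw [h1, h2, h3, h4, h5]
  change _ • g 0 1 2 3 + (_ • g 0 2 1 3 + (_ • g 0 3 1 2 + (_ • g 1 2 0 3 +
    (_ • g 1 3 0 2 + _ • g 2 3 0 1)))) = _
  simp
  abel

/-- A skew bracket concentrated in degree `0`, which vanishes on boundaries and takes values in
cycles and whose Jacobiator is the boundary of `-S ∘ jac`, extends to an sh-Lie structure with
`l_k = 0` for `k ≥ 4`. -/
structure IsShDatum (X : ℤ → Submodule ℝ T) (D : T →ₗ[ℝ] T) (B : T →ₗ[ℝ] T →ₗ[ℝ] T)
    (S : T →ₗ[ℝ] T) : Prop where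
  D_mem : ∀ i, ∀ x ∈ X i, D x ∈ X (i - 1)
  D_D : ∀ x, D (D x) = 0
  B_mem : ∀ x y, B x y ∈ X 0
  B_eq_zero : ∀ i, i ≠ 0 → ∀ x ∈ X i, ∀ y, B x y = 0
  B_skew : ∀ x y, B x y = - B y x
  B_D : ∀ x y, B (D x) y = 0
  D_B : ∀ x y, D (B x y) = 0
  S_mem : ∀ x, S x ∈ X 1
  D_S : ∀ x y z, D (S (jac B x y z)) = - jac B x y z

namespace IsShDatum

variable {X : ℤ → Submodule ℝ T}

lemma _root_.LocalFunctionals.jac_cyclic (B : T →ₗ[ℝ] T →ₗ[ℝ] T) (x y z : T) : jac B x y z = jac B y z x := by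
  simp only [jac]; abel

lemma jac_swap (h : IsShDatum X D B S) (x y z : T) : jac B y x z = - jac B x y z := by
  simp only [jac]
  have h1 := h.B_skew y x
  have h2 := h.B_skew x z
  have h3 := h.B_skew z y
  rw [h1, h2, h3]
  simp only [map_neg, LinearMap.neg_apply]
  abel

lemma jac_eq_zero (h : IsShDatum X D B S) {x : T} (hx : ∀ y, B x y = 0) (y z : T) : jac B x y z = 0 := by
  simp only [jac]
  rw [hx, h.B_skew _ x, hx, h.B_skew z x, hx]
  simp

lemma jac_eq_zero₂ (h : IsShDatum X D B S) {y : T} (hy : ∀ z, B y z = 0) (x z : T) : jac B x y z = 0 := by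
  rw [jac_cyclic, h.jac_eq_zero hy]

lemma jac_eq_zero₃ (h : IsShDatum X D B S) {z : T} (hz : ∀ y, B z y = 0) (x y : T) : jac B x y z = 0 := by
  rw [jac_cyclic, h.jac_eq_zero₂ hz]

/-- The Jacobiator is a boundary, and boundaries are central. -/
lemma B_jac (h : IsShDatum X D B S) (x y z w : T) : B (jac B x y z) w = 0 := by
  rw [← neg_neg (jac B x y z), ← h.D_S, map_neg, LinearMap.neg_apply, h.B_D, neg_zero]

/-- Modulo skewness the left side is an alternating sum of brackets of a Jacobiator of three of the
variables with the fourth, and each of these vanishes by `B_jac`. -/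
lemma sum_jac_B (h : IsShDatum X D B S) (x y z w : T) : jac B (B x y) z w - jac B (B x z) y w + jac B (B x w) y z
    + jac B (B y z) x w - jac B (B y w) x z + jac B (B z w) x y = 0 := by
  have h1 := h.B_jac x y z w
  have h2 := h.B_jac x y w z
  have h3 := h.B_jac x z w y
  have h4 := h.B_jac y z w x
  simp only [jac, map_add, LinearMap.add_apply] at h1 h2 h3 h4 ⊢
  rw [h.B_skew z x] at h1
  rw [h.B_skew w x] at h2 h3
  rw [h.B_skew w y] at h4
  rw [h.B_skew w (B x y), h.B_skew w (B x z), h.B_skew z (B x w), h.B_skew w (B y z),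
    h.B_skew z (B y w), h.B_skew y (B z w), h.B_skew (B z w) (B x y), h.B_skew (B y w) (B x z),
    h.B_skew (B y z) (B x w)]
  simp only [map_neg, LinearMap.neg_apply] at h1 h2 h3 h4 ⊢
  linear_combination (norm := module) h1 - h2 + h3 - h4

end IsShDatum

end ShLieAlgebra

/-! ### The sh-Lie relations -/

section ShLieOfDatum

variable {T : Type*} [AddCommGroup T] [Module ℝ T] {D : T →ₗ[ℝ] T} {B : T →ₗ[ℝ] T →ₗ[ℝ] T}
  {S : T →ₗ[ℝ] T} {X : ℤ → Submodule ℝ T}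

lemma shSign_one {m : ℕ} (d : Fin m → ℤ) : shSign d 1 = 1 := by
  have h : koszulSign d 1 = 1 := Finset.prod_eq_one fun a _ => Finset.prod_eq_one fun b _ =>
    if_neg fun h => lt_asymm h.1 h.2
  simp [shSign, h]

namespace IsShDatum

/-- A central argument kills every bracket of arity at least two. Elements of nonzero degree are
central, so degree, symmetry and relations need a real check only in degree zero, where Koszul signs
are trivial. -/
lemma shBracket_eq_zero (h : IsShDatum X D B S) {k : ℕ} (hk : 2 ≤ k) {x : Fin k → T}
    {a : Fin k} (ha : ∀ y, B (x a) y = 0) : shBracket D B S k x = 0 := by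
  rcases (by omega : k = 2 ∨ k = 3 ∨ 4 ≤ k) with rfl | rfl | hk
  · rw [shBracket_two rfl]
    fin_cases a
    · exact ha _
    · exact (h.B_skew _ _).trans (by rw [show B (x ⟨1, by omega⟩) _ = 0 from ha _, neg_zero])
  · rw [shBracket_three rfl]
    fin_cases a
    · exact (congrArg S (h.jac_eq_zero ha _ _)).trans (map_zero S)
    · exact (congrArg S (h.jac_eq_zero₂ ha _ _)).trans (map_zero S)
    · exact (congrArg S (h.jac_eq_zero₃ ha _ _)).trans (map_zero S)
  · exact shBracket_of_four_le hk x

lemma shBracket_degree (h : IsShDatum X D B S) (k : ℕ) (hk : 1 ≤ k) (d : Fin k → ℤ)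
    (x : Fin k → T) (hx : ∀ a, x a ∈ X (d a)) : shBracket D B S k x ∈ X (∑ a, d a + k - 2) := by
  rcases (by omega : k = 1 ∨ 2 ≤ k) with rfl | hk2
  · rw [shBracket_one rfl]
    have := h.D_mem _ _ (hx 0)
    rw [show ∑ a, d a + ((1 : ℕ) : ℤ) - 2 = d 0 - 1 by simp; ring]
    exact this
  by_cases hd : ∀ a, d a = 0
  · have hs : ∑ a, d a = 0 := Finset.sum_eq_zero fun a _ => hd a
    rw [hs]
    rcases (by omega : k = 2 ∨ k = 3 ∨ 4 ≤ k) with rfl | rfl | hk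
    · rw [shBracket_two rfl]
      exact h.B_mem _ _
    · rw [shBracket_three rfl]
      exact h.S_mem _
    · rw [shBracket_of_four_le hk]
      exact zero_mem _
  · push Not at hd
    obtain ⟨a, ha⟩ := hd
    rw [h.shBracket_eq_zero hk2 (h.B_eq_zero _ ha _ (hx a))]
    exact zero_mem _

lemma shBracket_skew (h : IsShDatum X D B S) (k : ℕ) (hk : 1 ≤ k) (d : Fin k → ℤ)
    (x : Fin k → T) (hx : ∀ a, x a ∈ X (d a)) (σ : Equiv.Perm (Fin k)) :
    shBracket D B S k (fun a => x (σ a)) = shSign d σ • shBracket D B S k x := by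
  rcases (by omega : k = 1 ∨ 2 ≤ k) with rfl | hk2
  · obtain rfl : σ = 1 := Subsingleton.elim _ _
    simp [shSign, koszulSign]
  by_cases hd : ∀ a, d a = 0
  · rw [shSign_zero hd]
    rcases (by omega : k = 2 ∨ k = 3 ∨ 4 ≤ k) with rfl | rfl | hk
    · rw [shBracket_two rfl, shBracket_two rfl]
      rcases perm_fin_two_cases σ with rfl | rfl
      · simp
      · rw [show Equiv.Perm.sign (Equiv.swap (0 : Fin 2) 1) = -1 by decide]
        change B (x 1) (x 0) = _ • B (x 0) (x 1)
        rw [h.B_skew (x 1)]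
        simp
    · rw [shBracket_three rfl, shBracket_three rfl]
      change S (jac B (x (σ 0)) (x (σ 1)) (x (σ 2))) = _ • S (jac B (x 0) (x 1) (x 2))
      rw [← map_smul]
      congr 1
      rcases perm_fin_three_cases σ with ⟨h0, h1, h2, hs⟩ | ⟨h0, h1, h2, hs⟩ | ⟨h0, h1, h2, hs⟩ |
        ⟨h0, h1, h2, hs⟩ | ⟨h0, h1, h2, hs⟩ | ⟨h0, h1, h2, hs⟩ <;> rw [h0, h1, h2, hs] <;> simp
      · rw [← jac_cyclic, h.jac_swap, ← jac_cyclic, ← jac_cyclic]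
      · exact h.jac_swap _ _ _
      · exact (jac_cyclic B _ _ _).symm
      · exact jac_cyclic B _ _ _
      · rw [jac_cyclic, h.jac_swap]
    · rw [shBracket_of_four_le hk, shBracket_of_four_le hk, smul_zero]
  · push Not at hd
    obtain ⟨a, ha⟩ := hd
    have h0 := h.B_eq_zero _ ha _ (hx a)
    rw [h.shBracket_eq_zero hk2 h0, h.shBracket_eq_zero hk2 (a := σ⁻¹ a) (by simpa using h0),
      smul_zero]

lemma jac_eq_zero_of_mem (h : IsShDatum X D B S) {x : Fin 3 → T} {a : Fin 3}
    (ha : ∀ y, B (x a) y = 0) : jac B (x 0) (x 1) (x 2) = 0 := by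
  fin_cases a
  · exact h.jac_eq_zero ha _ _
  · exact h.jac_eq_zero₂ ha _ _
  · exact h.jac_eq_zero₃ ha _ _

/-- In degree zero the three unshuffles give the cyclic sum after one use of skewness. Otherwise
some argument is central and both sides vanish. -/
lemma relation_three (h : IsShDatum X D B S) {d : Fin 3 → ℤ} {x : Fin 3 → T}
    (hx : ∀ a, x a ∈ X (d a)) :
    ∑ σ : Equiv.Perm (Fin 3) with IsUnshuffle 2 σ,
      shSign d σ • B (B (x (σ 0)) (x (σ 1))) (x (σ 2)) = jac B (x 0) (x 1) (x 2) := by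
  by_cases hd : ∀ a, d a = 0
  · simp only [shSign_zero hd]
    rw [sum_unshuffle_three fun a b c => B (B (x a) (x b)) (x c), jac, h.B_skew (x 2) (x 0)]
    simp only [map_neg, LinearMap.neg_apply]
    abel
  · push Not at hd
    obtain ⟨a, ha⟩ := hd
    have h0 := h.B_eq_zero _ ha _ (hx a)
    rw [h.jac_eq_zero_of_mem h0]
    refine Finset.sum_eq_zero fun σ _ => ?_
    obtain ⟨b, rfl⟩ := σ.surjective a
    have h1 : ∀ y, B y (x (σ b)) = 0 := fun y => by rw [h.B_skew, h0, neg_zero]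
    have : b = 0 ∨ b = 1 ∨ b = 2 := by fin_cases b <;> simp
    rcases this with rfl | rfl | rfl
    · rw [h0, map_zero]; simp
    · rw [h1, map_zero]; simp
    · rw [h1]; simp

lemma relation_four (h : IsShDatum X D B S) {d : Fin 4 → ℤ} {x : Fin 4 → T}
    (hx : ∀ a, x a ∈ X (d a)) :
    ∑ σ : Equiv.Perm (Fin 4) with IsUnshuffle 2 σ,
      shSign d σ • S (jac B (B (x (σ 0)) (x (σ 1))) (x (σ 2)) (x (σ 3))) = 0 := by
  by_cases hd : ∀ a, d a = 0
  · simp only [shSign_zero hd]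
    rw [sum_unshuffle_four fun a b c e => S (jac B (B (x a) (x b)) (x c) (x e))]
    simp only [← map_sub, ← map_add]
    rw [h.sum_jac_B, map_zero]
  · push Not at hd
    obtain ⟨a, ha⟩ := hd
    have h0 := h.B_eq_zero _ ha _ (hx a)
    refine Finset.sum_eq_zero fun σ _ => ?_
    obtain ⟨b, rfl⟩ := σ.surjective a
    have h1 : ∀ y, B y (x (σ b)) = 0 := fun y => by rw [h.B_skew, h0, neg_zero]
    have : b = 0 ∨ b = 1 ∨ b = 2 ∨ b = 3 := by fin_cases b <;> simp
    rcases this with rfl | rfl | rfl | rfl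
    · rw [h.jac_eq_zero (by simp [h0])]; simp
    · rw [h.jac_eq_zero (by simp [h1])]; simp
    · rw [h.jac_eq_zero₂ h0]; simp
    · rw [h.jac_eq_zero₃ h0]; simp

lemma shBracket_relation (h : IsShDatum X D B S) (m : ℕ) (hm : 1 ≤ m) (d : Fin m → ℤ)
    (x : Fin m → T) (hx : ∀ a, x a ∈ X (d a)) :
    ∑ i : Fin m, ∑ σ : Equiv.Perm (Fin m) with IsUnshuffle (i + 1) σ,
      (shSign d σ * (-1) ^ (((i : ℕ) + 1) * (m - i - 1))) •
        shBracket D B S (m - i) (fun b : Fin (m - i) =>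
          if (b : ℕ) = 0 then shBracket D B S (i + 1) (fun a : Fin (i + 1) => x (σ ⟨a, by omega⟩))
          else x (σ ⟨i + b, by omega⟩)) = 0 := by
  -- a term with inner bracket of arity `i + 1` vanishes if that bracket is central
  have key : ∀ (i : Fin m) (σ : Equiv.Perm (Fin m)), (i : ℕ) + 2 ≤ m →
      (∀ y, B (shBracket D B S (i + 1) (fun a : Fin (i + 1) => x (σ ⟨a, by omega⟩))) y = 0) →
      shBracket D B S (m - i) (fun b : Fin (m - i) =>
          if (b : ℕ) = 0 then shBracket D B S (i + 1) (fun a : Fin (i + 1) => x (σ ⟨a, by omega⟩))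
          else x (σ ⟨i + b, by omega⟩)) = 0 := fun i σ hi h0 =>
    h.shBracket_eq_zero (by omega) (a := ⟨0, by omega⟩) (by simpa using h0)
  -- Only an inner bracket of arity two can fail to be central: `D` gives boundaries, `S` lands in
  -- degree one, and the rest is zero.
  have hB1 : ∀ (i : Fin m) (σ : Equiv.Perm (Fin m)), (i : ℕ) ≠ 1 → ∀ y,
      B (shBracket D B S (i + 1) (fun a : Fin (i + 1) => x (σ ⟨a, by omega⟩))) y = 0 := by
    intro i σ hi y
    rcases (by omega : (i : ℕ) = 0 ∨ (i : ℕ) = 2 ∨ 3 ≤ (i : ℕ)) with h0 | h0 | h0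
    · rw [shBracket_one (by omega), h.B_D]
    · rw [shBracket_three (by omega)]
      exact h.B_eq_zero 1 one_ne_zero _ (h.S_mem _) y
    · rw [shBracket_of_four_le (by omega), map_zero, LinearMap.zero_apply]
  rcases (by omega : m = 1 ∨ m = 2 ∨ m = 3 ∨ m = 4 ∨ 5 ≤ m) with rfl | rfl | rfl | rfl | hm5
  · refine Finset.sum_eq_zero fun i _ => Finset.sum_eq_zero fun σ _ => ?_
    rw [shBracket_one (by omega)]
    simp only [if_true]
    rw [shBracket_one (by omega), h.D_D, smul_zero]
  · refine Finset.sum_eq_zero fun i _ => Finset.sum_eq_zero fun σ _ => ?_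
    rcases (by omega : (i : ℕ) = 0 ∨ (i : ℕ) = 1) with h0 | h0
    · rw [key i σ (by omega) (hB1 i σ (by omega)), smul_zero]
    · rw [shBracket_one (by omega)]
      simp only [if_true]
      rw [shBracket_two (by omega), h.D_B, smul_zero]
  · rw [Fin.sum_univ_three]
    have e0 : ∀ σ : Equiv.Perm (Fin 3), _ := fun σ => key 0 σ (by simp) (hB1 0 σ (by simp))
    rw [Finset.sum_eq_zero fun σ _ => by rw [e0 σ, smul_zero], zero_add]
    have e2 : (Finset.univ.filter fun σ : Equiv.Perm (Fin 3) =>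
        IsUnshuffle (((2 : Fin 3) : ℕ) + 1) σ) = {1} := by decide
    -- The only `(3, 0)`-unshuffle is the identity, so the term `l_1 l_3` is `D (S (jac))`, minus
    -- the Jacobiator, and it cancels the terms `l_2 l_2`.
    rw [e2, Finset.sum_singleton, shBracket_one (by simp)]
    simp only [if_true]
    rw [shBracket_three (by simp)]
    have e3 := (h.D_S (x 0) (x 1) (x 2)).trans (congrArg Neg.neg (h.relation_three hx).symm)
    refine (congrArg₂ (· + ·) (Finset.sum_congr rfl fun σ _ => ?_) ?_).trans
      (add_neg_cancel (∑ σ : Equiv.Perm (Fin 3) with IsUnshuffle 2 σ,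
        shSign d σ • B (B (x (σ 0)) (x (σ 1))) (x (σ 2))))
    · rw [shBracket_two (by simp)]
      simp only [if_true, one_ne_zero, if_false]
      rw [shBracket_two (by simp)]
      simp
    · refine Eq.trans ?_ e3
      rw [shSign_one]
      simp
  · rw [Fin.sum_univ_four]
    have e0 : ∀ σ : Equiv.Perm (Fin 4), _ := fun σ => key 0 σ (by simp) (hB1 0 σ (by simp))
    have e2 : ∀ σ : Equiv.Perm (Fin 4), _ := fun σ => key 2 σ (by simp) (hB1 2 σ (by simp))
    rw [Finset.sum_eq_zero fun σ _ => by rw [e0 σ, smul_zero], zero_add]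
    rw [Finset.sum_eq_zero (s := Finset.univ.filter fun σ : Equiv.Perm (Fin 4) =>
      IsUnshuffle (((2 : Fin 4) : ℕ) + 1) σ) fun σ _ => by rw [e2 σ, smul_zero], add_zero]
    refine (congrArg₂ (· + ·) ((Finset.sum_congr rfl fun σ _ => ?_).trans (h.relation_four hx))
      (Finset.sum_eq_zero fun σ _ => ?_)).trans (add_zero 0)
    · rw [shBracket_three (by simp)]
      simp only [if_true, one_ne_zero, if_false]
      rw [shBracket_two (by simp)]
      norm_num
      rfl
    · rw [shBracket_one (by simp)]
      simp only [if_true]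
      rw [shBracket_of_four_le (by simp), map_zero, smul_zero]
  -- From five variables on, a noncentral inner bracket is paired with an outer one of arity at
  -- least four, which is zero.
  · refine Finset.sum_eq_zero fun i _ => Finset.sum_eq_zero fun σ _ => ?_
    by_cases h1 : (i : ℕ) = 1
    · rw [shBracket_of_four_le (by omega), smul_zero]
    by_cases hi : (i : ℕ) + 2 ≤ m
    · rw [key i σ hi (hB1 i σ h1), smul_zero]
    · rw [shBracket_one (by omega)]
      simp only [if_true]
      rw [shBracket_of_four_le (by omega), map_zero, smul_zero]

/-- The sh-Lie structure of a datum. -/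
def shLieStructure (h : IsShDatum X D B S) : ShLieStructure X where
  l := shBracket D B S
  degree := h.shBracket_degree
  skew := h.shBracket_skew
  relation := h.shBracket_relation

lemma shLieStructure_one (h : IsShDatum X D B S) (x : T) : h.shLieStructure.l 1 ![x] = D x := rfl

lemma shLieStructure_two (h : IsShDatum X D B S) (x y : T) :
    h.shLieStructure.l 2 ![x, y] = B x y := rfl

end IsShDatum

end ShLieOfDatum

/-! ### The sh-Lie structure of a complex with a bracket in top degree -/

section GradedDatum

/-- A linear map has a linear section over its range. -/
lemma exists_section_on_range {U W : Type*} [AddCommGroup U] [Module ℝ U] [AddCommGroup W]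
    [Module ℝ W] (f : U →ₗ[ℝ] W) : ∃ s : W →ₗ[ℝ] U, ∀ u, f (s (f u)) = f u := by
  obtain ⟨g, hg⟩ := f.rangeRestrict.exists_rightInverse_of_surjective f.range_rangeRestrict
  obtain ⟨s, hs⟩ := g.exists_extend
  refine ⟨s, fun u => ?_⟩
  have h1 : s (f u) = g ⟨f u, u, rfl⟩ := LinearMap.congr_fun hs ⟨f u, u, rfl⟩
  rw [h1]
  exact congrArg Subtype.val (LinearMap.congr_fun hg ⟨f u, u, rfl⟩)

variable {n : ℕ} {A : ℕ → Type*} [∀ k, AddCommGroup (A k)] [∀ k, Module ℝ (A k)]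

/-- The grading of `⨁ A k` in which `A k` has degree `n - k`. -/
def degreeFrom (n : ℕ) (A : ℕ → Type*) [∀ k, AddCommGroup (A k)] [∀ k, Module ℝ (A k)] (i : ℤ) :
    Submodule ℝ (⨁ k, A k) :=
  ⨆ (k : ℕ) (_ : (k : ℤ) = n - i), LinearMap.range (DirectSum.lof ℝ ℕ A k)

lemma lof_mem_degreeFrom {k : ℕ} {i : ℤ} (h : (k : ℤ) = n - i) (x : A k) :
    DirectSum.lof ℝ ℕ A k x ∈ degreeFrom n A i :=
  Submodule.mem_iSup_of_mem k (Submodule.mem_iSup_of_mem h ⟨x, rfl⟩)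

lemma component_lof_of_ne {k l : ℕ} (h : k ≠ l) (x : A k) :
    DirectSum.component ℝ ℕ A l (DirectSum.lof ℝ ℕ A k x) = 0 :=
  DirectSum.of_eq_of_ne _ _ _ h.symm

/-- The total differential. -/
def totalDiff (d : ∀ k, A k →ₗ[ℝ] A (k + 1)) : (⨁ k, A k) →ₗ[ℝ] ⨁ k, A k :=
  DirectSum.toModule ℝ ℕ _ fun k => DirectSum.lof ℝ ℕ A (k + 1) ∘ₗ d k

lemma totalDiff_lof (d : ∀ k, A k →ₗ[ℝ] A (k + 1)) (k : ℕ) (x : A k) :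
    totalDiff d (DirectSum.lof ℝ ℕ A k x) = DirectSum.lof ℝ ℕ A (k + 1) (d k x) :=
  DirectSum.toModule_lof ..

/-- A bracket on the `n`-th component, extended by zero. -/
def totalBracket (b : A n →ₗ[ℝ] A n →ₗ[ℝ] A n) :
    (⨁ k, A k) →ₗ[ℝ] (⨁ k, A k) →ₗ[ℝ] ⨁ k, A k :=
  (b.compl₁₂ (DirectSum.component ℝ ℕ A n) (DirectSum.component ℝ ℕ A n)).compr₂
    (DirectSum.lof ℝ ℕ A n)

lemma totalBracket_apply (b : A n →ₗ[ℝ] A n →ₗ[ℝ] A n) (x y : ⨁ k, A k) :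
    totalBracket b x y = DirectSum.lof ℝ ℕ A n
      (b (DirectSum.component ℝ ℕ A n x) (DirectSum.component ℝ ℕ A n y)) := rfl

lemma jac_totalBracket (b : A n →ₗ[ℝ] A n →ₗ[ℝ] A n) (x y z : ⨁ k, A k) :
    jac (totalBracket b) x y z = DirectSum.lof ℝ ℕ A n (jac b (DirectSum.component ℝ ℕ A n x)
      (DirectSum.component ℝ ℕ A n y) (DirectSum.component ℝ ℕ A n z)) := by
  simp only [jac, totalBracket_apply, DirectSum.component.lof_self, map_add]

/-- `S` is minus a linear section of the last differential, which inverts it on Jacobiators as they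
are boundaries. For `n = 0` there is nothing in degree one, so the Jacobiator itself has to vanish.
Heterogeneous equality compares `A (k + 1)` with `A n`. -/
lemma exists_isShDatum (d : ∀ k, A k →ₗ[ℝ] A (k + 1)) (b : A n →ₗ[ℝ] A n →ₗ[ℝ] A n)
    (hdd : ∀ k x, d (k + 1) (d k x) = 0) (hskew : ∀ x y, b x y = - b y x)
    (hdb : ∀ x y, d n (b x y) = 0)
    (hbd : ∀ k, k + 1 = n → ∀ x z y, HEq (d k x) z → b z y = 0)
    (hjac₀ : n = 0 → ∀ x y z, jac b x y z = 0)
    (hjac : ∀ k, k + 1 = n → ∀ x y z, ∃ u, HEq (d k u) (jac b x y z)) :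
    ∃ S, IsShDatum (degreeFrom n A) (totalDiff d) (totalBracket b) S := by
  obtain ⟨S, hS, hdS⟩ : ∃ S : (⨁ k, A k) →ₗ[ℝ] ⨁ k, A k, (∀ x, S x ∈ degreeFrom n A 1) ∧
      ∀ x y z, totalDiff d (S (jac (totalBracket b) x y z)) = - jac (totalBracket b) x y z := by
    obtain _ | k := n
    · refine ⟨0, fun x => zero_mem _, fun x y z => ?_⟩
      rw [jac_totalBracket, hjac₀ rfl]
      simp
    · obtain ⟨s, hs⟩ := exists_section_on_range (d k)
      refine ⟨-(DirectSum.lof ℝ ℕ A k ∘ₗ s ∘ₗ DirectSum.component ℝ ℕ A (k + 1)),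
        fun x => neg_mem (lof_mem_degreeFrom (by push_cast; ring) _), fun x y z => ?_⟩
      obtain ⟨u, hu⟩ := hjac k rfl (DirectSum.component ℝ ℕ A (k + 1) x)
        (DirectSum.component ℝ ℕ A (k + 1) y) (DirectSum.component ℝ ℕ A (k + 1) z)
      rw [jac_totalBracket, ← eq_of_heq hu]
      simp only [LinearMap.neg_apply, LinearMap.comp_apply, DirectSum.component.lof_self, map_neg,
        totalDiff_lof]
      rw [hs]
  refine ⟨S, ⟨fun i => ?_, fun x => ?_, fun x y => lof_mem_degreeFrom (by simp) _,
    fun i hi => ?_, fun x y => ?_, fun x y => ?_, fun x y => ?_, hS, hdS⟩⟩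
  · refine show degreeFrom n A i ≤ (degreeFrom n A (i - 1)).comap (totalDiff d) from
      iSup₂_le fun k hk => ?_
    rintro _ ⟨f, rfl⟩
    rw [Submodule.mem_comap, totalDiff_lof]
    exact lof_mem_degreeFrom (by push_cast; omega) _
  · have : totalDiff d ∘ₗ totalDiff d = 0 := DirectSum.linearMap_ext ℝ fun k => by
      ext f : 1
      simp only [LinearMap.comp_apply, totalDiff_lof, hdd, map_zero, LinearMap.zero_apply]
    exact LinearMap.congr_fun this x
  · intro x hx y
    have h0 : degreeFrom n A i ≤ LinearMap.ker (DirectSum.component ℝ ℕ A n) := by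
      refine iSup₂_le fun k hk => ?_
      rintro _ ⟨f, rfl⟩
      exact component_lof_of_ne (by omega) f
    rw [totalBracket_apply, LinearMap.mem_ker.1 (h0 hx)]
    simp
  · rw [totalBracket_apply, totalBracket_apply, hskew, map_neg]
  · have : (totalBracket b).flip y ∘ₗ totalDiff d = 0 := DirectSum.linearMap_ext ℝ fun k => by
      ext f : 1
      simp only [LinearMap.comp_apply, totalDiff_lof, LinearMap.flip_apply, LinearMap.zero_apply,
        totalBracket_apply]
      by_cases h : k + 1 = n
      · subst h
        rw [DirectSum.component.lof_self, hbd k rfl _ _ _ HEq.rfl, map_zero]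
      · rw [component_lof_of_ne h]
        simp
    exact LinearMap.congr_fun this x
  · rw [totalBracket_apply, totalDiff_lof, hdb, map_zero]

/-- A complex with a skew bracket on its `n`-th term which vanishes on boundaries and satisfies the
Jacobi identity up to boundaries is an sh-Lie algebra. -/
theorem exists_shLieStructure (d : ∀ k, A k →ₗ[ℝ] A (k + 1)) (b : A n →ₗ[ℝ] A n →ₗ[ℝ] A n)
    (hdd : ∀ k x, d (k + 1) (d k x) = 0) (hskew : ∀ x y, b x y = - b y x)
    (hdb : ∀ x y, d n (b x y) = 0)
    (hbd : ∀ k, k + 1 = n → ∀ x z y, HEq (d k x) z → b z y = 0)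
    (hjac₀ : n = 0 → ∀ x y z, jac b x y z = 0)
    (hjac : ∀ k, k + 1 = n → ∀ x y z, ∃ u, HEq (d k u) (jac b x y z)) :
    ∃ L : ShLieStructure (degreeFrom n A),
      (∀ k f, L.l 1 ![DirectSum.lof ℝ ℕ A k f] = DirectSum.lof ℝ ℕ A (k + 1) (d k f)) ∧
      ∀ f₁ f₂, L.l 2 ![DirectSum.lof ℝ ℕ A n f₁, DirectSum.lof ℝ ℕ A n f₂]
        = DirectSum.lof ℝ ℕ A n (b f₁ f₂) := by
  obtain ⟨S, h⟩ := exists_isShDatum d b hdd hskew hdb hbd hjac₀ hjac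
  refine ⟨h.shLieStructure, fun k f => (h.shLieStructure_one _).trans (totalDiff_lof d k f),
    fun f₁ f₂ => (h.shLieStructure_two _ _).trans ?_⟩
  rw [totalBracket_apply, DirectSum.component.lof_self, DirectSum.component.lof_self]

end GradedDatum

/-! ### Descent of differential and bracket to the quotient -/

section Reduction

/-- A map which preserves combinations `c • x + y` is linear. -/
def linearOfComb {U W : Type*} [AddCommGroup U] [Module ℝ U] [AddCommGroup W] [Module ℝ W]
    (f : U → W) (h : ∀ (c : ℝ) x y, f (c • x + y) = c • f x + f y) : U →ₗ[ℝ] W where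
  toFun := f
  map_add' x y := by simpa using h 1 x y
  map_smul' c x := by
    have h0 : f 0 = 0 := by simpa using h 1 0 0
    simpa [h0] using h c x 0

/-- A map of two variables which preserves combinations in each of them is bilinear. -/
def bilinearOfComb {U W : Type*} [AddCommGroup U] [Module ℝ U] [AddCommGroup W] [Module ℝ W]
    (f : U → U → W) (h : ∀ (c : ℝ) x x' y, f (c • x + x') y = c • f x y + f x' y)
    (h' : ∀ (c : ℝ) y y' x, f x (c • y + y') = c • f x y + f x y') : U →ₗ[ℝ] U →ₗ[ℝ] W :=
  linearOfComb (fun x => linearOfComb (f x) fun c y y' => h' c y y' x)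
    fun c x x' => LinearMap.ext fun y => h c x x' y

variable {n : ℕ} {F : Type*} [NormedAddCommGroup F] [NormedSpace ℝ F] [FiniteDimensional ℝ F]
  {M : Type*} [TopologicalSpace M] [ChartedSpace (Model n) M]
  {V : M → Type*} [TopologicalSpace (TotalSpace F V)] [∀ x, AddCommGroup (V x)]
  [∀ x, Module ℝ (V x)] [∀ x, TopologicalSpace (V x)] [FiberBundle F V] [VectorBundle ℝ F V]
  [IsManifold (𝓡 n) ∞ M] [ContMDiffVectorBundle ∞ F V (𝓡 n)] [T2Space M]
  {G : Type*} [Group G] (ρ : FiberAction n F V G)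

/-- When the differential lands in top degree, the extra support condition holds because the
Euler–Lagrange form of an exact Lagrangian is zero. -/
lemma IsCompactForm.dH {k : ℕ} {α : HForm n F V k} (hα : IsCompactForm α) :
    IsCompactForm (dH α) := by
  by_cases h : k + 1 = n
  · subst h
    refine isCompactForm_iff.2 ⟨hα.1.dH, hα.2.1.dH hα.1, fun φ _ => ?_⟩
    rw [eulerLagrange_dH hα.1]
    simp
  · exact ⟨hα.1.dH, hα.2.1.dH hα.1, fun h' => absurd h' h⟩

namespace FiberAction

variable {ρ} in
lemma mem_invariantForms {k : ℕ} {α : HForm n F V k} :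
    α ∈ ρ.invariantForms k ↔ IsCompactForm α ∧ ∀ g, ρ.pull g α = α := by
  simp only [invariantForms, Submodule.mem_inf, Submodule.mem_iInf, LinearMap.mem_eqLocus]
  rfl

lemma projPull_injective {k : ℕ} : Function.Injective (ρ.projPull (k := k)) := by
  intro a b h
  funext q
  induction q using Quot.ind with
  | mk j => exact congrFun h j

/-- Invariance is exactly compatibility with the orbit relation. The action covers the identity, so
jets in one orbit have the same base point and the covectors can be compared. -/
lemma exists_projPull_eq {k : ℕ} {α : HForm n F V k} (h : ∀ g, ρ.pull g α = α) :
    ∃ a : ρ.QuotForm k, ρ.projPull a = α := by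
  refine ⟨fun q => Quot.hrecOn (motive := fun q => Cov n k (ρ.quotBase q)) q (fun j => α j) ?_, ?_⟩
  · rintro j _ ⟨g, rfl⟩
    exact heq_of_eq (congrFun (h g) j).symm
  · rfl

/-- The isomorphism `π^* : Ω_c(J^∞E/G) ≃ Ω_G(J^∞E)`. -/
def reducedEquiv (k : ℕ) : ρ.reducedForms k ≃ₗ[ℝ] ρ.invariantForms k :=
  LinearEquiv.ofBijective (ρ.projPull.restrict (p := ρ.reducedForms k) (q := ρ.invariantForms k)
    fun _ h => h) ⟨fun a b h => Subtype.ext (ρ.projPull_injective (congrArg Subtype.val h)),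
    fun α => by
      obtain ⟨a, ha⟩ := ρ.exists_projPull_eq (mem_invariantForms.1 α.2).2
      exact ⟨⟨a, show ρ.projPull a ∈ _ from ha ▸ α.2⟩, Subtype.ext ha⟩⟩

lemma projPull_reducedEquiv_symm {k : ℕ} (α : ρ.invariantForms k) :
    ρ.projPull ((ρ.reducedEquiv k).symm α : ρ.QuotForm k) = α :=
  congrArg Subtype.val ((ρ.reducedEquiv k).apply_symm_apply α)

lemma dH_mem_invariantForms {k : ℕ} {α : HForm n F V k} (h : α ∈ ρ.invariantForms k) :
    dH α ∈ ρ.invariantForms (k + 1) := by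
  rw [mem_invariantForms] at h ⊢
  exact ⟨h.1.dH, fun g => by rw [← ρ.dH_pull g h.1.1, h.2]⟩

lemma isLocalForm_of_mem {k : ℕ} (α : ρ.invariantForms k) : IsLocalForm (α : HForm n F V k) :=
  (mem_invariantForms.1 α.2).1.1

/-- The horizontal differential on invariant forms. -/
def invariantDiff (k : ℕ) : ρ.invariantForms k →ₗ[ℝ] ρ.invariantForms (k + 1) :=
  linearOfComb (fun α => ⟨dH (α : HForm n F V k), ρ.dH_mem_invariantForms α.2⟩)
    fun c α β => Subtype.ext (dH_comb c (ρ.isLocalForm_of_mem α) (ρ.isLocalForm_of_mem β))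

variable [SigmaCompactSpace M] {ν : VolumeForm n M} {Ω : BracketTensor n F V}

lemma bracketForm_mem_invariantForms (hcan : ∀ g : G, ρ.IsCanonical ν Ω g)
    {α β : HForm n F V n} (hα : α ∈ ρ.invariantForms n) (hβ : β ∈ ρ.invariantForms n) :
    bracketForm ν Ω α β ∈ ρ.invariantForms n := by
  rw [mem_invariantForms] at hα hβ ⊢
  exact ⟨isCompactForm_bracketForm ν Ω hα.1 hβ.1, fun g => by
    rw [← ρ.bracketForm_pull (hcan g) hα.1.1 hβ.1.1, hα.2, hβ.2]⟩

/-- The bracket of two invariant forms. -/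
def bracketInvariant (hcan : ∀ g : G, ρ.IsCanonical ν Ω g) (α β : ρ.invariantForms n) :
    ρ.invariantForms n :=
  ⟨bracketForm ν Ω (α : HForm n F V n) (β : HForm n F V n),
    ρ.bracketForm_mem_invariantForms hcan α.2 β.2⟩

lemma bracketInvariant_comb (hcan : ∀ g : G, ρ.IsCanonical ν Ω g) (c : ℝ)
    (α α' β : ρ.invariantForms n) : ρ.bracketInvariant hcan (c • α + α') β
      = c • ρ.bracketInvariant hcan α β + ρ.bracketInvariant hcan α' β := by
  apply Subtype.ext
  have h := bracketForm_comb ν Ω c (ρ.isLocalForm_of_mem α) (ρ.isLocalForm_of_mem α')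
    (β : HForm n F V n)
  exact h

lemma bracketInvariant_comb_right (hcan : ∀ g : G, ρ.IsCanonical ν Ω g) (c : ℝ)
    (β β' α : ρ.invariantForms n) : ρ.bracketInvariant hcan α (c • β + β')
      = c • ρ.bracketInvariant hcan α β + ρ.bracketInvariant hcan α β' := by
  apply Subtype.ext
  have h := bracketForm_comb_right ν Ω c (ρ.isLocalForm_of_mem β) (ρ.isLocalForm_of_mem β')
    (α : HForm n F V n)
  exact h

/-- The bracket on invariant forms. -/
def invariantBracket (hcan : ∀ g : G, ρ.IsCanonical ν Ω g) :
    ρ.invariantForms n →ₗ[ℝ] ρ.invariantForms n →ₗ[ℝ] ρ.invariantForms n :=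
  bilinearOfComb (ρ.bracketInvariant hcan) (ρ.bracketInvariant_comb hcan)
    (ρ.bracketInvariant_comb_right hcan)

/-- The differential `d̂_H`. -/
def reducedDiff (k : ℕ) : ρ.reducedForms k →ₗ[ℝ] ρ.reducedForms (k + 1) :=
  (ρ.reducedEquiv (k + 1)).symm ∘ₗ ρ.invariantDiff k ∘ₗ ρ.reducedEquiv k

/-- The bracket `l̂₂`. -/
def reducedBracket (hcan : ∀ g : G, ρ.IsCanonical ν Ω g) :
    ρ.reducedForms n →ₗ[ℝ] ρ.reducedForms n →ₗ[ℝ] ρ.reducedForms n :=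
  ((ρ.invariantBracket hcan).compl₁₂ (ρ.reducedEquiv n : _ →ₗ[ℝ] _)
    (ρ.reducedEquiv n : _ →ₗ[ℝ] _)).compr₂ ((ρ.reducedEquiv n).symm : _ →ₗ[ℝ] _)

lemma projPull_reducedDiff {k : ℕ} (f : ρ.reducedForms k) :
    ρ.projPull (ρ.reducedDiff k f : ρ.QuotForm (k + 1)) = dH (ρ.projPull (f : ρ.QuotForm k)) :=
  ρ.projPull_reducedEquiv_symm _

lemma projPull_reducedBracket (hcan : ∀ g : G, ρ.IsCanonical ν Ω g) (f₁ f₂ : ρ.reducedForms n) :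
    ρ.projPull (ρ.reducedBracket hcan f₁ f₂ : ρ.QuotForm n)
      = bracketForm ν Ω (ρ.projPull (f₁ : ρ.QuotForm n)) (ρ.projPull (f₂ : ρ.QuotForm n)) :=
  ρ.projPull_reducedEquiv_symm _

lemma reduced_ext {k : ℕ} {f f' : ρ.reducedForms k}
    (h : ρ.projPull (f : ρ.QuotForm k) = ρ.projPull (f' : ρ.QuotForm k)) : f = f' :=
  Subtype.ext (ρ.projPull_injective h)

lemma projPull_isCompactForm {k : ℕ} (f : ρ.reducedForms k) :
    IsCompactForm (ρ.projPull (f : ρ.QuotForm k)) :=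
  (mem_invariantForms.1 (show ρ.projPull (f : ρ.QuotForm k) ∈ ρ.invariantForms k from f.2)).1

lemma projPull_jac (hcan : ∀ g : G, ρ.IsCanonical ν Ω g) (x y z : ρ.reducedForms n) :
    ρ.projPull ((jac (ρ.reducedBracket hcan) x y z : ρ.reducedForms n) : ρ.QuotForm n)
      = jacobiator ν Ω (ρ.projPull (x : ρ.QuotForm n)) (ρ.projPull (y : ρ.QuotForm n))
        (ρ.projPull (z : ρ.QuotForm n)) := by
  simp only [jac, Submodule.coe_add, map_add, projPull_reducedBracket]
  rfl

end FiberAction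

end Reduction

/-! ### Verification of the axioms on the reduced complex -/

section ReducedDatum

variable {n : ℕ} {F : Type*} [NormedAddCommGroup F] [NormedSpace ℝ F] [FiniteDimensional ℝ F]
  {M : Type*} [TopologicalSpace M] [ChartedSpace (Model n) M]
  {V : M → Type*} [TopologicalSpace (TotalSpace F V)] [∀ x, AddCommGroup (V x)]
  [∀ x, Module ℝ (V x)] [∀ x, TopologicalSpace (V x)] [FiberBundle F V] [VectorBundle ℝ F V]
  [IsManifold (𝓡 n) ∞ M] [ContMDiffVectorBundle ∞ F V (𝓡 n)] [T2Space M]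
  {G : Type*} [Group G] (ρ : FiberAction n F V G)

  [SigmaCompactSpace M] {ν : VolumeForm n M} {Ω : BracketTensor n F V}

namespace FiberAction

lemma reducedDiff_reducedDiff (k : ℕ) (x : ρ.reducedForms k) :
    ρ.reducedDiff (k + 1) (ρ.reducedDiff k x) = 0 := by
  refine ρ.reduced_ext ?_
  rw [projPull_reducedDiff, projPull_reducedDiff, dH_dH (ρ.projPull_isCompactForm x).1]
  rfl

lemma reducedBracket_skew (hcan : ∀ g : G, ρ.IsCanonical ν Ω g) (x y : ρ.reducedForms n) :
    ρ.reducedBracket hcan x y = - ρ.reducedBracket hcan y x := by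
  refine ρ.reduced_ext ?_
  rw [projPull_reducedBracket, bracketForm_skew, ← projPull_reducedBracket ρ hcan]
  rfl

lemma reducedDiff_eq_zero (x : ρ.reducedForms n) : ρ.reducedDiff n x = 0 := by
  refine ρ.reduced_ext ?_
  funext j
  exact (alt_eq_zero_of_lt (Nat.lt_succ_self n) _).trans
    (alt_eq_zero_of_lt (Nat.lt_succ_self n) _).symm

lemma reducedBracket_diff (hcan : ∀ g : G, ρ.IsCanonical ν Ω g) (k : ℕ) (h : k + 1 = n)
    (x : ρ.reducedForms k) (z y : ρ.reducedForms n) (hz : HEq (ρ.reducedDiff k x) z) :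
    ρ.reducedBracket hcan z y = 0 := by
  subst h
  obtain rfl := eq_of_heq hz
  refine ρ.reduced_ext ?_
  rw [projPull_reducedBracket, projPull_reducedDiff]
  funext j
  exact bracketForm_eq_zero_left ν Ω
    (congrFun (eulerLagrange_dH (ρ.projPull_isCompactForm x).1) j)

lemma reducedJac_eq_zero (hJ : SatisfiesJacobi ν Ω) (hcan : ∀ g : G, ρ.IsCanonical ν Ω g)
    (h : n = 0) (x y z : ρ.reducedForms n) : jac (ρ.reducedBracket hcan) x y z = 0 := by
  subst h
  refine ρ.reduced_ext ?_
  rw [projPull_jac, jacobiator_eq_zero_of_dim_zero hJ (ρ.projPull_isCompactForm x).1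
    (ρ.projPull_isCompactForm y) (ρ.projPull_isCompactForm z)]
  rfl

/-- The only use of the reduction hypothesis: a primitive upstairs need not be invariant, but it may
be exchanged for one that is and hence descends. -/
lemma exists_reducedDiff_eq (hred : ρ.ReductionHypothesis) (k : ℕ) (w : ρ.reducedForms (k + 1))
    (hw : ∃ β : HForm n F V k, IsCompactForm β ∧ dH β = ρ.projPull w.1) :
    ∃ u : ρ.reducedForms k, ρ.reducedDiff k u = w := by
  obtain ⟨γ, hγ, hdγ⟩ := hred k (ρ.projPull w.1) w.2 hw
  refine ⟨(ρ.reducedEquiv k).symm ⟨γ, hγ⟩, ρ.reduced_ext ?_⟩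
  rw [← hdγ, projPull_reducedDiff, projPull_reducedEquiv_symm]

lemma exists_reducedDiff_eq_jacobiator (hJ : SatisfiesJacobi ν Ω) (hred : ρ.ReductionHypothesis)
    (k : ℕ) (h : k + 1 = n) (w : ρ.reducedForms n) {α β γ : HForm n F V n}
    (hα : IsLocalForm α) (hβ : IsCompactForm β) (hγ : IsCompactForm γ)
    (hw : ρ.projPull w.1 = jacobiator ν Ω α β γ) :
    ∃ u : ρ.reducedForms k, HEq (ρ.reducedDiff k u) w := by
  subst h
  obtain ⟨B, hB, hd⟩ := exists_primitive_jacobiator hJ hα hβ hγ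
  obtain ⟨u, hu⟩ := ρ.exists_reducedDiff_eq hred k w ⟨B, hB, hd.trans hw.symm⟩
  exact ⟨u, heq_of_eq hu⟩

lemma exists_reducedDiff_eq_jac (hJ : SatisfiesJacobi ν Ω) (hcan : ∀ g : G, ρ.IsCanonical ν Ω g)
    (hred : ρ.ReductionHypothesis) (k : ℕ) (h : k + 1 = n) (x y z : ρ.reducedForms n) :
    ∃ u : ρ.reducedForms k, HEq (ρ.reducedDiff k u) (jac (ρ.reducedBracket hcan) x y z) :=
  ρ.exists_reducedDiff_eq_jacobiator hJ hred k h _ (ρ.projPull_isCompactForm x).1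
    (ρ.projPull_isCompactForm y) (ρ.projPull_isCompactForm z) (ρ.projPull_jac hcan x y z)

/-- The reduced sh-Lie structure. -/
theorem exists_shLieStructure_reduced (hJ : SatisfiesJacobi ν Ω)
    (hcan : ∀ g : G, ρ.IsCanonical ν Ω g) (hred : ρ.ReductionHypothesis) :
    ∃ L : ShLieStructure ρ.grading,
      (∀ (k : ℕ) (f : ρ.reducedForms k),
        L.l 1 ![ρ.incl k f] = ρ.incl (k + 1) (ρ.reducedDiff k f)) ∧
      ∀ f₁ f₂ : ρ.reducedForms n,
        L.l 2 ![ρ.incl n f₁, ρ.incl n f₂] = ρ.incl n (ρ.reducedBracket hcan f₁ f₂) := by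
  have h := exists_shLieStructure (A := fun k => ρ.reducedForms k) ρ.reducedDiff
    (ρ.reducedBracket hcan) ρ.reducedDiff_reducedDiff (ρ.reducedBracket_skew hcan)
    (fun x y => ρ.reducedDiff_eq_zero (ρ.reducedBracket hcan x y)) (ρ.reducedBracket_diff hcan)
    (ρ.reducedJac_eq_zero hJ hcan) (ρ.exists_reducedDiff_eq_jac hJ hcan hred)
  exact h

end FiberAction

end ReducedDatum

end LocalFunctionals

end

theorem mainTheorem3 {n : ℕ} {M : Type*} [TopologicalSpace M]
    [ChartedSpace (LocalFunctionals.Model n) M] [IsManifold (𝓡 n) ∞ M] [T2Space M]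
    [SigmaCompactSpace M]
    {F : Type*} [NormedAddCommGroup F] [NormedSpace ℝ F] [FiniteDimensional ℝ F]
    {V : M → Type*} [TopologicalSpace (TotalSpace F V)] [∀ x, AddCommGroup (V x)]
    [∀ x, Module ℝ (V x)] [∀ x, TopologicalSpace (V x)] [FiberBundle F V]
    [VectorBundle ℝ F V] [ContMDiffVectorBundle ∞ F V (𝓡 n)]
    (ν : LocalFunctionals.VolumeForm n M) (Ω : LocalFunctionals.BracketTensor n F V)
    (hJacobi : LocalFunctionals.SatisfiesJacobi ν Ω)
    {G : Type*} [Group G] (ρ : LocalFunctionals.FiberAction n F V G)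
    (hcan : ∀ g : G, ρ.IsCanonical ν Ω g) (hred : ρ.ReductionHypothesis) :
    ∃ L : LocalFunctionals.ShLieStructure ρ.grading,
      (∀ (k : ℕ) (f : ρ.reducedForms k), ∃ f' : ρ.reducedForms (k + 1),
        L.l 1 ![ρ.incl k f] = ρ.incl (k + 1) f' ∧
          ρ.projPull (f' : ρ.QuotForm (k + 1)) =
            LocalFunctionals.dH (ρ.projPull (f : ρ.QuotForm k))) ∧
      (∀ f₁ f₂ : ρ.reducedForms n, ∃ f' : ρ.reducedForms n,
        L.l 2 ![ρ.incl n f₁, ρ.incl n f₂] = ρ.incl n f' ∧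
          ρ.projPull (f' : ρ.QuotForm n) =
            LocalFunctionals.bracketForm ν Ω (ρ.projPull (f₁ : ρ.QuotForm n))
              (ρ.projPull (f₂ : ρ.QuotForm n))) := by
  obtain ⟨L, h₁, h₂⟩ := ρ.exists_shLieStructure_reduced hJacobi hcan hred
  exact ⟨L, fun k f => ⟨ρ.reducedDiff k f, h₁ k f, ρ.projPull_reducedDiff f⟩,
    fun f₁ f₂ => ⟨ρ.reducedBracket hcan f₁ f₂, h₂ f₁ f₂, ρ.projPull_reducedBracket hcan f₁ f₂⟩⟩
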